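/- **Setting.** Let $\mathbb K=\mathbb R$ or $\mathbb C$, let $U\subseteq\mathbb R^d$ be open with coordinates $x^i$, and let $C^\infty(U)$ be the $\mathbb K$-valued smooth functions. One-forms $A=A_i\,\mathrm dx^i\in\Omega^1(U)$ and vector fields are written in components, repeated indices are summed, $t$ is a formal parameter, and $p_i$ are the fibre coordinates of $\pi:T^*U\to U$, $\partial_i=\partial/\partial x^i$, $\tilde\partial^i=\partial/\partial p_i$. Let $\theta^{ij}=-\theta^{ji}\in C^\infty(U)$ be an almost Poisson structure, $\{f,g\}_\theta=\theta^{ij}\partial_if\,\partial_jg$, with Jacobiator $$\Pi^{ijk}=\tfrac13\big(\theta^{il}\partial_l\theta^{jk}+\theta^{kl}\partial_l\theta^{ij}+\theta^{jl}\partial_l\theta^{ki}\big),$$ and write $\Pi(\alpha,\beta,\cdot)=\Pi^{ijk}\alpha_i\beta_j\partial_k$. A *local symplectic embedding* of $\theta$ is a Poisson bracket on formal power series in $t$ of fibre-polynomial functions on $T^*U$ of the form $$\{x^i,x^j\}=t\,\underline\theta^{ij},\qquad \{x^i,p_j\}=\delta^i_j+t\,\gamma_j^i,\qquad \{p_i,p_j\}=0,$$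 $$\gamma_i^j=\sum_{n\ge1}t^{n-1}\gamma_i^{j|k_1\cdots k_n}(x)\,p_{k_1}\cdots p_{k_n},\qquad \underline\theta^{ij}=\sum_{n\ge0}t^n\,\theta^{ij|k_1\cdots k_n}(x)\,p_{k_1}\cdots p_{k_n},$$ with smooth coefficients, symmetric in $k_1,\dots,k_n$, $\underline\theta^{ij}=-\underline\theta^{ji}$, leading terms $\theta^{ij|}=\theta^{ij}$, $\theta^{ij|k}=-\Pi^{ijk}$, and satisfying the Jacobi identity. Fix one. For $A\in\Omega^1(U)$ let $s_A^*$ be the substitution $p=A(x)$, let $(\Phi_A)_i=p_i-A_i(x)$ and $\Phi_A(X)=(\Phi_A)_iX^i$ for a vector field $X$. **Lagrangian multipliers.** For smooth coefficients $\Upsilon^{ijl|k_1\cdots k_n}$ ($n\ge0$) put $$\Lambda^{ij}(A)=-\sum_{n\ge0}\frac{t^n}{n+2}\,\Upsilon^{ijl|k_1\cdots k_n}A_lA_{k_1}\cdots A_{k_n},$$ $$L^{ij}=\Lambda^{ij}+\sum_{n\ge1}(-t^2)^n\,\Lambda^{ik_1}\,\partial_{k_1}A_{m_1}\,\Lambda^{m_1k_2}\cdots\partial_{k_n}A_{m_n}\,\Lambda^{m_nj},\qquad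 L_\varphi^i=t^2L^{ij}\,\partial_j\varphi$$ for $\varphi\in C^\infty(U)[[t]]$, and $$\delta_fA=s_A^*\{\pi^*f+\Phi_A(L_f),\Phi_A\},\qquad t\,[\![f,g]\!](A)=s_A^*\{\pi^*f,\pi^*g\}-s_A^*\{\Phi_A(L_f),\Phi_A(L_g)\}.$$ Call $\Upsilon$ a *family of Lagrangian multiplier coefficients* if $\Upsilon^{ijl|}=\Pi^{ijl}$, $\Upsilon^{ilj|k_1\cdots k_n}=-\Upsilon^{ijl|k_1\cdots k_n}$, $\Upsilon$ is symmetric in $k_1,\dots,k_n$, $\Upsilon^{ijl|mk_1\cdots k_n}+\Upsilon^{ilm|jk_1\cdots k_n}+\Upsilon^{imj|lk_1\cdots k_n}=0$, and for all $f,g\in C^\infty(U)$, $A\in\Omega^1(U)$ and $i$ $$\begin{aligned}L^i_{t[\![f,g]\!]}={}&\delta_fL_g^i-\delta_gL_f^i+s_A^*\tilde\partial^i\{f,g\}+L_f^jL_g^k\,s_A^*\tilde\partial^i\{(\Phi_A)_j,(\Phi_A)_k\}+s_A^*\{f,L_g^i\}-s_A^*\{g,L_f^i\}\\&+s_A^*\{L_f^i,\Phi_A(L_g)\}-s_A^*\{L_g^i,\Phi_A(L_f)\}+L_g^j\,s_A^*\tilde\partial^i\{f,(\Phi_A)_j\}-L_f^j\,s_A^*\tilde\partial^i\{g,(\Phi_A)_j\},\end{aligned}$$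 where $\delta_fL_g^i$ is the first-order variation of $L_g^i$ (a function of $A$ and $\partial A$) along $A\mapsto A+\delta_fA$, and pullbacks $\pi^*$ are suppressed. **$L_\infty$-structures.** Grade $V=C^\infty(U)\oplus\Omega^1(U)$ with functions in degree $0$ and one-forms in degree $1$. An $L_\infty$-structure on $V$ consists of graded skew-symmetric multilinear maps $\ell_n:V^{\otimes n}\to V$ ($n\ge1$) of degree $2-n$ such that for all $n$ the graded alternatization of $\sum_{k=1}^n\frac{(-1)^{k(n-k)}}{k!\,(n-k)!}\,\ell_{n-k+1}(\ell_k(v_1,\dots,v_k),v_{k+1},\dots,v_n)$ vanishes. It *induces* the gauge variations $\delta$ and the bracket $[\![\cdot,\cdot]\!]$ if for all $f,g\in C^\infty(U)$ and $A\in\Omega^1(U)$ $$\delta_fA=\sum_{n\ge0}\frac{t^n}{n!}(-1)^{\frac{n(n-1)}2}\ell_{n+1}(f,A^{\otimes n}),\qquad[\![f,g]\!](A)=-\sum_{n\ge0}\frac{t^n}{n!}(-1)^{\frac{n(n-1)}2}\ell_{n+2}(f,g,A^{\otimes n}).$$ **Tensors.** For one-forms $\alpha,\beta$ and a vector field $X$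 let $$\gamma^{(n)}(\alpha,A^{\otimes n})=n!\,\gamma_i^{j|k_1\cdots k_n}\alpha_jA_{k_1}\cdots A_{k_n}\mathrm dx^i,\qquad\theta^{(n)}(\alpha,\beta,A^{\otimes n})=n!\,\theta^{ij|k_1\cdots k_n}\alpha_i\beta_jA_{k_1}\cdots A_{k_n},$$ $$\Upsilon^{(n)}(\alpha,A^{\otimes n})=n!\,\Upsilon^{ijl|k_1\cdots k_{n-1}}\alpha_jA_lA_{k_1}\cdots A_{k_{n-1}}\partial_i,$$ $$\mathrm DA(X^\otimes)=\partial_lA_i\,X^i\,\mathrm dx^l,\qquad\mathrm dA(X,\cdot)=X^i(\partial_iA_k-\partial_kA_i)\,\mathrm dx^k,$$ and, for $n\ge1$, with $\Upsilon^{(l)}_{\mathrm DA}(X):=\Upsilon^{(l)}(\mathrm DA(X^\otimes),A^{\otimes l})$, $$L^{(n)}(\alpha,A^{\otimes n})=\Upsilon^{(n)}(\alpha,A^{\otimes n})+\sum_{k=1}^{\lfloor\frac{n-1}2\rfloor}\ \sum_{\substack{l_1,\dots,l_{k+1}\ge1\\ l_1+\cdots+l_{k+1}=n-k}}\frac{(n+1)!}{(l_1+1)!\cdots(l_{k+1}+1)!}\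 \Upsilon^{(l_1)}_{\mathrm DA}\cdots\Upsilon^{(l_k)}_{\mathrm DA}\,\Upsilon^{(l_{k+1})}(\alpha,A^{\otimes l_{k+1}}).$$ Abbreviate $L^{(n)}_f=L^{(n)}(\mathrm df,A^{\otimes n})$. **Claim.** There is exactly one family $\Upsilon$ of Lagrangian multiplier coefficients. For it there is an $L_\infty$-structure $(\ell_n)_{n\ge1}$ on $C^\infty(U)\oplus\Omega^1(U)$ which induces $\delta$ and $[\![\cdot,\cdot]\!]$, and whose brackets on coincident gauge fields are as follows (in components $i$ of one-forms). With one gauge parameter, $\ell_1(f)=\mathrm df$, $$\ell_2(f,A)_i=\{A_i,f\}_\theta+\gamma^{(1)}(\mathrm df,A)_i,$$ $$\ell_3(f,A^{\otimes2})_i=-\gamma^{(2)}(\mathrm df,A^{\otimes2})_i+2\,\Pi(\mathrm df,A,\mathrm dA_i)+\mathrm dA(\Pi(\mathrm df,A,\cdot),\cdot)_i,$$ and for $n\ge3$ $$\begin{aligned}\ell_{n+1}(f,A^{\otimes n})_i=(-1)^{\frac{n(n-1)}2}\Big[&\gamma^{(n)}(\mathrm df,A^{\otimes n})_i-n\,\theta^{(n-1)}(\mathrm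 df,\mathrm dA_i,A^{\otimes n-1})-\mathrm dA(L^{(n-1)}_f,\cdot)_i\\&+\sum_{k=2}^{n-1}\binom nk\Big(\gamma^{(n-k)}\big(\mathrm DA(L^{(k-1)\otimes}_f),A^{\otimes n-k}\big)_i-\big\langle\gamma^{(n-k)}(\mathrm dA_i,A^{\otimes n-k}),L^{(k-1)}_f\big\rangle\\&\qquad-(n-k)\,\theta^{(n-k-1)}\big(\mathrm DA(L^{(k-1)\otimes}_f),\mathrm dA_i,A^{\otimes n-k-1}\big)\Big)\Big].\end{aligned}$$ With two gauge parameters, $\ell_2(f,g)=-\{f,g\}_\theta$, $\ell_3(f,g,A)=\Pi(\mathrm df,\mathrm dg,A)$, $\ell_4(f,g,A^{\otimes2})=\theta^{(2)}(\mathrm df,\mathrm dg,A^{\otimes2})$, $$\ell_5(f,g,A^{\otimes3})=\theta^{(3)}(\mathrm df,\mathrm dg,A^{\otimes3})-\tfrac32\,\mathrm dA\big(\Pi(\mathrm df,A,\cdot),\Pi(\mathrm dg,A,\cdot)\big),$$ and for $n\ge4$ $$\begin{aligned}\ell_{n+2}(f,g,A^{\otimes n})=-(-1)^{\frac{n(n-1)}2}\Big[&\theta^{(n)}(\mathrm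 df,\mathrm dg,A^{\otimes n})-\sum_{k=1}^{n-2}\frac1{k+1}\binom nk\,\mathrm dA\big(L^{(k)}_f,L^{(n-k-1)}_g\big)\\&+\sum_{k=3}^{n-1}\frac1{k+1}\binom nk\sum_{l=1}^{k-2}\binom{k+1}{l+1}\Big(\big\langle\gamma^{(n-k)}(\mathrm DA(L^{(l)\otimes}_f),A^{\otimes n-k}),L^{(k-l-1)}_g\big\rangle\\&\qquad-\big\langle\gamma^{(n-k)}(\mathrm DA(L^{(l)\otimes}_g),A^{\otimes n-k}),L^{(k-l-1)}_f\big\rangle\\&\qquad-(n-k)\,\theta^{(n-k-1)}\big(\mathrm DA(L^{(l)\otimes}_f),\mathrm DA(L^{(k-l-1)\otimes}_g),A^{\otimes n-k-1}\big)\Big)\Big].\end{aligned}$$ (Brackets with no, or with at least three, gauge parameters vanish for degree reasons; all other values follow by polarization and graded skew-symmetry.) This structure is unique up to $L_\infty$-quasi-isomorphism: every $L_\infty$-structure on $C^\infty(U)\oplus\Omega^1(U)$ that induces $\delta$ and $[\![\cdot,\cdot]\!]$ is $L_\infty$-quasi-isomorphic to it; and so is every $L_\infty$-structure whose induced gauge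 variations $\delta'$ and bracket $[\![\cdot,\cdot]\!]'$ satisfy $\delta'_f(\chi(A))=(\mathrm d\chi)_A(\delta_fA)$ and $[\![f,g]\!]'(\chi(A))=[\![f,g]\!](A)$ for some formal field redefinition $\chi(A)=A+\sum_{n\ge2}\frac{t^{n-1}}{n!}\chi_n(A^{\otimes n})$ with symmetric multilinear maps $\chi_n:\Omega^1(U)^{\otimes n}\to\Omega^1(U)$. -/

import Mathlib

open scoped ContDiff

noncomputable section

namespace AlmostPoisson

/-! ## Smooth functions on an open subset of `ℝᵈ` -/

/-- `C^∞(U)`: the algebra of smooth `𝕜`-valued functions on an open set `U ⊆ ℝᵈ`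
(`𝕜` is the real or the complex field, smoothness is real smoothness). -/
def smoothFunctions (𝕜 : Type) [RCLike 𝕜] {d : ℕ}
    (U : TopologicalSpace.Opens (EuclideanSpace ℝ (Fin d))) : Subalgebra 𝕜 (U → 𝕜) where
  carrier := {f | ∃ g : EuclideanSpace ℝ (Fin d) → 𝕜, ContDiffOn ℝ ∞ g U ∧ ∀ x : U, f x = g x}
  mul_mem' := by
    rintro a b ⟨g, hg, hga⟩ ⟨h, hh, hhb⟩
    exact ⟨fun x => g x * h x, hg.mul hh, fun x => by simp [hga, hhb]⟩
  add_mem' := by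
    rintro a b ⟨g, hg, hga⟩ ⟨h, hh, hhb⟩
    exact ⟨fun x => g x + h x, hg.add hh, fun x => by simp [hga, hhb]⟩
  algebraMap_mem' := by
    intro r
    exact ⟨fun _ => r, contDiffOn_const, fun x => rfl⟩

/-- Extension of a function on `U` by zero to all of `ℝᵈ` (only its values on `U` are used). -/
def extendZero {𝕜 : Type} [RCLike 𝕜] {d : ℕ}
    {U : TopologicalSpace.Opens (EuclideanSpace ℝ (Fin d))} (f : U → 𝕜) :
    EuclideanSpace ℝ (Fin d) → 𝕜 :=
  open Classical in fun x => if h : x ∈ U then f ⟨x, h⟩ else 0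

theorem extendZero_apply {𝕜 : Type} [RCLike 𝕜] {d : ℕ}
    {U : TopologicalSpace.Opens (EuclideanSpace ℝ (Fin d))} (f : U → 𝕜) (x : U) :
    extendZero f x = f x := by
  simp [extendZero]

theorem contDiffOn_extendZero {𝕜 : Type} [RCLike 𝕜] {d : ℕ}
    {U : TopologicalSpace.Opens (EuclideanSpace ℝ (Fin d))} (f : smoothFunctions 𝕜 U) :
    ContDiffOn ℝ ∞ (extendZero f.1) U := by
  obtain ⟨f, g, hg, hfg⟩ := f
  refine hg.congr fun x hx => ?_
  have := extendZero_apply f ⟨x, hx⟩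
  simpa [hfg] using this

theorem differentiableAt_extendZero {𝕜 : Type} [RCLike 𝕜] {d : ℕ}
    {U : TopologicalSpace.Opens (EuclideanSpace ℝ (Fin d))} (f : smoothFunctions 𝕜 U) (x : U) :
    DifferentiableAt ℝ (extendZero f.1) x :=
  ((contDiffOn_extendZero f).contDiffAt (U.isOpen.mem_nhds x.2)).differentiableAt (by simp)

/-- The partial derivative `∂ᵢ = ∂/∂xⁱ`, as a derivation of the algebra `C^∞(U)`. -/
def partialDeriv (𝕜 : Type) [RCLike 𝕜] {d : ℕ}
    (U : TopologicalSpace.Opens (EuclideanSpace ℝ (Fin d))) (i : Fin d) :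
    Derivation 𝕜 (smoothFunctions 𝕜 U) (smoothFunctions 𝕜 U) :=
  Derivation.mk'
    { toFun := fun f =>
        ⟨fun x => fderiv ℝ (extendZero f.1) x (EuclideanSpace.single i 1),
          fun x => fderiv ℝ (extendZero f.1) x (EuclideanSpace.single i 1),
          ((contDiffOn_extendZero f).fderiv_of_isOpen U.isOpen (by simp)).clm_apply
            contDiffOn_const, fun _ => rfl⟩
      map_add' := by
        intro f g
        ext x
        have h : extendZero (f + g).1 = fun y => extendZero f.1 y + extendZero g.1 y := by
          funext y
          by_cases hy : y ∈ U <;> simp [extendZero, hy]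
        change fderiv ℝ (extendZero (f + g).1) x _ = fderiv ℝ (extendZero f.1) x _ +
          fderiv ℝ (extendZero g.1) x _
        rw [h, fderiv_fun_add (differentiableAt_extendZero f x) (differentiableAt_extendZero g x)]
        rfl
      map_smul' := by
        intro c f
        ext x
        have h : extendZero (c • f).1 = fun y => c • extendZero f.1 y := by
          funext y
          by_cases hy : y ∈ U <;> simp [extendZero, hy]
        change fderiv ℝ (extendZero (c • f).1) x _ = c • fderiv ℝ (extendZero f.1) x _
        rw [h, fderiv_fun_const_smul (differentiableAt_extendZero f x)]
        rfl }
    (by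
      intro f g
      ext x
      have h : extendZero (f * g).1 = fun y => extendZero f.1 y * extendZero g.1 y := by
        funext y
        by_cases hy : y ∈ U <;> simp [extendZero, hy]
      change fderiv ℝ (extendZero (f * g).1) x _ = f.1 x * fderiv ℝ (extendZero g.1) x _ +
          g.1 x * fderiv ℝ (extendZero f.1) x _
      rw [h, fderiv_fun_mul (differentiableAt_extendZero f x) (differentiableAt_extendZero g x)]
      simp [extendZero_apply])

/-! ## Formal power series of fibre-polynomial functions on `T*U`

From here on `R` is a commutative `𝕜`-algebra with derivations `D i`; it is always used with
`R = C^∞(U)` and `D i = ∂ᵢ`. One-forms `A = Aᵢ dxⁱ` and vector fields `X = Xⁱ ∂ᵢ` on `U` are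
given by their components, that is, as elements of `Fin d → R`. The formal parameter `t` is the
variable `PowerSeries.X`. -/

section Algebra

variable {𝕜 R : Type} {d : ℕ} [Field 𝕜] [CommRing R] [Algebra 𝕜 R]

/-- `C^∞_pol(T*U)[[t]]`: formal power series in `t` whose coefficients are polynomials in the fibre
coordinates `p₁, …, p_d` (the variables `MvPolynomial.X i`) with coefficients in `C^∞(U)`. -/
abbrev PhaseSeries (d : ℕ) (R : Type) [CommRing R] : Type := PowerSeries (MvPolynomial (Fin d) R)

/-- `∂ᵢ` on `C^∞(U)[[t]]`. -/
def dSeries (D : Fin d → Derivation 𝕜 R R) (i : Fin d) (F : PowerSeries R) : PowerSeries R :=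
  PowerSeries.mk fun n => D i (PowerSeries.coeff n F)

/-- The horizontal derivative `∂ᵢ = ∂/∂xⁱ` on `C^∞_pol(T*U)[[t]]`, acting on the coefficients of
the powers of `t` and `p`. -/
def dBase (D : Fin d → Derivation 𝕜 R R) (i : Fin d) (F : PhaseSeries d R) : PhaseSeries d R :=
  PowerSeries.mk fun n =>
    ∑ m ∈ (PowerSeries.coeff n F).support,
      MvPolynomial.monomial m (D i ((PowerSeries.coeff n F).coeff m))

/-- The vertical derivative `∂̃ⁱ = ∂/∂pᵢ` on `C^∞_pol(T*U)[[t]]`. -/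
def dFibre (i : Fin d) (F : PhaseSeries d R) : PhaseSeries d R :=
  PowerSeries.mk fun n => MvPolynomial.pderiv i (PowerSeries.coeff n F)

/-- `π^*`: pullback along the projection `π : T*U → U`. -/
def pullback (F : PowerSeries R) : PhaseSeries d R :=
  PowerSeries.map MvPolynomial.C F

/-- `s_A^*`: pullback along the section `s_A : U → T*U`, that is, the substitution `p = A(x)`. -/
def pullSection (A : Fin d → R) (F : PhaseSeries d R) : PowerSeries R :=
  PowerSeries.map (MvPolynomial.aeval (R := R) A).toRingHom F

/-- The fibre polynomial `∑ c^{k₁⋯kₙ}(x) p_{k₁} ⋯ p_{kₙ}` of a family of coefficients. -/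
def fibrePoly (n : ℕ) (c : (Fin n → Fin d) → R) : MvPolynomial (Fin d) R :=
  ∑ k : Fin n → Fin d, MvPolynomial.C (c k) * ∏ m, MvPolynomial.X (k m)

/-- `γ_i^j(x,p) = ∑_{n ≥ 1} t^{n-1} γ_i^{j|k₁⋯kₙ}(x) p_{k₁} ⋯ p_{kₙ}`; here `γ n i j k` stands for
`γ_i^{j|k₁⋯kₙ}`, and the member `n = 0` of the family is never used. -/
def gammaSeries (γ : (n : ℕ) → Fin d → Fin d → (Fin n → Fin d) → R) (i j : Fin d) :
    PhaseSeries d R :=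
  PowerSeries.mk fun n => fibrePoly (n + 1) (γ (n + 1) i j)

/-- `θ̲^{ij}(x,p) = ∑_{n ≥ 0} t^n θ^{ij|k₁⋯kₙ}(x) p_{k₁} ⋯ p_{kₙ}`; here `ϑ n i j k` stands for
`θ^{ij|k₁⋯kₙ}`. -/
def thetaSeries (ϑ : (n : ℕ) → Fin d → Fin d → (Fin n → Fin d) → R) (i j : Fin d) :
    PhaseSeries d R :=
  PowerSeries.mk fun n => fibrePoly n (ϑ n i j)

/-- The bracket on `C^∞_pol(T*U)[[t]]` of the formal bivector
`(t/2) θ̲^{ij} ∂ᵢ ∧ ∂ⱼ + (δ^i_j + t γ^i_j) ∂ᵢ ∧ ∂̃ʲ`, i.e. the biderivation with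
`{xⁱ,xʲ} = t θ̲^{ij}`, `{xⁱ,pⱼ} = δ^i_j + t γ_j^i` and `{pᵢ,pⱼ} = 0`. -/
def cosymplecticBracket (D : Fin d → Derivation 𝕜 R R)
    (γ ϑ : (n : ℕ) → Fin d → Fin d → (Fin n → Fin d) → R) (F G : PhaseSeries d R) :
    PhaseSeries d R :=
  ∑ i, ∑ j, (PowerSeries.X * thetaSeries ϑ i j * dBase D i F * dBase D j G
    + ((if i = j then 1 else 0) + PowerSeries.X * gammaSeries γ j i)
        * (dBase D i F * dFibre j G - dFibre j F * dBase D i G))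

/-- The Jacobiator of the almost Poisson structure `θ = ½ θ^{ij} ∂ᵢ ∧ ∂ⱼ`:
`Π^{ijk} = ⅓ (θ^{il} ∂ₗθ^{jk} + θ^{kl} ∂ₗθ^{ij} + θ^{jl} ∂ₗθ^{ki})`. -/
def jacobiator (D : Fin d → Derivation 𝕜 R R) (θ : Fin d → Fin d → R) (i j k : Fin d) : R :=
  (1 / 3 : 𝕜) • ∑ l, (θ i l * D l (θ j k) + θ k l * D l (θ i j) + θ j l * D l (θ k i))

/-- A local symplectic embedding of the almost Poisson structure `θ` on `U`, given by the components
of the formal Poisson bivector `ω⁻¹` on `T*U`. The symplectic form `ω` is its inverse: `ω⁻¹` reduces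
to the canonical bivector at `t = 0`, hence is invertible. The zero section (in fact every
submanifold where the `xⁱ` vary and the `pᵢ` are constant) is Lagrangian, as `{pᵢ,pⱼ} = 0`. -/
structure LocalSymplecticEmbedding (D : Fin d → Derivation 𝕜 R R) (θ : Fin d → Fin d → R) where
  /-- `γ n i j k` is `γ_i^{j|k₁⋯kₙ}`, for `n ≥ 1`. -/
  γ : (n : ℕ) → Fin d → Fin d → (Fin n → Fin d) → R
  /-- `ϑ n i j k` is `θ^{ij|k₁⋯kₙ}`. -/
  ϑ : (n : ℕ) → Fin d → Fin d → (Fin n → Fin d) → R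
  γ_symm : ∀ n i j k (σ : Equiv.Perm (Fin n)), γ n i j (k ∘ σ) = γ n i j k
  ϑ_symm : ∀ n i j k (σ : Equiv.Perm (Fin n)), ϑ n i j (k ∘ σ) = ϑ n i j k
  ϑ_skew : ∀ n i j k, ϑ n j i k = -ϑ n i j k
  /-- `θ̲ = θ - t Π + O(t²)`. -/
  ϑ_zero : ∀ i j k, ϑ 0 i j k = θ i j
  ϑ_one : ∀ i j k, ϑ 1 i j k = -jacobiator D θ i j (k 0)
  /-- `[ω⁻¹, ω⁻¹] = 0`. -/
  jacobi : ∀ F G H : PhaseSeries d R,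
    cosymplecticBracket D γ ϑ F (cosymplecticBracket D γ ϑ G H)
      + cosymplecticBracket D γ ϑ G (cosymplecticBracket D γ ϑ H F)
      + cosymplecticBracket D γ ϑ H (cosymplecticBracket D γ ϑ F G) = 0

/-! ## Lagrangian multipliers and the almost Poisson gauge algebroid -/

/-- The exterior derivative of a function, `df = ∂ᵢf dxⁱ`. -/
def dFun (D : Fin d → Derivation 𝕜 R R) (f : R) : Fin d → R := fun i => D i f

/-- Coordinates on the fibres of the first jet bundle `J¹T*U → U`: `Sum.inl l` is `A_l` and
`Sum.inr (k, l)` is `∂ₖA_l`. -/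
abbrev JetVar (d : ℕ) : Type := Fin d ⊕ Fin d × Fin d

/-- `C^∞_pol(J¹T*U)[[t]]`, the formal field dependent gauge parameters. -/
abbrev JetSeries (d : ℕ) (R : Type) [CommRing R] : Type := PowerSeries (MvPolynomial (JetVar d) R)

/-- Evaluation of an element of `C^∞_pol(J¹T*U)[[t]]` on (the prolongation of) a gauge field. -/
def evalJet (D : Fin d → Derivation 𝕜 R R) (A : Fin d → R) (F : JetSeries d R) : PowerSeries R :=
  PowerSeries.map
    (MvPolynomial.aeval (R := R) (Sum.elim A fun kl => D kl.1 (A kl.2))).toRingHom F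

/-- The derivative with respect to a jet coordinate, i.e. `∂_A^l` or `∂_A^{k;l}`. -/
def dJet (v : JetVar d) (F : JetSeries d R) : JetSeries d R :=
  PowerSeries.mk fun n => MvPolynomial.pderiv v (PowerSeries.coeff n F)

/-- `Λ^{ij}(A) = -∑_{n ≥ 0} (tⁿ/(n+2)) Υ^{ijl|k₁⋯kₙ} A_l A_{k₁} ⋯ A_{kₙ}`; here `Υ n i j l k` stands
for `Υ^{ijl|k₁⋯kₙ}`. -/
def lambdaSeries (𝕜 : Type) [Field 𝕜] [Algebra 𝕜 R]
    (Υ : (n : ℕ) → Fin d → Fin d → Fin d → (Fin n → Fin d) → R) :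
    Matrix (Fin d) (Fin d) (JetSeries d R) :=
  fun i j => PowerSeries.mk fun n =>
    -((1 / ((n : 𝕜) + 2)) • ∑ l, ∑ k : Fin n → Fin d,
      MvPolynomial.C (Υ n i j l k) * MvPolynomial.X (Sum.inl l)
        * ∏ m, MvPolynomial.X (Sum.inl (k m)))

/-- The matrix `∂ₖA_m` of jet coordinates. -/
def jetMatrix (d : ℕ) (R : Type) [CommRing R] : Matrix (Fin d) (Fin d) (JetSeries d R) :=
  fun k m => PowerSeries.C (MvPolynomial.X (Sum.inr (k, m)))

/-- `L^{ij}(A,∂A) = Λ^{ij} + ∑_{n ≥ 1} (-t²)ⁿ Λ^{ik₁} ∂_{k₁}A_{m₁} Λ^{m₁k₂} ⋯ ∂_{kₙ}A_{mₙ} Λ^{mₙj}`.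
Only the summands with `n ≤ N` (in fact `2n ≤ N`) contribute to the coefficient of `t^N`. -/
def multiplierSeries (𝕜 : Type) [Field 𝕜] [Algebra 𝕜 R]
    (Υ : (n : ℕ) → Fin d → Fin d → Fin d → (Fin n → Fin d) → R) (i j : Fin d) : JetSeries d R :=
  PowerSeries.mk fun N => ∑ n ∈ Finset.range (N + 1),
    PowerSeries.coeff N ((-(PowerSeries.X ^ 2)) ^ n *
      (lambdaSeries 𝕜 Υ * (jetMatrix d R * lambdaSeries 𝕜 Υ) ^ n) i j)

section Gauge

variable (D : Fin d → Derivation 𝕜 R R)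
  (γ ϑ : (n : ℕ) → Fin d → Fin d → (Fin n → Fin d) → R)
  (Υ : (n : ℕ) → Fin d → Fin d → Fin d → (Fin n → Fin d) → R)

/-- The components of the Lagrangian multiplier vector field
`L_φ^i = t² L^{ij}(x, A(x), ∂A(x)) ∂ⱼφ(x)`, evaluated at the gauge field `A`. -/
def multiplier (A : Fin d → R) (φ : PowerSeries R) (i : Fin d) : PowerSeries R :=
  PowerSeries.X ^ 2 * ∑ j, evalJet D A (multiplierSeries 𝕜 Υ i j) * dSeries D j φ

/-- The constraints `(Φ_A)ᵢ = pᵢ - Aᵢ(x)`. -/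
def constraint (A : Fin d → R) (i : Fin d) : PhaseSeries d R :=
  PowerSeries.C (MvPolynomial.X i - MvPolynomial.C (A i))

/-- `Φ_A(X) = (Φ_A)ᵢ Xⁱ` for a vector field `X` on `U`. -/
def constraintApply (A : Fin d → R) (X : Fin d → PowerSeries R) : PhaseSeries d R :=
  ∑ i, constraint A i * pullback (X i)

/-- The gauge variation `δ_f A = s_A^*{π^*f + Φ_A(L_f), Φ_A}`, an element of `Ω¹(U)[[t]]`. -/
def gaugeVariation (f : R) (A : Fin d → R) (k : Fin d) : PowerSeries R :=
  pullSection A (cosymplecticBracket D γ ϑ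
    (pullback (PowerSeries.C f) + constraintApply A (multiplier D Υ A (PowerSeries.C f)))
    (constraint A k))

/-- `t ⟦f,g⟧(A) = s_A^*{π^*f, π^*g} - s_A^*{Φ_A(L_f), Φ_A(L_g)}`. -/
def gaugeBracket (f g : R) (A : Fin d → R) : PowerSeries R :=
  pullSection A (cosymplecticBracket D γ ϑ (pullback (PowerSeries.C f)) (pullback (PowerSeries.C g)))
    - pullSection A (cosymplecticBracket D γ ϑ
        (constraintApply A (multiplier D Υ A (PowerSeries.C f)))
        (constraintApply A (multiplier D Υ A (PowerSeries.C g))))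

/-- The variation `δ_f L_g^i` of `L_g^i` (a function on the jet space) along `A ↦ A + δ_f A`. -/
def multiplierVariation (f g : R) (A : Fin d → R) (i : Fin d) : PowerSeries R :=
  PowerSeries.X ^ 2 * ∑ j,
    ((∑ l, evalJet D A (dJet (Sum.inl l) (multiplierSeries 𝕜 Υ i j))
        * gaugeVariation D γ ϑ Υ f A l)
      + ∑ k, ∑ l, evalJet D A (dJet (Sum.inr (k, l)) (multiplierSeries 𝕜 Υ i j))
        * dSeries D k (gaugeVariation D γ ϑ Υ f A l)) * PowerSeries.C (D j g)

/-- The recursion relations for the Lagrangian multipliers `L_f`. -/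
def MultiplierRecursion : Prop :=
  ∀ (f g : R) (A : Fin d → R) (i : Fin d),
    let br := cosymplecticBracket D γ ϑ
    let f' : PhaseSeries d R := pullback (PowerSeries.C f)
    let g' : PhaseSeries d R := pullback (PowerSeries.C g)
    let Φ := constraint A
    let Lf := multiplier D Υ A (PowerSeries.C f)
    let Lg := multiplier D Υ A (PowerSeries.C g)
    multiplier D Υ A (gaugeBracket D γ ϑ Υ f g A) i =
      multiplierVariation D γ ϑ Υ f g A i - multiplierVariation D γ ϑ Υ g f A i
      + pullSection A (dFibre i (br f' g'))
      + ∑ j, ∑ k, Lf j * Lg k * pullSection A (dFibre i (br (Φ j) (Φ k)))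
      + pullSection A (br f' (pullback (Lg i)))
      - pullSection A (br g' (pullback (Lf i)))
      + pullSection A (br (pullback (Lf i)) (constraintApply A Lg))
      - pullSection A (br (pullback (Lg i)) (constraintApply A Lf))
      + ∑ j, Lg j * pullSection A (dFibre i (br f' (Φ j)))
      - ∑ j, Lf j * pullSection A (dFibre i (br g' (Φ j)))

end Gauge

/-- The family `Υ^{ijl|k₁⋯kₙ}` consists of the coefficients of the Lagrangian multipliers of a local
symplectic embedding: it starts with the Jacobiator, has the index symmetries of the coefficients of
`∂_A^l Λ^{ij} - ∂_A^j Λ^{il}`, and the multipliers `L_f` built from it solve their recursion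
relations. -/
structure IsLagrangianMultiplier {D : Fin d → Derivation 𝕜 R R} {θ : Fin d → Fin d → R}
    (E : LocalSymplecticEmbedding D θ)
    (Υ : (n : ℕ) → Fin d → Fin d → Fin d → (Fin n → Fin d) → R) : Prop where
  zero : ∀ i j l k, Υ 0 i j l k = jacobiator D θ i j l
  skew : ∀ n i j l k, Υ n i l j k = -Υ n i j l k
  symm : ∀ n i j l k (σ : Equiv.Perm (Fin n)), Υ n i j l (k ∘ σ) = Υ n i j l k
  cyclic : ∀ n i j l m (k : Fin n → Fin d),
    Υ (n + 1) i j l (Fin.cons m k) + Υ (n + 1) i l m (Fin.cons j k)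
      + Υ (n + 1) i m j (Fin.cons l k) = 0
  recursion : MultiplierRecursion D E.γ E.ϑ Υ

/-! ## Tensors occurring in the brackets -/

section Tensors

variable (D : Fin d → Derivation 𝕜 R R)

/-- `∑ⱼ ∑ₖ c^{j|k₁⋯kₙ} αⱼ A_{k₁} ⋯ A_{kₙ}`. -/
def contract (n : ℕ) (c : Fin d → (Fin n → Fin d) → R) (α A : Fin d → R) : R :=
  ∑ j, ∑ k : Fin n → Fin d, c j k * α j * ∏ m, A (k m)

/-- The one-form `γ^{(n)}(α, A^{⊗n}) = n! γ_i^{j|k₁⋯kₙ} αⱼ A_{k₁} ⋯ A_{kₙ} dxⁱ`. -/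
def gammaT (γ : (n : ℕ) → Fin d → Fin d → (Fin n → Fin d) → R) (n : ℕ) (α A : Fin d → R) :
    Fin d → R :=
  fun i => n.factorial • contract n (γ n i) α A

/-- The function `θ^{(n)}(α, β, A^{⊗n}) = n! θ^{ij|k₁⋯kₙ} αᵢ βⱼ A_{k₁} ⋯ A_{kₙ}`. -/
def thetaT (ϑ : (n : ℕ) → Fin d → Fin d → (Fin n → Fin d) → R) (n : ℕ) (α β A : Fin d → R) : R :=
  n.factorial • ∑ i, α i * contract n (ϑ n i) β A

/-- The vector field `Υ^{(n)}(α, A^{⊗n}) = n! Υ^{ijl|k₁⋯k_{n-1}} αⱼ A_l A_{k₁} ⋯ A_{k_{n-1}} ∂ᵢ`, for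
`n ≥ 1`. -/
def upsilonT (Υ : (n : ℕ) → Fin d → Fin d → Fin d → (Fin n → Fin d) → R) :
    ℕ → (Fin d → R) → (Fin d → R) → Fin d → R
  | 0, _, _ => 0
  | n + 1, α, A => fun i => (n + 1).factorial • ∑ j, α j * contract n (Υ n i j) A A

/-- Pairing of a one-form with a vector field. -/
def pair (α X : Fin d → R) : R := ∑ i, α i * X i

/-- `DA(X^⊗) = ∂ₗAᵢ Xⁱ dxˡ`. -/
def covD (A X : Fin d → R) : Fin d → R := fun l => ∑ i, D l (A i) * X i

/-- `dA(X, ·) = Xⁱ (∂ᵢAₖ - ∂ₖAᵢ) dxᵏ`. -/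
def curv (A X : Fin d → R) : Fin d → R := fun k => ∑ i, X i * (D i (A k) - D k (A i))

/-- `Υ^{(l₁)}(Υ^{(l₂)⊗}(DA, ⋯ Υ^{(l_{r})⊗}(DA, α, A^{⊗l_r}) ⋯, A^{⊗l₂}), A^{⊗l₁})` for the list
`[l₁, …, l_r]`: each inner vector field `X` is inserted in the next tensor as the one-form
`DA(X^⊗)`. -/
def nestedUpsilon (Υ : (n : ℕ) → Fin d → Fin d → Fin d → (Fin n → Fin d) → R) (α A : Fin d → R) :
    List ℕ → Fin d → R
  | [] => 0
  | [l] => upsilonT Υ l α A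
  | l :: l' :: ls => upsilonT Υ l (covD D A (nestedUpsilon Υ α A (l' :: ls))) A

/-- The Lagrangian multiplier tensors: `L^{(n)}(α, A^{⊗n})` is the vector field
`Υ^{(n)}(α, A^{⊗n}) + ∑_{1 ≤ k ≤ ⌊(n-1)/2⌋} ∑_{l₁,…,l_{k+1} ≥ 1, l₁+⋯+l_{k+1} = n-k}
  (n+1)!/((l₁+1)! ⋯ (l_{k+1}+1)!) Υ^{(l₁)}(Υ^{(l₂)⊗}(DA, ⋯), A^{⊗l₁})`. -/
def multiplierT (Υ : (n : ℕ) → Fin d → Fin d → Fin d → (Fin n → Fin d) → R) (n : ℕ)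
    (α A : Fin d → R) : Fin d → R :=
  upsilonT Υ n α A +
    ∑ k ∈ Finset.Icc 1 ((n - 1) / 2),
      ∑ l ∈ (Finset.Nat.antidiagonalTuple (k + 1) (n - k)).filter (fun l => ∀ r, 1 ≤ l r),
        ((n + 1).factorial / ∏ r, ((l r + 1).factorial : 𝕜)) •
          nestedUpsilon D Υ α A (List.ofFn l)

end Tensors

end Algebra

/-! ## `L_∞`-algebras -/

section LInfinity

variable {𝕜 V W : Type} [Field 𝕜] [AddCommGroup V] [Module 𝕜 V] [AddCommGroup W] [Module 𝕜 W]

/-- The sign `(-1)^m`. -/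
def sgn (𝕜 : Type) [Field 𝕜] (m : ℤ) : 𝕜 := ((Int.negOnePow m : ℤ) : 𝕜)

/-- The Koszul sign of the permutation `v₁ ⊗ ⋯ ⊗ vₙ ↦ v_{σ(1)} ⊗ ⋯ ⊗ v_{σ(n)}` of homogeneous
elements of degrees `a₁, …, aₙ`: each transposition of `vᵢ` and `vⱼ` gives `(-1)^{aᵢ aⱼ}`. -/
def koszulSign (𝕜 : Type) [Field 𝕜] {n : ℕ} (a : Fin n → ℤ) (σ : Equiv.Perm (Fin n)) : 𝕜 :=
  ∏ i, ∏ j, if i < j ∧ σ j < σ i then sgn 𝕜 (a (σ i) * a (σ j)) else 1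

/-- The first `k` of `n` indices. -/
def firstIdx {n : ℕ} (k : Fin (n + 1)) (i : Fin k) : Fin n := ⟨i, by omega⟩

/-- The last `n - k` of `n` indices. -/
def lastIdx {n : ℕ} (k : Fin (n + 1)) (i : Fin (n - k)) : Fin n := ⟨k + i, by omega⟩

/-- A (flat) `L_∞`-structure on the graded vector space `⨁ᵢ 𝒱 i`. -/
structure LInfinityStructure (𝒱 : ℤ → Submodule 𝕜 V) where
  /-- The brackets `ℓₙ : V^{⊗n} → V` for `n ≥ 1`. -/
  ℓ : (n : ℕ) → MultilinearMap 𝕜 (fun _ : Fin n => V) V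
  /-- There is no bracket without arguments. -/
  flat : ℓ 0 = 0
  /-- `ℓₙ` has degree `2 - n`. -/
  degree : ∀ n (a : Fin n → ℤ) (v : Fin n → V), (∀ i, v i ∈ 𝒱 (a i)) →
    ℓ n v ∈ 𝒱 ((∑ i, a i) + 2 - n)
  /-- `ℓₙ` is graded skew-symmetric. -/
  skew : ∀ n (a : Fin n → ℤ) (v : Fin n → V), (∀ i, v i ∈ 𝒱 (a i)) →
    ∀ i j : Fin n, (i : ℕ) + 1 = j →
      ℓ n (v ∘ Equiv.swap i j) = -(sgn 𝕜 (a i * a j) • ℓ n v)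
  /-- The homotopy Jacobi identities `𝒥ₙ(v₁, …, vₙ) = 0`: the graded alternatization of
  `∑ₖ ((-1)^{k(n-k)} / (k! (n-k)!)) ℓ_{n-k+1}(ℓₖ(v₁, …, vₖ), v_{k+1}, …, vₙ)` vanishes. -/
  jacobi : ∀ n (a : Fin n → ℤ) (v : Fin n → V), (∀ i, v i ∈ 𝒱 (a i)) →
    ∑ k : Fin (n + 1), ∑ σ : Equiv.Perm (Fin n),
      (sgn 𝕜 (k * (n - k)) / ((k : ℕ).factorial * (n - k : ℕ).factorial) *
          ((Equiv.Perm.sign σ : ℤ) : 𝕜) * koszulSign 𝕜 a σ) •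
        ℓ (n - k + 1) (Fin.cons (ℓ k fun i => v (σ (firstIdx k i)))
          (fun i => v (σ (lastIdx k i)))) = 0

/-- Décalage: `(-1)^{∑ᵢ (n-i) aᵢ} φ(v₁, …, vₙ)` for elements of degrees `a₁, …, aₙ`. It turns graded
skew-symmetric maps into graded symmetric maps for the shifted degrees `aᵢ - 1`; `L_∞`-brackets
`ℓₙ` become maps of degree `1`, components of `L_∞`-morphisms become maps of degree `0`, and the
signs in their identities reduce to Koszul signs for the shifted degrees. -/
def decalage {n : ℕ} (φ : MultilinearMap 𝕜 (fun _ : Fin n => V) W) (a : Fin n → ℤ)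
    (v : Fin n → V) : W :=
  sgn 𝕜 (∑ i : Fin n, ((n : ℤ) - 1 - i) * a i) • φ v

/-- An `L_∞`-morphism: maps `φₙ : V^{⊗n} → W` of degree `1 - n`, graded skew-symmetric, compatible
with the brackets. The compatibility, in terms of the décalages, is
`∑_{k+l=n} ∑_σ ± (1/(k! l!)) φ_{l+1}(ℓₖ(v_σ …), v_σ …)
  = ∑_{c₁+⋯+c_m=n} ∑_σ ± (1/(m! c₁! ⋯ c_m!)) ℓ'_m(φ_{c₁}(v_σ …), …, φ_{c_m}(… v_σ))`. -/
structure LInfinityMorphism {𝒱 : ℤ → Submodule 𝕜 V} {𝒲 : ℤ → Submodule 𝕜 W}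
    (S : LInfinityStructure 𝒱) (S' : LInfinityStructure 𝒲) where
  φ : (n : ℕ) → MultilinearMap 𝕜 (fun _ : Fin n => V) W
  flat : φ 0 = 0
  degree : ∀ n (a : Fin n → ℤ) (v : Fin n → V), (∀ i, v i ∈ 𝒱 (a i)) →
    φ n v ∈ 𝒲 ((∑ i, a i) + 1 - n)
  skew : ∀ n (a : Fin n → ℤ) (v : Fin n → V), (∀ i, v i ∈ 𝒱 (a i)) →
    ∀ i j : Fin n, (i : ℕ) + 1 = j →
      φ n (v ∘ Equiv.swap i j) = -(sgn 𝕜 (a i * a j) • φ n v)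
  compat : ∀ n (a : Fin n → ℤ) (v : Fin n → V), (∀ i, v i ∈ 𝒱 (a i)) →
    ∑ k : Fin (n + 1), ∑ σ : Equiv.Perm (Fin n),
      (koszulSign 𝕜 (fun i => a i - 1) σ /
          ((k : ℕ).factorial * (n - k : ℕ).factorial)) •
        decalage (φ (n - k + 1))
          (Fin.cons ((∑ i, a (σ (firstIdx k i))) + 2 - k) (fun i => a (σ (lastIdx k i))))
          (Fin.cons
            (decalage (S.ℓ k) (fun i => a (σ (firstIdx k i))) fun i => v (σ (firstIdx k i)))
            (fun i => v (σ (lastIdx k i))))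
    = ∑ c : Composition n, ∑ σ : Equiv.Perm (Fin n),
      (koszulSign 𝕜 (fun i => a i - 1) σ /
          (c.length.factorial * ∏ r, ((c.blocksFun r).factorial : 𝕜))) •
        decalage (S'.ℓ c.length)
          (fun r => (∑ i, a (σ (c.embedding r i))) + 1 - c.blocksFun r)
          (fun r => decalage (φ (c.blocksFun r)) (fun i => a (σ (c.embedding r i)))
            fun i => v (σ (c.embedding r i)))

/-- The first component of a morphism, `φ₁ : (V, ℓ₁) → (W, ℓ'₁)`. -/
def LInfinityMorphism.linear {𝒱 : ℤ → Submodule 𝕜 V} {𝒲 : ℤ → Submodule 𝕜 W}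
    {S : LInfinityStructure 𝒱} {S' : LInfinityStructure 𝒲} (F : LInfinityMorphism S S') (v : V) :
    W :=
  F.φ 1 fun _ => v

/-- The differential `ℓ₁`. -/
def LInfinityStructure.differential {𝒱 : ℤ → Submodule 𝕜 V} (S : LInfinityStructure 𝒱) (v : V) :
    V :=
  S.ℓ 1 fun _ => v

/-- An `L_∞`-quasi-isomorphism: `φ₁` induces an isomorphism on the cohomology of `ℓ₁`. -/
structure LInfinityMorphism.IsQuasiIso {𝒱 : ℤ → Submodule 𝕜 V} {𝒲 : ℤ → Submodule 𝕜 W}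
    {S : LInfinityStructure 𝒱} {S' : LInfinityStructure 𝒲} (F : LInfinityMorphism S S') :
    Prop where
  injective : ∀ v, S.differential v = 0 → (∃ w, S'.differential w = F.linear v) →
    ∃ u, S.differential u = v
  surjective : ∀ w, S'.differential w = 0 →
    ∃ v u, S.differential v = 0 ∧ w = F.linear v + S'.differential u

/-- The two structures are related by an `L_∞`-quasi-isomorphism. -/
def LInfinityStructure.QuasiIsomorphic {𝒱 : ℤ → Submodule 𝕜 V} {𝒲 : ℤ → Submodule 𝕜 W}
    (S : LInfinityStructure 𝒱) (S' : LInfinityStructure 𝒲) : Prop :=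
  ∃ F : LInfinityMorphism S S', F.IsQuasiIso

end LInfinity

/-! ## The gauge algebroid induced by an `L_∞`-structure -/

section Induced

variable {𝕜 R : Type} {d : ℕ} [Field 𝕜] [CommRing R] [Algebra 𝕜 R]

/-- The grading of `C^∞(U) ⊕ Ω¹(U)` by the degree of forms. -/
def formGrading (𝕜 : Type) [Field 𝕜] (d : ℕ) (R : Type) [CommRing R] [Algebra 𝕜 R] :
    ℤ → Submodule 𝕜 (R × (Fin d → R)) :=
  fun n => if n = 0 then Submodule.prod ⊤ ⊥ else if n = 1 then Submodule.prod ⊥ ⊤ else ⊥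

/-- The arguments `(f, A₁, …, Aₙ)`. -/
def args₁ {n : ℕ} (f : R) (A : Fin n → Fin d → R) : Fin (n + 1) → R × (Fin d → R) :=
  Fin.cons (f, 0) fun i => (0, A i)

/-- The arguments `(f, g, A₁, …, Aₙ)`. -/
def args₂ {n : ℕ} (f g : R) (A : Fin n → Fin d → R) : Fin (n + 2) → R × (Fin d → R) :=
  Fin.cons (f, 0) (Fin.cons (g, 0) fun i => (0, A i))

variable (D : Fin d → Derivation 𝕜 R R)
  (γ ϑ : (n : ℕ) → Fin d → Fin d → (Fin n → Fin d) → R)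
  (Υ : (n : ℕ) → Fin d → Fin d → Fin d → (Fin n → Fin d) → R)

/-- The `L_∞`-structure induces the almost Poisson gauge algebroid: for all `f`, `g` and `A`,
`δ_f A = ∑ₙ (tⁿ/n!) (-1)^{n(n-1)/2} ℓ_{n+1}(f, A^{⊗n})` and
`⟦f,g⟧(A) = -∑ₙ (tⁿ/n!) (-1)^{n(n-1)/2} ℓ_{n+2}(f, g, A^{⊗n})`. -/
structure Induces (S : LInfinityStructure (formGrading 𝕜 d R)) : Prop where
  variation : ∀ (f : R) (A : Fin d → R) (i : Fin d),
    gaugeVariation D γ ϑ Υ f A i = PowerSeries.mk fun n =>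
      ((-1 : 𝕜) ^ (n * (n - 1) / 2) / n.factorial) •
        (S.ℓ (n + 1) (args₁ f fun _ : Fin n => A)).2 i
  bracket : ∀ (f g : R) (A : Fin d → R),
    gaugeBracket D γ ϑ Υ f g A = PowerSeries.X * PowerSeries.mk fun n =>
      -(((-1 : 𝕜) ^ (n * (n - 1) / 2) / n.factorial) •
        (S.ℓ (n + 2) (args₂ f g fun _ : Fin n => A)).1)

/-- A Seiberg-Witten map `χ(A) = ∑_{n ≥ 1} (t^{n-1}/n!) χₙ(A^{⊗n})`, a formal field redefinition with
`χ(A)|_{t=0} = A`; the member `n = 0` of the family is never used. -/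
structure SeibergWittenMap (𝕜 : Type) [Field 𝕜] (d : ℕ) (R : Type) [CommRing R] [Algebra 𝕜 R] where
  χ : (n : ℕ) → MultilinearMap 𝕜 (fun _ : Fin n => Fin d → R) (Fin d → R)
  symm : ∀ n (A : Fin n → Fin d → R) (σ : Equiv.Perm (Fin n)), χ n (A ∘ σ) = χ n A
  one : ∀ A, χ 1 A = A 0

/-- The `L_∞`-structure induces the gauge algebroid obtained from the almost Poisson gauge algebroid
by the field redefinition `χ`: its gauge variations `δ'` and its bracket `⟦·,·⟧'`, defined by the
same series as before, satisfy `δ'_f (χ(A)) = (dχ)_A (δ_f A)` and `⟦f,g⟧'(χ(A)) = ⟦f,g⟧(A)`. -/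
structure InducesUpTo (T : SeibergWittenMap 𝕜 d R)
    (S : LInfinityStructure (formGrading 𝕜 d R)) : Prop where
  variation : ∀ (f : R) (A : Fin d → R) (N : ℕ),
    ∑ c : Composition N,
      ((-1 : 𝕜) ^ (c.length * (c.length - 1) / 2) /
          (c.length.factorial * ∏ r, ((c.blocksFun r).factorial : 𝕜))) •
        (S.ℓ (c.length + 1) (args₁ f fun r => T.χ (c.blocksFun r) fun _ => A)).2
    = ∑ m ∈ Finset.range (N + 1), (1 / (m.factorial : 𝕜)) •
        T.χ (m + 1) (Fin.cons
          (fun i => PowerSeries.coeff (N - m) (gaugeVariation D γ ϑ Υ f A i)) fun _ => A)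
  bracket : ∀ (f g : R) (A : Fin d → R),
    gaugeBracket D γ ϑ Υ f g A = PowerSeries.X * PowerSeries.mk fun N =>
      -∑ c : Composition N,
        ((-1 : 𝕜) ^ (c.length * (c.length - 1) / 2) /
            (c.length.factorial * ∏ r, ((c.blocksFun r).factorial : 𝕜))) •
          (S.ℓ (c.length + 2) (args₂ f g fun r => T.χ (c.blocksFun r) fun _ => A)).1

end Induced

/-! ## The explicit brackets -/

section Explicit

variable {𝕜 R : Type} {d : ℕ} [Field 𝕜] [CommRing R] [Algebra 𝕜 R]
  (D : Fin d → Derivation 𝕜 R R)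
  (γ ϑ : (n : ℕ) → Fin d → Fin d → (Fin n → Fin d) → R)
  (Υ : (n : ℕ) → Fin d → Fin d → Fin d → (Fin n → Fin d) → R)

/-- The value of `ℓ_{n+1}(f, A^{⊗n})` for `n ≥ 3`, component `i`. -/
def explicitBracket₁ (n : ℕ) (f : R) (A : Fin d → R) (i : Fin d) : R :=
  let df := dFun D f
  let DA : Fin d → R := dFun D (A i)
  let L := fun m => multiplierT D Υ m df A
  (-1 : 𝕜) ^ (n * (n - 1) / 2) •
    (gammaT γ n df A i
      - n • thetaT ϑ (n - 1) df DA A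
      - curv D A (L (n - 1)) i
      + ∑ k ∈ Finset.Icc 2 (n - 1), n.choose k •
          (gammaT γ (n - k) (covD D A (L (k - 1))) A i
            - pair (gammaT γ (n - k) DA A) (L (k - 1))
            - (n - k) • thetaT ϑ (n - k - 1) (covD D A (L (k - 1))) DA A))

/-- The value of `ℓ_{n+2}(f, g, A^{⊗n})` for `n ≥ 4`. -/
def explicitBracket₂ (n : ℕ) (f g : R) (A : Fin d → R) : R :=
  let df := dFun D f
  let dg := dFun D g
  let L := fun m α => multiplierT D Υ m α A
  (-(-1 : 𝕜) ^ (n * (n - 1) / 2)) •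
    (thetaT ϑ n df dg A
      - ∑ k ∈ Finset.Icc 1 (n - 2), ((n.choose k : 𝕜) / (k + 1)) •
          pair (curv D A (L k df)) (L (n - k - 1) dg)
      + ∑ k ∈ Finset.Icc 3 (n - 1), ((n.choose k : 𝕜) / (k + 1)) •
          ∑ l ∈ Finset.Icc 1 (k - 2), (k + 1).choose (l + 1) •
            (pair (gammaT γ (n - k) (covD D A (L l df)) A) (L (k - l - 1) dg)
              - pair (gammaT γ (n - k) (covD D A (L l dg)) A) (L (k - l - 1) df)
              - (n - k) • thetaT ϑ (n - k - 1) (covD D A (L l df))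
                  (covD D A (L (k - l - 1) dg)) A))

/-- The vector field `Π(α, β, ·) = Π^{ijk} αᵢ βⱼ ∂ₖ`. -/
def jacobiatorT (θ : Fin d → Fin d → R) (α β : Fin d → R) : Fin d → R :=
  fun k => ∑ i, ∑ j, jacobiator D θ i j k * α i * β j

/-- The almost Poisson bracket `{f, g}_θ = θ^{ij} ∂ᵢf ∂ⱼg`. -/
def almostPoissonBracket (θ : Fin d → Fin d → R) (f g : R) : R :=
  ∑ i, ∑ j, θ i j * D i f * D j g

/-- The brackets of the `L_∞`-structure on coincident gauge fields. The brackets with no or with at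
least three gauge parameters vanish for degree reasons, and the other values follow from the
brackets below by polarization and graded skew-symmetry. -/
structure HasExplicitBrackets (θ : Fin d → Fin d → R)
    (S : LInfinityStructure (formGrading 𝕜 d R)) : Prop where
  one : ∀ f, S.ℓ 1 (args₁ f ![]) = (0, dFun D f)
  two : ∀ f (A : Fin d → R), S.ℓ 2 (args₁ f ![A]) =
    (0, fun i => almostPoissonBracket D θ (A i) f + gammaT γ 1 (dFun D f) A i)
  three : ∀ f (A : Fin d → R), S.ℓ 3 (args₁ f ![A, A]) =
    (0, fun i => -gammaT γ 2 (dFun D f) A i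
      + 2 * pair (dFun D (A i)) (jacobiatorT D θ (dFun D f) A)
      + curv D A (jacobiatorT D θ (dFun D f) A) i)
  general : ∀ n, 3 ≤ n → ∀ f (A : Fin d → R), S.ℓ (n + 1) (args₁ f fun _ : Fin n => A) =
    (0, explicitBracket₁ D γ ϑ Υ n f A)
  two' : ∀ f g, S.ℓ 2 (args₂ f g (![] : Fin 0 → Fin d → R)) = (-almostPoissonBracket D θ f g, 0)
  three' : ∀ f g (A : Fin d → R), S.ℓ 3 (args₂ f g ![A]) =
    (pair A (jacobiatorT D θ (dFun D f) (dFun D g)), 0)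
  four' : ∀ f g (A : Fin d → R), S.ℓ 4 (args₂ f g ![A, A]) =
    (thetaT ϑ 2 (dFun D f) (dFun D g) A, 0)
  five' : ∀ f g (A : Fin d → R), S.ℓ 5 (args₂ f g ![A, A, A]) =
    (thetaT ϑ 3 (dFun D f) (dFun D g) A
      - (3 / 2 : 𝕜) • pair (curv D A (jacobiatorT D θ (dFun D f) A))
          (jacobiatorT D θ (dFun D g) A), 0)
  general' : ∀ n, 4 ≤ n → ∀ f g (A : Fin d → R), S.ℓ (n + 2) (args₂ f g fun _ : Fin n => A) =
    (explicitBracket₂ D γ ϑ Υ n f g A, 0)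

end Explicit

end AlmostPoisson

end

open scoped ContDiff

noncomputable section

namespace AlmostPoisson

open Finset (sum_congr sum_add_distrib sum_comm mul_sum smul_sum sum_sub_distrib univ sum_mul
  dvd_sum sum_neg_distrib mem_univ mem_filter sum_eq_zero range mem_Icc mem_range Icc
  sum_powerset_insert card_insert_of_notMem sum_const sum_singleton powerset mem_sigma
  mem_powerset sum_eq_single sum_ite_eq' sum_insert sum_const_zero sum_subset sum_range_succ'
  sum_smul sum_comm' prod_eq_one prod_congr notMem_erase mem_insert_self sum_filter card_univ
  card_bij powersetCard sum_fiberwise_of_maps_to subset_univ prod_subset mem_insert mem_singleton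
  prod_pair prod_insert sum_range sum_powerset_apply_card mem_erase card_erase_of_mem
  insert_subset_iff sum_range_reflect mem_Ico sum_empty sum_sigma' sum_bij' notMem_empty
  sum_range_succ univ_unique univ_eq_empty prod_empty Icc_eq_empty)
open Sum (inl inr)
open Equiv (Perm swap)
open Fin (cons_zero cons_succ lt_def sum_univ_succ exists_succ_eq_of_ne_zero)
open PowerSeries (C X coeff coeff_mk X_pow_dvd_iff coeff_mul coeff_C X_dvd_iff coeff_mul_C
  coeff_zero_eq_constantCoeff_apply constantCoeff coeff_map coeff_X_pow_mul' coeff_succ_X_mul)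
open MvPolynomial (pderiv aeval pderiv_X IsHomogeneous pderiv_C aeval_X isHomogeneous_C
  isHomogeneous_X coeff_pderiv isHomogeneous_zero)
open Nat (cast_smul_eq_nsmul)
open Finset.HasAntidiagonal (antidiagonal)

/-- Tensors with two fixed indices and arbitrarily many further ones. -/
abbrev TensorFamily (d : ℕ) (R : Type) := (n : ℕ) → Fin d → Fin d → (Fin n → Fin d) → R

/-- Tensors with three fixed indices and arbitrarily many further ones. -/
abbrev MultiplierFamily (d : ℕ) (R : Type) :=
  (n : ℕ) → Fin d → Fin d → Fin d → (Fin n → Fin d) → R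

/-- The `n`-linear maps on `R ⊕ Ω¹`. -/
abbrev FormOperation (𝕜 : Type) (d : ℕ) (R : Type) [Field 𝕜] [CommRing R] [Algebra 𝕜 R] (n : ℕ) :=
  MultilinearMap 𝕜 (fun _ : Fin n => R × (Fin d → R)) (R × (Fin d → R))

/-- Families of multilinear maps on `R ⊕ Ω¹`. -/
abbrev OperationFamily (𝕜 : Type) (d : ℕ) (R : Type) [Field 𝕜] [CommRing R] [Algebra 𝕜 R] :=
  (n : ℕ) → FormOperation 𝕜 d R n

variable {𝕜 R : Type} {d : ℕ} [Field 𝕜] [CommRing R] [Algebra 𝕜 R]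

/-! ## Calculus of formal power series of fibre polynomials -/

section SeriesCalculus

/-- A derivation of a ring. -/
structure RingDer (S : Type) [CommRing S] extends S →+ S where
  leibniz' : ∀ a b, toFun (a * b) = a * toFun b + b * toFun a

instance {S : Type} [CommRing S] : FunLike (RingDer S) S S where
  coe δ := δ.toFun
  coe_injective := by
    rintro ⟨⟨⟨f, _⟩, _⟩, _⟩ ⟨⟨⟨g, _⟩, _⟩, _⟩ h
    congr

instance {S : Type} [CommRing S] : AddMonoidHomClass (RingDer S) S S where
  map_add δ := δ.map_add'
  map_zero δ := δ.map_zero'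

theorem RingDer.leibniz {S : Type} [CommRing S] (δ : RingDer S) (a b : S) :
    δ (a * b) = a * δ b + b * δ a := δ.leibniz' a b

@[simp] theorem RingDer.map_one {S : Type} [CommRing S] (δ : RingDer S) : δ 1 = 0 := by
  have h := δ.leibniz 1 1
  rw [mul_one, one_mul] at h
  exact left_eq_add.1 h

/-- The derivation of `S[[t]]` which acts on coefficients as a given derivation of `S`. -/
def seriesDer {S : Type} [CommRing S] (δ : RingDer S) : RingDer (PowerSeries S) where
  toFun F := PowerSeries.mk fun n => δ (coeff n F)
  map_zero' := by ext n; simp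
  map_add' F G := by ext n; simp
  leibniz' F G := by
    ext n
    simp only [coeff_mk, coeff_mul, map_add, map_sum, RingDer.leibniz,
      sum_add_distrib]
    congr 1
    rw [← Finset.Nat.sum_antidiagonal_swap]
    rfl

theorem coeff_seriesDer {S : Type} [CommRing S] (δ : RingDer S) (n : ℕ)
    (F : PowerSeries S) : coeff n (seriesDer δ F) = δ (coeff n F) := by
  change coeff n (PowerSeries.mk fun m => δ (coeff m F)) = _
  rw [coeff_mk]

theorem seriesDer_X {S : Type} [CommRing S] (δ : RingDer S) :
    seriesDer δ X = 0 := by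
  ext n
  rw [coeff_seriesDer, PowerSeries.coeff_X]
  split_ifs <;> simp

theorem seriesDer_C {S : Type} [CommRing S] (δ : RingDer S) (a : S) :
    seriesDer δ (C a) = C (δ a) := by
  ext n
  rw [coeff_seriesDer, coeff_C, coeff_C]
  split_ifs <;> simp

/-- A derivation of an algebra as a derivation of the underlying ring. -/
def intDer {K S : Type} [CommRing K] [CommRing S] [Algebra K S] (δ : Derivation K S S) :
    RingDer S where
  toFun := δ
  map_zero' := map_zero δ
  map_add' := map_add δ
  leibniz' a b := δ.leibniz a b

theorem coeff_sum_monomial_der {ι : Type} (δ : Derivation 𝕜 R R) (r : MvPolynomial ι R)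
    (m : ι →₀ ℕ) : MvPolynomial.coeff m
      (∑ m ∈ r.support, MvPolynomial.monomial m (δ (r.coeff m))) = δ (r.coeff m) := by
  classical
  rw [MvPolynomial.coeff_sum]
  simp only [MvPolynomial.coeff_monomial]
  rw [sum_ite_eq']
  split_ifs with h
  · rfl
  · rw [MvPolynomial.notMem_support_iff.1 h, map_zero]

/-- The derivation of a polynomial ring which acts on coefficients as a given derivation. -/
def polyDer {ι : Type} (δ : Derivation 𝕜 R R) : RingDer (MvPolynomial ι R) where
  toFun p := ∑ m ∈ p.support, MvPolynomial.monomial m (δ (p.coeff m))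
  map_zero' := by simp
  map_add' p q := by
    ext m
    rw [MvPolynomial.coeff_add, coeff_sum_monomial_der, coeff_sum_monomial_der,
      coeff_sum_monomial_der, MvPolynomial.coeff_add, map_add]
  leibniz' p q := by
    classical
    ext m
    rw [coeff_sum_monomial_der, MvPolynomial.coeff_add, MvPolynomial.coeff_mul,
      MvPolynomial.coeff_mul, mul_comm q, MvPolynomial.coeff_mul, map_sum,
      ← sum_add_distrib]
    refine sum_congr rfl fun x _ => ?_
    rw [coeff_sum_monomial_der, coeff_sum_monomial_der, Derivation.leibniz]
    simp only [smul_eq_mul]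
    ring

theorem coeff_polyDer {ι : Type} (δ : Derivation 𝕜 R R) (p : MvPolynomial ι R) (m : ι →₀ ℕ) :
    (polyDer δ p).coeff m = δ (p.coeff m) := coeff_sum_monomial_der δ p m

theorem polyDer_C {ι : Type} (δ : Derivation 𝕜 R R) (a : R) :
    polyDer (ι := ι) δ (MvPolynomial.C a) = MvPolynomial.C (δ a) := by
  classical
  ext m
  rw [coeff_polyDer, MvPolynomial.coeff_C, MvPolynomial.coeff_C]
  split_ifs <;> simp

theorem polyDer_X {ι : Type} (δ : Derivation 𝕜 R R) (i : ι) :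
    polyDer δ (MvPolynomial.X i) = 0 := by
  classical
  ext m
  rw [coeff_polyDer, MvPolynomial.coeff_X]
  split_ifs <;> simp

/-- `∂ᵢ` on `C^∞(U)[[t]]` as a derivation. -/
def dSer (D : Fin d → Derivation 𝕜 R R) (i : Fin d) :
    RingDer (PowerSeries R) := seriesDer (intDer (D i))

/-- `∂ᵢ` on formal fibre polynomials as a derivation. -/
def dHor (D : Fin d → Derivation 𝕜 R R) (i : Fin d) :
    RingDer (PhaseSeries d R) := seriesDer (polyDer (D i))

/-- `∂̃ⁱ` on formal fibre polynomials as a derivation. -/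
def dVert (i : Fin d) : RingDer (PhaseSeries d R) :=
  seriesDer (intDer (pderiv i))

/-- A jet coordinate derivative as a derivation. -/
def dJetD (v : JetVar d) : RingDer (JetSeries d R) :=
  seriesDer (intDer (pderiv v))

@[simp] theorem dVert_X (i : Fin d) : dVert (R := R) i X = 0 := seriesDer_X _

@[simp] theorem dJetD_X (v : JetVar d) : dJetD (R := R) v X = 0 := seriesDer_X _

/-- `π^*` as a ring homomorphism. -/
def pull : PowerSeries R →+* PhaseSeries d R := PowerSeries.map MvPolynomial.C

/-- `s_A^*` as a ring homomorphism. -/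
def sect (A : Fin d → R) : PhaseSeries d R →+* PowerSeries R :=
  PowerSeries.map (aeval (R := R) A).toRingHom

/-- Evaluation of jet functions at a gauge field as a ring homomorphism. -/
def evJ (D : Fin d → Derivation 𝕜 R R) (A : Fin d → R) : JetSeries d R →+* PowerSeries R :=
  PowerSeries.map (aeval (R := R) (Sum.elim A fun kl => D kl.1 (A kl.2))).toRingHom

theorem coeff_pull (n : ℕ) (F : PowerSeries R) :
    coeff n (pull (d := d) F) = MvPolynomial.C (coeff n F) := by
  simp [pull]

theorem coeff_sect (A : Fin d → R) (n : ℕ) (F : PhaseSeries d R) :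
    coeff n (sect A F) = aeval A (coeff n F) := by
  simp [sect]

theorem coeff_evJ (D : Fin d → Derivation 𝕜 R R) (A : Fin d → R) (n : ℕ) (F : JetSeries d R) :
    coeff n (evJ D A F)
      = aeval (Sum.elim A fun kl => D kl.1 (A kl.2)) (coeff n F) := by
  simp [evJ]

theorem coeff_dSer (D : Fin d → Derivation 𝕜 R R) (i : Fin d) (n : ℕ) (F : PowerSeries R) :
    coeff n (dSer D i F) = D i (coeff n F) := coeff_seriesDer _ _ _

theorem coeff_dHor (D : Fin d → Derivation 𝕜 R R) (i : Fin d) (n : ℕ) (F : PhaseSeries d R) :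
    coeff n (dHor D i F) = polyDer (D i) (coeff n F) :=
  coeff_seriesDer _ _ _

theorem coeff_dVert (i : Fin d) (n : ℕ) (F : PhaseSeries d R) :
    coeff n (dVert i F) = pderiv i (coeff n F) :=
  coeff_seriesDer _ _ _

theorem coeff_dJetD (v : JetVar d) (n : ℕ) (F : JetSeries d R) :
    coeff n (dJetD v F) = pderiv v (coeff n F) :=
  coeff_seriesDer _ _ _

theorem dSer_C (D : Fin d → Derivation 𝕜 R R) (i : Fin d) (a : R) :
    dSer D i (C a) = C (D i a) := seriesDer_C _ _

theorem dHor_C (D : Fin d → Derivation 𝕜 R R) (i : Fin d) (a : MvPolynomial (Fin d) R) :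
    dHor D i (C a) = C (polyDer (D i) a) := seriesDer_C _ _

theorem dVert_C (i : Fin d) (a : MvPolynomial (Fin d) R) :
    dVert i (C a) = C (pderiv i a) := seriesDer_C _ _

theorem dJetD_C (v : JetVar d) (a : MvPolynomial (JetVar d) R) :
    dJetD v (C a) = C (pderiv v a) := seriesDer_C _ _

@[simp] theorem pull_X : pull (d := d) (X : PowerSeries R) = X := by
  simp [pull]

@[simp] theorem sect_X (A : Fin d → R) : sect A X = X := by
  simp [sect]

@[simp] theorem evJ_X (D : Fin d → Derivation 𝕜 R R) (A : Fin d → R) :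
    evJ D A X = X := by
  simp [evJ]

@[simp] theorem sect_pull (A : Fin d → R) (F : PowerSeries R) : sect A (pull F) = F := by
  ext n
  simp [sect, pull]

@[simp] theorem dVert_pull (i : Fin d) (F : PowerSeries R) : dVert i (pull F) = 0 := by
  ext n : 1
  simp [coeff_dVert, coeff_pull]

@[simp] theorem dHor_pull (D : Fin d → Derivation 𝕜 R R) (i : Fin d) (F : PowerSeries R) :
    dHor D i (pull F) = pull (dSer D i F) := by
  ext n : 1
  simp [coeff_dHor, coeff_dSer, coeff_pull, polyDer_C]

@[simp] theorem sect_constraint (A : Fin d → R) (i : Fin d) : sect A (constraint A i) = 0 := by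
  ext n
  simp [sect, constraint]

theorem dVert_constraint (A : Fin d → R) (i j : Fin d) :
    dVert i (constraint A j) = if i = j then 1 else 0 := by
  classical
  rw [constraint, dVert_C]
  simp only [map_sub, pderiv_X, pderiv_C, sub_zero,
    Pi.single_apply]
  split_ifs with h1 h2 h2
  · simp
  · exact absurd h1.symm h2
  · exact absurd h2.symm h1
  · simp

@[simp] theorem dHor_constraint (D : Fin d → Derivation 𝕜 R R) (A : Fin d → R) (i j : Fin d) :
    dHor D i (constraint A j) = -pull (C (D i (A j))) := by
  rw [constraint, dHor_C, map_sub, polyDer_X, polyDer_C, zero_sub, map_neg]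
  simp [pull]

/-- The chain rule for the substitution `p = A(x)`. -/
theorem dSer_sect (D : Fin d → Derivation 𝕜 R R) (A : Fin d → R) (i : Fin d)
    (F : PhaseSeries d R) :
    dSer D i (sect A F)
      = sect A (dHor D i F) + ∑ j, sect A (dVert j F) * PowerSeries.C (D i (A j)) := by
  have key : ∀ p : MvPolynomial (Fin d) R, D i (aeval A p)
      = aeval A (polyDer (D i) p)
        + ∑ j, aeval A (pderiv j p) * D i (A j) := by
    classical
    intro p
    induction p using MvPolynomial.induction_on with
    | C a => simp [polyDer_C]
    | add p q hp hq =>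
      simp only [map_add, hp, hq, add_mul, sum_add_distrib]
      ring
    | mul_X p k hp =>
      rw [map_mul, aeval_X, Derivation.leibniz, hp, RingDer.leibniz, polyDer_X]
      have h : ∀ j, aeval A (pderiv j (p * MvPolynomial.X k)) * D i (A j)
          = (if j = k then aeval A p * D i (A j) else 0)
            + A k * (aeval A (pderiv j p) * D i (A j)) := by
        intro j
        rw [Derivation.leibniz, pderiv_X, Pi.single_apply]
        simp only [smul_eq_mul, map_add, map_mul, aeval_X]
        split_ifs with h1 h2 h2
        · simp; ring
        · exact absurd h1.symm h2
        · exact absurd h2.symm h1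
        · simp; ring
      simp only [h, sum_add_distrib, sum_ite_eq', mem_univ, if_true,
        ← mul_sum, map_mul, mul_zero, zero_add, smul_eq_mul,
        aeval_X]
      ring
  ext n
  simp only [coeff_dSer, map_add, map_sum, coeff_mul_C, coeff_sect, coeff_dHor,
    coeff_dVert]
  exact key _

/-- The derivative of a jet function along a variation `B` of the gauge field `A`. -/
def varJ (D : Fin d → Derivation 𝕜 R R) (A : Fin d → R) (B : Fin d → PowerSeries R)
    (F : JetSeries d R) : PowerSeries R :=
  (∑ l, evJ D A (dJetD (inl l) F) * B l)
    + ∑ k, ∑ l, evJ D A (dJetD (inr (k, l)) F) * dSer D k (B l)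

section

variable (D : Fin d → Derivation 𝕜 R R) (A : Fin d → R) (B : Fin d → PowerSeries R)

theorem varJ_add (F G : JetSeries d R) : varJ D A B (F + G) = varJ D A B F + varJ D A B G := by
  simp only [varJ, map_add, add_mul, sum_add_distrib]
  ring

theorem varJ_zero : varJ D A B 0 = 0 := by
  simp [varJ]

theorem varJ_neg (F : JetSeries d R) : varJ D A B (-F) = -varJ D A B F := by
  have h := varJ_add D A B F (-F)
  rw [add_neg_cancel, varJ_zero] at h
  exact (neg_eq_of_add_eq_zero_right h.symm).symm

theorem varJ_sub (F G : JetSeries d R) : varJ D A B (F - G) = varJ D A B F - varJ D A B G := by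
  rw [sub_eq_add_neg, varJ_add, varJ_neg, sub_eq_add_neg]

theorem varJ_sum {ι : Type} (s : Finset ι) (F : ι → JetSeries d R) :
    varJ D A B (∑ i ∈ s, F i) = ∑ i ∈ s, varJ D A B (F i) := by
  classical
  induction s using Finset.induction_on with
  | empty => simp [varJ_zero]
  | insert a s ha ih => rw [sum_insert ha, sum_insert ha, varJ_add, ih]

theorem varJ_mul (F G : JetSeries d R) :
    varJ D A B (F * G) = evJ D A F * varJ D A B G + evJ D A G * varJ D A B F := by
  simp only [varJ, RingDer.leibniz, map_add, map_mul, add_mul,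
    sum_add_distrib, mul_add, mul_sum]
  simp only [mul_assoc]
  ring

@[simp] theorem varJ_X : varJ D A B X = 0 := by
  simp [varJ]

theorem varJ_one : varJ D A B 1 = 0 := by
  simp [varJ]

/-- The jet function `p ↦ F(x, p)` given by a formal fibre polynomial. -/
def toJet : PhaseSeries d R →+* JetSeries d R :=
  PowerSeries.map (MvPolynomial.rename (R := R) inl).toRingHom

@[simp] theorem toJet_X : toJet (d := d) (R := R) X = X := by
  simp [toJet]

@[simp] theorem evJ_toJet (F : PhaseSeries d R) : evJ D A (toJet F) = sect A F := by
  ext n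
  simp only [evJ, toJet, sect, coeff_map, AlgHom.toRingHom_eq_coe, RingHom.coe_coe,
    MvPolynomial.aeval_rename]
  rfl

theorem pderiv_inl_rename (l : Fin d) (p : MvPolynomial (Fin d) R) :
    pderiv (inl l : JetVar d) (MvPolynomial.rename inl p)
      = MvPolynomial.rename inl (pderiv l p) :=
  MvPolynomial.pderiv_rename Sum.inl_injective _ _

theorem pderiv_inr_rename (v : Fin d × Fin d) (p : MvPolynomial (Fin d) R) :
    pderiv (inr v : JetVar d) (MvPolynomial.rename inl p) = 0 := by
  classical
  induction p using MvPolynomial.induction_on with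
  | C a => simp
  | add p q hp hq => simp [hp, hq]
  | mul_X p k hp => simp [hp, pderiv_X]

@[simp] theorem dJetD_inl_toJet (l : Fin d) (F : PhaseSeries d R) :
    dJetD (inl l) (toJet F) = toJet (dVert l F) := by
  ext n : 1
  simp only [coeff_dJetD, toJet, coeff_map, coeff_dVert]
  exact pderiv_inl_rename _ _

@[simp] theorem dJetD_inr_toJet (v : Fin d × Fin d) (F : PhaseSeries d R) :
    dJetD (inr v) (toJet F) = 0 := by
  ext n : 1
  simp only [coeff_dJetD, toJet, coeff_map, map_zero]
  exact pderiv_inr_rename _ _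

theorem varJ_toJet (F : PhaseSeries d R) :
    varJ D A B (toJet F) = ∑ l, sect A (dVert l F) * B l := by
  simp [varJ]

theorem evJ_jetMatrix (k m : Fin d) :
    evJ D A (jetMatrix d R k m) = C (D k (A m)) := by
  simp [evJ, jetMatrix]

theorem varJ_jetMatrix (k m : Fin d) : varJ D A B (jetMatrix d R k m) = dSer D k (B m) := by
  classical
  have h : ∀ v : JetVar d, evJ D A (dJetD v (jetMatrix d R k m))
      = if inr (k, m) = v then 1 else 0 := by
    intro v
    rw [jetMatrix, dJetD_C, pderiv_X, Pi.single_apply]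
    split_ifs <;> simp_all
  simp only [varJ, h, reduceCtorEq, if_false, zero_mul, sum_const_zero, zero_add,
    Sum.inr.injEq, Prod.mk.injEq, ite_mul, one_mul]
  rw [sum_eq_single k, sum_eq_single m]
  · simp
  · intro b _ hb
    simp [Ne.symm hb]
  · simp
  · intro b _ hb
    simp [Ne.symm hb]
  · simp

end

end SeriesCalculus

/-! ## The bracket as a biderivation -/

section Bracket

/-- The component `{xⁱ, pⱼ} = δ^i_j + t γ_j^i`. -/
def mixedBracket (γ : TensorFamily d R) (i j : Fin d) :
    PhaseSeries d R :=
  (if i = j then 1 else 0) + X * gammaSeries γ j i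

/-- The component `{xⁱ, xʲ} = t θ̲^{ij}`. -/
def baseBracket (ϑ : TensorFamily d R) (i j : Fin d) :
    PhaseSeries d R :=
  X * thetaSeries ϑ i j

variable (D : Fin d → Derivation 𝕜 R R)
  (γ ϑ : TensorFamily d R)

theorem bracket_eq (F G : PhaseSeries d R) :
    cosymplecticBracket D γ ϑ F G = ∑ i, ∑ j, (baseBracket ϑ i j * dHor D i F * dHor D j G
      + mixedBracket γ i j * (dHor D i F * dVert j G - dVert j F * dHor D i G)) := rfl

/-- The Hamiltonian derivation `{F, ·}`. -/
def hamDer (F : PhaseSeries d R) : RingDer (PhaseSeries d R) where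
  toFun := cosymplecticBracket D γ ϑ F
  map_zero' := by simp [bracket_eq]
  map_add' G H := by
    simp only [bracket_eq, map_add, ← sum_add_distrib]
    refine sum_congr rfl fun i _ => sum_congr rfl fun j _ => ?_
    ring
  leibniz' G H := by
    simp only [bracket_eq, RingDer.leibniz, mul_sum, ← sum_add_distrib]
    refine sum_congr rfl fun i _ => sum_congr rfl fun j _ => ?_
    ring

variable {ϑ}

theorem bracket_skew (hϑ : ∀ n i j k, ϑ n j i k = -ϑ n i j k) (F G : PhaseSeries d R) :
    cosymplecticBracket D γ ϑ F G = -cosymplecticBracket D γ ϑ G F := by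
  have hθ : ∀ i j, baseBracket ϑ i j = -baseBracket ϑ j i := by
    intro i j
    simp only [baseBracket, ← mul_neg]
    congr 1
    ext n : 1
    simp [thetaSeries, fibrePoly, hϑ n j i]
  simp only [bracket_eq, sum_add_distrib, neg_add]
  congr 1
  · rw [sum_comm, ← sum_neg_distrib]
    refine sum_congr rfl fun i _ => ?_
    rw [← sum_neg_distrib]
    refine sum_congr rfl fun j _ => ?_
    rw [hθ j i]
    ring
  · rw [← sum_neg_distrib]
    refine sum_congr rfl fun i _ => ?_
    rw [← sum_neg_distrib]
    refine sum_congr rfl fun j _ => ?_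
    ring

variable (ϑ)

theorem bracket_add_right (F G H : PhaseSeries d R) : cosymplecticBracket D γ ϑ F (G + H)
    = cosymplecticBracket D γ ϑ F G + cosymplecticBracket D γ ϑ F H :=
  map_add (hamDer D γ ϑ F) G H

theorem bracket_sub_right (F G H : PhaseSeries d R) : cosymplecticBracket D γ ϑ F (G - H)
    = cosymplecticBracket D γ ϑ F G - cosymplecticBracket D γ ϑ F H :=
  map_sub (hamDer D γ ϑ F) G H

theorem bracket_neg_right (F G : PhaseSeries d R) : cosymplecticBracket D γ ϑ F (-G)
    = -cosymplecticBracket D γ ϑ F G :=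
  map_neg (hamDer D γ ϑ F) G

theorem bracket_sum_right {ι : Type} (s : Finset ι) (F : PhaseSeries d R)
    (G : ι → PhaseSeries d R) : cosymplecticBracket D γ ϑ F (∑ i ∈ s, G i)
    = ∑ i ∈ s, cosymplecticBracket D γ ϑ F (G i) :=
  map_sum (hamDer D γ ϑ F) G s

theorem bracket_mul_right (F G H : PhaseSeries d R) : cosymplecticBracket D γ ϑ F (G * H)
    = G * cosymplecticBracket D γ ϑ F H + H * cosymplecticBracket D γ ϑ F G :=
  (hamDer D γ ϑ F).leibniz G H

theorem bracket_add_left (F G H : PhaseSeries d R) : cosymplecticBracket D γ ϑ (F + G) H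
    = cosymplecticBracket D γ ϑ F H + cosymplecticBracket D γ ϑ G H := by
  simp only [bracket_eq, map_add, ← sum_add_distrib]
  refine sum_congr rfl fun i _ => sum_congr rfl fun j _ => ?_
  ring

theorem bracket_zero_left (H : PhaseSeries d R) : cosymplecticBracket D γ ϑ 0 H = 0 := by
  simp [bracket_eq]

theorem bracket_neg_left (F H : PhaseSeries d R) : cosymplecticBracket D γ ϑ (-F) H
    = -cosymplecticBracket D γ ϑ F H := by
  have h := bracket_add_left D γ ϑ F (-F) H
  rw [add_neg_cancel, bracket_zero_left] at h
  exact (neg_eq_of_add_eq_zero_right h.symm).symm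

theorem bracket_sub_left (F G H : PhaseSeries d R) : cosymplecticBracket D γ ϑ (F - G) H
    = cosymplecticBracket D γ ϑ F H - cosymplecticBracket D γ ϑ G H := by
  rw [sub_eq_add_neg, bracket_add_left, bracket_neg_left, sub_eq_add_neg]

theorem bracket_mul_left (F G H : PhaseSeries d R) : cosymplecticBracket D γ ϑ (F * G) H
    = F * cosymplecticBracket D γ ϑ G H + G * cosymplecticBracket D γ ϑ F H := by
  simp only [bracket_eq, RingDer.leibniz, mul_sum, ← sum_add_distrib]
  refine sum_congr rfl fun i _ => sum_congr rfl fun j _ => ?_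
  ring

theorem bracket_sum_left {ι : Type} (s : Finset ι) (F : ι → PhaseSeries d R)
    (H : PhaseSeries d R) : cosymplecticBracket D γ ϑ (∑ i ∈ s, F i) H
    = ∑ i ∈ s, cosymplecticBracket D γ ϑ (F i) H := by
  classical
  induction s using Finset.induction_on with
  | empty => simp [bracket_zero_left]
  | insert a s ha ih => rw [sum_insert ha, sum_insert ha, bracket_add_left, ih]

theorem bracket_pull_pull (f g : PowerSeries R) :
    cosymplecticBracket D γ ϑ (pull f) (pull g)
      = ∑ i, ∑ j, baseBracket ϑ i j * pull (dSer D i f) * pull (dSer D j g) := by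
  simp [bracket_eq]

theorem bracket_pull_constraint (A : Fin d → R) (f : PowerSeries R) (k : Fin d) :
    cosymplecticBracket D γ ϑ (pull f) (constraint A k)
      = ∑ i, (mixedBracket γ i k - ∑ j, baseBracket ϑ i j * pull (C (D j (A k))))
          * pull (dSer D i f) := by
  simp only [bracket_eq, dHor_pull, dHor_constraint, dVert_constraint, dVert_pull, zero_mul,
    sub_zero, sum_add_distrib, sub_mul, sum_sub_distrib]
  have h : ∀ i, (∑ j, mixedBracket γ i j * (pull (dSer D i f) * if j = k then 1 else 0))
      = mixedBracket γ i k * pull (dSer D i f) := by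
    intro i
    simp
  simp only [h, sub_eq_add_neg, ← sum_neg_distrib, sum_mul]
  rw [add_comm]
  congr 1
  refine sum_congr rfl fun i _ => sum_congr rfl fun j _ => ?_
  ring

theorem bracket_constraint_constraint (A : Fin d → R) (i k : Fin d) :
    cosymplecticBracket D γ ϑ (constraint A i) (constraint A k)
      = ∑ a, (mixedBracket γ a i * pull (C (D a (A k)))
          - mixedBracket γ a k * pull (C (D a (A i)))
          + ∑ b, baseBracket ϑ a b * pull (C (D a (A i)))
              * pull (C (D b (A k)))) := by
  simp only [bracket_eq, dHor_constraint, dVert_constraint, sum_add_distrib]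
  have h : ∀ a, (∑ j, mixedBracket γ a j *
        (-pull (C (D a (A i))) * (if j = k then 1 else 0)
          - (if j = i then 1 else 0) * -pull (C (D a (A k)))))
      = mixedBracket γ a i * pull (C (D a (A k)))
          - mixedBracket γ a k * pull (C (D a (A i))) := by
    intro a
    simp only [mul_sub, sum_sub_distrib, mul_ite, ite_mul, mul_one, mul_zero, one_mul,
      zero_mul, sum_ite_eq', mem_univ, if_true]
    ring
  simp only [h]
  simp only [mul_neg, neg_mul, neg_neg]
  rw [add_comm]

/-- On the section `p = A(x)` a function may be replaced by its restriction to the section, up to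
its normal derivatives. -/
theorem sect_bracket_right (A : Fin d → R) (F u : PhaseSeries d R) :
    sect A (cosymplecticBracket D γ ϑ F u)
      = sect A (cosymplecticBracket D γ ϑ F (pull (sect A u)))
        + ∑ k, sect A (dVert k u) * sect A (cosymplecticBracket D γ ϑ F (constraint A k)) := by
  obtain ⟨a, b, h⟩ : ∃ a b : Fin d → PowerSeries R, ∀ G : PhaseSeries d R,
      sect A (cosymplecticBracket D γ ϑ F G)
        = ∑ j, a j * sect A (dHor D j G) + ∑ j, b j * sect A (dVert j G) := by
    refine ⟨fun j => ∑ i, sect A (baseBracket ϑ i j) * sect A (dHor D i F)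
        - ∑ i, sect A (mixedBracket γ j i) * sect A (dVert i F),
      fun j => ∑ i, sect A (mixedBracket γ i j) * sect A (dHor D i F), fun G => ?_⟩
    have e1 : (∑ i, ∑ j, sect A (baseBracket ϑ i j) * sect A (dHor D i F) * sect A (dHor D j G))
        = ∑ j, ∑ i, sect A (baseBracket ϑ i j) * sect A (dHor D i F) * sect A (dHor D j G) :=
      sum_comm
    have e2 : (∑ i, ∑ j, sect A (mixedBracket γ i j) * sect A (dHor D i F) * sect A (dVert j G))
        = ∑ j, ∑ i, sect A (mixedBracket γ i j) * sect A (dHor D i F) * sect A (dVert j G) :=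
      sum_comm
    simp only [bracket_eq, map_sum, map_add, map_mul, map_sub, mul_sub, sum_add_distrib,
      sum_sub_distrib, sub_mul, sum_mul, ← mul_assoc, e1, e2]
    ring
  have h1 : ∀ k, sect A (cosymplecticBracket D γ ϑ F (constraint A k))
      = b k - ∑ j, a j * C (D j (A k)) := by
    intro k
    rw [h]
    simp only [dHor_constraint, map_neg, sect_pull, mul_neg, sum_neg_distrib,
      dVert_constraint]
    simp
    ring
  rw [h, h (pull _)]
  simp only [h1, dHor_pull, sect_pull, dVert_pull, map_zero, mul_zero, sum_const_zero,
    add_zero, dSer_sect, mul_add, sum_add_distrib, mul_sub, sum_sub_distrib,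
    mul_sum]
  rw [sum_comm (f := fun j k => sect A (dVert j u) * (a k * C (D k (A j))))]
  have e : ∀ j k, a j * (sect A (dVert k u) * C (D j (A k)))
      = sect A (dVert k u) * (a j * C (D j (A k))) := fun j k => by ring
  simp only [e, mul_comm (b _)]
  ring

/-- `Φ_A(X)`. -/
theorem constraintApply_eq (A : Fin d → R) (X : Fin d → PowerSeries R) :
    constraintApply A X = ∑ i, constraint A i * pull (X i) := rfl

@[simp] theorem sect_constraintApply (A : Fin d → R) (X : Fin d → PowerSeries R) :
    sect A (constraintApply A X) = 0 := by
  simp [constraintApply_eq]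

theorem dVert_constraintApply (A : Fin d → R) (X : Fin d → PowerSeries R) (i : Fin d) :
    dVert i (constraintApply A X) = pull (X i) := by
  simp [constraintApply_eq, RingDer.leibniz, dVert_constraint]

theorem sect_bracket_constraintApply_right (A : Fin d → R) (X : Fin d → PowerSeries R)
    (F : PhaseSeries d R) :
    sect A (cosymplecticBracket D γ ϑ F (constraintApply A X))
      = ∑ i, X i * sect A (cosymplecticBracket D γ ϑ F (constraint A i)) := by
  simp [constraintApply_eq, bracket_sum_right, bracket_mul_right]

theorem sect_bracket_constraintApply_left (A : Fin d → R) (X : Fin d → PowerSeries R)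
    (F : PhaseSeries d R) :
    sect A (cosymplecticBracket D γ ϑ (constraintApply A X) F)
      = ∑ i, X i * sect A (cosymplecticBracket D γ ϑ (constraint A i) F) := by
  simp [constraintApply_eq, bracket_sum_left, bracket_mul_left]

theorem sect_dVert_bracket_constraintApply_right (A : Fin d → R) (X : Fin d → PowerSeries R)
    (F : PhaseSeries d R) (m : Fin d) :
    sect A (dVert m (cosymplecticBracket D γ ϑ F (constraintApply A X)))
      = ∑ i, X i * sect A (dVert m (cosymplecticBracket D γ ϑ F (constraint A i)))
        + sect A (cosymplecticBracket D γ ϑ F (pull (X m))) := by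
  simp [constraintApply_eq, bracket_sum_right, bracket_mul_right, RingDer.leibniz,
    dVert_constraint, sum_add_distrib]
  ring

theorem sect_dVert_bracket_constraintApply_left (A : Fin d → R) (X : Fin d → PowerSeries R)
    (F : PhaseSeries d R) (m : Fin d) :
    sect A (dVert m (cosymplecticBracket D γ ϑ (constraintApply A X) F))
      = ∑ i, X i * sect A (dVert m (cosymplecticBracket D γ ϑ (constraint A i) F))
        + sect A (cosymplecticBracket D γ ϑ (pull (X m)) F) := by
  simp [constraintApply_eq, bracket_sum_left, bracket_mul_left, RingDer.leibniz,
    dVert_constraint, sum_add_distrib]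
  ring

end Bracket

/-! ## Jet functions representing the gauge variations and their brackets -/

section Variations

variable (D : Fin d → Derivation 𝕜 R R)
  (γ ϑ : TensorFamily d R)

/-- The jet function `s_A^*{Φᵢ, Φₖ}`. -/
def constraintJet (i k : Fin d) : JetSeries d R :=
  ∑ a, (toJet (mixedBracket γ a i) * jetMatrix d R a k
    - toJet (mixedBracket γ a k) * jetMatrix d R a i
    + ∑ b, toJet (baseBracket ϑ a b) * jetMatrix d R a i * jetMatrix d R b k)

/-- The coefficient of `∂ⱼf` in the jet function `s_A^*{π^*f, Φₖ}`. -/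
def anchorJet (k j : Fin d) : JetSeries d R :=
  toJet (mixedBracket γ j k) - ∑ l, toJet (baseBracket ϑ j l) * jetMatrix d R l k

theorem evJ_constraintJet (A : Fin d → R) (i k : Fin d) :
    evJ D A (constraintJet γ ϑ i k)
      = sect A (cosymplecticBracket D γ ϑ (constraint A i) (constraint A k)) := by
  simp [constraintJet, bracket_constraint_constraint, evJ_jetMatrix]

theorem evJ_anchorJet (A : Fin d → R) (f : PowerSeries R) (k : Fin d) :
    ∑ j, evJ D A (anchorJet γ ϑ k j) * dSer D j f
      = sect A (cosymplecticBracket D γ ϑ (pull f) (constraint A k)) := by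
  simp [anchorJet, bracket_pull_constraint, evJ_jetMatrix]

/-- The derivative of a fibre polynomial along a vertical vector field on the section. -/
def vertVar (A : Fin d → R) (B : Fin d → PowerSeries R) (F : PhaseSeries d R) : PowerSeries R :=
  ∑ m, sect A (dVert m F) * B m

section VertVar

variable (A : Fin d → R) (B : Fin d → PowerSeries R)

theorem varJ_toJet_eq (F : PhaseSeries d R) : varJ D A B (toJet F) = vertVar A B F :=
  varJ_toJet D A B F

theorem vertVar_add (F G : PhaseSeries d R) :
    vertVar A B (F + G) = vertVar A B F + vertVar A B G := by
  simp [vertVar, add_mul, sum_add_distrib]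

theorem vertVar_sub (F G : PhaseSeries d R) :
    vertVar A B (F - G) = vertVar A B F - vertVar A B G := by
  simp [vertVar, sub_mul, sum_sub_distrib]

theorem vertVar_sum {ι : Type} (s : Finset ι) (F : ι → PhaseSeries d R) :
    vertVar A B (∑ i ∈ s, F i) = ∑ i ∈ s, vertVar A B (F i) := by
  simp only [vertVar, map_sum, sum_mul]
  exact sum_comm

theorem vertVar_mul (F G : PhaseSeries d R) :
    vertVar A B (F * G) = sect A F * vertVar A B G + sect A G * vertVar A B F := by
  simp only [vertVar, RingDer.leibniz, map_add, map_mul, add_mul, sum_add_distrib,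
    mul_sum, mul_assoc]

theorem vertVar_pull (F : PowerSeries R) : vertVar A B (pull F) = 0 := by
  simp [vertVar]

end VertVar

theorem varJ_anchorJet (A : Fin d → R) (B : Fin d → PowerSeries R) (f : PowerSeries R)
    (k : Fin d) :
    ∑ j, varJ D A B (anchorJet γ ϑ k j) * dSer D j f
      = vertVar A B (cosymplecticBracket D γ ϑ (pull f) (constraint A k))
        - sect A (cosymplecticBracket D γ ϑ (pull f) (pull (B k))) := by
  simp only [anchorJet, varJ_sub, varJ_sum, varJ_mul, varJ_toJet_eq, evJ_toJet, varJ_jetMatrix,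
    evJ_jetMatrix, bracket_pull_constraint, bracket_pull_pull, vertVar_sum, vertVar_mul,
    vertVar_sub, vertVar_pull, map_sum, map_mul, sect_pull, mul_zero, zero_add]
  rw [← sum_sub_distrib]
  refine sum_congr rfl fun j _ => ?_
  simp only [mul_sub, sub_mul, sum_add_distrib, mul_sum, sum_mul, add_mul]
  rw [sum_congr rfl fun l _ =>
    mul_right_comm (sect A (baseBracket ϑ j l)) (dSer D j f) (dSer D l (B k))]
  simp only [mul_comm (dSer D j f)]
  ring

theorem varJ_constraintJet (A : Fin d → R) (B : Fin d → PowerSeries R) (i k : Fin d)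
    (hϑ : ∀ n i j k, ϑ n j i k = -ϑ n i j k) :
    varJ D A B (constraintJet γ ϑ i k)
      = vertVar A B (cosymplecticBracket D γ ϑ (constraint A i) (constraint A k))
        - sect A (cosymplecticBracket D γ ϑ (pull (B i)) (constraint A k))
        - sect A (cosymplecticBracket D γ ϑ (constraint A i) (pull (B k))) := by
  rw [bracket_skew D γ hϑ (constraint A i) (pull (B k))]
  simp only [constraintJet, varJ_sub, varJ_add, varJ_sum, varJ_mul, varJ_toJet_eq, evJ_toJet,
    varJ_jetMatrix, evJ_jetMatrix, bracket_pull_constraint, bracket_constraint_constraint,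
    vertVar_sum, vertVar_mul, vertVar_sub, vertVar_add, vertVar_pull, map_sum, map_mul, map_neg,
    map_sub, sect_pull, mul_zero, zero_add, evJ_toJet, map_mul]
  have hθ : ∀ a b, sect A (baseBracket ϑ a b) = -sect A (baseBracket ϑ b a) := by
    intro i j
    rw [← map_neg]
    congr 1
    simp only [baseBracket, ← mul_neg]
    congr 1
    ext n : 1
    simp [thetaSeries, fibrePoly, hϑ n j i]
  have e : (∑ a, ∑ b, sect A (baseBracket ϑ a b) * C (D a (A i)) * dSer D b (B k))
      = -∑ a, (∑ b, sect A (baseBracket ϑ a b) * C (D b (A i))) * dSer D a (B k) := by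
    rw [sum_comm, ← sum_neg_distrib]
    refine sum_congr rfl fun a _ => ?_
    rw [sum_mul, ← sum_neg_distrib]
    refine sum_congr rfl fun b _ => ?_
    rw [hθ b a]
    ring
  have e' : ∀ a b, C (D b (A k)) * (sect A (baseBracket ϑ a b) * dSer D a (B i)
        + C (D a (A i)) * vertVar A B (baseBracket ϑ a b))
      = sect A (baseBracket ϑ a b) * C (D b (A k)) * dSer D a (B i)
        + C (D b (A k)) * (C (D a (A i)) *
          vertVar A B (baseBracket ϑ a b)) := fun a b => by ring
  simp only [sum_add_distrib, e', e, sum_sub_distrib, sub_mul, sum_mul]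
  ring

end Variations

/-! ## Closure of the gauge variations and the Jacobi identity of their bracket -/

section Closure

variable (D : Fin d → Derivation 𝕜 R R)
  (γ ϑ : TensorFamily d R)

/-- The field dependent Hamiltonian `π^*f + Φ_A(X)`. -/
def ham (A : Fin d → R) (f : PowerSeries R) (X : Fin d → PowerSeries R) : PhaseSeries d R :=
  pull f + constraintApply A X

/-- The variation of `π^*f + Φ_A(X)` along `δA = B`, `δX = Y`. -/
def hamVar (A : Fin d → R) (B X Y : Fin d → PowerSeries R) : PhaseSeries d R :=
  constraintApply A Y - pull (∑ i, B i * X i)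

theorem sect_ham (A : Fin d → R) (f : PowerSeries R) (X : Fin d → PowerSeries R) :
    sect A (ham A f X) = f := by
  simp [ham]

theorem dVert_ham (A : Fin d → R) (f : PowerSeries R) (X : Fin d → PowerSeries R) (i : Fin d) :
    dVert i (ham A f X) = pull (X i) := by
  simp [ham, dVert_constraintApply]

theorem sect_hamVar (A : Fin d → R) (B X Y : Fin d → PowerSeries R) :
    sect A (hamVar A B X Y) = -∑ i, B i * X i := by
  simp [hamVar]

theorem dVert_hamVar (A : Fin d → R) (B X Y : Fin d → PowerSeries R) (i : Fin d) :
    dVert i (hamVar A B X Y) = pull (Y i) := by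
  rw [hamVar, map_sub, dVert_constraintApply, dVert_pull, sub_zero]

/-- The Jacobi identity of the bracket. -/
def BracketJacobi : Prop :=
  ∀ F G H : PhaseSeries d R,
    cosymplecticBracket D γ ϑ F (cosymplecticBracket D γ ϑ G H)
      + cosymplecticBracket D γ ϑ G (cosymplecticBracket D γ ϑ H F)
      + cosymplecticBracket D γ ϑ H (cosymplecticBracket D γ ϑ F G) = 0

local notation "⦃" F "," G "⦄" => cosymplecticBracket D γ ϑ F G

theorem sect_bracket_vertVar (A : Fin d → R) (F u : PhaseSeries d R) :
    sect A ⦃F, u⦄ = sect A ⦃F, pull (sect A u)⦄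
      + vertVar A (fun k => sect A ⦃F, constraint A k⦄) u :=
  sect_bracket_right D γ ϑ A F u

/-- The restriction of a bracket to the section depends on the restrictions of the entries and of
their vertical derivatives only. -/
theorem sect_bracket_congr_right (A : Fin d → R) (F u v : PhaseSeries d R)
    (h : sect A u = sect A v) (h' : ∀ i, sect A (dVert i u) = sect A (dVert i v)) :
    sect A ⦃F, u⦄ = sect A ⦃F, v⦄ := by
  rw [sect_bracket_right, sect_bracket_right D γ ϑ A F v, h]
  simp only [h']

/-- `⟦f, g⟧` in terms of the Hamiltonians. -/
theorem sect_bracket_sub_constraintApply (hϑ : ∀ n i j k, ϑ n j i k = -ϑ n i j k)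
    (A : Fin d → R) (f g : PowerSeries R) (X Y : Fin d → PowerSeries R) :
    sect A ⦃pull f, pull g⦄ - sect A ⦃constraintApply A X, constraintApply A Y⦄
      = sect A ⦃ham A f X, ham A g Y⦄ - ∑ i, sect A ⦃ham A f X, constraint A i⦄ * Y i
        + ∑ i, sect A ⦃ham A g Y, constraint A i⦄ * X i := by
  have h1 : ∑ i, sect A ⦃ham A f X, constraint A i⦄ * Y i
      = sect A ⦃ham A f X, constraintApply A Y⦄ := by
    rw [sect_bracket_constraintApply_right]
    simp only [mul_comm]
  have h2 : ∑ i, sect A ⦃ham A g Y, constraint A i⦄ * X i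
      = sect A ⦃ham A g Y, constraintApply A X⦄ := by
    rw [sect_bracket_constraintApply_right]
    simp only [mul_comm]
  rw [h1, h2]
  simp only [ham, bracket_add_left, bracket_add_right, map_add]
  rw [bracket_skew D γ hϑ (pull g) (constraintApply A X),
    bracket_skew D γ hϑ (constraintApply A Y) (constraintApply A X)]
  simp only [map_neg]
  ring

/-- The variation of `s_A^*{π^*f + Φ_A(X), Φₖ}`, computed term by term. -/
theorem gauge_variation_formula (A : Fin d → R)
    (f : PowerSeries R) (B X Y : Fin d → PowerSeries R) (k : Fin d) :
    (vertVar A B ⦃pull f, constraint A k⦄ - sect A ⦃pull f, pull (B k)⦄)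
      + ∑ i, (Y i * sect A ⦃constraint A i, constraint A k⦄
          + X i * (vertVar A B ⦃constraint A i, constraint A k⦄
            - sect A ⦃pull (B i), constraint A k⦄ - sect A ⦃constraint A i, pull (B k)⦄))
      = vertVar A B ⦃ham A f X, constraint A k⦄ + sect A ⦃hamVar A B X Y, constraint A k⦄
        - sect A ⦃ham A f X, pull (B k)⦄ := by
  have e : pull (∑ i, B i * X i) = ∑ i, pull (d := d) (B i) * pull (X i) := by simp
  have h1 : sect A ⦃pull (∑ i, B i * X i), constraint A k⦄
      = ∑ i, (B i * sect A ⦃pull (X i), constraint A k⦄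
        + X i * sect A ⦃pull (B i), constraint A k⦄) := by
    rw [e, bracket_sum_left, map_sum]
    simp [bracket_mul_left]
  have h2 : vertVar A B ⦃constraintApply A X, constraint A k⦄
      = ∑ i, (X i * vertVar A B ⦃constraint A i, constraint A k⦄
        + B i * sect A ⦃pull (X i), constraint A k⦄) := by
    simp only [vertVar, sect_dVert_bracket_constraintApply_left, add_mul, sum_add_distrib,
      sum_mul, mul_sum]
    rw [sum_comm]
    simp only [mul_assoc, mul_comm (B _)]
  simp only [ham, hamVar, bracket_add_left, bracket_sub_left, map_add, map_sub, vertVar_add, h1, h2,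
    sect_bracket_constraintApply_left, sum_add_distrib, mul_sub, sum_sub_distrib]
  ring

section Three

variable (hϑ : ∀ n i j k, ϑ n j i k = -ϑ n i j k)
  (hJ : BracketJacobi D γ ϑ)
  (A : Fin d → R) {ι : Type} (H : ι → PhaseSeries d R) (X : ι → Fin d → PowerSeries R)
  (Y : ι → ι → Fin d → PowerSeries R)

/-- The gauge variations `δ_a A` of a family of Hamiltonians. -/
def famVar (a : ι) (k : Fin d) : PowerSeries R := sect A ⦃H a, constraint A k⦄

/-- The variation of the Hamiltonian `H b` along `δ_a`. -/
def famHamVar (a b : ι) : PhaseSeries d R := hamVar A (famVar D γ ϑ A H a) (X b) (Y a b)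

/-- The field dependent bracket of the Hamiltonians `H a` and `H b`. -/
def famBracket (a b : ι) : PhaseSeries d R :=
  ⦃H a, H b⦄ + famHamVar D γ ϑ A H X Y a b - famHamVar D γ ϑ A H X Y b a

/-- The variation of `δ_b A` along `δ_a`. -/
def famVarVar (a b : ι) (k : Fin d) : PowerSeries R :=
  vertVar A (famVar D γ ϑ A H a) ⦃H b, constraint A k⦄
    + sect A ⦃famHamVar D γ ϑ A H X Y a b, constraint A k⦄
    - sect A ⦃H b, pull (famVar D γ ϑ A H a k)⦄

include hϑ hJ in
theorem famVarVar_sub (a b : ι) (k : Fin d) :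
    famVarVar D γ ϑ A H X Y a b k - famVarVar D γ ϑ A H X Y b a k
      = sect A ⦃famBracket D γ ϑ A H X Y a b, constraint A k⦄ := by
  have h1 : ∀ a b, sect A ⦃H a, ⦃H b, constraint A k⦄⦄
      = sect A ⦃H a, pull (famVar D γ ϑ A H b k)⦄
        + vertVar A (famVar D γ ϑ A H a) ⦃H b, constraint A k⦄ :=
    fun a b => sect_bracket_vertVar D γ ϑ A (H a) _
  have h2 := hJ (H a) (H b) (constraint A k)
  rw [bracket_skew D γ hϑ (constraint A k) (H a), bracket_neg_right,
    bracket_skew D γ hϑ (constraint A k) ⦃H a, H b⦄] at h2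
  have h3 := congrArg (sect A) h2
  simp only [map_add, map_neg, map_zero, h1] at h3
  simp only [famVarVar, famBracket, bracket_add_left, bracket_sub_left, map_add, map_sub]
  linear_combination h3

/-- `⟦a, b⟧` evaluated at `A`. -/
def famPhi (a b : ι) : PowerSeries R :=
  sect A ⦃H a, H b⦄ - ∑ i, famVar D γ ϑ A H a i * X b i + ∑ i, famVar D γ ϑ A H b i * X a i

theorem sect_famBracket (a b : ι) :
    sect A (famBracket D γ ϑ A H X Y a b) = famPhi D γ ϑ A H X a b := by
  simp [famBracket, famHamVar, sect_hamVar, famPhi]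
  ring

/-- The variation of `⟦a, b⟧` along `δ_c`. -/
def famPhiVar (c a b : ι) : PowerSeries R :=
  vertVar A (famVar D γ ϑ A H c) ⦃H a, H b⦄ + sect A ⦃famHamVar D γ ϑ A H X Y c a, H b⦄
    + sect A ⦃H a, famHamVar D γ ϑ A H X Y c b⦄
    - ∑ i, (famVarVar D γ ϑ A H X Y c a i * X b i + famVar D γ ϑ A H a i * Y c b i)
    + ∑ i, (famVarVar D γ ϑ A H X Y c b i * X a i + famVar D γ ϑ A H b i * Y c a i)

/-- `⟦c, ⟦a, b⟧⟧` evaluated at `A`. -/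
def famPhiPhi (c a b : ι) : PowerSeries R :=
  sect A ⦃H c, famBracket D γ ϑ A H X Y a b⦄
    - vertVar A (famVar D γ ϑ A H c) (famBracket D γ ϑ A H X Y a b)
    + ∑ i, sect A ⦃famBracket D γ ϑ A H X Y a b, constraint A i⦄ * X c i

include hϑ hJ in
theorem famPhi_jacobi (a b c : ι) :
    (famPhiPhi D γ ϑ A H X Y c a b + famPhiVar D γ ϑ A H X Y c a b)
      + (famPhiPhi D γ ϑ A H X Y a b c + famPhiVar D γ ϑ A H X Y a b c)
      + (famPhiPhi D γ ϑ A H X Y b c a + famPhiVar D γ ϑ A H X Y b c a) = 0 := by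
  have e1 : ∀ c a b, vertVar A (famVar D γ ϑ A H c) (famBracket D γ ϑ A H X Y a b)
      = vertVar A (famVar D γ ϑ A H c) ⦃H a, H b⦄ + ∑ i, famVar D γ ϑ A H c i * Y a b i
        - ∑ i, famVar D γ ϑ A H c i * Y b a i := by
    intro c a b
    have e : ∀ a b, vertVar A (famVar D γ ϑ A H c) (famHamVar D γ ϑ A H X Y a b)
        = ∑ i, famVar D γ ϑ A H c i * Y a b i := by
      intro a b
      simp [vertVar, famHamVar, dVert_hamVar, mul_comm]
    rw [famBracket, vertVar_sub, vertVar_add, e, e]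
  have e2 : ∀ c a b, sect A ⦃H c, famBracket D γ ϑ A H X Y a b⦄
      = sect A ⦃H c, ⦃H a, H b⦄⦄ + sect A ⦃H c, famHamVar D γ ϑ A H X Y a b⦄
        - sect A ⦃H c, famHamVar D γ ϑ A H X Y b a⦄ := by
    intro c a b
    rw [famBracket, bracket_sub_right, bracket_add_right, map_sub, map_add]
  have e3 : ∀ c a b, sect A ⦃famHamVar D γ ϑ A H X Y c a, H b⦄
      = -sect A ⦃H b, famHamVar D γ ϑ A H X Y c a⦄ := by
    intro c a b
    rw [bracket_skew D γ hϑ, map_neg]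
  have e4 : ∀ c a b, ∑ i, sect A ⦃famBracket D γ ϑ A H X Y a b, constraint A i⦄ * X c i
      = ∑ i, famVarVar D γ ϑ A H X Y a b i * X c i
        - ∑ i, famVarVar D γ ϑ A H X Y b a i * X c i := by
    intro c a b
    rw [← sum_sub_distrib]
    refine sum_congr rfl fun i _ => ?_
    rw [← famVarVar_sub D γ ϑ hϑ hJ, sub_mul]
  have e5 := congrArg (sect A) (hJ (H a) (H b) (H c))
  simp only [map_add, map_zero] at e5
  simp only [famPhiPhi, famPhiVar, e1, e2, e3, e4, sum_add_distrib]
  linear_combination e5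

end Three

end Closure

/-! ## The gauge algebroid in terms of jet functions -/

section Algebroid

variable (D : Fin d → Derivation 𝕜 R R)
  (γ ϑ : TensorFamily d R)
  (Υ : MultiplierFamily d R)

local notation "⦃" F "," G "⦄" => cosymplecticBracket D γ ϑ F G

theorem sect_bracket_hamVar_right (A : Fin d → R) (B X Y : Fin d → PowerSeries R)
    (F : PhaseSeries d R) :
    sect A ⦃F, hamVar A B X Y⦄ = ∑ i, Y i * sect A ⦃F, constraint A i⦄
      - ∑ i, (B i * sect A ⦃F, pull (X i)⦄ + X i * sect A ⦃F, pull (B i)⦄) := by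
  rw [hamVar, bracket_sub_right, map_sub, sect_bracket_constraintApply_right, map_sum,
    bracket_sum_right, map_sum]
  simp [bracket_mul_right]

theorem vertVar_bracket_constraintApply (A : Fin d → R) (B X : Fin d → PowerSeries R)
    (F : PhaseSeries d R) :
    vertVar A B ⦃F, constraintApply A X⦄ = ∑ i, X i * vertVar A B ⦃F, constraint A i⦄
      + ∑ i, B i * sect A ⦃F, pull (X i)⦄ := by
  simp only [vertVar, sect_dVert_bracket_constraintApply_right, add_mul, sum_add_distrib,
    sum_mul, mul_sum]
  rw [sum_comm]
  simp only [mul_assoc, mul_comm (B _)]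

theorem variation_constraintApply (A : Fin d → R) (F F' : PhaseSeries d R)
    (B Y Y' : Fin d → PowerSeries R) :
    vertVar A B ⦃F, constraintApply A Y⦄ + sect A ⦃F, hamVar A B Y Y'⦄
        + sect A ⦃F', constraintApply A Y⦄
      = ∑ i, ((vertVar A B ⦃F, constraint A i⦄ + sect A ⦃F', constraint A i⦄
          - sect A ⦃F, pull (B i)⦄) * Y i + sect A ⦃F, constraint A i⦄ * Y' i) := by
  rw [vertVar_bracket_constraintApply, sect_bracket_hamVar_right,
    sect_bracket_constraintApply_right]
  simp only [sum_add_distrib, sub_mul, add_mul, sum_sub_distrib, mul_comm (Y _),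
    mul_comm (Y' _)]
  ring

theorem vertVar_neg (A : Fin d → R) (B : Fin d → PowerSeries R) (F : PhaseSeries d R) :
    vertVar A B (-F) = -vertVar A B F := by
  simp [vertVar]

/-- The variation of `⟦f, g⟧`, computed term by term. -/
theorem bracket_variation_formula (hϑ : ∀ n i j k, ϑ n j i k = -ϑ n i j k) (A : Fin d → R)
    (f g : PowerSeries R) (B X X' Y Y' : Fin d → PowerSeries R) :
    vertVar A B ⦃pull f, pull g⦄
      - ∑ k, ((∑ i, (X' i * sect A ⦃constraint A i, constraint A k⦄
          + X i * (vertVar A B ⦃constraint A i, constraint A k⦄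
            - sect A ⦃pull (B i), constraint A k⦄ - sect A ⦃constraint A i, pull (B k)⦄))) * Y k
          + (∑ i, X i * sect A ⦃constraint A i, constraint A k⦄) * Y' k)
    = vertVar A B ⦃ham A f X, ham A g Y⦄ + sect A ⦃hamVar A B X X', ham A g Y⦄
      + sect A ⦃ham A f X, hamVar A B Y Y'⦄
      - ∑ i, ((vertVar A B ⦃ham A f X, constraint A i⦄ + sect A ⦃hamVar A B X X', constraint A i⦄
          - sect A ⦃ham A f X, pull (B i)⦄) * Y i + sect A ⦃ham A f X, constraint A i⦄ * Y' i)
      + ∑ i, ((vertVar A B ⦃ham A g Y, constraint A i⦄ + sect A ⦃hamVar A B Y Y', constraint A i⦄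
          - sect A ⦃ham A g Y, pull (B i)⦄) * X i + sect A ⦃ham A g Y, constraint A i⦄ * X' i) := by
  have e0 : ham A 0 X = constraintApply A X := by simp [ham]
  have h0 : ∀ k, ∑ i, (X' i * sect A ⦃constraint A i, constraint A k⦄
          + X i * (vertVar A B ⦃constraint A i, constraint A k⦄
            - sect A ⦃pull (B i), constraint A k⦄ - sect A ⦃constraint A i, pull (B k)⦄))
      = vertVar A B ⦃constraintApply A X, constraint A k⦄
        + sect A ⦃hamVar A B X X', constraint A k⦄
        - sect A ⦃constraintApply A X, pull (B k)⦄ := by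
    intro k
    have h := gauge_variation_formula D γ ϑ A 0 B X X' k
    rw [e0] at h
    simpa [vertVar, bracket_zero_left] using h
  simp only [h0, ← sect_bracket_constraintApply_left]
  rw [← variation_constraintApply, ← variation_constraintApply, ← variation_constraintApply]
  rw [bracket_skew D γ hϑ (ham A g Y) (constraintApply A X), vertVar_neg,
    bracket_skew D γ hϑ (ham A g Y) (hamVar A B X X'),
    bracket_skew D γ hϑ (hamVar A B Y Y') (constraintApply A X)]
  simp only [ham, bracket_add_left, bracket_add_right, map_add, vertVar_add, map_neg]
  ring

theorem varJ_X_pow (A : Fin d → R) (B : Fin d → PowerSeries R) (n : ℕ) :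
    varJ D A B (X ^ n) = 0 := by
  induction n with
  | zero => simp [varJ_one]
  | succ n ih => rw [pow_succ, varJ_mul, ih, varJ_X]; simp

/-- The coefficient of `∂ⱼf` in the jet function `δ_f Aₖ`. -/
def gaugeJet (k j : Fin d) : JetSeries d R :=
  anchorJet γ ϑ k j
    + X ^ 2 * ∑ i, multiplierSeries 𝕜 Υ i j * constraintJet γ ϑ i k

/-- The coefficient of `∂ᵢf ∂ⱼg` in the jet function `t ⟦f, g⟧`. -/
def bracketJet (i j : Fin d) : JetSeries d R :=
  toJet (baseBracket ϑ i j)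
    - X ^ 4 * ∑ b, (∑ a, multiplierSeries 𝕜 Υ a i * constraintJet γ ϑ a b)
        * multiplierSeries 𝕜 Υ b j

/-- The variation of the multiplier `L_f` along `δA = B`. -/
def multVar (A : Fin d → R) (B : Fin d → PowerSeries R) (f : R) (i : Fin d) : PowerSeries R :=
  X ^ 2 * ∑ j, varJ D A B (multiplierSeries 𝕜 Υ i j) * C (D j f)

/-- The field dependent Hamiltonian of a gauge parameter. -/
def gaugeHam (A : Fin d → R) (φ : PowerSeries R) : PhaseSeries d R :=
  ham A φ (multiplier D Υ A φ)

theorem multiplier_eq (A : Fin d → R) (φ : PowerSeries R) (i : Fin d) :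
    multiplier D Υ A φ i
      = X ^ 2 * ∑ j, evJ D A (multiplierSeries 𝕜 Υ i j) * dSer D j φ := rfl

theorem multiplier_C (A : Fin d → R) (f : R) (i : Fin d) :
    multiplier D Υ A (C f) i
      = X ^ 2 * ∑ j, evJ D A (multiplierSeries 𝕜 Υ i j) * C (D j f) := by
  simp only [multiplier_eq, dSer_C]

theorem gaugeVariation_eq (f : R) (A : Fin d → R) (k : Fin d) :
    gaugeVariation D γ ϑ Υ f A k
      = sect A ⦃gaugeHam D Υ A (C f), constraint A k⦄ := rfl

theorem multiplierVariation_eq (f g : R) (A : Fin d → R) (i : Fin d) :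
    multiplierVariation D γ ϑ Υ f g A i
      = multVar D Υ A (gaugeVariation D γ ϑ Υ f A) g i := rfl

theorem gaugeBracket_eq (f g : R) (A : Fin d → R) :
    gaugeBracket D γ ϑ Υ f g A = sect A ⦃pull (C f), pull (C g)⦄
      - sect A ⦃constraintApply A (multiplier D Υ A (C f)),
          constraintApply A (multiplier D Υ A (C g))⦄ := rfl

theorem evJ_gaugeJet (A : Fin d → R) (φ : PowerSeries R) (k : Fin d) :
    ∑ j, evJ D A (gaugeJet (𝕜 := 𝕜) γ ϑ Υ k j) * dSer D j φ
      = sect A ⦃gaugeHam D Υ A φ, constraint A k⦄ := by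
  simp only [gaugeJet, map_add, add_mul, sum_add_distrib, evJ_anchorJet, gaugeHam, ham,
    bracket_add_left, sect_bracket_constraintApply_left, map_mul, map_pow, evJ_X, map_sum,
    evJ_constraintJet, multiplier_eq, mul_sum, sum_mul]
  rw [add_right_inj, sum_comm]
  refine sum_congr rfl fun i _ => sum_congr rfl fun j _ => ?_
  ring

theorem gaugeVariation_eq_sum (f : R) (A : Fin d → R) (k : Fin d) :
    gaugeVariation D γ ϑ Υ f A k
      = ∑ j, evJ D A (gaugeJet (𝕜 := 𝕜) γ ϑ Υ k j) * C (D j f) := by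
  rw [gaugeVariation_eq, ← evJ_gaugeJet]
  simp only [dSer_C]

theorem varJ_gaugeJet (hϑ : ∀ n i j k, ϑ n j i k = -ϑ n i j k) (A : Fin d → R)
    (B : Fin d → PowerSeries R) (f : R) (k : Fin d) :
    ∑ j, varJ D A B (gaugeJet (𝕜 := 𝕜) γ ϑ Υ k j) * C (D j f)
      = vertVar A B ⦃gaugeHam D Υ A (C f), constraint A k⦄
        + sect A ⦃hamVar A B (multiplier D Υ A (C f)) (multVar D Υ A B f),
            constraint A k⦄
        - sect A ⦃gaugeHam D Υ A (C f), pull (B k)⦄ := by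
  rw [gaugeHam, ← gauge_variation_formula]
  have h1 := varJ_anchorJet D γ ϑ A B (C f) k
  simp only [dSer_C] at h1
  rw [← h1]
  have h3 : ∀ j, varJ D A B (gaugeJet (𝕜 := 𝕜) γ ϑ Υ k j)
      = varJ D A B (anchorJet γ ϑ k j) + ∑ i, X ^ 2
        * (evJ D A (multiplierSeries 𝕜 Υ i j) * varJ D A B (constraintJet γ ϑ i k)
          + evJ D A (constraintJet γ ϑ i k) * varJ D A B (multiplierSeries 𝕜 Υ i j)) := by
    intro j
    rw [gaugeJet, varJ_add, varJ_mul, varJ_X_pow, mul_zero, add_zero, varJ_sum, map_pow, evJ_X,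
      mul_sum]
    simp only [varJ_mul]
  simp only [h3, add_mul _ _ (C _), sum_add_distrib (f := fun j =>
    varJ D A B (anchorJet γ ϑ k j) * _), sum_mul, add_right_inj]
  rw [sum_comm]
  refine sum_congr rfl fun i _ => ?_
  rw [← varJ_constraintJet D γ ϑ A B _ _ hϑ, ← evJ_constraintJet, multVar, multiplier_C]
  simp only [mul_sum, sum_mul, ← sum_add_distrib]
  refine sum_congr rfl fun j _ => ?_
  ring

theorem sum_mul_sum_quad {S : Type} [CommRing S] (P Q : Fin d → Fin d → S) (x y : Fin d → S) :
    ∑ i, ∑ j, (∑ b, P b i * Q b j) * x i * y j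
      = ∑ b, (∑ i, P b i * x i) * ∑ j, Q b j * y j := by
  simp only [sum_mul, mul_sum]
  rw [sum_congr rfl fun i _ => sum_comm, sum_comm]
  refine sum_congr rfl fun b _ => ?_
  rw [sum_comm]
  refine sum_congr rfl fun i _ => sum_congr rfl fun j _ => ?_
  ring

theorem evJ_bracketJet (A : Fin d → R) (φ ψ : PowerSeries R) :
    ∑ i, ∑ j, evJ D A (bracketJet (𝕜 := 𝕜) γ ϑ Υ i j) * dSer D i φ * dSer D j ψ
      = sect A ⦃pull φ, pull ψ⦄ - sect A ⦃constraintApply A (multiplier D Υ A φ),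
          constraintApply A (multiplier D Υ A ψ)⦄ := by
  have h : ∀ i j, evJ D A (bracketJet (𝕜 := 𝕜) γ ϑ Υ i j) = sect A (baseBracket ϑ i j)
      - ∑ b, (∑ a, X ^ 2 * evJ D A (multiplierSeries 𝕜 Υ a i)
          * sect A ⦃constraint A a, constraint A b⦄)
        * (X ^ 2 * evJ D A (multiplierSeries 𝕜 Υ b j)) := by
    intro i j
    simp only [bracketJet, map_sub, evJ_toJet, map_mul, map_pow, evJ_X, map_sum,
      evJ_constraintJet D γ ϑ A, mul_sum, sum_mul, sub_right_inj]
    refine sum_congr rfl fun b _ => sum_congr rfl fun a _ => ?_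
    ring
  simp only [h, sub_mul, sum_sub_distrib, sum_mul_sum_quad, bracket_pull_pull,
    map_sum, map_mul, sect_pull, sect_bracket_constraintApply_right,
    sect_bracket_constraintApply_left, multiplier_eq, sub_right_inj]
  refine sum_congr rfl fun b _ => ?_
  rw [mul_comm]
  congr 1
  · simp only [mul_sum, mul_assoc]
  · simp only [mul_sum, sum_mul]
    rw [sum_comm]
    refine sum_congr rfl fun b _ => sum_congr rfl fun a _ => ?_
    ring

theorem gaugeBracket_eq_sum (f g : R) (A : Fin d → R) :
    gaugeBracket D γ ϑ Υ f g A
      = ∑ i, ∑ j, evJ D A (bracketJet (𝕜 := 𝕜) γ ϑ Υ i j) * C (D i f)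
        * C (D j g) := by
  rw [gaugeBracket_eq, ← evJ_bracketJet]
  simp only [dSer_C]

theorem varJ_bracketJet (hϑ : ∀ n i j k, ϑ n j i k = -ϑ n i j k) (A : Fin d → R)
    (B : Fin d → PowerSeries R) (f g : R) :
    ∑ i, ∑ j, varJ D A B (bracketJet (𝕜 := 𝕜) γ ϑ Υ i j) * C (D i f)
        * C (D j g)
      = vertVar A B ⦃pull (C f), pull (C g)⦄
      - ∑ k, ((∑ i, (multVar D Υ A B f i * sect A ⦃constraint A i, constraint A k⦄
          + multiplier D Υ A (C f) i * (vertVar A B ⦃constraint A i, constraint A k⦄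
            - sect A ⦃pull (B i), constraint A k⦄ - sect A ⦃constraint A i, pull (B k)⦄)))
              * multiplier D Υ A (C g) k
          + (∑ i, multiplier D Υ A (C f) i * sect A ⦃constraint A i, constraint A k⦄)
            * multVar D Υ A B g k) := by
  have h : ∀ i j, varJ D A B (bracketJet (𝕜 := 𝕜) γ ϑ Υ i j) = vertVar A B (baseBracket ϑ i j)
      - ∑ b, (∑ a, X ^ 2 * (evJ D A (multiplierSeries 𝕜 Υ a i)
            * varJ D A B (constraintJet γ ϑ a b)
            + sect A ⦃constraint A a, constraint A b⦄ * varJ D A B (multiplierSeries 𝕜 Υ a i)))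
          * (X ^ 2 * evJ D A (multiplierSeries 𝕜 Υ b j))
      - ∑ b, (∑ a, X ^ 2 * evJ D A (multiplierSeries 𝕜 Υ a i)
            * sect A ⦃constraint A a, constraint A b⦄)
          * (X ^ 2 * varJ D A B (multiplierSeries 𝕜 Υ b j)) := by
    intro i j
    rw [bracketJet, varJ_sub, varJ_toJet_eq, varJ_mul, varJ_X_pow, varJ_sum, mul_zero, add_zero,
      map_pow, evJ_X, sub_sub, sub_right_inj, ← sum_add_distrib, mul_sum]
    refine sum_congr rfl fun b _ => ?_
    simp only [varJ_mul, varJ_sum, map_sum, map_mul, evJ_constraintJet D γ ϑ A, ← mul_sum,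
      mul_assoc]
    ring
  have h1 : vertVar A B ⦃pull (C f), pull (C g)⦄
      = ∑ i, ∑ j, vertVar A B (baseBracket ϑ i j) * C (D i f)
        * C (D j g) := by
    simp only [bracket_pull_pull, vertVar_sum, vertVar_mul, vertVar_pull, sect_pull, dSer_C,
      mul_zero, zero_add]
    refine sum_congr rfl fun i _ => sum_congr rfl fun j _ => ?_
    ring
  rw [h1]
  simp only [h, sub_mul _ _ (C _), sum_sub_distrib, sum_mul_sum_quad]
  rw [sub_sub, sub_right_inj, ← sum_add_distrib]
  refine sum_congr rfl fun k _ => ?_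
  have e1 : ∑ j, X ^ 2 * evJ D A (multiplierSeries 𝕜 Υ k j) * C (D j g)
      = multiplier D Υ A (C g) k := by
    simp only [multiplier_C, mul_sum, mul_assoc]
  have e2 : ∑ j, X ^ 2 * varJ D A B (multiplierSeries 𝕜 Υ k j) * C (D j g)
      = multVar D Υ A B g k := by
    simp only [multVar, mul_sum, mul_assoc]
  rw [e1, e2]
  refine congrArg₂ (fun a b => a * _ + b * _) ?_ ?_
  · simp only [sum_mul]
    rw [sum_comm]
    refine sum_congr rfl fun i _ => ?_
    rw [← varJ_constraintJet D γ ϑ A B _ _ hϑ, multVar, multiplier_C]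
    simp only [mul_sum, sum_mul, ← sum_add_distrib]
    refine sum_congr rfl fun j _ => ?_
    ring
  · simp only [sum_mul, multiplier_C, mul_sum]
    rw [sum_comm]
    refine sum_congr rfl fun i _ => sum_congr rfl fun j _ => ?_
    ring

section Main

variable (hϑ : ∀ n i j k, ϑ n j i k = -ϑ n i j k) (hJ : BracketJacobi D γ ϑ)
  (A : Fin d → R)

/-- The field dependent bracket of the Hamiltonians of two gauge parameters. -/
def gaugeHamBracket (f g : R) : PhaseSeries d R :=
  famBracket D γ ϑ A (fun a : R => gaugeHam D Υ A (C a))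
    (fun a => multiplier D Υ A (C a))
    (fun a b => multVar D Υ A (gaugeVariation D γ ϑ Υ a A) b) f g

include hϑ in
theorem gaugeBracket_eq_famPhi (f g : R) : gaugeBracket D γ ϑ Υ f g A
    = famPhi D γ ϑ A (fun a : R => gaugeHam D Υ A (C a))
      (fun a => multiplier D Υ A (C a)) f g := by
  rw [gaugeBracket_eq, sect_bracket_sub_constraintApply D γ ϑ hϑ]
  rfl

include hϑ in
theorem sect_gaugeHamBracket (f g : R) :
    sect A (gaugeHamBracket D γ ϑ Υ A f g) = gaugeBracket D γ ϑ Υ f g A := by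
  rw [gaugeHamBracket, sect_famBracket, gaugeBracket_eq_famPhi D γ ϑ Υ hϑ]

/-- The recursion relations in terms of the Hamiltonians. -/
theorem multiplierRecursion_iff (hϑ : ∀ n i j k, ϑ n j i k = -ϑ n i j k) :
    MultiplierRecursion D γ ϑ Υ ↔ ∀ (f g : R) (A : Fin d → R) (i : Fin d),
      multiplier D Υ A (gaugeBracket D γ ϑ Υ f g A) i
        = sect A (dVert i (gaugeHamBracket D γ ϑ Υ A f g)) := by
  refine forall_congr' fun f => forall_congr' fun g => forall_congr' fun A =>
    forall_congr' fun i => ?_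
  generalize hX : multiplier D Υ A (C f) = X
  generalize hY : multiplier D Υ A (C g) = Y
  have key : multiplierVariation D γ ϑ Υ f g A i - multiplierVariation D γ ϑ Υ g f A i
      + sect A (dVert i ⦃pull (C f), pull (C g)⦄)
      + ∑ j, ∑ k, X j * Y k * sect A (dVert i ⦃constraint A j, constraint A k⦄)
      + sect A ⦃pull (C f), pull (Y i)⦄
      - sect A ⦃pull (C g), pull (X i)⦄
      + sect A ⦃pull (X i), constraintApply A Y⦄
      - sect A ⦃pull (Y i), constraintApply A X⦄
      + ∑ j, Y j * sect A (dVert i ⦃pull (C f), constraint A j⦄)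
      - ∑ j, X j * sect A (dVert i ⦃pull (C g), constraint A j⦄)
      = sect A (dVert i (gaugeHamBracket D γ ϑ Υ A f g)) := by
    have e : ∑ k, Y k * sect A (dVert i ⦃constraintApply A X, constraint A k⦄)
        = ∑ j, ∑ k, X j * Y k * sect A (dVert i ⦃constraint A j, constraint A k⦄)
          + sect A ⦃pull (X i), constraintApply A Y⦄ := by
      simp only [sect_dVert_bracket_constraintApply_left, mul_add, sum_add_distrib,
        mul_sum, sect_bracket_constraintApply_right]
      rw [sum_comm, add_left_inj]
      refine sum_congr rfl fun j _ => sum_congr rfl fun k _ => ?_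
      ring
    rw [gaugeHamBracket, famBracket, map_sub, map_add, famHamVar, famHamVar, dVert_hamVar,
      dVert_hamVar, gaugeHam, gaugeHam, ham, ham, map_sub, map_add, sect_pull, sect_pull, hX, hY,
      ← multiplierVariation_eq, ← multiplierVariation_eq]
    simp only [bracket_add_left, bracket_add_right, map_add,
      sect_dVert_bracket_constraintApply_right, e]
    rw [bracket_skew D γ hϑ (constraintApply A X) (pull (C g)),
      bracket_skew D γ hϑ (constraintApply A X) (pull (Y i)), map_neg, map_neg, map_neg,
      sect_dVert_bracket_constraintApply_right]
    ring
  subst hX hY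
  exact ⟨fun h => h.trans key, fun h => h.trans key.symm⟩

variable (hR : MultiplierRecursion D γ ϑ Υ)

include hϑ hR in
theorem sect_bracket_gaugeHam_right (f g : R) (F : PhaseSeries d R) :
    sect A ⦃F, gaugeHam D Υ A (gaugeBracket D γ ϑ Υ f g A)⦄
      = sect A ⦃F, gaugeHamBracket D γ ϑ Υ A f g⦄ := by
  refine sect_bracket_congr_right D γ ϑ A F _ _ ?_ fun i => ?_
  · rw [sect_gaugeHamBracket D γ ϑ Υ hϑ, gaugeHam, sect_ham]
  · rw [gaugeHam, dVert_ham, sect_pull, (multiplierRecursion_iff D γ ϑ Υ hϑ).1 hR]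

include hϑ hR in
theorem sect_bracket_gaugeHam_left (f g : R) (F : PhaseSeries d R) :
    sect A ⦃gaugeHam D Υ A (gaugeBracket D γ ϑ Υ f g A), F⦄
      = sect A ⦃gaugeHamBracket D γ ϑ Υ A f g, F⦄ := by
  rw [bracket_skew D γ hϑ, map_neg, sect_bracket_gaugeHam_right D γ ϑ Υ hϑ A hR,
    bracket_skew D γ hϑ F, map_neg, neg_neg]

include hϑ hJ hR in
/-- Closure of the gauge variations: `[δ_f, δ_g] A = δ_{t⟦f,g⟧} A`. -/
theorem gauge_closure (f g : R) (k : Fin d) :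
    ∑ j, varJ D A (gaugeVariation D γ ϑ Υ f A) (gaugeJet (𝕜 := 𝕜) γ ϑ Υ k j)
        * C (D j g)
      - ∑ j, varJ D A (gaugeVariation D γ ϑ Υ g A) (gaugeJet (𝕜 := 𝕜) γ ϑ Υ k j)
        * C (D j f)
      = ∑ j, evJ D A (gaugeJet (𝕜 := 𝕜) γ ϑ Υ k j) * dSer D j (gaugeBracket D γ ϑ Υ f g A) := by
  rw [evJ_gaugeJet, sect_bracket_gaugeHam_left D γ ϑ Υ hϑ A hR, varJ_gaugeJet _ _ _ _ hϑ,
    varJ_gaugeJet _ _ _ _ hϑ]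
  exact famVarVar_sub D γ ϑ hϑ hJ A (fun a : R => gaugeHam D Υ A (C a))
    (fun a => multiplier D Υ A (C a))
    (fun a b => multVar D Υ A (gaugeVariation D γ ϑ Υ a A) b) f g k

include hϑ hJ hR in
/-- The Jacobi identity for the field dependent bracket of gauge parameters. -/
theorem gauge_jacobi (f g h : R) :
    let nest := fun a b c : R =>
      ∑ i, ∑ j, evJ D A (bracketJet (𝕜 := 𝕜) γ ϑ Υ i j) * C (D i a)
          * dSer D j (gaugeBracket D γ ϑ Υ b c A)
        + ∑ i, ∑ j, varJ D A (gaugeVariation D γ ϑ Υ a A) (bracketJet (𝕜 := 𝕜) γ ϑ Υ i j)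
          * C (D i b) * C (D j c)
    nest h f g + nest f g h + nest g h f = 0 := by
  intro nest
  have key : ∀ a b c, nest a b c
      = famPhiPhi D γ ϑ A (fun a : R => gaugeHam D Υ A (C a))
          (fun a => multiplier D Υ A (C a))
          (fun a b => multVar D Υ A (gaugeVariation D γ ϑ Υ a A) b) a b c
        + famPhiVar D γ ϑ A (fun a : R => gaugeHam D Υ A (C a))
          (fun a => multiplier D Υ A (C a))
          (fun a b => multVar D Υ A (gaugeVariation D γ ϑ Υ a A) b) a b c := by
    intro a b c
    have e1 := evJ_bracketJet D γ ϑ Υ A (C a) (gaugeBracket D γ ϑ Υ b c A)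
    rw [sect_bracket_sub_constraintApply D γ ϑ hϑ] at e1
    simp only [← gaugeHam.eq_1, sect_bracket_gaugeHam_right D γ ϑ Υ hϑ A hR,
      sect_bracket_gaugeHam_left D γ ϑ Υ hϑ A hR,
      (multiplierRecursion_iff D γ ϑ Υ hϑ).1 hR] at e1
    simp only [dSer_C] at e1
    simp only [nest]
    rw [e1, varJ_bracketJet D γ ϑ Υ hϑ, bracket_variation_formula D γ ϑ hϑ]
    congr 1
    simp only [famPhiPhi, gaugeHamBracket, vertVar, famVar, mul_comm (sect A (dVert _ _))]
  rw [key, key, key]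
  exact famPhi_jacobi D γ ϑ hϑ hJ A _ _ _ f g h

end Main

end Algebroid

/-! ## Fixed points of contractions of power series -/

section Contraction

variable {S ι : Type} [CommRing S]

theorem eq_zero_of_X_pow_dvd {F : PowerSeries S} (h : ∀ n, X ^ n ∣ F) : F = 0 := by
  ext n
  exact X_pow_dvd_iff.1 (h (n + 1)) n n.lt_succ_self

/-- A contraction of families of power series has a fixed point. -/
theorem exists_fixed_of_contraction (T : (ι → PowerSeries S) → ι → PowerSeries S)
    (hT : ∀ n v w, (∀ i, X ^ n ∣ v i - w i) →
      ∀ i, X ^ (n + 1) ∣ T v i - T w i) :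
    ∃ v, T v = v := by
  let u : ℕ → ι → PowerSeries S := fun k => T^[k] 0
  have hu : ∀ k, u (k + 1) = T (u k) := fun k => Function.iterate_succ_apply' T k 0
  have h1 : ∀ k i, X ^ k ∣ u (k + 1) i - u k i := by
    intro k
    induction k with
    | zero => intro i; simp
    | succ k ih =>
      intro i
      have h := hT k _ _ ih i
      rwa [← hu, ← hu] at h
  have h2 : ∀ k m i, X ^ k ∣ u (k + m) i - u k i := by
    intro k m i
    induction m with
    | zero => simp
    | succ m ih =>
      have h := dvd_add ((pow_dvd_pow X (Nat.le_add_right k m)).trans (h1 (k + m) i)) ih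
      rwa [sub_add_sub_cancel] at h
  let v : ι → PowerSeries S := fun i => PowerSeries.mk fun n => coeff n (u (n + 1) i)
  have h3 : ∀ k i, X ^ k ∣ v i - u k i := by
    intro k i
    refine X_pow_dvd_iff.2 fun n hn => ?_
    obtain ⟨m, rfl⟩ := Nat.exists_eq_add_of_lt hn
    have h := X_pow_dvd_iff.1 (h2 (n + 1) m i) n n.lt_succ_self
    rw [map_sub, sub_eq_zero] at h
    rw [map_sub, coeff_mk, ← h, Nat.add_right_comm n m 1, sub_self]
  refine ⟨v, funext fun i => sub_eq_zero.1 (eq_zero_of_X_pow_dvd fun n => ?_)⟩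
  have h := dvd_sub (hT n _ _ (h3 n) i) (h3 (n + 1) i)
  rw [← hu, sub_sub_sub_cancel_right] at h
  exact (pow_dvd_pow _ n.le_succ).trans h

theorem eq_zero_of_contraction [Fintype ι] (a : ι → ι → PowerSeries S)
    (ha : ∀ i j, X ∣ a i j) (v : ι → PowerSeries S)
    (h : ∀ i, v i = ∑ j, a i j * v j) : v = 0 := by
  refine funext fun i => eq_zero_of_X_pow_dvd fun n => ?_
  induction n generalizing i with
  | zero => simp
  | succ n ih =>
    rw [h i]
    refine dvd_sum fun j _ => ?_
    rw [pow_succ']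
    exact mul_dvd_mul (ha i j) (ih j)

end Contraction

/-! ## The linear equation for the multipliers -/

section MultiplierEquation

variable (D : Fin d → Derivation 𝕜 R R)
  (Υ : MultiplierFamily d R)

theorem X_pow_dvd_multiplierSeries_sub (K : ℕ) (i j : Fin d) :
    X ^ K ∣ multiplierSeries 𝕜 Υ i j
      - ∑ n ∈ range K, (-(X ^ 2)) ^ n *
        (lambdaSeries 𝕜 Υ * (jetMatrix d R * lambdaSeries 𝕜 Υ) ^ n) i j := by
  refine X_pow_dvd_iff.2 fun N hN => ?_
  rw [map_sub, map_sum, multiplierSeries, coeff_mk, sub_eq_zero]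
  refine sum_subset (Finset.range_mono hN) fun n _ hn => ?_
  have hn : N < n := by simpa using hn
  have h : X ^ n ∣ (-(X ^ 2)) ^ n *
      (lambdaSeries 𝕜 Υ * (jetMatrix d R * lambdaSeries 𝕜 Υ) ^ n) i j := by
    refine Dvd.dvd.mul_right (pow_dvd_pow_of_dvd ?_ n) _
    rw [dvd_neg]
    exact dvd_pow_self _ two_ne_zero
  exact X_pow_dvd_iff.1 h N hn

theorem multiplierSeries_eq (i j : Fin d) :
    multiplierSeries 𝕜 Υ i j = lambdaSeries 𝕜 Υ i j
      - X ^ 2 * ∑ k, ∑ m, lambdaSeries 𝕜 Υ i k * jetMatrix d R k m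
          * multiplierSeries 𝕜 Υ m j := by
  refine sub_eq_zero.1 (eq_zero_of_X_pow_dvd fun K => ?_)
  have h1 := (pow_dvd_pow _ K.le_succ).trans (X_pow_dvd_multiplierSeries_sub (𝕜 := 𝕜) Υ (K + 1) i j)
  have h2 : X ^ K ∣ X ^ 2 * ∑ k, ∑ m, lambdaSeries 𝕜 Υ i k
      * jetMatrix d R k m * (multiplierSeries 𝕜 Υ m j
        - ∑ n ∈ range K, (-(X ^ 2)) ^ n *
          (lambdaSeries 𝕜 Υ * (jetMatrix d R * lambdaSeries 𝕜 Υ) ^ n) m j) :=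
    Dvd.dvd.mul_left (dvd_sum fun k _ => dvd_sum fun m _ =>
      (X_pow_dvd_multiplierSeries_sub Υ K m j).mul_left _) _
  have h3 : ∑ n ∈ range (K + 1), (-(X ^ 2)) ^ n *
        (lambdaSeries 𝕜 Υ * (jetMatrix d R * lambdaSeries 𝕜 Υ) ^ n) i j
      = lambdaSeries 𝕜 Υ i j - X ^ 2 * ∑ k, ∑ m, lambdaSeries 𝕜 Υ i k
        * jetMatrix d R k m * ∑ n ∈ range K, (-(X ^ 2)) ^ n *
          (lambdaSeries 𝕜 Υ * (jetMatrix d R * lambdaSeries 𝕜 Υ) ^ n) m j := by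
    rw [sum_range_succ', pow_zero, pow_zero, mul_one, one_mul, add_comm, sub_eq_add_neg,
      add_right_inj, ← neg_mul]
    simp only [mul_sum]
    rw [sum_congr rfl fun k _ => sum_comm, sum_comm]
    refine sum_congr rfl fun n _ => ?_
    have e : lambdaSeries 𝕜 Υ * (jetMatrix d R * lambdaSeries 𝕜 Υ) ^ (n + 1)
        = lambdaSeries 𝕜 Υ * (jetMatrix d R *
          (lambdaSeries 𝕜 Υ * (jetMatrix d R * lambdaSeries 𝕜 Υ) ^ n)) := by
      simp only [pow_succ', mul_assoc]
    rw [e]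
    generalize lambdaSeries 𝕜 Υ * (jetMatrix d R * lambdaSeries 𝕜 Υ) ^ n = Q
    rw [Matrix.mul_apply, mul_sum]
    refine sum_congr rfl fun k _ => ?_
    rw [Matrix.mul_apply, mul_sum, mul_sum]
    refine sum_congr rfl fun m _ => ?_
    ring
  rw [h3] at h1
  have h4 := dvd_add h1 h2
  simp only [mul_sub, sum_sub_distrib] at h4
  convert h4 using 1
  ring

/-- The fixed point equation of the multipliers. -/
theorem multiplier_fixed (A : Fin d → R) (φ : PowerSeries R) (i : Fin d) :
    multiplier D Υ A φ i = ∑ b, X ^ 2 * evJ D A (lambdaSeries 𝕜 Υ i b)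
      * (dSer D b φ - ∑ m, C (D b (A m)) * multiplier D Υ A φ m) := by
  have h : ∀ j, evJ D A (multiplierSeries 𝕜 Υ i j) = evJ D A (lambdaSeries 𝕜 Υ i j)
      - ∑ k, ∑ m, X ^ 2 * (evJ D A (lambdaSeries 𝕜 Υ i k) * C (D k (A m))
          * evJ D A (multiplierSeries 𝕜 Υ m j)) := by
    intro j
    conv_lhs => rw [multiplierSeries_eq]
    simp [evJ_jetMatrix, mul_sum]
  rw [multiplier_eq]
  simp only [h, multiplier_eq, mul_sub, sub_mul, sum_sub_distrib, mul_sum,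
    sum_mul]
  refine congrArg₂ _ (sum_congr rfl fun j _ => by ring) ?_
  rw [sum_comm]
  refine sum_congr rfl fun k _ => ?_
  rw [sum_comm]
  refine sum_congr rfl fun m _ => sum_congr rfl fun j _ => ?_
  ring

theorem eq_multiplier_of_fixed (A : Fin d → R) (φ : PowerSeries R) (Q : Fin d → PowerSeries R)
    (hQ : ∀ i, Q i = ∑ b, X ^ 2 * evJ D A (lambdaSeries 𝕜 Υ i b)
      * (dSer D b φ - ∑ m, C (D b (A m)) * Q m)) :
    Q = multiplier D Υ A φ := by
  refine sub_eq_zero.1 (eq_zero_of_contraction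
    (fun i m => -∑ b, X ^ 2 * evJ D A (lambdaSeries 𝕜 Υ i b)
      * C (D b (A m))) (fun i m => ?_) _ fun i => ?_)
  · rw [dvd_neg]
    refine dvd_sum fun b _ => ((dvd_pow_self _ two_ne_zero).mul_right _).mul_right _
  · rw [Pi.sub_apply, hQ, multiplier_fixed, ← sum_sub_distrib]
    simp only [Pi.sub_apply, neg_mul, sum_mul]
    rw [sum_neg_distrib, sum_comm, ← sum_neg_distrib]
    refine sum_congr rfl fun b _ => ?_
    rw [← mul_sub, sub_sub_sub_cancel_left, ← sum_sub_distrib, mul_sum,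
      ← sum_neg_distrib]
    refine sum_congr rfl fun m _ => ?_
    ring

/-- The variation of the fixed point equation of the multipliers. -/
theorem multVar_fixed (A : Fin d → R) (B : Fin d → PowerSeries R) (f : R) (i : Fin d) :
    multVar D Υ A B f i = ∑ b, (X ^ 2 * varJ D A B (lambdaSeries 𝕜 Υ i b)
        * (C (D b f)
          - ∑ m, C (D b (A m)) * multiplier D Υ A (C f) m)
      - X ^ 2 * evJ D A (lambdaSeries 𝕜 Υ i b)
        * ∑ m, (dSer D b (B m) * multiplier D Υ A (C f) m
          + C (D b (A m)) * multVar D Υ A B f m)) := by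
  have h : ∀ j, varJ D A B (multiplierSeries 𝕜 Υ i j) = varJ D A B (lambdaSeries 𝕜 Υ i j)
      - ∑ k, ∑ m, X ^ 2 * (
          (varJ D A B (lambdaSeries 𝕜 Υ i k) * C (D k (A m))
            + evJ D A (lambdaSeries 𝕜 Υ i k) * dSer D k (B m))
              * evJ D A (multiplierSeries 𝕜 Υ m j)
          + evJ D A (lambdaSeries 𝕜 Υ i k) * C (D k (A m))
              * varJ D A B (multiplierSeries 𝕜 Υ m j)) := by
    intro j
    conv_lhs => rw [multiplierSeries_eq]
    simp only [varJ_sub, varJ_mul, varJ_X_pow, varJ_sum, mul_zero, add_zero, map_pow, evJ_X,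
      mul_sum, varJ_jetMatrix, evJ_jetMatrix, map_mul]
    refine congrArg₂ _ rfl (sum_congr rfl fun k _ => sum_congr rfl fun m _ => ?_)
    ring
  rw [multVar]
  simp only [h, multVar, multiplier_C, mul_sub, sub_mul, sum_sub_distrib, mul_sum,
    sum_mul, mul_add, add_mul, sum_add_distrib]
  have e1 : ∀ F : Fin d → Fin d → Fin d → PowerSeries R,
      ∑ j, ∑ k, ∑ m, F j k m = ∑ k, ∑ m, ∑ j, F j k m := by
    intro F
    rw [sum_comm]
    exact sum_congr rfl fun k _ => sum_comm
  rw [e1, e1, e1, sub_sub]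
  refine congrArg₂ _ (sum_congr rfl fun j _ => by ring) ?_
  simp only [← sum_add_distrib]
  rw [e1]
  refine sum_congr rfl fun k _ => sum_congr rfl fun m _ =>
    sum_congr rfl fun j _ => ?_
  ring

end MultiplierEquation

/-! ## The weight derivation -/

section Weight

/-- The derivation `t d/dt`. -/
def degreeDer (S : Type) [CommRing S] : RingDer (PowerSeries S) where
  toFun F := PowerSeries.mk fun n => (n : S) * coeff n F
  map_zero' := by ext n; simp
  map_add' F G := by ext n; simp [mul_add]
  leibniz' F G := by
    ext n
    simp only [coeff_mk, coeff_mul, map_add]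
    rw [← Finset.Nat.sum_antidiagonal_swap (f := fun p => coeff p.1 G *
      ((p.2 : S) * coeff p.2 F)), ← sum_add_distrib, mul_sum]
    refine sum_congr rfl fun p hp => ?_
    have hn : p.1 + p.2 = n := by simpa using hp
    rw [← hn]
    push_cast [Prod.fst_swap, Prod.snd_swap]
    ring

theorem coeff_degreeDer {S : Type} [CommRing S] (n : ℕ) (F : PowerSeries S) :
    coeff n (degreeDer S F) = (n : S) * coeff n F := by
  change coeff n (PowerSeries.mk fun m => (m : S) * coeff m F) = _
  rw [coeff_mk]

/-- The Euler derivation `∑ pₖ ∂̃ᵏ`. -/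
def eulerDer (d : ℕ) (R : Type) [CommRing R] : RingDer (MvPolynomial (Fin d) R) where
  toFun p := ∑ k, MvPolynomial.X k * pderiv k p
  map_zero' := by simp
  map_add' p q := by simp [mul_add, sum_add_distrib]
  leibniz' p q := by
    simp only [mul_sum, ← sum_add_distrib]
    refine sum_congr rfl fun k _ => ?_
    rw [Derivation.leibniz, smul_eq_mul, smul_eq_mul]
    ring

theorem eulerDer_apply (p : MvPolynomial (Fin d) R) :
    eulerDer d R p = ∑ k, MvPolynomial.X k * pderiv k p := rfl

theorem coeff_eulerDer (p : MvPolynomial (Fin d) R) (m : Fin d →₀ ℕ) :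
    (eulerDer d R p).coeff m = (m.degree : R) * p.coeff m := by
  induction p using MvPolynomial.induction_on' with
  | monomial u a =>
    simp only [eulerDer_apply, MvPolynomial.X_mul_pderiv_monomial, ← sum_smul,
      MvPolynomial.coeff_smul, MvPolynomial.coeff_monomial, ← Finsupp.degree_eq_sum]
    split_ifs with h
    · rw [h, nsmul_eq_mul]
    · simp
  | add p q hp hq => rw [map_add, MvPolynomial.coeff_add, hp, hq, MvPolynomial.coeff_add, mul_add]

theorem eulerDer_fibrePoly (n : ℕ) (c : (Fin n → Fin d) → R) :
    eulerDer d R (fibrePoly n c) = n • fibrePoly n c := by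
  rw [eulerDer_apply]
  refine MvPolynomial.IsHomogeneous.sum_X_mul_pderiv (φ := fibrePoly n c) ?_
  refine MvPolynomial.IsHomogeneous.sum _ _ _ fun k _ => ?_
  have h := (isHomogeneous_C (Fin d) (c k)).mul
    (MvPolynomial.IsHomogeneous.prod univ (fun m : Fin n => MvPolynomial.X (R := R) (k m))
      (fun _ => 1) fun m _ => isHomogeneous_X R (k m))
  simpa using h

/-- The derivation which multiplies `tⁿ p^m` by `n - |m|`. -/
def weightDer (d : ℕ) (R : Type) [CommRing R] : RingDer (PhaseSeries d R) where
  toFun F := degreeDer _ F - seriesDer (eulerDer d R) F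
  map_zero' := by simp
  map_add' F G := by simp only [map_add]; ring
  leibniz' F G := by simp only [RingDer.leibniz]; ring

theorem coeff_weightDer (n : ℕ) (F : PhaseSeries d R) :
    coeff n (weightDer d R F) = (n : MvPolynomial (Fin d) R) * coeff n F
      - eulerDer d R (coeff n F) := by
  change coeff n (degreeDer _ F - seriesDer (eulerDer d R) F) = _
  rw [map_sub, coeff_degreeDer, coeff_seriesDer]

theorem coeff_coeff_weightDer (n : ℕ) (m : Fin d →₀ ℕ) (F : PhaseSeries d R) :
    (coeff n (weightDer d R F)).coeff m
      = ((n : R) - m.degree) * (coeff n F).coeff m := by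
  rw [coeff_weightDer, MvPolynomial.coeff_sub, coeff_eulerDer, ← map_natCast MvPolynomial.C,
    MvPolynomial.coeff_C_mul, sub_mul]

theorem weightDer_X : weightDer d R X = X := by
  ext n : 1
  rw [coeff_weightDer, PowerSeries.coeff_X]
  split_ifs with h <;> simp [h]

theorem weightDer_C (p : MvPolynomial (Fin d) R) :
    weightDer d R (C p) = -C (eulerDer d R p) := by
  ext n : 1
  rw [coeff_weightDer, coeff_C, map_neg, coeff_C]
  split_ifs with h <;> simp [h]

theorem weightDer_dHor (D : Fin d → Derivation 𝕜 R R) (i : Fin d) (F : PhaseSeries d R) :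
    weightDer d R (dHor D i F) = dHor D i (weightDer d R F) := by
  ext n m
  rw [coeff_coeff_weightDer, coeff_dHor, coeff_dHor, coeff_polyDer, coeff_polyDer,
    coeff_coeff_weightDer, Derivation.leibniz]
  simp

theorem weightDer_dVert (i : Fin d) (F : PhaseSeries d R) :
    weightDer d R (dVert i F) = dVert i (weightDer d R F) + dVert i F := by
  ext n m
  rw [coeff_coeff_weightDer, map_add, MvPolynomial.coeff_add, coeff_dVert, coeff_dVert,
    coeff_pderiv, coeff_pderiv, coeff_coeff_weightDer, map_add]
  simp
  ring

theorem weightDer_thetaSeries (ϑ : TensorFamily d R) (i j : Fin d) :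
    weightDer d R (thetaSeries ϑ i j) = 0 := by
  ext n : 1
  rw [coeff_weightDer, thetaSeries, coeff_mk, eulerDer_fibrePoly, nsmul_eq_mul, sub_self,
    map_zero]

theorem weightDer_gammaSeries (γ : TensorFamily d R) (i j : Fin d) :
    weightDer d R (gammaSeries γ i j) = -gammaSeries γ i j := by
  ext n : 1
  rw [coeff_weightDer, map_neg, gammaSeries, coeff_mk, eulerDer_fibrePoly, nsmul_eq_mul]
  push_cast
  ring

theorem weightDer_baseBracket (ϑ : TensorFamily d R) (i j : Fin d) :
    weightDer d R (baseBracket ϑ i j) = baseBracket ϑ i j := by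
  rw [baseBracket, RingDer.leibniz, weightDer_thetaSeries, weightDer_X]
  ring

theorem weightDer_X_mul_gammaSeries (γ : TensorFamily d R)
    (i j : Fin d) : weightDer d R (X * gammaSeries γ i j) = 0 := by
  rw [RingDer.leibniz, weightDer_gammaSeries, weightDer_X]
  ring

theorem weightDer_mixedBracket (γ : TensorFamily d R) (i j : Fin d) :
    weightDer d R (mixedBracket γ i j) = 0 := by
  rw [mixedBracket, map_add, weightDer_X_mul_gammaSeries, add_zero]
  split_ifs <;> simp

end Weight

/-! ## Coordinates whose joint zero bracket characterizes the multipliers -/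

section Coordinates

variable (D : Fin d → Derivation 𝕜 R R)
  (γ ϑ : TensorFamily d R)

local notation "⦃" F "," G "⦄" => cosymplecticBracket D γ ϑ F G

/-- The fibre coordinate `pₖ`. -/
def momentum (R : Type) [CommRing R] {d : ℕ} (k : Fin d) : PhaseSeries d R :=
  C (MvPolynomial.X k)

/-- The base coordinate with components `x`. -/
def position (d : ℕ) {R : Type} [CommRing R] (a : R) : PhaseSeries d R := pull (C a)

theorem weightDer_momentum (k : Fin d) : weightDer d R (momentum R k) = -momentum R k := by
  rw [momentum, weightDer_C, eulerDer_apply]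
  simp [pderiv_X, Pi.single_apply]

theorem weightDer_position (a : R) : weightDer d R (position d a) = 0 := by
  have h : position d a = C (MvPolynomial.C a) := PowerSeries.map_C ..
  rw [h, weightDer_C, eulerDer_apply]
  simp

theorem dVert_momentum (j k : Fin d) : dVert (R := R) j (momentum R k) = if j = k then 1 else 0 := by
  rw [momentum, dVert_C, pderiv_X, Pi.single_apply]
  simp only [eq_comm]
  split_ifs <;> simp

theorem dHor_momentum (j k : Fin d) : dHor D j (momentum R k) = 0 := by
  rw [momentum, dHor_C, polyDer_X, map_zero]

theorem bracket_momentum (F : PhaseSeries d R) (k : Fin d) :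
    ⦃F, momentum R k⦄ = ∑ i, mixedBracket γ i k * dHor D i F := by
  simp [bracket_eq, dHor_momentum, dVert_momentum]

section Position

variable (x : Fin d → R) (hx : ∀ i j, D i (x j) = if i = j then 1 else 0)

include hx in
theorem dHor_position (i j : Fin d) : dHor D i (position d (x j)) = if i = j then 1 else 0 := by
  rw [position, dHor_pull, dSer_C, hx]
  split_ifs <;> simp

include hx in
theorem bracket_position (F : PhaseSeries d R) (k : Fin d) :
    ⦃F, position d (x k)⦄ = ∑ i, (baseBracket ϑ i k * dHor D i F - mixedBracket γ k i * dVert i F) := by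
  have h : ∀ i, dVert i (position d (x k)) = 0 := fun i => dVert_pull i _
  simp [bracket_eq, dHor_position D x hx, h, sum_add_distrib, sub_eq_add_neg]

include hx in
theorem position_bracket (F : PhaseSeries d R) (k : Fin d) :
    ⦃position d (x k), F⦄ = ∑ i, (baseBracket ϑ k i * dHor D i F + mixedBracket γ k i * dVert i F) := by
  have h : ∀ i, dVert i (position d (x k)) = 0 := fun i => dVert_pull i _
  simp [bracket_eq, dHor_position D x hx, h, sum_add_distrib]

include hx in
/-- The bracket in terms of the brackets with the coordinates. -/
theorem bracket_eq_coordinates (F H : PhaseSeries d R) :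
    ⦃F, H⦄ = ∑ i, (⦃F, position d (x i)⦄ * dHor D i H + ⦃F, momentum R i⦄ * dVert i H) := by
  simp only [bracket_position D γ ϑ x hx, bracket_momentum]
  rw [bracket_eq]
  simp only [sum_add_distrib, sum_sub_distrib, sum_mul, sub_mul, mul_sub]
  have e1 : ∑ i, ∑ j, mixedBracket γ i j * dHor D i F * dVert j H
      = ∑ i, ∑ j, mixedBracket γ j i * dHor D j F * dVert i H := sum_comm
  have e2 : ∑ i, ∑ j, baseBracket ϑ i j * dHor D i F * dHor D j H
      = ∑ i, ∑ j, baseBracket ϑ j i * dHor D j F * dHor D i H := sum_comm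
  simp only [← mul_assoc]
  rw [e1, e2]
  ring

/-- The part of positive order of `∑ pₖ {xᵏ, ·}`. -/
def radialPart (F : PhaseSeries d R) : PhaseSeries d R :=
  ∑ k, momentum R k * ∑ i, (baseBracket ϑ k i * dHor D i F
    + X * gammaSeries γ i k * dVert i F)

include hx in
theorem sum_momentum_bracket (F : PhaseSeries d R) :
    ∑ k, momentum R k * ⦃position d (x k), F⦄
      = radialPart D γ ϑ F + seriesDer (eulerDer d R) F := by
  have h : seriesDer (eulerDer d R) F = ∑ k, momentum R k * dVert k F := by
    ext n : 1
    rw [coeff_seriesDer, eulerDer_apply, map_sum]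
    simp [momentum, coeff_dVert]
  rw [h, radialPart, ← sum_add_distrib]
  refine sum_congr rfl fun k _ => ?_
  rw [position_bracket D γ ϑ x hx, ← mul_add]
  simp [mixedBracket, add_mul, sum_add_distrib]
  ring

theorem radialPart_sub (F H : PhaseSeries d R) :
    radialPart D γ ϑ (F - H) = radialPart D γ ϑ F - radialPart D γ ϑ H := by
  simp only [radialPart, map_sub, ← sum_sub_distrib, ← mul_sub]
  refine sum_congr rfl fun k _ => congrArg₂ _ rfl (sum_congr rfl fun i _ => ?_)
  ring

theorem weightDer_radialPart (F : PhaseSeries d R) :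
    weightDer d R (radialPart D γ ϑ F) = radialPart D γ ϑ (weightDer d R F) := by
  simp only [radialPart, map_sum, RingDer.leibniz, map_add, weightDer_momentum,
    weightDer_baseBracket, weightDer_dHor, weightDer_dVert, mul_sum]
  refine sum_congr rfl fun k _ => ?_
  refine sum_congr rfl fun i _ => ?_
  rw [weightDer_X, weightDer_gammaSeries]
  ring

theorem X_pow_dvd_coeffwise {S T : Type} [CommRing S] [CommRing T] (δ : ℕ → S →+ T) (n : ℕ)
    (F : PowerSeries S) (h : X ^ n ∣ F) :
    X ^ n ∣ (PowerSeries.mk fun m => δ m (coeff m F) : PowerSeries T) := by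
  refine X_pow_dvd_iff.2 fun m hm => ?_
  rw [coeff_mk, X_pow_dvd_iff.1 h m hm, map_zero]

theorem X_pow_dvd_seriesDer {S : Type} [CommRing S] (δ : RingDer S) (n : ℕ)
    (F : PowerSeries S) (h : X ^ n ∣ F) : X ^ n ∣ seriesDer δ F :=
  X_pow_dvd_coeffwise (fun _ => (δ : S →+ S)) n F h

theorem X_pow_succ_dvd_radialPart (n : ℕ) (F : PhaseSeries d R) (h : X ^ n ∣ F) :
    X ^ (n + 1) ∣ radialPart D γ ϑ F := by
  refine dvd_sum fun k _ => Dvd.dvd.mul_left (dvd_sum fun i _ => ?_) _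
  rw [pow_succ']
  exact dvd_add (mul_dvd_mul (dvd_mul_right _ _) (X_pow_dvd_seriesDer _ n F h))
    (mul_dvd_mul (dvd_mul_right _ _) (X_pow_dvd_seriesDer _ n F h))

/-- Division of the coefficient of `tⁿ` by `n`. -/
def degreeInv (𝕜 : Type) [Field 𝕜] [Algebra 𝕜 R] (F : PhaseSeries d R) : PhaseSeries d R :=
  PowerSeries.mk fun n => ((n : 𝕜)⁻¹) • coeff n F

theorem degreeDer_degreeInv [CharZero 𝕜] (F : PhaseSeries d R) (hF : X ∣ F) :
    degreeDer _ (degreeInv 𝕜 F) = F := by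
  ext n : 1
  rw [coeff_degreeDer, degreeInv, coeff_mk]
  rcases Nat.eq_zero_or_pos n with rfl | hn
  · simpa using (X_dvd_iff.1 hF).symm
  · have h : (n : 𝕜) ≠ 0 := by exact_mod_cast hn.ne'
    rw [← nsmul_eq_mul, ← cast_smul_eq_nsmul 𝕜, smul_smul, mul_inv_cancel₀ h, one_smul]

theorem degreeDer_weightDer (F : PhaseSeries d R) :
    degreeDer _ (weightDer d R F) = weightDer d R (degreeDer _ F) := by
  ext n m
  rw [coeff_degreeDer, coeff_coeff_weightDer, coeff_degreeDer, ← map_natCast MvPolynomial.C,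
    MvPolynomial.coeff_C_mul, MvPolynomial.coeff_C_mul, coeff_coeff_weightDer]
  ring

theorem eq_zero_of_X_pow_dvd_degreeDer (F : PhaseSeries d R) (h0 : X ∣ F) (𝕜 : Type)
    [Field 𝕜] [CharZero 𝕜] [Algebra 𝕜 R]
    (h : ∀ n, X ^ n ∣ F → X ^ (n + 1) ∣ degreeDer _ F) : F = 0 := by
  refine eq_zero_of_X_pow_dvd fun n => ?_
  induction n with
  | zero => simp
  | succ n ih =>
    refine X_pow_dvd_iff.2 fun m hm => ?_
    rcases Nat.eq_zero_or_pos m with rfl | hm0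
    · simpa using X_dvd_iff.1 h0
    · have h1 := X_pow_dvd_iff.1 (h n ih) m hm
      have hm1 : (m : 𝕜) ≠ 0 := by exact_mod_cast hm0.ne'
      rw [coeff_degreeDer, ← nsmul_eq_mul, ← cast_smul_eq_nsmul 𝕜] at h1
      exact (smul_eq_zero_iff_right hm1).1 h1

include hx in
theorem exists_radial_coordinates [CharZero 𝕜] :
    ∃ y : Fin d → PhaseSeries d R, (∀ j, X ∣ y j - position d (x j)) ∧
      (∀ j, weightDer d R (y j) = 0) ∧
      ∀ j, ∑ k, momentum R k * ⦃position d (x k), y j⦄ = 0 := by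
  obtain ⟨y, hy⟩ := exists_fixed_of_contraction
    (fun v j => position d (x j) - degreeInv 𝕜 (radialPart D γ ϑ (v j))) (by
      intro n v w h i
      have e : degreeInv 𝕜 (radialPart D γ ϑ (w i - v i))
          = degreeInv 𝕜 (radialPart D γ ϑ (w i)) - degreeInv 𝕜 (radialPart D γ ϑ (v i)) := by
        ext n : 1
        simp [degreeInv, radialPart_sub, smul_sub]
      rw [sub_sub_sub_cancel_left, ← e]
      refine X_pow_dvd_coeffwise (fun m => (DistribSMul.toAddMonoidHom _ ((m : 𝕜)⁻¹))) _ _ ?_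
      exact X_pow_succ_dvd_radialPart D γ ϑ n _ (by rw [← dvd_neg, neg_sub]; exact h i))
  have h0 : ∀ j, X ∣ radialPart D γ ϑ (y j) := fun j => by
    simpa using X_pow_succ_dvd_radialPart D γ ϑ 0 (y j) (by simp)
  have h1 : ∀ j, y j = position d (x j) - degreeInv 𝕜 (radialPart D γ ϑ (y j)) := fun j =>
    (congrFun hy j).symm
  have h2 : ∀ j, X ∣ y j - position d (x j) := by
    intro j
    rw [h1 j, sub_sub_cancel_left, dvd_neg]
    have e := X_pow_dvd_coeffwise
      (fun m => (DistribSMul.toAddMonoidHom (MvPolynomial (Fin d) R) ((m : 𝕜)⁻¹))) 1 _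
      (by simpa using h0 j)
    rwa [pow_one] at e
  have h3 : ∀ j, degreeDer _ (y j) = -radialPart D γ ϑ (y j) := by
    intro j
    have e : degreeDer _ (position d (x j)) = 0 := by
      ext n : 1
      rw [coeff_degreeDer, position, coeff_pull, coeff_C]
      split_ifs with h <;> simp [h]
    conv_lhs => rw [h1 j]
    rw [map_sub, degreeDer_degreeInv _ (h0 j), e, zero_sub]
  have h4 : ∀ j, weightDer d R (y j) = 0 := by
    intro j
    refine eq_zero_of_X_pow_dvd_degreeDer _ ?_ 𝕜 fun n hn => ?_
    · have e := h2 j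
      rw [X_dvd_iff, ← coeff_zero_eq_constantCoeff_apply] at e ⊢
      have e' : coeff 0 (y j) = coeff 0 (position d (x j)) := by
        rwa [map_sub, sub_eq_zero] at e
      rw [coeff_weightDer, e', ← coeff_weightDer, weightDer_position, map_zero]
    · rw [degreeDer_weightDer, h3, map_neg, weightDer_radialPart, dvd_neg]
      exact X_pow_succ_dvd_radialPart D γ ϑ n _ hn
  refine ⟨y, h2, h4, fun j => ?_⟩
  have e : degreeDer _ (y j) - seriesDer (eulerDer d R) (y j) = 0 := h4 j
  rw [sum_momentum_bracket D γ ϑ x hx, ← sub_eq_zero.1 e, h3, add_neg_cancel]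

end Position

end Coordinates

/-! ## A solution of the recursion relations -/

section Polarization

variable (D : Fin d → Derivation 𝕜 R R)
  (γ ϑ : TensorFamily d R)

local notation "⦃" F "," G "⦄" => cosymplecticBracket D γ ϑ F G

/-- The vector field `∂̃ⁱ - G^{ij} ∂ⱼ`. -/
def polarField (G : Fin d → Fin d → PhaseSeries d R) (i : Fin d) (F : PhaseSeries d R) :
    PhaseSeries d R :=
  dVert i F - ∑ b, G i b * dHor D b F

theorem eq_zero_of_near_one {S ι : Type} [CommRing S] [Fintype ι] [DecidableEq ι]
    (C : ι → ι → PowerSeries S) (hC : ∀ i j, X ∣ C i j - if i = j then 1 else 0)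
    (v : ι → PowerSeries S) (h : ∀ i, ∑ j, C i j * v j = 0) : v = 0 := by
  refine eq_zero_of_contraction (fun i j => -(C i j - if i = j then 1 else 0))
    (fun i j => (dvd_neg).2 (hC i j)) v fun i => ?_
  simp [sub_mul, h]

theorem exists_solution_near_one {S ι : Type} [CommRing S] [Fintype ι] [DecidableEq ι]
    (C : ι → ι → PowerSeries S) (hC : ∀ i j, X ∣ C i j - if i = j then 1 else 0)
    (w : ι → PowerSeries S) : ∃ v : ι → PowerSeries S, ∀ i, ∑ j, C i j * v j = w i := by
  obtain ⟨v, hv⟩ := exists_fixed_of_contraction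
    (fun (v : ι → PowerSeries S) i => w i - ∑ j, (C i j - if i = j then 1 else 0) * v j) (by
      intro n v w' h i
      rw [sub_sub_sub_cancel_left, ← sum_sub_distrib]
      refine dvd_sum fun j _ => ?_
      rw [← mul_sub, pow_succ']
      refine mul_dvd_mul (hC i j) ?_
      rw [← dvd_neg, neg_sub]
      exact h j)
  refine ⟨v, fun i => ?_⟩
  have h := congrFun hv i
  simp only [sub_mul, sum_sub_distrib, ite_mul, one_mul, zero_mul, Finset.sum_ite_eq,
    mem_univ, if_true] at h
  linear_combination -h

theorem polar_sect (G : Fin d → Fin d → PhaseSeries d R) (A : Fin d → R) (i : Fin d)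
    (F : PhaseSeries d R) :
    sect A (polarField D G i F) = sect A (dVert i F) - ∑ b, sect A (G i b)
      * (dSer D b (sect A F) - ∑ m, C (D b (A m)) * sect A (dVert m F)) := by
  rw [polarField, map_sub, map_sum]
  refine congrArg₂ _ rfl (sum_congr rfl fun b _ => ?_)
  rw [map_mul, dSer_sect]
  simp only [mul_comm (C _), add_sub_cancel_right]

section Recursion

variable (Υ : MultiplierFamily d R)
  (G : Fin d → Fin d → PhaseSeries d R)
  (hG : ∀ i j, X ^ 2 * lambdaSeries 𝕜 Υ i j = toJet (G i j))

include hG in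
theorem X_sq_mul_evJ_lambdaSeries (A : Fin d → R) (i j : Fin d) :
    X ^ 2 * evJ D A (lambdaSeries 𝕜 Υ i j) = sect A (G i j) := by
  rw [← evJ_toJet D, ← hG, map_mul, map_pow, evJ_X]

include hG in
theorem X_sq_mul_varJ_lambdaSeries (A : Fin d → R) (B : Fin d → PowerSeries R) (i j : Fin d) :
    X ^ 2 * varJ D A B (lambdaSeries 𝕜 Υ i j) = vertVar A B (G i j) := by
  rw [← varJ_toJet_eq D, ← hG, varJ_mul, varJ_X_pow, mul_zero, add_zero, map_pow, evJ_X]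

include hG in
theorem sect_polarField_gaugeHam (A : Fin d → R) (φ : PowerSeries R) (i : Fin d) :
    sect A (polarField D G i (gaugeHam D Υ A φ)) = 0 := by
  have h := multiplier_fixed D Υ A φ i
  simp only [X_sq_mul_evJ_lambdaSeries D Υ G hG] at h
  simp only [polar_sect, gaugeHam, sect_ham, dVert_ham, sect_pull]
  exact sub_eq_zero.2 h

include hG in
/-- The variation of the previous identity. -/
theorem vertVar_polarField_gaugeHam (A : Fin d → R) (B : Fin d → PowerSeries R) (f : R)
    (i : Fin d) :
    vertVar A B (polarField D G i (gaugeHam D Υ A (C f)))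
      + sect A (polarField D G i (hamVar A B (multiplier D Υ A (C f))
          (multVar D Υ A B f))) = 0 := by
  have h := multVar_fixed D Υ A B f i
  simp only [X_sq_mul_evJ_lambdaSeries D Υ G hG, X_sq_mul_varJ_lambdaSeries D Υ G hG] at h
  have e : gaugeHam D Υ A (C f)
      = ham A (C f) (multiplier D Υ A (C f)) := rfl
  rw [e]
  generalize multiplier D Υ A (C f) = Q at h ⊢
  have e1 : ∀ b, dHor D b (ham A (C f) Q) = pull (C (D b f))
      + ∑ m, (constraint A m * pull (dSer D b (Q m))
        - pull (Q m) * pull (C (D b (A m)))) := by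
    intro b
    simp [ham, constraintApply_eq, RingDer.leibniz, dSer_C, sub_eq_add_neg]
  have e2 : ∀ m, vertVar A B (constraint A m) = B m := by
    intro m
    simp [vertVar, dVert_constraint, apply_ite]
  have e3 : ∀ b, sect A (dHor D b (ham A (C f) Q))
      = C (D b f) - ∑ m, C (D b (A m)) * Q m := by
    intro b
    simp [e1, mul_comm, sub_eq_add_neg]
  have e4 : ∀ b, vertVar A B (dHor D b (ham A (C f) Q)) = ∑ m, dSer D b (Q m) * B m := by
    intro b
    simp [e1, vertVar_add, vertVar_sum, vertVar_sub, vertVar_mul, vertVar_pull, e2]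
  have e5 : vertVar A B (polarField D G i (ham A (C f) Q))
      = -∑ b, (sect A (G i b) * ∑ m, dSer D b (Q m) * B m
        + (C (D b f) - ∑ m, C (D b (A m)) * Q m)
          * vertVar A B (G i b)) := by
    rw [polarField, vertVar_sub, dVert_ham, vertVar_pull, vertVar_sum, zero_sub]
    simp only [vertVar_mul, e3, e4]
  rw [e5, polar_sect, dVert_hamVar, sect_pull, sect_hamVar]
  simp only [dVert_hamVar, sect_pull]
  rw [h, ← sum_neg_distrib, ← sum_sub_distrib, ← sum_add_distrib]
  refine sum_eq_zero fun b _ => ?_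
  simp only [map_neg, map_sum, RingDer.leibniz, sum_add_distrib, mul_add, mul_sub]
  simp only [mul_comm (B _), mul_comm (Q _)]
  ring

variable (hϑ : ∀ n i j k, ϑ n j i k = -ϑ n i j k) (hJ : BracketJacobi D γ ϑ)
  (y : Fin d → PhaseSeries d R) (C : Fin d → Fin d → PhaseSeries d R)
  (hC : ∀ i j, X ∣ C i j - if i = j then 1 else 0)
  (hy : ∀ j F, cosymplecticBracket D γ ϑ (y j) F = ∑ k, C j k * polarField D G k F)

include hG hϑ hJ hC hy in
theorem multiplierRecursion_of_polarization : MultiplierRecursion D γ ϑ Υ := by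
  rw [multiplierRecursion_iff D γ ϑ Υ hϑ]
  intro f g A i
  have hu : ∀ j φ, sect A ⦃y j, gaugeHam D Υ A φ⦄ = 0 := by
    intro j φ
    rw [hy, map_sum]
    refine sum_eq_zero fun k _ => ?_
    rw [map_mul, sect_polarField_gaugeHam D Υ G hG, mul_zero]
  have hv : ∀ j B a, vertVar A B ⦃y j, gaugeHam D Υ A (PowerSeries.C a)⦄
      + sect A ⦃y j, hamVar A B (multiplier D Υ A (PowerSeries.C a)) (multVar D Υ A B a)⦄ = 0 := by
    intro j B a
    rw [hy, hy, vertVar_sum, map_sum, ← sum_add_distrib]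
    refine sum_eq_zero fun k _ => ?_
    rw [vertVar_mul, map_mul, sect_polarField_gaugeHam D Υ G hG, zero_mul, add_zero, ← mul_add,
      vertVar_polarField_gaugeHam D Υ G hG, mul_zero]
  have hz : ∀ j, sect A ⦃y j, gaugeHamBracket D γ ϑ Υ A f g⦄ = 0 := by
    intro j
    have h1 := congrArg (sect A) (hJ (y j) (gaugeHam D Υ A (PowerSeries.C f))
      (gaugeHam D Υ A (PowerSeries.C g)))
    rw [bracket_skew D γ hϑ _ (y j), bracket_neg_right, map_add, map_add, map_neg,
      sect_bracket_vertVar D γ ϑ A (gaugeHam D Υ A (PowerSeries.C f)), hu,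
      sect_bracket_vertVar D γ ϑ A (gaugeHam D Υ A (PowerSeries.C g)), hu, map_zero] at h1
    have h2 : ∀ F, ⦃F, (0 : PhaseSeries d R)⦄ = 0 := fun F => map_zero (hamDer D γ ϑ F)
    rw [map_zero, h2, h2, map_zero, zero_add, zero_add] at h1
    have h3 := hv j (gaugeVariation D γ ϑ Υ f A) g
    have h4 := hv j (gaugeVariation D γ ϑ Υ g A) f
    rw [gaugeHamBracket, famBracket, bracket_sub_right, bracket_add_right, map_sub, map_add]
    simp only [famHamVar]
    change _ + sect A ⦃y j, hamVar A (gaugeVariation D γ ϑ Υ f A) _ _⦄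
      - sect A ⦃y j, hamVar A (gaugeVariation D γ ϑ Υ g A) _ _⦄ = 0
    change _ + (-vertVar A (gaugeVariation D γ ϑ Υ f A) _)
      + vertVar A (gaugeVariation D γ ϑ Υ g A) _ = 0 at h1
    linear_combination h1 + h3 - h4
  have hZ : (fun k => sect A (polarField D G k (gaugeHamBracket D γ ϑ Υ A f g))) = 0 := by
    refine eq_zero_of_near_one (fun j k => sect A (C j k)) (fun j k => ?_) _ fun j => ?_
    · have h := map_dvd (sect A) (hC j k)
      rw [sect_X, map_sub] at h
      convert h using 2
      split_ifs <;> simp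
    · rw [← hz j, hy, map_sum]
      simp only [map_mul]
  refine (congrFun (eq_multiplier_of_fixed D Υ A _
    (fun i => sect A (dVert i (gaugeHamBracket D γ ϑ Υ A f g))) fun i => ?_) i).symm
  have h := congrFun hZ i
  simp only [polar_sect, sect_gaugeHamBracket D γ ϑ Υ hϑ] at h
  simp only [X_sq_mul_evJ_lambdaSeries D Υ G hG]
  exact sub_eq_zero.1 h

end Recursion

section Existence

variable [CharZero 𝕜] (x : Fin d → R) (hx : ∀ i j, D i (x j) = if i = j then 1 else 0)

include hx in
theorem exists_polarization (hϑ : ∀ n i j k, ϑ n j i k = -ϑ n i j k) :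
    ∃ (y : Fin d → PhaseSeries d R) (C G : Fin d → Fin d → PhaseSeries d R),
      (∀ i j, X ∣ C i j - if i = j then 1 else 0) ∧
      (∀ j F, ⦃y j, F⦄ = ∑ k, C j k * polarField D G k F) ∧
      (∀ i j, weightDer d R (G i j) = G i j) ∧
      (∀ i, ∑ j, momentum R j * G i j = 0) ∧ ∀ i j, X ^ 2 ∣ G i j := by
  obtain ⟨y, hy0, hyw, hyp⟩ := exists_radial_coordinates (𝕜 := 𝕜) D γ ϑ x hx
  have hyc : ∀ j, constantCoeff (y j) = MvPolynomial.C (x j) := by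
    intro j
    have h := X_dvd_iff.1 (hy0 j)
    rw [map_sub, sub_eq_zero] at h
    rw [h, position, ← coeff_zero_eq_constantCoeff_apply, coeff_pull]
    simp
  have hm : ∀ i k, constantCoeff (mixedBracket γ i k) = if i = k then 1 else 0 := by
    intro i k
    simp only [mixedBracket, map_add, map_mul, PowerSeries.constantCoeff_X, zero_mul, add_zero]
    split_ifs <;> simp
  have hC : ∀ i j, X ∣ ⦃y i, momentum R j⦄ - if i = j then 1 else 0 := by
    intro i j
    rw [X_dvd_iff, bracket_momentum]
    have h : ∀ k, constantCoeff (dHor D k (y i)) = if k = i then 1 else 0 := by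
      intro k
      rw [← coeff_zero_eq_constantCoeff_apply, coeff_dHor,
        coeff_zero_eq_constantCoeff_apply, hyc, polyDer_C, hx]
      split_ifs <;> simp
    simp only [map_sub, map_sum, map_mul, hm, h]
    split_ifs <;> simp_all
  have hG : ∀ b, ∃ v : Fin d → PhaseSeries d R, ∀ j,
      ∑ k, ⦃y j, momentum R k⦄ * v k = -⦃y j, position d (x b)⦄ := fun b =>
    exists_solution_near_one (fun j k => ⦃y j, momentum R k⦄) hC
      fun j => -⦃y j, position d (x b)⦄
  choose G hG using hG
  have hCw : ∀ j k, weightDer d R ⦃y j, momentum R k⦄ = 0 := by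
    intro j k
    simp [bracket_momentum, RingDer.leibniz, weightDer_mixedBracket, weightDer_dHor, hyw]
  have hYw : ∀ j k, weightDer d R ⦃y j, position d (x k)⦄ = ⦃y j, position d (x k)⦄ := by
    intro j k
    rw [bracket_position D γ ϑ x hx, map_sum]
    refine sum_congr rfl fun i _ => ?_
    simp [RingDer.leibniz, weightDer_mixedBracket, weightDer_baseBracket, weightDer_dHor,
      weightDer_dVert, hyw, mul_comm]
  have hw : ∀ i j, weightDer d R (G j i) = G j i := by
    intro i j
    have h := eq_zero_of_near_one (fun j k => ⦃y j, momentum R k⦄) hC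
      (fun i => weightDer d R (G j i) - G j i) fun m => by
        have e := congrArg (weightDer d R) (hG j m)
        rw [map_neg, hYw, ← hG j m, map_sum] at e
        simp only [RingDer.leibniz, hCw, mul_zero, add_zero] at e
        simp only [mul_sub, sum_sub_distrib, e, sub_self]
    exact sub_eq_zero.1 (congrFun h i)
  have hp : ∀ i, ∑ j, momentum R j * G j i = 0 := by
    intro i
    refine congrFun (eq_zero_of_near_one (fun j k => ⦃y j, momentum R k⦄) hC
      (fun i => ∑ j, momentum R j * G j i) fun m => ?_) i
    simp only [mul_sum]
    rw [sum_comm, ← hyp m]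
    refine sum_congr rfl fun j _ => ?_
    rw [bracket_skew D γ hϑ, ← hG, mul_sum]
    exact sum_congr rfl fun k _ => by ring
  have h0 : ∀ i j, constantCoeff (G j i) = 0 := by
    intro i j
    have h := congrArg constantCoeff (hG j i)
    have e1 : ∀ k, constantCoeff ⦃y i, momentum R k⦄ = if i = k then 1 else 0 := by
      intro k
      have h := X_dvd_iff.1 (hC i k)
      rw [map_sub, sub_eq_zero] at h
      rw [h]
      split_ifs <;> simp
    have e2 : ∀ k, constantCoeff (dVert k (y i)) = 0 := by
      intro k
      rw [← coeff_zero_eq_constantCoeff_apply, coeff_dVert,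
        coeff_zero_eq_constantCoeff_apply, hyc, pderiv_C]
    simpa [bracket_position D γ ϑ x hx, e1, e2, baseBracket] using h
  have h1 : ∀ i j, coeff 1 (G j i) = 0 := by
    intro i j
    have e1 : ∀ j, coeff 1 (G j i)
        = MvPolynomial.C ((coeff 1 (G j i)).coeff 0) := by
      intro j
      ext m
      rw [MvPolynomial.coeff_C]
      split_ifs with hm0
      · rw [hm0]
      · have h := coeff_coeff_weightDer 1 m (G j i)
        rw [hw] at h
        have h' : (m.degree : R) * (coeff 1 (G j i)).coeff m = 0 := by
          push_cast at h
          linear_combination h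
        have hm1 : (m.degree : 𝕜) ≠ 0 := by
          rw [Nat.cast_ne_zero, Ne, Finsupp.degree_eq_zero_iff]
          exact fun h => hm0 h.symm
        rw [← nsmul_eq_mul, ← cast_smul_eq_nsmul 𝕜] at h'
        exact (smul_eq_zero_iff_right hm1).1 h'
    have h := congrArg (fun F => pderiv j (coeff 1 F)) (hp i)
    simp only [momentum, map_sum, PowerSeries.coeff_C_mul, map_zero] at h
    rw [sum_congr rfl fun k _ => by rw [e1 k]] at h
    simp only [Derivation.leibniz, pderiv_C, pderiv_X,
      zero_add, Pi.single_apply, smul_eq_mul, mul_ite, mul_one, mul_zero, sum_ite_eq',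
      mem_univ, if_true] at h
    rw [e1, h]
  refine ⟨y, fun j k => ⦃y j, momentum R k⦄, fun i j => G j i, hC, fun j F => ?_, hw, hp,
    fun i j => ?_⟩
  · rw [bracket_eq_coordinates D γ ϑ x hx]
    simp only [polarField, mul_sub, sum_sub_distrib, sum_add_distrib, mul_sum]
    rw [sum_comm (f := fun k b => ⦃y j, momentum R k⦄ * (G b k * dHor D b F))]
    simp only [← mul_assoc, ← sum_mul, hG]
    simp
    ring
  · refine X_pow_dvd_iff.2 fun m hm => ?_
    interval_cases m
    · rw [coeff_zero_eq_constantCoeff_apply, h0]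
    · exact h1 i j

end Existence

end Polarization

/-! ## Symmetric coefficients of homogeneous polynomials -/

section SymmetricCoefficients

theorem pderiv_comm {ι : Type} (i j : ι) (p : MvPolynomial ι R) :
    pderiv i (pderiv j p)
      = pderiv j (pderiv i p) := by
  classical
  ext m
  simp only [coeff_pderiv, Finsupp.add_apply, Finsupp.single_apply,
    add_right_comm m (Finsupp.single i 1)]
  by_cases h : i = j
  · subst h; rfl
  · rw [if_neg h, if_neg (Ne.symm h)]
    push_cast
    ring

/-- The symmetric coefficients of a homogeneous polynomial of degree `n`. -/
def symCoeff (𝕜 : Type) [Field 𝕜] [Algebra 𝕜 R] (n : ℕ) (q : MvPolynomial (Fin d) R)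
    (k : Fin n → Fin d) : R :=
  ((n.factorial : 𝕜)⁻¹) •
    ((List.ofFn k).foldl (fun p m => pderiv m p) q).coeff 0

theorem symCoeff_perm (n : ℕ) (q : MvPolynomial (Fin d) R) (k : Fin n → Fin d)
    (σ : Perm (Fin n)) : symCoeff 𝕜 n q (k ∘ σ) = symCoeff 𝕜 n q k := by
  have : RightCommutative (fun (p : MvPolynomial (Fin d) R) (m : Fin d) =>
      pderiv m p) := ⟨fun p i j => pderiv_comm j i p⟩
  rw [symCoeff, symCoeff, (σ.ofFn_comp_perm k).foldl_eq]

theorem symCoeff_zero (q : MvPolynomial (Fin d) R) (k : Fin 0 → Fin d) :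
    symCoeff 𝕜 0 q k = q.coeff 0 := by
  simp [symCoeff]

theorem symCoeff_cons (n : ℕ) (q : MvPolynomial (Fin d) R) (m : Fin d) (k : Fin n → Fin d) :
    symCoeff 𝕜 (n + 1) q (Fin.cons m k)
      = ((n + 1 : 𝕜)⁻¹) • symCoeff 𝕜 n (pderiv m q) k := by
  rw [symCoeff, symCoeff, smul_smul, List.ofFn_cons, List.foldl_cons, Nat.factorial_succ]
  push_cast
  rw [mul_inv]

theorem foldl_pderiv_add (l : List (Fin d)) (p q : MvPolynomial (Fin d) R) :
    l.foldl (fun p m => pderiv m p) (p + q)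
      = l.foldl (fun p m => pderiv m p) p
        + l.foldl (fun p m => pderiv m p) q := by
  induction l generalizing p q with
  | nil => rfl
  | cons a l ih => rw [List.foldl_cons, map_add, ih]; rfl

theorem symCoeff_add (n : ℕ) (p q : MvPolynomial (Fin d) R) (k : Fin n → Fin d) :
    symCoeff 𝕜 n (p + q) k = symCoeff 𝕜 n p k + symCoeff 𝕜 n q k := by
  rw [symCoeff, foldl_pderiv_add, MvPolynomial.coeff_add, smul_add]
  rfl

theorem symCoeff_zero_right (n : ℕ) (k : Fin n → Fin d) :
    symCoeff 𝕜 n (0 : MvPolynomial (Fin d) R) k = 0 := by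
  have h := symCoeff_add (𝕜 := 𝕜) (R := R) n 0 0 k
  rwa [add_zero, left_eq_add] at h

theorem symCoeff_neg (n : ℕ) (p : MvPolynomial (Fin d) R) (k : Fin n → Fin d) :
    symCoeff 𝕜 n (-p) k = -symCoeff 𝕜 n p k := by
  have h := symCoeff_add (𝕜 := 𝕜) n p (-p) k
  rw [add_neg_cancel, symCoeff_zero_right] at h
  exact (neg_eq_of_add_eq_zero_right h.symm).symm

theorem fibrePoly_zero (c : (Fin 0 → Fin d) → R) (k : Fin 0 → Fin d) :
    fibrePoly 0 c = MvPolynomial.C (c k) := by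
  simp [fibrePoly, Subsingleton.elim default k]

theorem fibrePoly_succ (n : ℕ) (c : (Fin (n + 1) → Fin d) → R) :
    fibrePoly (n + 1) c
      = ∑ m, MvPolynomial.X m * fibrePoly n (fun k => c (Fin.cons m k)) := by
  rw [fibrePoly, ← (Fin.consEquiv fun _ : Fin (n + 1) => Fin d).sum_comp, Fintype.sum_prod_type]
  refine sum_congr rfl fun m _ => ?_
  rw [fibrePoly, mul_sum]
  refine sum_congr rfl fun k _ => ?_
  change MvPolynomial.C (c (Fin.cons m k))
    * ∏ i, MvPolynomial.X ((Fin.cons m k : Fin (n + 1) → Fin d) i) = _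
  simp only [Fin.prod_univ_succ, cons_zero, cons_succ]
  ring

theorem fibrePoly_add (n : ℕ) (b c : (Fin n → Fin d) → R) :
    fibrePoly n (fun k => b k + c k) = fibrePoly n b + fibrePoly n c := by
  simp [fibrePoly, add_mul, sum_add_distrib]

theorem fibrePoly_neg (n : ℕ) (c : (Fin n → Fin d) → R) :
    fibrePoly n (fun k => -c k) = -fibrePoly n c := by
  simp [fibrePoly]

theorem smul_eq_C_algebraMap_mul {ι : Type} (a : 𝕜) (p : MvPolynomial ι R) :
    a • p = MvPolynomial.C (algebraMap 𝕜 R a) * p := by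
  rw [Algebra.smul_def, MvPolynomial.algebraMap_apply]

theorem fibrePoly_smul (n : ℕ) (a : 𝕜) (c : (Fin n → Fin d) → R) :
    fibrePoly n (fun k => a • c k) = a • fibrePoly n c := by
  simp only [fibrePoly, smul_sum]
  refine sum_congr rfl fun k _ => ?_
  rw [smul_eq_C_algebraMap_mul, Algebra.smul_def, map_mul, mul_assoc]

theorem eulerDer_pderiv (m : Fin d) (q : MvPolynomial (Fin d) R) :
    eulerDer d R (pderiv m q) + pderiv m q
      = pderiv m (eulerDer d R q) := by
  ext k
  rw [MvPolynomial.coeff_add, coeff_eulerDer, coeff_pderiv, coeff_pderiv,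
    coeff_eulerDer, map_add, Finsupp.degree_single]
  push_cast
  ring

theorem fibrePoly_symCoeff [CharZero 𝕜] (n : ℕ) (q : MvPolynomial (Fin d) R)
    (hq : eulerDer d R q = n • q) : fibrePoly n (symCoeff 𝕜 n q) = q := by
  induction n generalizing q with
  | zero =>
    rw [fibrePoly_zero _ Fin.elim0, symCoeff_zero]
    ext m
    rw [MvPolynomial.coeff_C]
    split_ifs with hm
    · rw [hm]
    · have h := coeff_eulerDer q m
      rw [hq, zero_smul, MvPolynomial.coeff_zero, ← nsmul_eq_mul, ← cast_smul_eq_nsmul 𝕜] at h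
      have hm1 : (m.degree : 𝕜) ≠ 0 := by
        rw [Nat.cast_ne_zero, Ne, Finsupp.degree_eq_zero_iff]
        exact fun h => hm h.symm
      exact ((smul_eq_zero_iff_right hm1).1 h.symm).symm
  | succ n ih =>
    have h : ∀ m, eulerDer d R (pderiv m q) = n • pderiv m q := by
      intro m
      have h := eulerDer_pderiv m q
      rw [hq, map_nsmul, succ_nsmul, add_left_inj] at h
      exact h
    rw [fibrePoly_succ]
    simp only [symCoeff_cons, fibrePoly_smul]
    rw [sum_congr rfl fun m _ => by rw [ih _ (h m), mul_smul_comm], ← smul_sum,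
      ← eulerDer_apply, hq, ← cast_smul_eq_nsmul 𝕜, smul_smul]
    push_cast
    rw [inv_mul_cancel₀ (Nat.cast_add_one_ne_zero n), one_smul]

theorem cons_comp_perm {α : Type} {n : ℕ} (a : α) (k : Fin n → α) (σ : Perm (Fin n)) :
    (Fin.cons a (k ∘ σ) : Fin (n + 1) → α)
      = Fin.cons a k ∘ Equiv.Perm.decomposeFin.symm (0, σ) := by
  funext i
  refine Fin.cases ?_ (fun i => ?_) i <;> simp

theorem cons_cons_swap {α : Type} {n : ℕ} (a b : α) (k : Fin n → α) :
    (Fin.cons a (Fin.cons b k) : Fin (n + 2) → α) = Fin.cons b (Fin.cons a k) ∘ swap 0 1 := by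
  funext i
  refine Fin.cases ?_ (fun i => Fin.cases ?_ (fun i => ?_) i) i
  · simp
  · simp
  · have h1 : (i.succ.succ : Fin (n + 2)) ≠ 0 := Fin.succ_ne_zero _
    have h2 : (i.succ.succ : Fin (n + 2)) ≠ 1 := by
      intro h
      exact Fin.succ_ne_zero i (Fin.succ_injective _ h)
    simp [Equiv.swap_apply_of_ne_of_ne h1 h2]

theorem pderiv_fibrePoly (n : ℕ) (c : (Fin (n + 1) → Fin d) → R)
    (hc : ∀ k (σ : Perm (Fin (n + 1))), c (k ∘ σ) = c k) (m : Fin d) :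
    pderiv m (fibrePoly (n + 1) c)
      = (n + 1) • fibrePoly n (fun k => c (Fin.cons m k)) := by
  induction n with
  | zero =>
    rw [fibrePoly_succ, map_sum]
    simp [fibrePoly_zero _ Fin.elim0, pderiv_X, Pi.single_apply]
  | succ n ih =>
    have h : ∀ a, pderiv m (fibrePoly (n + 1) fun k => c (Fin.cons a k))
        = (n + 1) • fibrePoly n (fun k => c (Fin.cons m (Fin.cons a k))) := by
      intro a
      rw [ih _ fun k σ => by rw [cons_comp_perm, hc]]
      congr 2
      funext k
      rw [cons_cons_swap, hc]
    rw [fibrePoly_succ, map_sum]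
    simp only [Derivation.leibniz, smul_eq_mul, h, pderiv_X, Pi.single_apply,
      sum_add_distrib, mul_ite, mul_one, mul_zero, sum_ite_eq', mem_univ,
      if_true, mul_smul_comm, ← smul_sum]
    rw [← fibrePoly_succ n fun k => c (Fin.cons m k)]
    simp only [nsmul_eq_mul]
    push_cast
    ring

theorem symCoeff_nsmul (n a : ℕ) (p : MvPolynomial (Fin d) R) (k : Fin n → Fin d) :
    symCoeff 𝕜 n (a • p) k = a • symCoeff 𝕜 n p k := by
  induction a with
  | zero => simp [symCoeff_zero_right]
  | succ a ih => rw [succ_nsmul, symCoeff_add, ih, succ_nsmul]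

theorem symCoeff_fibrePoly [CharZero 𝕜] (n : ℕ) (c : (Fin n → Fin d) → R)
    (hc : ∀ k (σ : Perm (Fin n)), c (k ∘ σ) = c k) (k : Fin n → Fin d) :
    symCoeff 𝕜 n (fibrePoly n c) k = c k := by
  induction n with
  | zero => rw [symCoeff_zero, fibrePoly_zero _ k, MvPolynomial.coeff_C, if_pos rfl]
  | succ n ih =>
    obtain ⟨m, k, rfl⟩ : ∃ m k', k = Fin.cons m k' := ⟨k 0, Fin.tail k, (Fin.cons_self_tail k).symm⟩
    rw [symCoeff_cons, pderiv_fibrePoly n c hc, symCoeff_nsmul,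
      ih _ fun k σ => by rw [cons_comp_perm, hc], ← cast_smul_eq_nsmul 𝕜, smul_smul]
    push_cast
    rw [inv_mul_cancel₀ (Nat.cast_add_one_ne_zero n), one_smul]

end SymmetricCoefficients

/-! ## The polynomials `Λ` -/

section Lambda

/-- The coefficient of `tⁿ` in `Λ^{ij}`. -/
def lambdaPoly (𝕜 : Type) [Field 𝕜] [Algebra 𝕜 R]
    (Υ : MultiplierFamily d R) (n : ℕ) (i j : Fin d) :
    MvPolynomial (Fin d) R :=
  -((1 / ((n : 𝕜) + 2)) • ∑ l, MvPolynomial.X l * fibrePoly n (Υ n i j l))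

theorem lambdaSeries_eq (Υ : MultiplierFamily d R)
    (i j : Fin d) :
    lambdaSeries 𝕜 Υ i j = toJet (PowerSeries.mk fun n => lambdaPoly 𝕜 Υ n i j) := by
  ext n : 1
  rw [lambdaSeries, coeff_mk, toJet, coeff_map, coeff_mk]
  simp only [lambdaPoly, fibrePoly, mul_sum, smul_eq_C_algebraMap_mul]
  simp only [one_div, map_neg, map_sum, map_mul, map_prod, AlgHom.toRingHom_eq_coe, RingHom.coe_coe,
    MvPolynomial.rename_C, MvPolynomial.rename_X, neg_inj]
  refine sum_congr rfl fun l _ => sum_congr rfl fun k _ => ?_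
  ring

/-- The index symmetries of the coefficients of Lagrangian multipliers. -/
structure MultiplierSymmetries (Υ : MultiplierFamily d R) :
    Prop where
  skew : ∀ n i j l k, Υ n i l j k = -Υ n i j l k
  symm : ∀ n i j l k (σ : Perm (Fin n)), Υ n i j l (k ∘ σ) = Υ n i j l k
  cyclic : ∀ n i j l m (k : Fin n → Fin d),
    Υ (n + 1) i j l (Fin.cons m k) + Υ (n + 1) i l m (Fin.cons j k)
      + Υ (n + 1) i m j (Fin.cons l k) = 0

theorem pderiv_lambdaPoly_sub [CharZero 𝕜]
    (Υ : MultiplierFamily d R) (hΥ : MultiplierSymmetries Υ)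
    (n : ℕ) (i j l : Fin d) :
    pderiv j (lambdaPoly 𝕜 Υ n i l) - pderiv l (lambdaPoly 𝕜 Υ n i j)
      = fibrePoly n (Υ n i j l) := by
  have hs : fibrePoly n (Υ n i l j) = -fibrePoly n (Υ n i j l) := by
    rw [← fibrePoly_neg]
    congr 1
    funext k
    exact hΥ.skew n i j l k
  have h : ∑ m, MvPolynomial.X m * pderiv j (fibrePoly n (Υ n i l m))
      - ∑ m, MvPolynomial.X m * pderiv l (fibrePoly n (Υ n i j m))
      = -(n • fibrePoly n (Υ n i j l)) := by
    rcases n with _ | n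
    · simp [fibrePoly_zero _ Fin.elim0]
    · rw [fibrePoly_succ, smul_sum, ← sum_sub_distrib, ← sum_neg_distrib]
      refine sum_congr rfl fun m _ => ?_
      rw [pderiv_fibrePoly n _ fun k σ => hΥ.symm _ _ _ _ k σ,
        pderiv_fibrePoly n _ fun k σ => hΥ.symm _ _ _ _ k σ, ← mul_sub, ← smul_sub, sub_eq_add_neg,
        ← fibrePoly_neg, ← fibrePoly_add, mul_smul_comm, ← smul_neg, ← mul_neg, ← fibrePoly_neg]
      congr 3
      funext k
      have h := hΥ.cyclic n i j l m k
      rw [hΥ.skew (n + 1) i j m] at h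
      linear_combination h
  have h' : ∀ a b, pderiv a (lambdaPoly 𝕜 Υ n i b)
      = -((1 / ((n : 𝕜) + 2)) • (fibrePoly n (Υ n i b a)
        + ∑ m, MvPolynomial.X m * pderiv a (fibrePoly n (Υ n i b m)))) := by
    intro a b
    rw [lambdaPoly, map_neg, ← Derivation.coeFn_coe, LinearMap.map_smul_of_tower,
      Derivation.coeFn_coe, map_sum]
    simp only [Derivation.leibniz, smul_eq_mul, pderiv_X, Pi.single_apply,
      sum_add_distrib, mul_ite, mul_one, mul_zero, sum_ite_eq', mem_univ,
      if_true]
    rw [add_comm (∑ m, _)]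
  have hn : (n : 𝕜) + 2 ≠ 0 := by exact_mod_cast (n + 1).succ_ne_zero
  have e : fibrePoly n (Υ n i j l) = (1 / ((n : 𝕜) + 2)) • ((n + 2) • fibrePoly n (Υ n i j l)) := by
    rw [← cast_smul_eq_nsmul 𝕜, smul_smul]
    push_cast
    rw [one_div, inv_mul_cancel₀ hn, one_smul]
  conv_rhs => rw [e]
  rw [h', h', neg_sub_neg, ← smul_sub, hs]
  congr 1
  rw [add_smul, two_smul]
  linear_combination -h

theorem lambdaPoly_symCoeff [CharZero 𝕜] (Λ : ℕ → Fin d → Fin d → MvPolynomial (Fin d) R)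
    (hΛ : ∀ n i j, eulerDer d R (Λ n i j) = (n + 1) • Λ n i j)
    (hΛ' : ∀ n i, ∑ j, MvPolynomial.X j * Λ n i j = 0) (n : ℕ) (i j : Fin d) :
    lambdaPoly 𝕜 (fun n i j l => symCoeff 𝕜 n
        (pderiv j (Λ n i l) + -pderiv l (Λ n i j))) n i j = Λ n i j := by
  have h : ∀ m l, eulerDer d R (pderiv m (Λ n i l))
      = n • pderiv m (Λ n i l) := by
    intro m l
    have h := eulerDer_pderiv m (Λ n i l)
    rwa [hΛ, map_nsmul, succ_nsmul, add_left_inj] at h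
  have h1 : ∀ l, fibrePoly n (symCoeff 𝕜 n
      (pderiv j (Λ n i l) + -pderiv l (Λ n i j)))
      = pderiv j (Λ n i l) + -pderiv l (Λ n i j) := fun l =>
    fibrePoly_symCoeff n _ (by rw [map_add, map_neg, h, h, smul_add, smul_neg])
  have h2 := congrArg (pderiv j) (hΛ' n i)
  simp only [map_sum, map_zero, Derivation.leibniz, smul_eq_mul, pderiv_X,
    Pi.single_apply, sum_add_distrib, mul_ite, mul_one, mul_zero, sum_ite_eq',
    mem_univ, if_true] at h2
  have hn : (n : 𝕜) + 2 ≠ 0 := by exact_mod_cast (n + 1).succ_ne_zero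
  have e : Λ n i j = (1 / ((n : 𝕜) + 2)) • ((n + 2) • Λ n i j) := by
    rw [← cast_smul_eq_nsmul 𝕜, smul_smul]
    push_cast
    rw [one_div, inv_mul_cancel₀ hn, one_smul]
  rw [lambdaPoly]
  simp only [h1, mul_add, mul_neg, sum_add_distrib, sum_neg_distrib,
    ← eulerDer_apply, hΛ]
  conv_rhs => rw [e]
  rw [← smul_neg]
  congr 1
  have e3 : (n + 2) • Λ n i j = (n + 1) • Λ n i j + Λ n i j := succ_nsmul _ _
  rw [e3]
  linear_combination -h2

variable (D : Fin d → Derivation 𝕜 R R)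
  (γ ϑ : TensorFamily d R)

/-- The recursion relations have a solution. -/
theorem exists_multiplierRecursion [CharZero 𝕜] (x : Fin d → R)
    (hx : ∀ i j, D i (x j) = if i = j then 1 else 0)
    (hϑ : ∀ n i j k, ϑ n j i k = -ϑ n i j k) (hJ : BracketJacobi D γ ϑ) :
    ∃ Υ, MultiplierSymmetries Υ ∧ MultiplierRecursion D γ ϑ Υ := by
  obtain ⟨y, C, G, hC, hy, hw, hp, hX⟩ := exists_polarization D γ ϑ x hx hϑ
  let Λ : ℕ → Fin d → Fin d → MvPolynomial (Fin d) R := fun n i j => coeff (n + 2) (G i j)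
  let Υ : MultiplierFamily d R := fun n i j l =>
    symCoeff 𝕜 n (pderiv j (Λ n i l) + -pderiv l (Λ n i j))
  have hΛ : ∀ n i j, eulerDer d R (Λ n i j) = (n + 1) • Λ n i j := by
    intro n i j
    have h := coeff_weightDer (n + 2) (G i j)
    rw [hw] at h
    rw [nsmul_eq_mul]
    push_cast at h ⊢
    linear_combination h
  have hΛ' : ∀ n i, ∑ j, MvPolynomial.X j * Λ n i j = 0 := by
    intro n i
    have h := congrArg (coeff (n + 2)) (hp i)
    simpa [momentum] using h
  have hL : ∀ i j, X ^ 2 * lambdaSeries 𝕜 Υ i j = toJet (G i j) := by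
    intro i j
    rw [lambdaSeries_eq, ← toJet_X, ← map_pow, ← map_mul]
    congr 1
    ext n : 1
    rw [coeff_X_pow_mul']
    split_ifs with hn
    · obtain ⟨m, rfl⟩ := Nat.exists_eq_add_of_le' hn
      rw [coeff_mk, Nat.add_sub_cancel]
      exact lambdaPoly_symCoeff Λ hΛ hΛ' m i j
    · exact (X_pow_dvd_iff.1 (hX i j) n (not_le.1 hn)).symm
  refine ⟨Υ, ⟨fun n i j l k => ?_, fun n i j l k σ => symCoeff_perm _ _ _ _, fun n i j l m k => ?_⟩,
    multiplierRecursion_of_polarization D γ ϑ Υ G hL hϑ hJ y C hC hy⟩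
  · change symCoeff 𝕜 n _ k = -symCoeff 𝕜 n _ k
    rw [← symCoeff_neg]
    congr 1
    ring
  · change symCoeff 𝕜 (n + 1) _ _ + symCoeff 𝕜 (n + 1) _ _ + symCoeff 𝕜 (n + 1) _ _ = 0
    simp only [symCoeff_cons, ← smul_add, ← symCoeff_add, map_add, map_neg]
    rw [pderiv_comm m j, pderiv_comm l j, pderiv_comm m l]
    have e : ∀ a b c : MvPolynomial (Fin d) R, a + -b + (c + -a) + (b + -c) = 0 := fun a b c => by
      ring
    rw [e, symCoeff_zero_right, smul_zero]

end Lambda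

/-! ## Uniqueness of the multipliers -/

section Uniqueness

variable {R : Type} {d : ℕ} [CommRing R]

theorem eq_zero_of_forall_aeval (𝕜 : Type) [Field 𝕜] [CharZero 𝕜] [Algebra 𝕜 R]
    (p : MvPolynomial (Fin d) R) (h : ∀ A : Fin d → R, aeval A p = 0) : p = 0 := by
  ext m
  rw [MvPolynomial.coeff_zero]
  refine (Module.forall_dual_apply_eq_zero_iff 𝕜 _).1 fun φ => ?_
  have hq : (∑ m ∈ p.support, MvPolynomial.monomial m (φ (p.coeff m))
      : MvPolynomial (Fin d) 𝕜) = 0 := by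
    refine MvPolynomial.funext fun c => ?_
    have h1 := congrArg φ (h fun i => algebraMap 𝕜 R (c i))
    rw [MvPolynomial.aeval_def, MvPolynomial.eval₂_eq', map_sum, map_zero] at h1
    rw [map_sum, map_zero, ← h1]
    refine sum_congr rfl fun m _ => ?_
    simp only [← map_pow, ← map_prod]
    rw [MvPolynomial.eval_monomial, Algebra.algebraMap_self, RingHom.id_apply, mul_comm (p.coeff m),
      ← Algebra.smul_def, map_smul, smul_eq_mul, mul_comm, Finsupp.prod_fintype _ _ (by simp)]
  have h2 := congrArg (MvPolynomial.coeff m) hq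
  simp only [MvPolynomial.coeff_sum, MvPolynomial.coeff_monomial, sum_ite_eq',
    MvPolynomial.mem_support_iff, MvPolynomial.coeff_zero] at h2
  by_cases hm : p.coeff m = 0
  · rw [hm, map_zero]
  · simpa [hm] using h2

variable {𝕜 : Type} [Field 𝕜] [Algebra 𝕜 R]

section Divisibility

variable (D : Fin d → Derivation 𝕜 R R) (A : Fin d → R)

theorem X_pow_dvd_sect (n : ℕ) (F : PhaseSeries d R) (h : X ^ n ∣ F) :
    X ^ n ∣ sect A F := by
  have h := map_dvd (sect A) h
  rwa [map_pow, sect_X] at h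

theorem X_pow_dvd_evJ (n : ℕ) (F : JetSeries d R) (h : X ^ n ∣ F) :
    X ^ n ∣ evJ D A F := by
  have h := map_dvd (evJ D A) h
  rwa [map_pow, evJ_X] at h

theorem seriesDer_X_pow_mul {S : Type} [CommRing S] (δ : RingDer S) (n : ℕ) (F : PowerSeries S) :
    seriesDer δ (X ^ n * F) = X ^ n * seriesDer δ F := by
  ext m
  rw [coeff_seriesDer, coeff_X_pow_mul', coeff_X_pow_mul', coeff_seriesDer]
  split_ifs <;> simp

theorem sect_C (p : MvPolynomial (Fin d) R) :
    sect A (C p) = C (aeval A p) :=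
  PowerSeries.map_C ..

theorem X_pow_dvd_varJ_of_dvd (B : Fin d → PowerSeries R) (n : ℕ) (F : JetSeries d R)
    (h : X ^ n ∣ F) : X ^ n ∣ varJ D A B F := by
  refine dvd_add (dvd_sum fun l _ => ?_)
    (dvd_sum fun k _ => dvd_sum fun l _ => ?_)
  · exact (X_pow_dvd_evJ D A n _ (X_pow_dvd_seriesDer _ n F h)).mul_right _
  · exact (X_pow_dvd_evJ D A n _ (X_pow_dvd_seriesDer _ n F h)).mul_right _

theorem X_pow_dvd_varJ_of_dvd_field (B : Fin d → PowerSeries R) (n : ℕ) (F : JetSeries d R)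
    (h : ∀ l, X ^ n ∣ B l) : X ^ n ∣ varJ D A B F := by
  refine dvd_add (dvd_sum fun l _ => ?_)
    (dvd_sum fun k _ => dvd_sum fun l _ => ?_)
  · exact (h l).mul_left _
  · exact (X_pow_dvd_seriesDer _ n _ (h l)).mul_left _

theorem varJ_sub_field (B B' : Fin d → PowerSeries R) (F : JetSeries d R) :
    varJ D A B F - varJ D A B' F = varJ D A (fun l => B l - B' l) F := by
  simp only [varJ, map_sub, mul_sub, sum_sub_distrib]
  ring

end Divisibility

section Order

variable (D : Fin d → Derivation 𝕜 R R)
  (γ ϑ : TensorFamily d R)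
  (Υ Υ' : MultiplierFamily d R)
  (n : ℕ) (hΥ : ∀ m < n, ∀ i j, lambdaPoly 𝕜 Υ m i j = lambdaPoly 𝕜 Υ' m i j)

local notation "⦃" F "," G "⦄" => cosymplecticBracket D γ ϑ F G

include hΥ in
theorem X_pow_dvd_lambdaSeries_sub (i j : Fin d) :
    X ^ n ∣ lambdaSeries 𝕜 Υ i j - lambdaSeries 𝕜 Υ' i j := by
  rw [lambdaSeries_eq, lambdaSeries_eq, ← map_sub, ← toJet_X, ← map_pow]
  refine map_dvd toJet (X_pow_dvd_iff.2 fun m hm => ?_)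
  rw [map_sub, coeff_mk, coeff_mk, hΥ m hm, sub_self]

include hΥ in
theorem X_pow_dvd_lambdaSeries_sub_leading (i j : Fin d) :
    X ^ (n + 1) ∣ lambdaSeries 𝕜 Υ i j - lambdaSeries 𝕜 Υ' i j
      - toJet (X ^ n
        * C (lambdaPoly 𝕜 Υ n i j - lambdaPoly 𝕜 Υ' n i j)) := by
  rw [lambdaSeries_eq, lambdaSeries_eq, ← map_sub, ← map_sub, ← toJet_X, ← map_pow]
  refine map_dvd toJet (X_pow_dvd_iff.2 fun m hm => ?_)
  rw [map_sub, map_sub, coeff_mk, coeff_mk, coeff_X_pow_mul']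
  split_ifs with h
  · obtain rfl : m = n := by omega
    simp
  · rw [hΥ m (not_le.1 h), sub_self, sub_zero]

theorem multiplierSeries_sub (i j : Fin d) :
    multiplierSeries 𝕜 Υ i j - multiplierSeries 𝕜 Υ' i j
      = lambdaSeries 𝕜 Υ i j - lambdaSeries 𝕜 Υ' i j
        - X ^ 2 * ∑ k, ∑ m,
          ((lambdaSeries 𝕜 Υ i k - lambdaSeries 𝕜 Υ' i k) * jetMatrix d R k m
              * multiplierSeries 𝕜 Υ m j
            + lambdaSeries 𝕜 Υ' i k * jetMatrix d R k m
              * (multiplierSeries 𝕜 Υ m j - multiplierSeries 𝕜 Υ' m j)) := by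
  conv_lhs => rw [multiplierSeries_eq Υ, multiplierSeries_eq Υ']
  have e : ∀ k m, (lambdaSeries 𝕜 Υ i k - lambdaSeries 𝕜 Υ' i k) * jetMatrix d R k m
              * multiplierSeries 𝕜 Υ m j
            + lambdaSeries 𝕜 Υ' i k * jetMatrix d R k m
              * (multiplierSeries 𝕜 Υ m j - multiplierSeries 𝕜 Υ' m j)
      = lambdaSeries 𝕜 Υ i k * jetMatrix d R k m * multiplierSeries 𝕜 Υ m j
        - lambdaSeries 𝕜 Υ' i k * jetMatrix d R k m * multiplierSeries 𝕜 Υ' m j := by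
    intro k m
    ring
  simp only [e, sum_sub_distrib]
  ring

include hΥ in
theorem X_pow_dvd_multiplierSeries_sub_of_le (m : ℕ) (hm : m ≤ n) (i j : Fin d) :
    X ^ m ∣ multiplierSeries 𝕜 Υ i j - multiplierSeries 𝕜 Υ' i j := by
  induction m generalizing i j with
  | zero => simp
  | succ m ih =>
    rw [multiplierSeries_sub]
    refine dvd_sub ((pow_dvd_pow _ hm).trans (X_pow_dvd_lambdaSeries_sub Υ Υ' n hΥ i j)) ?_
    refine (pow_dvd_pow _ (by omega : m + 1 ≤ 2 + m)).trans ?_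
    rw [pow_add]
    refine mul_dvd_mul_left _ (dvd_sum fun k _ => dvd_sum fun l _ => dvd_add ?_ ?_)
    · refine Dvd.dvd.mul_right (Dvd.dvd.mul_right ?_ _) _
      exact (pow_dvd_pow _ (by omega)).trans (X_pow_dvd_lambdaSeries_sub Υ Υ' n hΥ i k)
    · exact (ih (by omega) l j).mul_left _

include hΥ in
theorem X_pow_dvd_multiplierSeries_sub_leading (i j : Fin d) :
    X ^ (n + 1) ∣ multiplierSeries 𝕜 Υ i j - multiplierSeries 𝕜 Υ' i j
      - toJet (X ^ n
        * C (lambdaPoly 𝕜 Υ n i j - lambdaPoly 𝕜 Υ' n i j)) := by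
  rw [multiplierSeries_sub, sub_right_comm]
  refine dvd_sub (X_pow_dvd_lambdaSeries_sub_leading Υ Υ' n hΥ i j) ?_
  refine (pow_dvd_pow _ (by omega : n + 1 ≤ 2 + n)).trans ?_
  rw [pow_add]
  refine mul_dvd_mul_left _ (dvd_sum fun k _ => dvd_sum fun l _ => dvd_add ?_ ?_)
  · exact Dvd.dvd.mul_right (Dvd.dvd.mul_right (X_pow_dvd_lambdaSeries_sub Υ Υ' n hΥ i k) _) _
  · exact (X_pow_dvd_multiplierSeries_sub_of_le Υ Υ' n hΥ n le_rfl l j).mul_left _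

variable (A : Fin d → R)

theorem X_dvd_evJ_anchorJet_sub (k j : Fin d) :
    X ∣ evJ D A (anchorJet γ ϑ k j) - if j = k then 1 else 0 := by
  have e : evJ D A (anchorJet γ ϑ k j) - (if j = k then 1 else 0)
      = X * (sect A (gammaSeries γ k j)
        - ∑ l, sect A (thetaSeries ϑ j l) * evJ D A (jetMatrix d R l k)) := by
    simp only [anchorJet, map_sub, evJ_toJet, mixedBracket, map_add, apply_ite (sect A), map_one,
      map_zero, map_mul, sect_X, map_sum, baseBracket, mul_sub, mul_sum, mul_assoc]
    ring
  rw [e]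
  exact dvd_mul_right _ _

theorem X_dvd_gaugeVariation_sub (f : R) (k : Fin d) :
    X ∣ gaugeVariation D γ ϑ Υ f A k - C (D k f) := by
  have e : C (D k f) = ∑ j, (if j = k then 1 else 0) * C (D j f) := by
    simp
  rw [gaugeVariation_eq_sum, e, ← sum_sub_distrib]
  refine dvd_sum fun j _ => ?_
  rw [← sub_mul, gaugeJet, map_add, map_mul, map_pow, evJ_X, add_sub_right_comm]
  exact Dvd.dvd.mul_right (dvd_add (X_dvd_evJ_anchorJet_sub D γ ϑ A k j)
    ((dvd_pow_self _ two_ne_zero).mul_right _)) _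

include hΥ in
theorem X_pow_dvd_gaugeVariation_sub (f : R) (k : Fin d) :
    X ^ (n + 2) ∣ gaugeVariation D γ ϑ Υ f A k - gaugeVariation D γ ϑ Υ' f A k := by
  rw [gaugeVariation_eq_sum, gaugeVariation_eq_sum, ← sum_sub_distrib]
  refine dvd_sum fun j _ => ?_
  rw [← sub_mul, gaugeJet, gaugeJet, ← map_sub, add_sub_add_left_eq_sub, ← mul_sub,
    ← sum_sub_distrib, add_comm n, pow_add]
  refine Dvd.dvd.mul_right ?_ _
  rw [map_mul, map_pow, evJ_X]
  refine mul_dvd_mul_left _ (X_pow_dvd_evJ D A n _ (dvd_sum fun i _ => ?_))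
  rw [← sub_mul]
  exact (X_pow_dvd_multiplierSeries_sub_of_le Υ Υ' n hΥ n le_rfl i j).mul_right _

theorem X_sq_dvd_multiplier (φ : PowerSeries R) (i : Fin d) :
    X ^ 2 ∣ multiplier D Υ A φ i := dvd_mul_right _ _

include hΥ in
theorem X_pow_dvd_multiplier_sub (φ : PowerSeries R) (i : Fin d) :
    X ^ (n + 2) ∣ multiplier D Υ A φ i - multiplier D Υ' A φ i := by
  rw [multiplier_eq, multiplier_eq, ← mul_sub, ← sum_sub_distrib, add_comm n, pow_add]
  refine mul_dvd_mul_left _ (dvd_sum fun j _ => ?_)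
  rw [← sub_mul, ← map_sub]
  exact (X_pow_dvd_evJ D A n _
    (X_pow_dvd_multiplierSeries_sub_of_le Υ Υ' n hΥ n le_rfl i j)).mul_right _

include hΥ in
theorem X_pow_dvd_multVar_sub (f g : R) (i : Fin d) :
    X ^ (n + 3) ∣ multVar D Υ A (gaugeVariation D γ ϑ Υ f A) g i
      - multVar D Υ' A (gaugeVariation D γ ϑ Υ' f A) g i
      - X ^ (n + 2) * ∑ j, ∑ l, C (aeval A
          (pderiv l (lambdaPoly 𝕜 Υ n i j - lambdaPoly 𝕜 Υ' n i j)) * D l f * D j g) := by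
  have e : ∀ j, X ^ (n + 1) ∣
      varJ D A (gaugeVariation D γ ϑ Υ f A) (multiplierSeries 𝕜 Υ i j)
        - varJ D A (gaugeVariation D γ ϑ Υ' f A) (multiplierSeries 𝕜 Υ' i j)
        - X ^ n * ∑ l, C (aeval A
          (pderiv l (lambdaPoly 𝕜 Υ n i j - lambdaPoly 𝕜 Υ' n i j)) * D l f) := by
    intro j
    have h1 := X_pow_dvd_varJ_of_dvd D A (gaugeVariation D γ ϑ Υ f A) _ _
      (X_pow_dvd_multiplierSeries_sub_leading Υ Υ' n hΥ i j)
    have h2 := X_pow_dvd_varJ_of_dvd_field D A (fun l => gaugeVariation D γ ϑ Υ f A l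
      - gaugeVariation D γ ϑ Υ' f A l) (n + 1) (multiplierSeries 𝕜 Υ' i j) fun l =>
        (pow_dvd_pow _ (by omega)).trans (X_pow_dvd_gaugeVariation_sub D γ ϑ Υ Υ' n hΥ A f l)
    rw [← varJ_sub_field] at h2
    rw [varJ_sub, varJ_sub, varJ_toJet_eq] at h1
    have h3 : X ^ (n + 1) ∣ vertVar A (gaugeVariation D γ ϑ Υ f A) (X ^ n
        * C (lambdaPoly 𝕜 Υ n i j - lambdaPoly 𝕜 Υ' n i j))
        - X ^ n * ∑ l, C (aeval A
          (pderiv l (lambdaPoly 𝕜 Υ n i j - lambdaPoly 𝕜 Υ' n i j)) * D l f) := by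
      have e1 : ∀ l, sect A (dVert l (X ^ n
          * C (lambdaPoly 𝕜 Υ n i j - lambdaPoly 𝕜 Υ' n i j)))
          = X ^ n * C (aeval A
          (pderiv l (lambdaPoly 𝕜 Υ n i j - lambdaPoly 𝕜 Υ' n i j))) := by
        intro l
        rw [dVert, seriesDer_X_pow_mul, ← dVert, dVert_C, map_mul, map_pow, sect_X, sect_C]
      simp only [vertVar, e1]
      rw [mul_sum, ← sum_sub_distrib]
      refine dvd_sum fun l _ => ?_
      rw [map_mul, ← mul_assoc, ← mul_sub, pow_succ]
      exact mul_dvd_mul (dvd_mul_right _ _) (X_dvd_gaugeVariation_sub D γ ϑ Υ A f l)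
    have h4 := dvd_add (dvd_add h1 h2) h3
    convert h4 using 1
    ring
  rw [multVar, multVar, add_comm n 2, pow_add _ 2 n, mul_assoc, ← mul_sub, ← mul_sub,
    show n + 3 = 2 + (n + 1) by ring, pow_add _ 2 (n + 1)]
  refine mul_dvd_mul_left _ ?_
  rw [mul_sum, ← sum_sub_distrib, ← sum_sub_distrib]
  refine dvd_sum fun j _ => ?_
  have h := (e j).mul_right (C (D j g))
  rw [sub_mul, sub_mul, mul_assoc (X ^ n), sum_mul] at h
  simpa only [map_mul] using h

theorem X_pow_dvd_bracket (k m : ℕ) (F H : PhaseSeries d R) (hF : X ^ k ∣ F)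
    (hH : X ^ m ∣ H) : X ^ (k + m) ∣ ⦃F, H⦄ := by
  have h1 : ∀ δ : RingDer (MvPolynomial (Fin d) R), X ^ k ∣ seriesDer δ F :=
    fun δ => X_pow_dvd_seriesDer δ k F hF
  have h2 : ∀ δ : RingDer (MvPolynomial (Fin d) R), X ^ m ∣ seriesDer δ H :=
    fun δ => X_pow_dvd_seriesDer δ m H hH
  rw [bracket_eq, pow_add]
  refine dvd_sum fun i _ => dvd_sum fun j _ => dvd_add ?_ (Dvd.dvd.mul_left ?_ _)
  · rw [mul_assoc]
    exact (mul_dvd_mul (h1 _) (h2 _)).mul_left _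
  · exact dvd_sub (mul_dvd_mul (h1 _) (h2 _)) (mul_dvd_mul (h1 _) (h2 _))

theorem X_pow_dvd_sect_bracket_pull (a b : PowerSeries R) (k : ℕ) (hb : X ^ k ∣ b) :
    X ^ (k + 1) ∣ sect A ⦃pull a, pull b⦄ := by
  rw [bracket_pull_pull, map_sum]
  refine dvd_sum fun i _ => ?_
  rw [map_sum]
  refine dvd_sum fun j _ => ?_
  rw [map_mul, map_mul, baseBracket, map_mul, sect_X, sect_pull, sect_pull, mul_assoc, mul_assoc,
    pow_succ']
  exact mul_dvd_mul_left _ (((X_pow_dvd_seriesDer _ k b hb).mul_left _).mul_left _)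

theorem X_dvd_sect_dVert_bracket_constraint (a : PowerSeries R) (i k : Fin d) :
    X ∣ sect A (dVert i ⦃pull a, constraint A k⦄) := by
  rw [bracket_pull_constraint, map_sum, map_sum]
  refine dvd_sum fun j _ => ?_
  rw [RingDer.leibniz, dVert_pull, mul_zero, zero_add, map_mul]
  refine Dvd.dvd.mul_left ?_ _
  rw [map_sub, mixedBracket, map_add, map_sum, RingDer.leibniz, dVert_X, mul_zero, add_zero,
    map_sub, map_add, map_mul, sect_X, map_sum]
  refine dvd_sub (dvd_add ?_ (dvd_mul_right _ _)) (dvd_sum fun l _ => ?_)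
  · split_ifs <;> simp
  · rw [baseBracket, mul_assoc, RingDer.leibniz, dVert_X, mul_zero, add_zero, map_mul, sect_X]
    exact dvd_mul_right _ _

theorem X_pow_dvd_sect_dVert_bracket_ham (a : PowerSeries R) (W Z : Fin d → PowerSeries R) (k : ℕ)
    (hW : ∀ i, X ^ 2 ∣ W i) (hZ : ∀ i, X ^ k ∣ Z i) (i : Fin d) :
    X ^ (k + 1) ∣ sect A (dVert i ⦃ham A a W, constraintApply A Z⦄) := by
  have hΦ : ∀ (Z : Fin d → PowerSeries R) k, (∀ i, X ^ k ∣ Z i) →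
      X ^ k ∣ constraintApply A Z := by
    intro Z k hZ
    refine dvd_sum fun i _ => Dvd.dvd.mul_left ?_ _
    have h := map_dvd (pull (d := d)) (hZ i)
    rwa [map_pow, pull_X] at h
  rw [ham, bracket_add_left, map_add, map_add, sect_dVert_bracket_constraintApply_right]
  refine dvd_add (dvd_add (dvd_sum fun j _ => ?_)
    (X_pow_dvd_sect_bracket_pull D γ ϑ A a _ k (hZ i))) ?_
  · rw [pow_succ]
    exact mul_dvd_mul (hZ j) (X_dvd_sect_dVert_bracket_constraint D γ ϑ A a i j)
  · refine X_pow_dvd_sect A _ _ (X_pow_dvd_seriesDer _ _ _ ((pow_dvd_pow _ ?_).trans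
      (X_pow_dvd_bracket D γ ϑ 2 k _ _ (hΦ W 2 hW) (hΦ Z k hZ))))
    omega

theorem ham_sub (a : PowerSeries R) (X Y : Fin d → PowerSeries R) :
    ham A a X - ham A a Y = constraintApply A fun i => X i - Y i := by
  simp only [ham, constraintApply_eq, add_sub_add_left_eq_sub, ← sum_sub_distrib, map_sub,
    mul_sub]

theorem sect_dVert_gaugeHamBracket (f g : R) (i : Fin d) :
    sect A (dVert i (gaugeHamBracket D γ ϑ Υ A f g))
      = sect A (dVert i ⦃gaugeHam D Υ A (C f), gaugeHam D Υ A (C g)⦄)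
        + multVar D Υ A (gaugeVariation D γ ϑ Υ f A) g i
        - multVar D Υ A (gaugeVariation D γ ϑ Υ g A) f i := by
  simp only [gaugeHamBracket, famBracket, map_sub, map_add, famHamVar, dVert_hamVar, sect_pull]

variable (hϑ : ∀ n i j k, ϑ n j i k = -ϑ n i j k)

include hΥ hϑ in
theorem X_pow_dvd_gaugeHamBracket_sub (f g : R) (i : Fin d) :
    X ^ (n + 3) ∣ sect A (dVert i (gaugeHamBracket D γ ϑ Υ A f g))
      - sect A (dVert i (gaugeHamBracket D γ ϑ Υ' A f g))
      - X ^ (n + 2) * ((∑ j, ∑ l, C (aeval A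
          (pderiv l (lambdaPoly 𝕜 Υ n i j - lambdaPoly 𝕜 Υ' n i j)) * D l f * D j g))
        - ∑ j, ∑ l, C (aeval A
          (pderiv l (lambdaPoly 𝕜 Υ n i j - lambdaPoly 𝕜 Υ' n i j))
            * D l g * D j f)) := by
  have h1 := X_pow_dvd_multVar_sub D γ ϑ Υ Υ' n hΥ A f g i
  have h2 := X_pow_dvd_multVar_sub D γ ϑ Υ Υ' n hΥ A g f i
  have h3 := X_pow_dvd_sect_dVert_bracket_ham D γ ϑ A (C f)
    (multiplier D Υ' A (C f))
    (fun i => multiplier D Υ A (C g) i - multiplier D Υ' A (C g) i) (n + 2)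
    (X_sq_dvd_multiplier D Υ' A _) (X_pow_dvd_multiplier_sub D Υ Υ' n hΥ A _) i
  have h4 := X_pow_dvd_sect_dVert_bracket_ham D γ ϑ A (C g)
    (multiplier D Υ A (C g))
    (fun i => multiplier D Υ A (C f) i - multiplier D Υ' A (C f) i) (n + 2)
    (X_sq_dvd_multiplier D Υ A _) (X_pow_dvd_multiplier_sub D Υ Υ' n hΥ A _) i
  rw [← ham_sub, bracket_sub_right, map_sub, map_sub] at h3 h4
  rw [bracket_skew D γ hϑ (ham A (C g) _) (ham A (C f) _),
    bracket_skew D γ hϑ (ham A (C g) _) (ham A (C f) _)] at h4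
  simp only [map_neg] at h4
  have h5 := dvd_add (dvd_sub h1 h2) (dvd_sub h3 h4)
  rw [sect_dVert_gaugeHamBracket, sect_dVert_gaugeHamBracket]
  convert h5 using 1
  simp only [gaugeHam]
  ring

include hΥ in
theorem X_pow_dvd_multiplier_gaugeBracket_sub (f g : R) (i : Fin d) :
    X ^ (n + 3) ∣ multiplier D Υ A (gaugeBracket D γ ϑ Υ f g A) i
      - multiplier D Υ' A (gaugeBracket D γ ϑ Υ' f g A) i := by
  have h0 : ∀ Υ, X ∣ gaugeBracket D γ ϑ Υ f g A := by
    intro Υ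
    rw [gaugeBracket_eq]
    refine dvd_sub ?_ ?_
    · simpa using X_pow_dvd_sect_bracket_pull D γ ϑ A (C f) (C g) 0 (by simp)
    · rw [sect_bracket_constraintApply_right]
      exact dvd_sum fun k _ =>
        ((dvd_pow_self _ two_ne_zero).trans (X_sq_dvd_multiplier D Υ A _ k)).mul_right _
  have h1 : X ^ (n + 1) ∣ gaugeBracket D γ ϑ Υ f g A - gaugeBracket D γ ϑ Υ' f g A := by
    rw [gaugeBracket_eq, gaugeBracket_eq, sub_sub_sub_cancel_left]
    simp only [sect_bracket_constraintApply_right, sect_bracket_constraintApply_left]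
    rw [← sum_sub_distrib]
    refine dvd_sum fun k _ => ?_
    simp only [mul_sum]
    rw [← sum_sub_distrib]
    refine dvd_sum fun l _ => ?_
    have e : ∀ a b a' b' c : PowerSeries R, a * (b * c) - a' * (b' * c)
        = (a - a') * (b * c) + a' * ((b - b') * c) := fun a b a' b' c => by ring
    rw [← dvd_neg, neg_sub, e]
    have h := fun φ k => (pow_dvd_pow X (by omega : n + 1 ≤ n + 2)).trans
      (X_pow_dvd_multiplier_sub D Υ Υ' n hΥ A φ k)
    exact dvd_add ((h _ _).mul_right _) (((h _ _).mul_right _).mul_left _)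
  have e : multiplier D Υ A (gaugeBracket D γ ϑ Υ f g A) i
      - multiplier D Υ' A (gaugeBracket D γ ϑ Υ' f g A) i
      = X ^ 2 * ∑ j, (evJ D A (multiplierSeries 𝕜 Υ i j - multiplierSeries 𝕜 Υ' i j)
          * dSer D j (gaugeBracket D γ ϑ Υ f g A)
        + evJ D A (multiplierSeries 𝕜 Υ' i j)
          * dSer D j (gaugeBracket D γ ϑ Υ f g A - gaugeBracket D γ ϑ Υ' f g A)) := by
    rw [multiplier_eq, multiplier_eq, ← mul_sub, ← sum_sub_distrib]
    refine congrArg₂ _ rfl (sum_congr rfl fun j _ => ?_)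
    rw [map_sub, map_sub]
    ring
  rw [e, show n + 3 = 2 + (n + 1) by ring, pow_add]
  refine mul_dvd_mul_left _ (dvd_sum fun j _ => dvd_add ?_ ?_)
  · rw [pow_succ]
    refine mul_dvd_mul (X_pow_dvd_evJ D A n _
      (X_pow_dvd_multiplierSeries_sub_of_le Υ Υ' n hΥ n le_rfl i j)) ?_
    have h := X_pow_dvd_seriesDer (intDer (D j)) 1 _ (by simpa using h0 Υ)
    rwa [pow_one] at h
  · exact (X_pow_dvd_seriesDer _ _ _ h1).mul_left _

end Order

section Main

variable (D : Fin d → Derivation 𝕜 R R)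
  (γ ϑ : TensorFamily d R)
  (hϑ : ∀ n i j k, ϑ n j i k = -ϑ n i j k)
  (x : Fin d → R) (hx : ∀ i j, D i (x j) = if i = j then 1 else 0)
  (Υ Υ' : MultiplierFamily d R)

include hx in
theorem sum_coordinates (c : Fin d → Fin d → R) (l j : Fin d) :
    ∑ j', ∑ l', C (c j' l' * D l' (x l) * D j' (x j)) = C (c j l) := by
  simp only [← map_sum]
  simp [hx]

include hϑ hx in
theorem pderiv_lambdaPoly_sub_eq [CharZero 𝕜] (n : ℕ)
    (hΥ : ∀ m < n, ∀ i j, lambdaPoly 𝕜 Υ m i j = lambdaPoly 𝕜 Υ' m i j)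
    (c : Fin d → Fin d → Fin d → MvPolynomial (Fin d) R)
    (h : ∀ A i j l, X ^ (n + 3) ∣
      (multiplier D Υ A (gaugeBracket D γ ϑ Υ (x l) (x j) A) i
        - sect A (dVert i (gaugeHamBracket D γ ϑ Υ A (x l) (x j))))
      - (multiplier D Υ' A (gaugeBracket D γ ϑ Υ' (x l) (x j) A) i
        - sect A (dVert i (gaugeHamBracket D γ ϑ Υ' A (x l) (x j))))
      + X ^ (n + 2) * C (aeval A (c i j l))) (i j l : Fin d) :
    pderiv l (lambdaPoly 𝕜 Υ n i j - lambdaPoly 𝕜 Υ' n i j)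
      - pderiv j (lambdaPoly 𝕜 Υ n i l - lambdaPoly 𝕜 Υ' n i l) = c i j l := by
  refine sub_eq_zero.1 (eq_zero_of_forall_aeval 𝕜 _ fun A => ?_)
  have h1 := X_pow_dvd_gaugeHamBracket_sub D γ ϑ Υ Υ' n hΥ A hϑ (x l) (x j) i
  have h2 := X_pow_dvd_multiplier_gaugeBracket_sub D γ ϑ Υ Υ' n hΥ A (x l) (x j) i
  have e1 := sum_coordinates D x hx (fun j l => aeval A
    (pderiv l (lambdaPoly 𝕜 Υ n i j - lambdaPoly 𝕜 Υ' n i j)))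
  rw [e1, e1] at h1
  have h3 := dvd_add h1 (dvd_sub (h A i j l) h2)
  have h4 : X ^ (n + 3) ∣ X ^ (n + 2) * C (aeval A
      (pderiv l (lambdaPoly 𝕜 Υ n i j - lambdaPoly 𝕜 Υ' n i j)
        - pderiv j (lambdaPoly 𝕜 Υ n i l - lambdaPoly 𝕜 Υ' n i l) - c i j l)) := by
    rw [← dvd_neg]
    convert h3 using 1
    rw [map_sub (aeval (R := R) A), map_sub (aeval (R := R) A), map_sub C,
      map_sub C]
    ring
  have h5 := X_pow_dvd_iff.1 h4 (n + 2) (by omega)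
  rwa [coeff_X_pow_mul', if_pos le_rfl, Nat.sub_self, PowerSeries.coeff_zero_C] at h5

include hϑ hx in
theorem multiplier_unique [CharZero 𝕜] (hΥ : MultiplierSymmetries Υ) (hΥ' : MultiplierSymmetries Υ')
    (hR : MultiplierRecursion D γ ϑ Υ) (hR' : MultiplierRecursion D γ ϑ Υ') : Υ = Υ' := by
  have key : ∀ n, Υ n = Υ' n := by
    intro n
    induction n using Nat.strong_induction_on with
    | _ n ih =>
      have h0 : ∀ m < n, ∀ i j, lambdaPoly 𝕜 Υ m i j = lambdaPoly 𝕜 Υ' m i j := by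
        intro m hm i j
        rw [lambdaPoly, lambdaPoly, ih m hm]
      rw [multiplierRecursion_iff D γ ϑ Υ hϑ] at hR
      rw [multiplierRecursion_iff D γ ϑ Υ' hϑ] at hR'
      funext i j l k
      have h := pderiv_lambdaPoly_sub_eq D γ ϑ hϑ x hx Υ Υ' n h0 (fun _ _ _ => 0)
        (fun A i j l => by rw [hR, hR']; simp) i l j
      rw [map_sub, map_sub, sub_sub_sub_comm, pderiv_lambdaPoly_sub Υ hΥ,
        pderiv_lambdaPoly_sub Υ' hΥ', sub_eq_zero] at h
      rw [← symCoeff_fibrePoly (𝕜 := 𝕜) n (Υ n i j l) (fun k σ => hΥ.symm _ _ _ _ k σ), h,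
        symCoeff_fibrePoly n (Υ' n i j l) (fun k σ => hΥ'.symm _ _ _ _ k σ)]
  exact funext key

theorem lambdaPoly_zero (n : ℕ) (i j : Fin d) :
    lambdaPoly 𝕜 (fun _ _ _ _ _ => 0 : MultiplierFamily d R) n i j
      = 0 := by
  simp [lambdaPoly, fibrePoly]

theorem multiplierSeries_zero (i j : Fin d) :
    multiplierSeries 𝕜 (fun _ _ _ _ _ => 0 :
      MultiplierFamily d R) i j = 0 := by
  have h : ∀ i j, lambdaSeries 𝕜 (fun _ _ _ _ _ => 0 :
      MultiplierFamily d R) i j = 0 := by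
    intro i j
    rw [lambdaSeries_eq]
    simp only [lambdaPoly_zero]
    rw [← map_zero toJet]
    congr 1
  rw [multiplierSeries_eq]
  simp [h]

include hϑ hx in
/-- The leading coefficient of a solution of the recursion relations. -/
theorem multiplier_leading [CharZero 𝕜] (hΥ : MultiplierSymmetries Υ) (hR : MultiplierRecursion D γ ϑ Υ)
    (i j l : Fin d) (k : Fin 0 → Fin d) : Υ 0 i j l k = -ϑ 1 j l fun _ => i := by
  rw [multiplierRecursion_iff D γ ϑ Υ hϑ] at hR
  have h := pderiv_lambdaPoly_sub_eq D γ ϑ hϑ x hx Υ (fun _ _ _ _ _ => 0) 0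
    (fun m hm => absurd hm m.not_lt_zero)
    (fun i j l => -MvPolynomial.C (ϑ 1 l j fun _ => i)) (fun A i j l => ?_) i l j
  · simp only [lambdaPoly_zero, sub_zero] at h
    rw [pderiv_lambdaPoly_sub Υ hΥ, fibrePoly_zero _ k, ← map_neg] at h
    exact MvPolynomial.C_injective _ _ h
  · have e1 : ∀ φ m, multiplier D (fun _ _ _ _ _ => 0 : (n : ℕ) → Fin d → Fin d → Fin d →
        (Fin n → Fin d) → R) A φ m = 0 := by
      intro φ m
      simp [multiplier_eq, multiplierSeries_zero]
    have e2 : ∀ φ, gaugeHam D (fun _ _ _ _ _ => 0 : (n : ℕ) → Fin d → Fin d → Fin d →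
        (Fin n → Fin d) → R) A φ = pull φ := by
      intro φ
      simp [gaugeHam, ham, constraintApply_eq, e1]
    have e3 : ∀ B f m, multVar D (fun _ _ _ _ _ => 0 : (n : ℕ) → Fin d → Fin d → Fin d →
        (Fin n → Fin d) → R) A B f m = 0 := by
      intro B f m
      simp [multVar, multiplierSeries_zero, varJ_zero]
    have e4 : dVert i (cosymplecticBracket D γ ϑ (pull (C (x l)))
          (pull (C (x j))))
        = X * dVert i (thetaSeries ϑ l j) := by
      have e := position_bracket D γ ϑ x hx (pull (C (x j))) l
      simp only [position] at e
      rw [e]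
      simp [dSer_C, hx, apply_ite (pull (d := d)), apply_ite (C (R := R)), baseBracket,
        RingDer.leibniz]
    rw [hR, sub_self, sect_dVert_gaugeHamBracket, e2, e2, e3, e3, e1, e4, map_mul, sect_X]
    have e5 : X ^ 2 ∣ sect A (dVert i (thetaSeries ϑ l j))
        - X * C (ϑ 1 l j fun _ => i) := by
      refine X_pow_dvd_iff.2 fun m hm => ?_
      rw [map_sub, coeff_sect, coeff_dVert, thetaSeries, coeff_mk]
      interval_cases m
      · simp [fibrePoly_zero _ Fin.elim0]
      · have e6 : ∀ m, (Fin.cons m Fin.elim0 : Fin 1 → Fin d) = fun _ => m := by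
          intro m
          funext a
          exact Fin.cases rfl (fun a => a.elim0) a
        simp [fibrePoly_succ, fibrePoly_zero _ Fin.elim0, pderiv_X, Pi.single_apply,
          e6, PowerSeries.coeff_one_X]
    have e7 := mul_dvd_mul_left X e5
    rw [← pow_succ'] at e7
    convert e7 using 1
    rw [map_neg (aeval (R := R) A), MvPolynomial.aeval_C, Algebra.algebraMap_self, RingHom.id_apply,
      map_neg]
    ring

end Main

end Uniqueness

/-! ## The coordinate functions -/

section Coordinates

variable (𝕜 : Type) [RCLike 𝕜] {d : ℕ} (U : TopologicalSpace.Opens (EuclideanSpace ℝ (Fin d)))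

/-- The coordinate function `xʲ` on `U`. -/
def coordinate (j : Fin d) : smoothFunctions 𝕜 U :=
  ⟨fun x => ((x.1 j : ℝ) : 𝕜), fun x => ((x j : ℝ) : 𝕜),
    ((RCLike.ofRealCLM (K := 𝕜)).comp
      (EuclideanSpace.proj j : EuclideanSpace ℝ (Fin d) →L[ℝ] ℝ)).contDiff.contDiffOn, fun _ => rfl⟩

theorem partialDeriv_coordinate (i j : Fin d) :
    partialDeriv 𝕜 U i (coordinate 𝕜 U j) = if i = j then 1 else 0 := by
  ext x
  change fderiv ℝ (extendZero (coordinate 𝕜 U j).1) x (EuclideanSpace.single i 1) = _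
  have h : extendZero (coordinate 𝕜 U j).1 =ᶠ[nhds (x : EuclideanSpace ℝ (Fin d))]
      ((RCLike.ofRealCLM (K := 𝕜)).comp
        (EuclideanSpace.proj j : EuclideanSpace ℝ (Fin d) →L[ℝ] ℝ)) := by
    filter_upwards [U.isOpen.mem_nhds x.2] with y hy
    exact extendZero_apply (coordinate 𝕜 U j).1 ⟨y, hy⟩
  rw [h.fderiv_eq, ContinuousLinearMap.fderiv]
  by_cases hij : i = j
  · subst hij
    simp
  · simp [hij, Ne.symm hij]

end Coordinates

section ExistsUnique

theorem jacobiator_rotate (D : Fin d → Derivation 𝕜 R R) (θ : Fin d → Fin d → R) (i j k : Fin d) :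
    jacobiator D θ j k i = jacobiator D θ i j k := by
  rw [jacobiator, jacobiator]
  congr 1
  exact sum_congr rfl fun l _ => by ring

/-- Lagrangian multipliers exist and are unique. -/
theorem existsUnique_isLagrangianMultiplier [CharZero 𝕜] {D : Fin d → Derivation 𝕜 R R} {θ : Fin d → Fin d → R}
    (E : LocalSymplecticEmbedding D θ) (x : Fin d → R)
    (hx : ∀ i j, D i (x j) = if i = j then 1 else 0) : ∃! Υ, IsLagrangianMultiplier E Υ := by
  obtain ⟨Υ, hΥ, hR⟩ := exists_multiplierRecursion D E.γ E.ϑ x hx E.ϑ_skew E.jacobi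
  refine ⟨Υ, ⟨fun i j l k => ?_, hΥ.skew, hΥ.symm, hΥ.cyclic, hR⟩, fun Υ' h => ?_⟩
  · rw [multiplier_leading D E.γ E.ϑ E.ϑ_skew x hx Υ hΥ hR, E.ϑ_one, neg_neg, jacobiator_rotate]
  · exact multiplier_unique D E.γ E.ϑ E.ϑ_skew x hx Υ' Υ ⟨h.skew, h.symm, h.cyclic⟩ hΥ h.recursion hR

end ExistsUnique

/-! ## Permutations and adjacent transpositions -/

theorem perm_induction_adjacent {n : ℕ} {p : Perm (Fin n) → Prop} (one : p 1)
    (step : ∀ τ, ∀ i j : Fin n, (i : ℕ) + 1 = j → p τ → p (τ * swap i j))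
    (τ : Perm (Fin n)) : p τ := by
  cases n with
  | zero => rwa [Subsingleton.elim τ 1]
  | succ n =>
    have h : τ ∈ Submonoid.closure
        (Set.range fun i : Fin n => swap i.castSucc i.succ) := by
      rw [Equiv.Perm.mclosure_swap_castSucc_succ]; trivial
    induction h using Submonoid.closure_induction_right with
    | one => exact one
    | mul_right x _ y hy ih =>
      obtain ⟨i, rfl⟩ := hy
      exact step x _ _ (by simp) ih

/-! ## Polarization of polynomials -/

section Polarization

variable {𝕜 R ι M : Type} [Field 𝕜] [CommRing R] [Algebra 𝕜 R] [Fintype ι]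
  [AddCommGroup M] [Module 𝕜 M] (J : M →ₗ[𝕜] ι → R)

/-- The derivative of a polynomial in the direction of `B`. -/
def directional : MvPolynomial ι R →ₗ[𝕜] M →ₗ[𝕜] MvPolynomial ι R :=
  LinearMap.mk₂ 𝕜 (fun P B => ∑ v, J B v • pderiv v P)
    (fun P Q B => by simp [smul_add, sum_add_distrib])
    (fun c P B => by
      rw [smul_sum]
      refine sum_congr rfl fun v _ => ?_
      rw [← algebraMap_smul R c P, (pderiv v).map_smul, ← algebraMap_smul R c,
        smul_comm])
    (fun P B C => by simp [add_smul, sum_add_distrib])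
    (fun c P B => by simp [smul_sum])

theorem directional_apply (P : MvPolynomial ι R) (B : M) :
    directional J P B = ∑ v, J B v • pderiv v P := rfl

/-- The multilinear map given by the `n`-th derivative of a polynomial at the origin. -/
def polar : (n : ℕ) → MvPolynomial ι R →ₗ[𝕜] MultilinearMap 𝕜 (fun _ : Fin n => M) R
  | 0 => (MultilinearMap.constLinearEquivOfIsEmpty (R := 𝕜) (S := 𝕜) (M₁ := fun _ : Fin 0 => M)
        (M₂ := R)).toLinearMap ∘ₗ (MvPolynomial.lcoeff R 0).restrictScalars 𝕜
  | n + 1 => (multilinearCurryLeftEquiv 𝕜 (fun _ : Fin (n + 1) => M) R).symm.toLinearMap ∘ₗ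
      LinearMap.compRight 𝕜 (polar n) ∘ₗ directional J

theorem polar_zero (P : MvPolynomial ι R) (A : Fin 0 → M) : polar J 0 P A = P.coeff 0 := rfl

theorem polar_succ (n : ℕ) (P : MvPolynomial ι R) (A : Fin (n + 1) → M) :
    polar J (n + 1) P A = polar J n (directional J P (A 0)) (fun i => A i.succ) := rfl

theorem directional_comm (P : MvPolynomial ι R) (B C : M) :
    directional J (directional J P B) C = directional J (directional J P C) B := by
  rw [directional_apply J (directional J P B), directional_apply J (directional J P C)]
  simp only [directional_apply, map_sum, (pderiv _).map_smul, smul_sum]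
  rw [sum_comm]
  refine sum_congr rfl fun v _ => sum_congr rfl fun w _ => ?_
  rw [smul_comm, pderiv_comm]

theorem polar_swap (n : ℕ) (P : MvPolynomial ι R) (A : Fin n → M) (i j : Fin n)
    (h : (i : ℕ) + 1 = j) : polar J n P (A ∘ swap i j) = polar J n P A := by
  induction n generalizing P with
  | zero => exact i.elim0
  | succ n ih =>
    induction i using Fin.cases with
    | zero =>
      cases n with
      | zero => exact absurd j.2 (by simp at h)
      | succ n =>
        obtain rfl : j = 1 := Fin.ext (by simpa using h.symm)
        simp only [polar_succ, Function.comp_apply, Equiv.swap_apply_left]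
        rw [directional_comm]
        have h1 : (swap (0 : Fin (n + 2)) 1) (Fin.succ 0) = 0 := Equiv.swap_apply_right _ _
        rw [h1]
        congr 1
    | succ i =>
      induction j using Fin.cases with
      | zero => simp at h
      | succ j =>
        rw [polar_succ, polar_succ, ← ih _ (fun k => A k.succ) i j (by simpa using h)]
        have h1 : (A ∘ swap i.succ j.succ) 0 = A 0 := by
          rw [Function.comp_apply, Equiv.swap_apply_of_ne_of_ne] <;> simp [Fin.ext_iff]
        rw [h1]
        congr 1
        ext k
        simp only [Function.comp_apply, Equiv.swap_apply_def, Fin.succ_inj]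
        split_ifs <;> rfl

theorem polar_symm (n : ℕ) (P : MvPolynomial ι R) (A : Fin n → M) (σ : Perm (Fin n)) :
    polar J n P (A ∘ σ) = polar J n P A := by
  induction σ using perm_induction_adjacent generalizing A with
  | one => rfl
  | step τ i j h ih => rw [Equiv.Perm.coe_mul, ← Function.comp_assoc, polar_swap J n P _ i j h, ih]

theorem aeval_directional (P : MvPolynomial ι R) (A B : M) :
    aeval (R := R) (J A) (directional J P B)
      = ∑ v, J B v * aeval (R := R) (J A) (pderiv v P) := by
  simp [directional_apply]

theorem isHomogeneous_directional {n : ℕ} {P : MvPolynomial ι R} (hP : P.IsHomogeneous n) (B : M) :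
    (directional J P B).IsHomogeneous (n - 1) :=
  MvPolynomial.IsHomogeneous.sum _ _ _ fun v _ => by
    rw [MvPolynomial.smul_eq_C_mul]
    simpa using (isHomogeneous_C ι (J B v)).mul (hP.pderiv (i := v))

theorem polar_diag {n : ℕ} {P : MvPolynomial ι R} (hP : P.IsHomogeneous n) (A : M) :
    polar J n P (fun _ => A) = n.factorial • aeval (R := R) (J A) P := by
  induction n generalizing P with
  | zero =>
    rw [polar_zero]
    conv_rhs => rw [MvPolynomial.totalDegree_eq_zero_iff_eq_C.1
      (Nat.le_zero.1 hP.totalDegree_le)]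
    simp
  | succ n ih =>
    rw [polar_succ, ih (isHomogeneous_directional J hP A), aeval_directional]
    have h := congrArg (aeval (R := R) (J A)) hP.sum_X_mul_pderiv
    simp only [map_sum, map_mul, aeval_X, map_nsmul] at h
    rw [h, smul_smul, Nat.factorial_succ, mul_comm]

theorem polar_cons_diag {n : ℕ} {P : MvPolynomial ι R} (hP : P.IsHomogeneous (n + 1)) (A B : M) :
    polar J (n + 1) P (Fin.cons B fun _ => A)
      = n.factorial • ∑ v, J B v * aeval (R := R) (J A) (pderiv v P) := by
  rw [polar_succ, ← aeval_directional]
  exact polar_diag J (isHomogeneous_directional J hP B) A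

end Polarization

/-! ## Homogeneity of the jet functions -/

section Weights

variable {ι : Type}

/-- The coefficient of `tⁿ` is homogeneous of degree `n + s`. -/
def HomSeries (s : ℕ) (F : PowerSeries (MvPolynomial ι R)) : Prop :=
  ∀ n, (coeff n F).IsHomogeneous (n + s)

namespace HomSeries

variable {s r : ℕ} {F G : PowerSeries (MvPolynomial ι R)}

theorem add (hF : HomSeries s F) (hG : HomSeries s G) : HomSeries s (F + G) := fun n => by
  rw [map_add]; exact (hF n).add (hG n)

theorem neg (hF : HomSeries s F) : HomSeries s (-F) := fun n => by
  rw [map_neg]; exact (MvPolynomial.homogeneousSubmodule ι R (n + s)).neg_mem (hF n)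

theorem sub (hF : HomSeries s F) (hG : HomSeries s G) : HomSeries s (F - G) := by
  rw [sub_eq_add_neg]; exact hF.add hG.neg

theorem sum {κ : Type} (t : Finset κ) (F : κ → PowerSeries (MvPolynomial ι R))
    (hF : ∀ i, HomSeries s (F i)) : HomSeries s (∑ i ∈ t, F i) := fun n => by
  rw [map_sum]; exact MvPolynomial.IsHomogeneous.sum _ _ _ fun i _ => hF i n

theorem mul (hF : HomSeries s F) (hG : HomSeries r G) : HomSeries (s + r) (F * G) := fun n => by
  rw [coeff_mul]
  refine MvPolynomial.IsHomogeneous.sum _ _ _ fun i hi => ?_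
  have h := (hF i.1).mul (hG i.2)
  rw [← Finset.HasAntidiagonal.mem_antidiagonal.1 hi]
  convert h using 1
  omega

theorem X_pow_mul (k : ℕ) (hF : HomSeries (s + k) F) : HomSeries s (X ^ k * F) :=
  fun n => by
    rw [coeff_X_pow_mul']
    split_ifs with h
    · convert hF (n - k) using 1
      omega
    · exact isHomogeneous_zero _ _ _

theorem one : HomSeries 0 (1 : PowerSeries (MvPolynomial ι R)) := fun n => by
  rw [PowerSeries.coeff_one]
  split_ifs with h
  · subst h; exact MvPolynomial.isHomogeneous_one _ _
  · exact isHomogeneous_zero _ _ _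

theorem zero : HomSeries s (0 : PowerSeries (MvPolynomial ι R)) := fun n => by
  rw [map_zero]; exact isHomogeneous_zero _ _ _

theorem toJet {F : PhaseSeries d R} (hF : HomSeries s F) : HomSeries s (toJet F) := fun n => by
  rw [AlmostPoisson.toJet, coeff_map]
  exact (hF n).rename_isHomogeneous

end HomSeries

theorem isHomogeneous_fibrePoly (n : ℕ) (c : (Fin n → Fin d) → R) :
    (fibrePoly n c).IsHomogeneous n := by
  refine MvPolynomial.IsHomogeneous.sum _ _ _ fun k _ => ?_
  have h := (isHomogeneous_C (Fin d) (c k)).mul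
    (MvPolynomial.IsHomogeneous.prod univ (fun m : Fin n => MvPolynomial.X (R := R) (k m))
      (fun _ => 1) fun m _ => isHomogeneous_X R (k m))
  simpa using h

theorem homSeries_thetaSeries (ϑ : TensorFamily d R) (i j : Fin d) :
    HomSeries 0 (thetaSeries ϑ i j) := fun n => by
  rw [thetaSeries, coeff_mk]; exact isHomogeneous_fibrePoly _ _

theorem homSeries_mixedBracket (γ : TensorFamily d R) (i j : Fin d) :
    HomSeries 0 (mixedBracket γ i j) := by
  refine HomSeries.add ?_ ?_
  · split_ifs
    exacts [HomSeries.one, HomSeries.zero]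
  · rw [← pow_one (X (R := MvPolynomial (Fin d) R))]
    refine HomSeries.X_pow_mul 1 fun n => ?_
    rw [gammaSeries, coeff_mk]
    exact isHomogeneous_fibrePoly _ _

theorem homSeries_jetMatrix (k m : Fin d) : HomSeries 1 (jetMatrix d R k m) := fun n => by
  rw [jetMatrix, coeff_C]
  split_ifs with h
  · subst h; exact isHomogeneous_X _ _
  · exact isHomogeneous_zero _ _ _

variable (γ ϑ : TensorFamily d R)
  (Υ : MultiplierFamily d R)

theorem homSeries_lambdaSeries (i j : Fin d) : HomSeries 1 (lambdaSeries 𝕜 Υ i j) := by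
  rw [lambdaSeries_eq]
  refine HomSeries.toJet fun n => ?_
  rw [coeff_mk, lambdaPoly, smul_eq_C_algebraMap_mul]
  refine (MvPolynomial.homogeneousSubmodule (Fin d) R (n + 1)).neg_mem ?_
  have h := (isHomogeneous_C (Fin d) (algebraMap 𝕜 R (1 / ((n : 𝕜) + 2)))).mul
    (MvPolynomial.IsHomogeneous.sum univ
      (fun l => MvPolynomial.X l * fibrePoly n (Υ n i j l)) (n + 1) fun l _ => by
        have h := (isHomogeneous_X R l).mul (isHomogeneous_fibrePoly n (Υ n i j l))
        rwa [add_comm 1 n] at h)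
  simpa using h

theorem homSeries_multiplierSeries (i j : Fin d) : HomSeries 1 (multiplierSeries 𝕜 Υ i j) := by
  have hMat : ∀ n a b, HomSeries (2 * n) (((jetMatrix d R * lambdaSeries 𝕜 Υ) ^ n) a b) := by
    intro n
    induction n with
    | zero =>
      intro a b
      rw [pow_zero, Matrix.one_apply]
      split_ifs
      exacts [HomSeries.one, HomSeries.zero]
    | succ n ih =>
      intro a b
      rw [pow_succ, Matrix.mul_apply]
      refine HomSeries.sum _ _ fun c => (ih a c).mul ?_
      rw [Matrix.mul_apply]
      exact HomSeries.sum _ _ fun e =>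
        (homSeries_jetMatrix c e).mul (homSeries_lambdaSeries Υ e b)
  intro N
  rw [multiplierSeries, coeff_mk]
  refine MvPolynomial.IsHomogeneous.sum _ _ _ fun n _ => ?_
  rw [neg_pow, ← pow_mul, mul_assoc]
  have hs : HomSeries 1 (X ^ (2 * n) *
      (lambdaSeries 𝕜 Υ * (jetMatrix d R * lambdaSeries 𝕜 Υ) ^ n) i j) := by
    refine HomSeries.X_pow_mul _ ?_
    rw [Matrix.mul_apply]
    exact HomSeries.sum _ _ fun e => (homSeries_lambdaSeries Υ i e).mul (hMat n e j)
  rcases neg_one_pow_eq_or (PowerSeries (MvPolynomial (JetVar d) R)) n with h | h <;> rw [h]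
  · rw [one_mul]; exact hs N
  · rw [neg_one_mul]; exact hs.neg N

theorem homSeries_baseBracket_mul (a b i k : Fin d) :
    HomSeries 0 (toJet (baseBracket ϑ a b) * jetMatrix d R i k) := by
  have h := HomSeries.X_pow_mul (s := 0) 1
    ((homSeries_thetaSeries ϑ a b).toJet.mul (homSeries_jetMatrix i k))
  rwa [pow_one, ← toJet_X, ← mul_assoc, ← map_mul] at h

theorem homSeries_constraintJet (i k : Fin d) : HomSeries 1 (constraintJet γ ϑ i k) :=
  HomSeries.sum _ _ fun a =>
    (((homSeries_mixedBracket γ a i).toJet.mul (homSeries_jetMatrix a k)).sub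
      ((homSeries_mixedBracket γ a k).toJet.mul (homSeries_jetMatrix a i))).add
    (HomSeries.sum _ _ fun b =>
      (homSeries_baseBracket_mul ϑ a b a i).mul (homSeries_jetMatrix b k))

theorem homSeries_gaugeJet (k j : Fin d) : HomSeries 0 (gaugeJet (𝕜 := 𝕜) γ ϑ Υ k j) :=
  ((homSeries_mixedBracket γ j k).toJet.sub
    (HomSeries.sum _ _ fun l => homSeries_baseBracket_mul ϑ j l l k)).add
  (HomSeries.X_pow_mul 2 (HomSeries.sum _ _ fun i =>
    (homSeries_multiplierSeries Υ i j).mul (homSeries_constraintJet γ ϑ i k)))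

/-- The coefficient of `∂ᵢf ∂ⱼg` in the jet function `⟦f, g⟧`. -/
def bracketJet₀ (𝕜 : Type) [Field 𝕜] [Algebra 𝕜 R]
    (γ ϑ : TensorFamily d R)
    (Υ : MultiplierFamily d R) (i j : Fin d) : JetSeries d R :=
  toJet (thetaSeries ϑ i j)
    - X ^ 3 * ∑ b, (∑ a, multiplierSeries 𝕜 Υ a i * constraintJet γ ϑ a b)
        * multiplierSeries 𝕜 Υ b j

theorem bracketJet_eq (i j : Fin d) :
    bracketJet (𝕜 := 𝕜) γ ϑ Υ i j = X * bracketJet₀ 𝕜 γ ϑ Υ i j := by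
  rw [bracketJet, bracketJet₀, baseBracket, map_mul, toJet_X, mul_sub, ← mul_assoc X,
    ← pow_succ']

theorem homSeries_bracketJet₀ (i j : Fin d) : HomSeries 0 (bracketJet₀ 𝕜 γ ϑ Υ i j) :=
  (homSeries_thetaSeries ϑ i j).toJet.sub (HomSeries.X_pow_mul 3 (HomSeries.sum _ _ fun _ =>
    (HomSeries.sum _ _ fun _ => (homSeries_multiplierSeries Υ _ _).mul
      (homSeries_constraintJet γ ϑ _ _)).mul (homSeries_multiplierSeries Υ _ _)))

end Weights

/-! ## The gauge algebroid as a family of multilinear maps -/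

section GaugeMaps

variable (D : Fin d → Derivation 𝕜 R R)
  (γ ϑ : TensorFamily d R)
  (Υ : MultiplierFamily d R)

/-- The first jet of a one-form. -/
def jetProlong : (Fin d → R) →ₗ[𝕜] JetVar d → R where
  toFun A := Sum.elim A fun kl => D kl.1 (A kl.2)
  map_add' A B := by
    funext v
    rcases v with l | kl <;> simp
  map_smul' c A := by
    funext v
    rcases v with l | kl <;> simp

theorem coeff_evJ_eq (A : Fin d → R) (n : ℕ) (F : JetSeries d R) :
    coeff n (evJ D A F)
      = aeval (R := R) (jetProlong D A) (coeff n F) :=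
  coeff_evJ D A n F

/-- The multilinear map `Pₙ(f; ·)` with `δ_f A = ∑ₙ (tⁿ/n!) Pₙ(f; A, …, A)`. -/
def variationMap (n : ℕ) : R →ₗ[𝕜] MultilinearMap 𝕜 (fun _ : Fin n => Fin d → R) (Fin d → R) where
  toFun f := MultilinearMap.pi fun k => ∑ j, D j f •
    polar (jetProlong D) n (coeff n (gaugeJet (𝕜 := 𝕜) γ ϑ Υ k j))
  map_add' f g := by
    ext A k
    simp [add_mul, sum_add_distrib]
  map_smul' c f := by
    ext A k
    simp [smul_sum]

/-- The multilinear map `Qₙ(f, g; ·)` with `⟦f, g⟧(A) = ∑ₙ (tⁿ/n!) Qₙ(f, g; A, …, A)`. -/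
def bracketMap (n : ℕ) :
    R →ₗ[𝕜] R →ₗ[𝕜] MultilinearMap 𝕜 (fun _ : Fin n => Fin d → R) R :=
  LinearMap.mk₂ 𝕜 (fun f g => ∑ i, ∑ j, (D i f * D j g) •
      polar (jetProlong D) n (coeff n (bracketJet₀ 𝕜 γ ϑ Υ i j)))
    (fun f f' g => by simp [add_mul, add_smul, sum_add_distrib])
    (fun c f g => MultilinearMap.ext fun A => by simp [smul_sum])
    (fun f g g' => by simp [mul_add, add_smul, sum_add_distrib])
    (fun c f g => MultilinearMap.ext fun A => by simp [smul_sum])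

theorem variationMap_apply (n : ℕ) (f : R) (A : Fin n → Fin d → R) (k : Fin d) :
    variationMap D γ ϑ Υ n f A k = ∑ j, D j f *
      polar (jetProlong D) n (coeff n (gaugeJet (𝕜 := 𝕜) γ ϑ Υ k j)) A := by
  simp [variationMap]

theorem bracketMap_apply (n : ℕ) (f g : R) (A : Fin n → Fin d → R) :
    bracketMap D γ ϑ Υ n f g A = ∑ i, ∑ j, D i f * D j g *
      polar (jetProlong D) n (coeff n (bracketJet₀ 𝕜 γ ϑ Υ i j)) A := by
  simp [bracketMap]

theorem variationMap_symm (n : ℕ) (f : R) (A : Fin n → Fin d → R) (σ : Perm (Fin n)) :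
    variationMap D γ ϑ Υ n f (A ∘ σ) = variationMap D γ ϑ Υ n f A := by
  funext k
  simp only [variationMap_apply, polar_symm]

theorem bracketMap_symm (n : ℕ) (f g : R) (A : Fin n → Fin d → R) (σ : Perm (Fin n)) :
    bracketMap D γ ϑ Υ n f g (A ∘ σ) = bracketMap D γ ϑ Υ n f g A := by
  simp only [bracketMap_apply, polar_symm]

variable {ϑ} in
theorem constraintJet_skew (hϑ : ∀ n i j k, ϑ n j i k = -ϑ n i j k) (i k : Fin d) :
    constraintJet γ ϑ k i = -constraintJet γ ϑ i k := by
  have h : ∀ a b, thetaSeries ϑ b a = -thetaSeries ϑ a b := by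
    intro a b
    ext n : 1
    rw [map_neg, thetaSeries, thetaSeries, coeff_mk, coeff_mk,
      ← fibrePoly_neg]
    exact congrArg _ (funext fun k => hϑ n a b k)
  simp only [constraintJet, sum_add_distrib, sum_sub_distrib, neg_add_rev, neg_sub]
  rw [add_comm, add_left_inj, sum_comm, ← sum_neg_distrib]
  refine sum_congr rfl fun a _ => ?_
  rw [← sum_neg_distrib]
  refine sum_congr rfl fun b _ => ?_
  simp only [baseBracket, h a b, map_mul, map_neg]
  ring

variable {ϑ} in
theorem bracketJet₀_skew (hϑ : ∀ n i j k, ϑ n j i k = -ϑ n i j k) (i j : Fin d) :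
    bracketJet₀ 𝕜 γ ϑ Υ j i = -bracketJet₀ 𝕜 γ ϑ Υ i j := by
  have h : ∀ a b, thetaSeries ϑ b a = -thetaSeries ϑ a b := by
    intro a b
    ext n : 1
    rw [map_neg, thetaSeries, thetaSeries, coeff_mk, coeff_mk,
      ← fibrePoly_neg]
    exact congrArg _ (funext fun k => hϑ n a b k)
  simp only [bracketJet₀, h i j, map_neg, sum_mul]
  rw [sum_comm]
  have h2 : ∀ a b, multiplierSeries 𝕜 Υ a j * constraintJet γ ϑ a b * multiplierSeries 𝕜 Υ b i
      = -(multiplierSeries 𝕜 Υ b i * constraintJet γ ϑ b a * multiplierSeries 𝕜 Υ a j) := by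
    intro a b
    rw [constraintJet_skew γ hϑ b a]
    ring
  simp only [h2, sum_neg_distrib]
  ring

variable {ϑ} in
theorem bracketMap_skew (hϑ : ∀ n i j k, ϑ n j i k = -ϑ n i j k) (n : ℕ) (f g : R) :
    bracketMap D γ ϑ Υ n g f = -bracketMap D γ ϑ Υ n f g := by
  refine MultilinearMap.ext fun A => ?_
  rw [neg_apply, bracketMap_apply, bracketMap_apply, sum_comm,
    ← sum_neg_distrib]
  refine sum_congr rfl fun i _ => ?_
  rw [← sum_neg_distrib]
  refine sum_congr rfl fun j _ => ?_
  rw [bracketJet₀_skew γ Υ hϑ, map_neg, map_neg, neg_apply]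
  ring

theorem variationMap_diag (n : ℕ) (f : R) (A : Fin d → R) (k : Fin d) :
    variationMap D γ ϑ Υ n f (fun _ => A) k
      = n.factorial • coeff n (gaugeVariation D γ ϑ Υ f A k) := by
  rw [variationMap_apply, gaugeVariation_eq_sum, map_sum, smul_sum]
  refine sum_congr rfl fun j _ => ?_
  have h := homSeries_gaugeJet (𝕜 := 𝕜) γ ϑ Υ k j n
  rw [add_zero] at h
  rw [polar_diag _ h, coeff_mul_C, coeff_evJ_eq, mul_smul_comm, mul_comm]

theorem coeff_gaugeVariation [CharZero 𝕜] (n : ℕ) (f : R) (A : Fin d → R) (k : Fin d) :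
    coeff n (gaugeVariation D γ ϑ Υ f A k)
      = (1 / (n.factorial : 𝕜)) • variationMap D γ ϑ Υ n f (fun _ => A) k := by
  rw [variationMap_diag, ← cast_smul_eq_nsmul 𝕜, smul_smul, one_div_mul_cancel, one_smul]
  exact_mod_cast n.factorial_ne_zero

theorem coeff_gaugeBracket_zero (f g : R) (A : Fin d → R) :
    coeff 0 (gaugeBracket D γ ϑ Υ f g A) = 0 := by
  rw [gaugeBracket_eq_sum, map_sum]
  refine sum_eq_zero fun i _ => ?_
  rw [map_sum]
  refine sum_eq_zero fun j _ => ?_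
  rw [bracketJet_eq, (evJ D A).map_mul, evJ_X, mul_assoc, mul_assoc, PowerSeries.coeff_zero_X_mul]

theorem bracketMap_diag (n : ℕ) (f g : R) (A : Fin d → R) :
    bracketMap D γ ϑ Υ n f g (fun _ => A)
      = n.factorial • coeff (n + 1) (gaugeBracket D γ ϑ Υ f g A) := by
  rw [bracketMap_apply, gaugeBracket_eq_sum, map_sum, smul_sum]
  refine sum_congr rfl fun i _ => ?_
  rw [map_sum, smul_sum]
  refine sum_congr rfl fun j _ => ?_
  have h := homSeries_bracketJet₀ (𝕜 := 𝕜) γ ϑ Υ i j n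
  rw [add_zero] at h
  rw [polar_diag _ h, coeff_mul_C, coeff_mul_C, bracketJet_eq, (evJ D A).map_mul,
    evJ_X, coeff_succ_X_mul, coeff_evJ_eq, mul_smul_comm]
  ring

theorem coeff_gaugeBracket [CharZero 𝕜] (n : ℕ) (f g : R) (A : Fin d → R) :
    coeff (n + 1) (gaugeBracket D γ ϑ Υ f g A)
      = (1 / (n.factorial : 𝕜)) • bracketMap D γ ϑ Υ n f g (fun _ => A) := by
  rw [bracketMap_diag, ← cast_smul_eq_nsmul 𝕜, smul_smul, one_div_mul_cancel, one_smul]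
  exact_mod_cast n.factorial_ne_zero

theorem varJ_eq_sum (A : Fin d → R) (B : Fin d → PowerSeries R) (F : JetSeries d R) (n : ℕ) :
    coeff n (varJ D A B F) = ∑ ab ∈ antidiagonal n,
      ∑ v, jetProlong D (fun k => coeff ab.1 (B k)) v *
        aeval (R := R) (jetProlong D A)
          (pderiv v (coeff ab.2 F)) := by
  have h : ∀ (v : JetVar d) (C : PowerSeries R), coeff n (evJ D A (dJetD v F) * C)
      = ∑ ab ∈ antidiagonal n, coeff ab.1 C *
        aeval (R := R) (jetProlong D A)
          (pderiv v (coeff ab.2 F)) := by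
    intro v C
    rw [mul_comm, coeff_mul]
    simp only [coeff_evJ_eq, coeff_dJetD]
  rw [varJ, map_add, map_sum, map_sum]
  simp only [map_sum, h, coeff_dSer, Fintype.sum_sum_type, Fintype.sum_prod_type,
    sum_add_distrib]
  congr 1
  · rw [sum_comm]; rfl
  · rw [sum_comm' (t' := univ) (s' := fun _ => antidiagonal n) (by simp)]
    refine sum_congr rfl fun k _ => ?_
    rw [sum_comm]; rfl

variable [CharZero 𝕜]

theorem coeff_varJ (A : Fin d → R) (B : Fin d → PowerSeries R) (F : JetSeries d R)
    (hF : HomSeries 0 F) (n : ℕ) :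
    coeff (n + 1) (varJ D A B F) = ∑ ab ∈ antidiagonal n,
      (1 / (ab.2.factorial : 𝕜)) • polar (jetProlong D) (ab.2 + 1) (coeff (ab.2 + 1) F)
        (Fin.cons (fun k => coeff ab.1 (B k)) fun _ => A) := by
  rw [varJ_eq_sum, Finset.Nat.sum_antidiagonal_succ']
  have h0 : coeff 0 F = MvPolynomial.C ((coeff 0 F).coeff 0) :=
    MvPolynomial.totalDegree_eq_zero_iff_eq_C.1 (Nat.le_zero.1 (hF 0).totalDegree_le)
  rw [h0]
  simp only [pderiv_C, map_zero, mul_zero, sum_const_zero, zero_add]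
  refine sum_congr rfl fun ab _ => ?_
  rw [polar_cons_diag _ (hF (ab.2 + 1)), ← cast_smul_eq_nsmul 𝕜, smul_smul,
    one_div_mul_cancel, one_smul]
  exact_mod_cast ab.2.factorial_ne_zero

theorem varJ_gaugeJet_eq_variationMap (f g : R) (A : Fin d → R) (k : Fin d) (m : ℕ) :
    coeff (m + 1) (∑ j, varJ D A (gaugeVariation D γ ϑ Υ f A)
        (gaugeJet (𝕜 := 𝕜) γ ϑ Υ k j) * C (D j g))
      = ∑ ab ∈ antidiagonal m,
        (1 / (ab.1.factorial * ab.2.factorial : 𝕜)) •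
          variationMap D γ ϑ Υ (ab.2 + 1) g
            (Fin.cons (variationMap D γ ϑ Υ ab.1 f fun _ => A) fun _ => A) k := by
  rw [map_sum]
  simp only [coeff_mul_C, coeff_varJ D A _ _ (homSeries_gaugeJet γ ϑ Υ k _),
    sum_mul]
  rw [sum_comm]
  refine sum_congr rfl fun ab _ => ?_
  rw [variationMap_apply, smul_sum]
  refine sum_congr rfl fun j _ => ?_
  have e : (fun k => coeff ab.1 (gaugeVariation D γ ϑ Υ f A k))
      = (1 / (ab.1.factorial : 𝕜)) • variationMap D γ ϑ Υ ab.1 f (fun _ => A) := by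
    funext k
    rw [coeff_gaugeVariation, Pi.smul_apply]
  rw [e, MultilinearMap.cons_smul, smul_smul, smul_mul_assoc, one_div_mul_one_div,
    mul_comm (ab.2.factorial : 𝕜), mul_comm (D j g)]

theorem smul_sum_choose {W : Type} [AddCommGroup W] [Module 𝕜 W] (m : ℕ) (F : ℕ × ℕ → W)
    (h : ∑ ab ∈ antidiagonal m,
      (1 / (ab.1.factorial * ab.2.factorial : 𝕜)) • F ab = 0) :
    ∑ ab ∈ antidiagonal m, m.choose ab.1 • F ab = 0 := by
  have h2 := congrArg (fun w => (m.factorial : 𝕜) • w) h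
  simp only [smul_sum, smul_zero, smul_smul] at h2
  rw [← h2]
  refine sum_congr rfl fun ab hab => ?_
  rw [← cast_smul_eq_nsmul 𝕜]
  congr 1
  have h3 := Finset.HasAntidiagonal.mem_antidiagonal.1 hab
  have h4 : ((ab.1.factorial * ab.2.factorial : ℕ) : 𝕜) ≠ 0 := by
    exact_mod_cast mul_ne_zero ab.1.factorial_ne_zero ab.2.factorial_ne_zero
  push_cast at h4
  rw [mul_one_div, eq_div_iff h4, ← h3, ← Nat.add_choose_mul_factorial_mul_factorial,
    Nat.choose_symm_add]
  push_cast
  ring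

/-- The closure of the gauge variations. -/
theorem variationMap_closure (hϑ : ∀ n i j k, ϑ n j i k = -ϑ n i j k) (hJ : BracketJacobi D γ ϑ)
    (hR : MultiplierRecursion D γ ϑ Υ) (f g : R) (A : Fin d → R) (m : ℕ) :
    ∑ ab ∈ antidiagonal m, m.choose ab.1 •
      (variationMap D γ ϑ Υ (ab.2 + 1) g
          (Fin.cons (variationMap D γ ϑ Υ ab.1 f fun _ => A) fun _ => A)
        - variationMap D γ ϑ Υ (ab.2 + 1) f
          (Fin.cons (variationMap D γ ϑ Υ ab.1 g fun _ => A) fun _ => A)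
        - variationMap D γ ϑ Υ ab.2 (bracketMap D γ ϑ Υ ab.1 f g fun _ => A) fun _ => A) = 0 := by
  refine smul_sum_choose (𝕜 := 𝕜) m _ ?_
  funext k
  have h := congrArg (coeff (m + 1)) (gauge_closure D γ ϑ Υ hϑ hJ A hR f g k)
  rw [map_sub, varJ_gaugeJet_eq_variationMap, varJ_gaugeJet_eq_variationMap, map_sum] at h
  have h2 : ∀ j, coeff (m + 1)
      (evJ D A (gaugeJet (𝕜 := 𝕜) γ ϑ Υ k j) * dSer D j (gaugeBracket D γ ϑ Υ f g A))
      = ∑ ab ∈ antidiagonal m,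
        (1 / (ab.1.factorial * ab.2.factorial : 𝕜)) •
          (D j (bracketMap D γ ϑ Υ ab.1 f g fun _ => A) * polar (jetProlong D) ab.2
            (coeff ab.2 (gaugeJet (𝕜 := 𝕜) γ ϑ Υ k j)) fun _ => A) := by
    intro j
    rw [mul_comm, coeff_mul, Finset.Nat.sum_antidiagonal_succ, coeff_dSer,
      coeff_gaugeBracket_zero, map_zero, zero_mul, zero_add]
    refine sum_congr rfl fun ab _ => ?_
    have h3 := homSeries_gaugeJet (𝕜 := 𝕜) γ ϑ Υ k j ab.2
    rw [add_zero] at h3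
    rw [coeff_dSer, coeff_gaugeBracket, polar_diag _ h3, coeff_evJ_eq, (D j).map_smul,
      ← cast_smul_eq_nsmul 𝕜, mul_smul_comm, smul_smul, smul_mul_assoc]
    congr 1
    have := (Nat.cast_ne_zero (R := 𝕜)).2 ab.2.factorial_ne_zero
    field_simp
  simp only [h2] at h
  rw [sum_comm] at h
  simp only [Finset.sum_apply, Pi.smul_apply, Pi.sub_apply, Pi.zero_apply, smul_sub,
    sum_sub_distrib]
  rw [h, sub_eq_zero]
  refine sum_congr rfl fun ab _ => ?_
  rw [variationMap_apply, smul_sum]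

/-- The Jacobi identity for the field dependent bracket of gauge parameters. -/
theorem bracketMap_jacobi (hϑ : ∀ n i j k, ϑ n j i k = -ϑ n i j k) (hJ : BracketJacobi D γ ϑ)
    (hR : MultiplierRecursion D γ ϑ Υ) (f g h : R) (A : Fin d → R) (m : ℕ) :
    let nest := fun (ab : ℕ × ℕ) (f g h : R) =>
      bracketMap D γ ϑ Υ ab.2 f (bracketMap D γ ϑ Υ ab.1 g h fun _ => A) (fun _ => A)
        + bracketMap D γ ϑ Υ (ab.2 + 1) g h
          (Fin.cons (variationMap D γ ϑ Υ ab.1 f fun _ => A) fun _ => A)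
    ∑ ab ∈ antidiagonal m,
      m.choose ab.1 • (nest ab h f g + nest ab f g h + nest ab g h f) = 0 := by
  intro nest
  refine smul_sum_choose (𝕜 := 𝕜) m _ ?_
  have key : ∀ f g h : R, coeff (m + 2)
      (∑ i, ∑ j, evJ D A (bracketJet (𝕜 := 𝕜) γ ϑ Υ i j) * C (D i f)
          * dSer D j (gaugeBracket D γ ϑ Υ g h A)
        + ∑ i, ∑ j, varJ D A (gaugeVariation D γ ϑ Υ f A) (bracketJet (𝕜 := 𝕜) γ ϑ Υ i j)
          * C (D i g) * C (D j h))
      = ∑ ab ∈ antidiagonal m,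
        (1 / (ab.1.factorial * ab.2.factorial : 𝕜)) • nest ab f g h := by
    intro f g h
    simp only [nest, smul_add, sum_add_distrib]
    rw [map_add]
    congr 1
    · have e : ∀ i j, coeff (m + 2)
          (evJ D A (bracketJet (𝕜 := 𝕜) γ ϑ Υ i j) * C (D i f)
            * dSer D j (gaugeBracket D γ ϑ Υ g h A))
          = ∑ ab ∈ antidiagonal m,
            (1 / (ab.1.factorial * ab.2.factorial : 𝕜)) •
              (D i f * D j (bracketMap D γ ϑ Υ ab.1 g h fun _ => A) * polar (jetProlong D) ab.2
                (coeff ab.2 (bracketJet₀ 𝕜 γ ϑ Υ i j)) fun _ => A) := by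
        intro i j
        rw [bracketJet_eq, (evJ D A).map_mul, evJ_X, mul_assoc, mul_assoc,
          coeff_succ_X_mul, mul_comm (C _), ← mul_assoc,
          mul_comm (evJ D A _), coeff_mul_C, coeff_mul, Finset.Nat.sum_antidiagonal_succ, coeff_dSer,
          coeff_gaugeBracket_zero, map_zero, zero_mul, zero_add, sum_mul]
        refine sum_congr rfl fun ab _ => ?_
        have h3 := homSeries_bracketJet₀ (𝕜 := 𝕜) γ ϑ Υ i j ab.2
        rw [add_zero] at h3
        rw [coeff_dSer, coeff_gaugeBracket, polar_diag _ h3, coeff_evJ_eq, (D j).map_smul,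
          ← cast_smul_eq_nsmul 𝕜, mul_smul_comm, smul_smul, smul_mul_assoc, smul_mul_assoc]
        have := (Nat.cast_ne_zero (R := 𝕜)).2 ab.2.factorial_ne_zero
        congr 1
        · field_simp
        · ring
      simp only [map_sum, e]
      rw [sum_comm' (t' := univ) (s' := fun _ => univ) (by simp),
        sum_congr rfl fun j _ => sum_comm, sum_comm]
      refine sum_congr rfl fun ab _ => ?_
      rw [bracketMap_apply D γ ϑ Υ ab.2 f, smul_sum, sum_comm]
      simp only [smul_sum]
    · have e : ∀ i j, coeff (m + 2)
          (varJ D A (gaugeVariation D γ ϑ Υ f A) (bracketJet (𝕜 := 𝕜) γ ϑ Υ i j)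
            * C (D i g) * C (D j h))
          = ∑ ab ∈ antidiagonal m,
            (1 / (ab.1.factorial * ab.2.factorial : 𝕜)) •
              (D i g * D j h * polar (jetProlong D) (ab.2 + 1)
                (coeff (ab.2 + 1) (bracketJet₀ 𝕜 γ ϑ Υ i j))
                (Fin.cons (variationMap D γ ϑ Υ ab.1 f fun _ => A) fun _ => A)) := by
        intro i j
        rw [bracketJet_eq, varJ_mul, varJ_X, mul_zero, add_zero, evJ_X,
          coeff_mul_C, coeff_mul_C, coeff_succ_X_mul,
          coeff_varJ D A _ _ (homSeries_bracketJet₀ γ ϑ Υ i j), sum_mul, sum_mul]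
        refine sum_congr rfl fun ab _ => ?_
        have e : (fun k => coeff ab.1 (gaugeVariation D γ ϑ Υ f A k))
            = (1 / (ab.1.factorial : 𝕜)) • variationMap D γ ϑ Υ ab.1 f (fun _ => A) := by
          funext k
          rw [coeff_gaugeVariation, Pi.smul_apply]
        rw [e, MultilinearMap.cons_smul, smul_smul, smul_mul_assoc, smul_mul_assoc,
          one_div_mul_one_div, mul_comm (ab.2.factorial : 𝕜)]
        congr 1
        ring
      simp only [map_sum, e]
      rw [sum_congr rfl fun j _ => sum_comm, sum_comm]
      refine sum_congr rfl fun ab _ => ?_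
      rw [bracketMap_apply D γ ϑ Υ (ab.2 + 1), smul_sum]
      simp only [smul_sum]
  have h1 := congrArg (coeff (m + 2)) (gauge_jacobi D γ ϑ Υ hϑ hJ A hR f g h)
  rw [map_zero, map_add, map_add, key, key, key] at h1
  rw [← h1, ← sum_add_distrib, ← sum_add_distrib]
  exact sum_congr rfl fun ab _ => by rw [smul_add, smul_add]

end GaugeMaps

/-! ## Koszul signs -/

section Signs

variable {𝕜 : Type} [Field 𝕜]

theorem sgn_add (a b : ℤ) : sgn 𝕜 (a + b) = sgn 𝕜 a * sgn 𝕜 b := by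
  simp [sgn, Int.negOnePow_add]

theorem sgn_congr {a b : ℤ} (h : Even (a - b)) : sgn 𝕜 a = sgn 𝕜 b := by
  rw [sgn, sgn, (Int.negOnePow_eq_iff a b).2 h]

theorem sgn_zero : sgn 𝕜 0 = 1 := by simp [sgn]

theorem sgn_one : sgn 𝕜 1 = -1 := by simp [sgn]

theorem sgn_mul_self (a : ℤ) : sgn 𝕜 a * sgn 𝕜 a = 1 := by
  rw [← sgn_add, ← sgn_zero]
  exact sgn_congr (by simp)

theorem sgn_smul_sgn_smul {W : Type} [AddCommGroup W] [Module 𝕜 W] (a : ℤ) (w : W) :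
    sgn 𝕜 a • sgn 𝕜 a • w = w := by
  rw [smul_smul, sgn_mul_self, one_smul]

theorem koszulSign_eq {n : ℕ} (a : Fin n → ℤ) (σ : Perm (Fin n)) :
    koszulSign 𝕜 a σ
      = ∏ x, ∏ y, if y < x ∧ σ.symm x < σ.symm y then sgn 𝕜 (a x * a y) else 1 := by
  exact Fintype.prod_equiv σ _ _ fun i => Fintype.prod_equiv σ _ _ fun j => by simp [and_comm]

theorem koszulSign_one {n : ℕ} (a : Fin n → ℤ) : koszulSign 𝕜 a 1 = 1 := by
  refine prod_eq_one fun i _ => prod_eq_one fun j _ => if_neg ?_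
  rintro ⟨h1, h2⟩
  exact absurd h1 (not_lt.2 h2.le)

theorem swap_lt_swap {n : ℕ} {i j : Fin n} (h : (i : ℕ) + 1 = j) (u w : Fin n)
    (hne : ¬((u = i ∧ w = j) ∨ (u = j ∧ w = i))) :
    swap i j u < swap i j w ↔ u < w := by
  simp only [Equiv.swap_apply_def, Fin.ext_iff] at *
  split_ifs <;> simp only [lt_def] <;> omega

theorem koszulSign_mul_swap {n : ℕ} (a : Fin n → ℤ) (τ : Perm (Fin n)) {i j : Fin n}
    (h : (i : ℕ) + 1 = j) :
    koszulSign 𝕜 a (τ * swap i j) = sgn 𝕜 (a (τ i) * a (τ j)) * koszulSign 𝕜 a τ := by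
  have hij : i ≠ j := fun e => by subst e; omega
  have hτ : τ i ≠ τ j := fun e => hij (τ.injective e)
  have key : ∀ x y, (if y < x ∧ (τ * swap i j).symm x < (τ * swap i j).symm y
        then sgn 𝕜 (a x * a y) else 1)
      = (if y < x ∧ ((x = τ i ∧ y = τ j) ∨ (x = τ j ∧ y = τ i)) then sgn 𝕜 (a x * a y) else 1)
        * (if y < x ∧ τ.symm x < τ.symm y then sgn 𝕜 (a x * a y) else 1) := by
    intro x y
    have e : ∀ z, (τ * swap i j).symm z = swap i j (τ.symm z) := fun z => rfl
    rw [e, e]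
    by_cases hyx : y < x
    · simp only [hyx, true_and]
      by_cases hc : (x = τ i ∧ y = τ j) ∨ (x = τ j ∧ y = τ i)
      · rw [if_pos hc]
        have hlt : i < j := by rw [lt_def]; omega
        rcases hc with ⟨rfl, rfl⟩ | ⟨rfl, rfl⟩
        · simp [hlt, hlt.le, sgn_mul_self]
        · simp [hlt, hlt.le]
      · rw [if_neg hc, one_mul]
        simp only [swap_lt_swap h (τ.symm x) (τ.symm y)
          (by simpa only [Equiv.symm_apply_eq] using hc)]
    · simp [hyx]
  rw [koszulSign_eq, koszulSign_eq]
  simp only [key, Finset.prod_mul_distrib]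
  congr 1
  have single : ∀ p q : Fin n, q < p → p = τ i ∧ q = τ j ∨ p = τ j ∧ q = τ i →
      ∏ x, ∏ y, (if y < x ∧ ((x = τ i ∧ y = τ j) ∨ (x = τ j ∧ y = τ i))
        then sgn 𝕜 (a x * a y) else 1) = sgn 𝕜 (a p * a q) := by
    intro p q hqp hc
    rw [Fintype.prod_eq_single p, Fintype.prod_eq_single q, if_pos ⟨hqp, hc⟩]
    · intro y hy
      refine if_neg ?_
      rintro ⟨h1, h2⟩
      rcases h2 with ⟨rfl, rfl⟩ | ⟨rfl, rfl⟩ <;> rcases hc with ⟨h3, rfl⟩ | ⟨h3, rfl⟩ <;>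
        first | exact hy rfl | exact hτ h3 | exact hτ h3.symm
    · intro x hx
      refine prod_eq_one fun y _ => if_neg ?_
      rintro ⟨h1, h2⟩
      rcases h2 with ⟨rfl, rfl⟩ | ⟨rfl, rfl⟩ <;> rcases hc with ⟨rfl, rfl⟩ | ⟨rfl, rfl⟩ <;>
        first | exact hx rfl | exact lt_asymm h1 hqp
  rcases lt_or_gt_of_ne hτ with hlt | hlt
  · rw [single _ _ hlt (Or.inr ⟨rfl, rfl⟩), mul_comm (a (τ i))]
  · exact single _ _ hlt (Or.inl ⟨rfl, rfl⟩)

theorem sum_decalage_swap {n : ℕ} (b : Fin n → ℤ) {i j : Fin n} (h : (i : ℕ) + 1 = j) :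
    ∑ k : Fin n, ((n : ℤ) - 1 - k) * b (swap i j k)
      = ∑ k : Fin n, ((n : ℤ) - 1 - k) * b k + (b j - b i) := by
  have hij : i ≠ j := fun e => by subst e; omega
  rw [← Equiv.sum_comp (swap i j)]
  simp only [Equiv.swap_apply_self]
  have e : ∀ k : Fin n, ((n : ℤ) - 1 - (swap i j k : Fin n)) * b k
      = ((n : ℤ) - 1 - k) * b k + ((if k = j then b k else 0) - if k = i then b k else 0) := by
    intro k
    rw [Equiv.swap_apply_def]
    by_cases h1 : k = i
    · subst h1
      rw [if_pos rfl, if_neg hij, if_pos rfl, ← h]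
      push_cast
      ring
    · by_cases h2 : k = j
      · subst h2
        rw [if_neg h1, if_pos rfl, if_pos rfl, if_neg h1, ← h]
        push_cast
        ring
      · rw [if_neg h1, if_neg h2, if_neg h2, if_neg h1]
        ring
  simp only [e, sum_add_distrib, sum_sub_distrib]
  simp

theorem sign_mul_koszulSign {n : ℕ} (a : Fin n → ℤ) (σ : Perm (Fin n)) :
    ((Equiv.Perm.sign σ : ℤ) : 𝕜) * koszulSign 𝕜 a σ
        * sgn 𝕜 (∑ k : Fin n, ((n : ℤ) - 1 - k) * a (σ k))
      = koszulSign 𝕜 (fun i => a i - 1) σ * sgn 𝕜 (∑ k : Fin n, ((n : ℤ) - 1 - k) * a k) := by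
  induction σ using perm_induction_adjacent with
  | one => simp [koszulSign_one]
  | step τ i j h ih =>
    have hij : i ≠ j := fun e => by subst e; omega
    have e := sum_decalage_swap (fun k => a (τ k)) h
    rw [koszulSign_mul_swap _ _ h, koszulSign_mul_swap _ _ h, Equiv.Perm.sign_mul,
      Equiv.Perm.sign_swap hij]
    simp only [Equiv.Perm.coe_mul, Function.comp_apply]
    rw [e, sgn_add, mul_assoc _ (koszulSign 𝕜 (fun i => a i - 1) τ), ← ih]
    have e2 : sgn 𝕜 ((a (τ i) - 1) * (a (τ j) - 1))
        = -(sgn 𝕜 (a (τ i) * a (τ j)) * sgn 𝕜 (a (τ j) - a (τ i))) := by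
      rw [← sgn_add, neg_eq_neg_one_mul, ← sgn_one, ← sgn_add]
      exact sgn_congr ⟨-a (τ j), by ring⟩
    rw [e2]
    push_cast
    ring

theorem koszulSign_of_fixed {n : ℕ} (a : Fin n → ℤ) (τ σ : Perm (Fin n))
    (hτ : ∀ x, a x ≠ 0 → τ x = x) : koszulSign 𝕜 a (τ * σ) = koszulSign 𝕜 a σ := by
  rw [koszulSign_eq, koszulSign_eq]
  refine prod_congr rfl fun x _ => prod_congr rfl fun y _ => ?_
  by_cases hx : a x = 0
  · simp [hx, sgn_zero]
  · by_cases hy : a y = 0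
    · simp [hy, sgn_zero]
    · have e : ∀ z, a z ≠ 0 → (τ * σ).symm z = σ.symm z := by
        intro z hz
        change σ.symm (τ.symm z) = _
        rw [τ.symm_apply_eq.2 (hτ z hz).symm]
      rw [e x hx, e y hy]

end Signs

/-! ## Décalage -/

section Decalage

variable {𝕜 V W : Type} [Field 𝕜] [AddCommGroup V] [Module 𝕜 V] [AddCommGroup W] [Module 𝕜 W]

theorem decalage_perm {𝒱 : ℤ → Submodule 𝕜 V} {n : ℕ} (φ : MultilinearMap 𝕜 (fun _ : Fin n => V) W)
    (hskew : ∀ (a : Fin n → ℤ) (v : Fin n → V), (∀ i, v i ∈ 𝒱 (a i)) →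
      ∀ i j : Fin n, (i : ℕ) + 1 = j → φ (v ∘ swap i j) = -(sgn 𝕜 (a i * a j) • φ v))
    (a : Fin n → ℤ) (v : Fin n → V) (hv : ∀ i, v i ∈ 𝒱 (a i)) (σ : Perm (Fin n)) :
    decalage φ (fun i => a (σ i)) (fun i => v (σ i))
      = koszulSign 𝕜 (fun i => a i - 1) σ • decalage φ a v := by
  induction σ using perm_induction_adjacent with
  | one => simp [koszulSign_one]
  | step τ i j h ih =>
    have e := hskew (fun k => a (τ k)) (fun k => v (τ k)) (fun k => hv _) i j h
    rw [koszulSign_mul_swap _ _ h, mul_smul, ← ih]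
    simp only [Equiv.Perm.coe_mul, Function.comp_apply, decalage]
    rw [sum_decalage_swap (fun k => a (τ k)) h, sgn_add]
    change _ • φ ((fun k => v (τ k)) ∘ swap i j) = _
    rw [e, smul_neg, smul_smul, smul_smul, ← neg_smul]
    congr 1
    have e2 : sgn 𝕜 ((a (τ i) - 1) * (a (τ j) - 1))
        = -(sgn 𝕜 (a (τ i) * a (τ j)) * sgn 𝕜 (a (τ j) - a (τ i))) := by
      rw [← sgn_add, neg_eq_neg_one_mul, ← sgn_one, ← sgn_add]
      exact sgn_congr ⟨-a (τ j), by ring⟩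
    rw [e2]
    ring

end Decalage

/-! ## Polarization of symmetric multilinear maps -/

section SymmetricMultilinear

variable {𝕜 V W : Type} [Field 𝕜] [AddCommGroup V] [Module 𝕜 V] [AddCommGroup W] [Module 𝕜 W]

theorem sum_superset_neg_one_pow {ι : Type} [Fintype ι] [DecidableEq ι] (s : Finset ι)
    (hs : s ≠ univ) :
    ∑ S : Finset ι, (if s ⊆ S then (-1 : ℤ) ^ S.card else 0) = 0 := by
  obtain ⟨j, hj⟩ : ∃ j, j ∉ s := by
    by_contra! h
    exact hs (Finset.eq_univ_iff_forall.2 h)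
  refine Finset.sum_involution (fun S _ => if j ∈ S then S.erase j else insert j S) ?_ ?_ ?_ ?_
  · intro S _
    by_cases h : j ∈ S
    · have e : s ⊆ S.erase j ↔ s ⊆ S :=
        ⟨fun h1 => h1.trans (Finset.erase_subset _ _), fun h1 x hx =>
          Finset.mem_erase.2 ⟨fun e => hj (e ▸ hx), h1 hx⟩⟩
      simp only [h, if_true, e]
      split_ifs
      · rw [← Finset.card_erase_add_one h, pow_succ]; ring
      · simp
    · have e : s ⊆ insert j S ↔ s ⊆ S := Finset.subset_insert_iff_of_notMem hj
      simp only [h, if_false, e]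
      split_ifs
      · rw [card_insert_of_notMem h, pow_succ]; ring
      · simp
  · intro S _ _
    by_cases h : j ∈ S
    · simp only [h, if_true]
      exact fun e => absurd h (e ▸ notMem_erase j S)
    · simp only [h, if_false]
      exact fun e => h (e ▸ mem_insert_self j S)
  · simp
  · intro S _
    by_cases h : j ∈ S
    · simp [h]
    · simp [h]

/-- A symmetric multilinear map in characteristic zero is determined by its values on the
diagonal. -/
theorem multilinear_eq_zero_of_diag [CharZero 𝕜] {ι : Type} [Fintype ι]
    (F : MultilinearMap 𝕜 (fun _ : ι => V) W)
    (hsymm : ∀ (x : ι → V) (ρ : Perm ι), F (x ∘ ρ) = F x) (hdiag : ∀ x, F (fun _ => x) = 0) :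
    F = 0 := by
  classical
  ext v
  have h1 : ∀ S : Finset ι, ∑ r : ι → ι, (if univ.image r ⊆ S then F (v ∘ r) else 0) = 0 := by
    intro S
    rw [← sum_filter, ← hdiag (∑ j ∈ S, v j), MultilinearMap.map_sum_finset]
    refine sum_congr ?_ fun r _ => rfl
    ext r
    simp [Finset.image_subset_iff]
  have h2 : ∑ S : Finset ι, (-1 : ℤ) ^ S.card •
      ∑ r : ι → ι, (if univ.image r ⊆ S then F (v ∘ r) else 0) = 0 := by
    simp [h1]
  simp only [smul_sum] at h2
  rw [sum_comm] at h2
  have h3 : ∀ r : ι → ι, ∑ S : Finset ι, (-1 : ℤ) ^ S.card •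
      (if univ.image r ⊆ S then F (v ∘ r) else 0)
      = if r.Bijective then (-1 : ℤ) ^ Fintype.card ι • F (v ∘ r) else 0 := by
    intro r
    have e : ∀ S : Finset ι, (-1 : ℤ) ^ S.card •
        (if univ.image r ⊆ S then F (v ∘ r) else 0)
        = (if univ.image r ⊆ S then (-1 : ℤ) ^ S.card else 0) • F (v ∘ r) := by
      intro S
      split_ifs <;> simp
    simp only [e, ← sum_smul]
    have hb : r.Bijective ↔ univ.image r = univ := by
      rw [← Finset.coe_eq_univ, Finset.coe_image, Finset.coe_univ, Set.image_univ,
        Set.range_eq_univ]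
      exact ⟨fun h => h.2, fun h => h.bijective_of_finite⟩
    split_ifs with h
    · rw [hb.1 h, sum_eq_single univ]
      · simp
      · intro S _ hS
        rw [if_neg]
        rwa [Finset.univ_subset_iff]
      · simp
    · rw [sum_superset_neg_one_pow _ (fun e => h (hb.2 e)), zero_smul]
  simp only [h3] at h2
  rw [← sum_filter] at h2
  have h4 : ∑ r ∈ univ.filter (fun r : ι → ι => r.Bijective),
      (-1 : ℤ) ^ Fintype.card ι • F (v ∘ r)
      = ∑ ρ : Perm ι, (-1 : ℤ) ^ Fintype.card ι • F v := by
    refine Finset.sum_bij (fun r h => Equiv.ofBijective r (mem_filter.1 h).2)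
      (fun _ _ => mem_univ _) ?_ ?_ ?_
    · intro r _ r' _ h
      exact congrArg (fun e : Perm ι => (e : ι → ι)) h
    · intro ρ _
      exact ⟨ρ, by simp, Equiv.ext fun _ => rfl⟩
    · intro r hr
      rw [← hsymm v (Equiv.ofBijective r (mem_filter.1 hr).2)]
      rfl
  rw [h4, sum_const, card_univ, Fintype.card_perm, ← Int.cast_smul_eq_zsmul 𝕜,
    ← cast_smul_eq_nsmul 𝕜, smul_smul] at h2
  refine (smul_eq_zero.1 h2).resolve_left (mul_ne_zero ?_ ?_)
  · exact_mod_cast (Fintype.card ι).factorial_ne_zero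
  · push_cast
    exact pow_ne_zero _ (by simp)

end SymmetricMultilinear

/-! ## Sums over permutations -/

section PermSums

variable {W : Type} [AddCommGroup W] {n : ℕ}

theorem card_perm_prefix (S : Finset (Fin n)) :
    (univ.filter fun σ : Perm (Fin n) =>
      (univ.filter fun x => (σ.symm x : ℕ) < S.card) = S).card
      = S.card.factorial * (n - S.card).factorial := by
  have h := Numbering.card_prefixed S
  rw [Fintype.card_fin] at h
  rw [← h]
  refine card_bij (fun σ _ => σ.symm.trans (finCongr (Fintype.card_fin n).symm)) ?_ ?_ ?_
  · intro σ hσ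
    rw [Numbering.mem_prefixed]
    intro x
    conv_lhs => rw [← (mem_filter.1 hσ).2]
    simp
  · intro σ _ τ _ e
    refine Equiv.symm_bijective.injective (Equiv.ext fun x => ?_)
    have := congrArg (fun g => ((g x : Fin (Fintype.card (Fin n))) : ℕ)) e
    exact Fin.ext (by simpa using this)
  · intro f hf
    refine ⟨(f.trans (finCongr (Fintype.card_fin n))).symm, ?_, ?_⟩
    · rw [mem_filter]
      refine ⟨mem_univ _, ?_⟩
      ext x
      have := (Numbering.mem_prefixed.1 hf) x
      simp [this]
    · ext x
      simp

theorem card_filter_symm_lt (σ : Perm (Fin n)) {k : ℕ} (hk : k ≤ n) :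
    (univ.filter fun x => (σ.symm x : ℕ) < k).card = k := by
  have h : (univ.filter fun x => (σ.symm x : ℕ) < k)
      = (univ.filter fun i : Fin n => (i : ℕ) < k).map σ.toEmbedding := by
    ext x
    simp only [mem_filter, mem_univ, true_and, Finset.mem_map_equiv]
  rw [h, Finset.card_map, Fin.card_filter_val_lt, min_eq_right hk]

/-- A sum over permutations of a function of the set of the first `k` entries. -/
theorem sum_perm_prefix (F : Finset (Fin n) → W) {k : ℕ} (hk : k ≤ n) :
    ∑ σ : Perm (Fin n), F (univ.filter fun x => (σ.symm x : ℕ) < k)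
      = (k.factorial * (n - k).factorial) • ∑ S ∈ powersetCard k univ, F S := by
  rw [← sum_fiberwise_of_maps_to (t := powersetCard k univ)
    (g := fun σ : Perm (Fin n) => univ.filter fun x => (σ.symm x : ℕ) < k)
    (fun σ _ => Finset.mem_powersetCard.2 ⟨subset_univ _, card_filter_symm_lt σ hk⟩),
    smul_sum]
  refine sum_congr rfl fun S hS => ?_
  obtain rfl := (Finset.mem_powersetCard.1 hS).2
  rw [← card_perm_prefix S, ← sum_const]
  refine sum_congr rfl fun σ hσ => ?_
  rw [(mem_filter.1 hσ).2]

theorem card_perm_extending {α ι : Type} [Fintype α] [DecidableEq α] [Fintype ι] {x e : ι → α}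
    (hx : x.Injective) (he : e.Injective) :
    (univ.filter fun σ : Perm α => ∀ i, σ (x i) = e i).card
      = (Fintype.card α - Fintype.card ι).factorial := by
  classical
  obtain ⟨τ, hτ⟩ : ∃ τ : Perm α, ∀ i, τ (x i) = e i := by
    let g : {a // a ∈ Set.range x} ≃ {a // a ∈ Set.range e} :=
      (Equiv.ofInjective x hx).symm.trans (Equiv.ofInjective e he)
    refine ⟨g.extendSubtype, fun i => ?_⟩
    rw [Equiv.extendSubtype_apply_of_mem g _ ⟨i, rfl⟩]
    simp only [g, Equiv.trans_apply]
    rw [Equiv.ofInjective_symm_apply]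
    rfl
  have h1 : (univ.filter fun σ : Perm α => ∀ i, σ (x i) = e i).card
      = (univ.filter fun ρ : Perm α =>
          ∀ a, ¬(a ∉ Set.range x) → ρ a = a).card := by
    refine card_bij (fun σ _ => τ⁻¹ * σ) ?_ ?_ ?_
    · intro σ hσ
      simp only [mem_filter, mem_univ, true_and, not_not] at hσ ⊢
      rintro _ ⟨i, rfl⟩
      rw [Equiv.Perm.mul_apply, hσ, ← hτ, Equiv.Perm.inv_def, Equiv.symm_apply_apply]
    · intro σ _ σ' _ h
      exact mul_left_cancel h
    · intro ρ hρ
      simp only [mem_filter, mem_univ, true_and, not_not] at hρ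
      refine ⟨τ * ρ, ?_, by simp⟩
      simp only [mem_filter, mem_univ, true_and]
      intro i
      rw [Equiv.Perm.mul_apply, hρ _ ⟨i, rfl⟩, hτ]
  rw [h1, ← Fintype.card_subtype,
    ← Fintype.card_congr (Equiv.Perm.subtypeEquivSubtypePerm fun a => a ∉ Set.range x),
    Fintype.card_perm, Fintype.card_subtype_compl]
  congr 2
  exact (Fintype.card_congr (Equiv.ofInjective x hx)).symm

theorem sum_perm_apply (x : Fin n) (K : Fin n → W) :
    ∑ σ : Perm (Fin n), K (σ.symm x) = (n - 1).factorial • ∑ s, K s := by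
  rw [← Equiv.sum_comp (Equiv.inv (Perm (Fin n)))]
  change ∑ σ : Perm (Fin n), K (σ x) = _
  rw [← sum_fiberwise_of_maps_to (t := univ)
    (g := fun σ : Perm (Fin n) => σ x) (fun _ _ => mem_univ _), smul_sum]
  refine sum_congr rfl fun s _ => ?_
  have h := card_perm_extending (α := Fin n) (ι := Unit) (x := fun _ => x) (e := fun _ => s)
    (fun _ _ _ => rfl) (fun _ _ _ => rfl)
  simp only [forall_const, Fintype.card_fin, Fintype.card_unit] at h
  rw [← h, ← sum_const]
  refine sum_congr rfl fun σ hσ => ?_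
  rw [(mem_filter.1 hσ).2]

theorem sum_perm_apply₂ {x y : Fin n} (hxy : x ≠ y) (K : Fin n → Fin n → W) :
    ∑ σ : Perm (Fin n), K (σ.symm x) (σ.symm y)
      = (n - 2).factorial • ∑ s, ∑ t, if s ≠ t then K s t else 0 := by
  rw [← Equiv.sum_comp (Equiv.inv (Perm (Fin n)))]
  change ∑ σ : Perm (Fin n), K (σ x) (σ y) = _
  rw [← sum_fiberwise_of_maps_to (t := univ)
    (g := fun σ : Perm (Fin n) => (σ x, σ y)) (fun _ _ => mem_univ _),
    ← Fintype.sum_prod_type', smul_sum]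
  refine sum_congr rfl fun st _ => ?_
  split_ifs with hst
  · have h := card_perm_extending (α := Fin n) (ι := Fin 2) (x := ![x, y]) (e := ![st.1, st.2])
      (by intro i j; fin_cases i <;> fin_cases j <;> simp [hxy, hxy.symm])
      (by intro i j; fin_cases i <;> fin_cases j <;> simp [hst, hst.symm])
    simp only [Fin.forall_fin_two, Fintype.card_fin,
      Matrix.cons_val_zero, Matrix.cons_val_one] at h
    rw [← h, ← sum_const]
    have e : ∀ σ : Perm (Fin n), (σ x, σ y) = st ↔ σ x = st.1 ∧ σ y = st.2 :=
      fun σ => Prod.ext_iff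
    simp only [e]
    refine sum_congr rfl fun σ hσ => ?_
    rw [(mem_filter.1 hσ).2.1, (mem_filter.1 hσ).2.2]
  · rw [smul_zero]
    refine sum_eq_zero fun σ hσ => ?_
    have h := (mem_filter.1 hσ).2
    refine absurd (fun e => hxy (σ.injective ?_)) hst
    rw [← h] at e
    exact e

end PermSums

/-! ## Graded alternating sums -/

section Alternation

variable {𝕜 R M W : Type} [Field 𝕜] [AddCommGroup R] [Module 𝕜 R] [AddCommGroup M] [Module 𝕜 M]
  [AddCommGroup W] [Module 𝕜 W] {n : ℕ}
  (G : (Fin n → ℤ) → MultilinearMap 𝕜 (fun _ : Fin n => R × M) W)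

/-- The graded symmetrization of `G`, for the degrees shifted by one. -/
def altMap (a : Fin n → ℤ) : MultilinearMap 𝕜 (fun _ : Fin n => R × M) W :=
  ∑ σ : Perm (Fin n), koszulSign 𝕜 (fun i => a i - 1) σ •
    (G fun i => a (σ i)).domDomCongr σ

theorem altMap_apply (a : Fin n → ℤ) (v : Fin n → R × M) :
    altMap G a v = ∑ σ : Perm (Fin n), koszulSign 𝕜 (fun i => a i - 1) σ •
      G (fun i => a (σ i)) (fun i => v (σ i)) := by
  simp [altMap]

theorem altMap_perm (a : Fin n → ℤ) (v : Fin n → R × M) (τ : Perm (Fin n))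
    (hτ : ∀ x, a x ≠ 1 → τ x = x) : altMap G a (fun i => v (τ i)) = altMap G a v := by
  have ha : ∀ x, a (τ x) = a x := by
    intro x
    by_cases h : a x = 1
    · by_contra h2
      have h3 := hτ (τ x) (by rwa [h] at h2)
      rw [τ.injective h3] at h2
      exact h2 rfl
    · rw [hτ x h]
  rw [altMap_apply, altMap_apply]
  conv_rhs => rw [← Equiv.sum_comp (Equiv.mulLeft τ)]
  refine sum_congr rfl fun σ _ => ?_
  simp only [Equiv.coe_mulLeft, Equiv.Perm.coe_mul, Function.comp_apply, ha]
  rw [koszulSign_of_fixed _ τ σ fun x hx => hτ x fun e => hx (by rw [e, sub_self])]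

theorem altMap_eq_zero_of_diag [CharZero 𝕜] (a : Fin n → ℤ)
    (hdiag : ∀ (f : Fin n → R) (A : M),
      altMap G a (fun i => if a i = 1 then (0, A) else (f i, 0)) = 0)
    (f : Fin n → R) (B : Fin n → M) :
    altMap G a (fun i => if a i = 1 then (0, B i) else (f i, 0)) = 0 := by
  let F : MultilinearMap 𝕜 (fun _ : {i // a i = 1} => M) W :=
    ((altMap G a).domDomRestrict (fun i => a i = 1) fun i => (f i, 0)).compLinearMap
      fun _ => LinearMap.inr 𝕜 R M
  have hF : ∀ x : {i // a i = 1} → M, F x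
      = altMap G a (fun i => if h : a i = 1 then (0, x ⟨i, h⟩) else (f i, 0)) := fun x => rfl
  have h0 : F = 0 := by
    refine multilinear_eq_zero_of_diag F (fun x ρ => ?_) fun x => ?_
    · rw [hF, hF]
      conv_rhs => rw [← altMap_perm G a _ (Equiv.Perm.ofSubtype ρ)
        fun y hy => Equiv.Perm.ofSubtype_apply_of_not_mem ρ hy]
      congr 1
      funext i
      by_cases h : a i = 1
      · have e : Equiv.Perm.ofSubtype ρ i = ρ ⟨i, h⟩ := Equiv.Perm.ofSubtype_apply_of_mem ρ h
        rw [dif_pos h, dif_pos (by rw [e]; exact (ρ ⟨i, h⟩).2)]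
        simp [e]
      · have e : Equiv.Perm.ofSubtype ρ i = i := Equiv.Perm.ofSubtype_apply_of_not_mem ρ h
        rw [dif_neg h, dif_neg (by rwa [e]), e]
    · rw [hF]
      simpa using hdiag f x
  have h1 := hF fun i => B i
  rw [h0] at h1
  simpa using h1.symm

end Alternation

/-! ## Graded skew-symmetric maps on `C^∞(U) ⊕ Ω¹(U)` -/

section FormGrading

theorem mem_formGrading {k : ℤ} {v : R × (Fin d → R)} :
    v ∈ formGrading 𝕜 d R k ↔ (k ≠ 0 → v.1 = 0) ∧ (k ≠ 1 → v.2 = 0) := by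
  rw [formGrading]
  split_ifs with h0 h1
  · subst h0; simp [Submodule.mem_prod]
  · subst h1; simp [Submodule.mem_prod]
  · simp [h0, h1, Prod.ext_iff]

theorem formGrading_eq_zero {k : ℤ} {v : R × (Fin d → R)} (hv : v ∈ formGrading 𝕜 d R k)
    (h0 : k ≠ 0) (h1 : k ≠ 1) : v = 0 :=
  Prod.ext ((mem_formGrading.1 hv).1 h0) ((mem_formGrading.1 hv).2 h1)

/-- The projection onto the component of degree `0` (for `false`) or `1` (for `true`). -/
def degreeProj (𝕜 R : Type) (d : ℕ) [Field 𝕜] [CommRing R] [Algebra 𝕜 R] :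
    Bool → (R × (Fin d → R)) →ₗ[𝕜] R × (Fin d → R)
  | false => LinearMap.inl 𝕜 R (Fin d → R) ∘ₗ LinearMap.fst 𝕜 R (Fin d → R)
  | true => LinearMap.inr 𝕜 R (Fin d → R) ∘ₗ LinearMap.snd 𝕜 R (Fin d → R)

/-- The degree `0` or `1`. -/
def boolDegree (b : Bool) : ℤ := if b then 1 else 0

theorem degreeProj_self (b : Bool) {v : R × (Fin d → R)}
    (hv : v ∈ formGrading 𝕜 d R (boolDegree b)) : degreeProj 𝕜 R d b v = v := by
  rw [mem_formGrading] at hv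
  cases b
  · exact Prod.ext rfl (hv.2 (by simp [boolDegree])).symm
  · exact Prod.ext (hv.1 (by simp [boolDegree])).symm rfl

theorem degreeProj_ne {b c : Bool} (h : b ≠ c) {v : R × (Fin d → R)}
    (hv : v ∈ formGrading 𝕜 d R (boolDegree c)) : degreeProj 𝕜 R d b v = 0 := by
  rw [mem_formGrading] at hv
  cases b <;> cases c
  · exact absurd rfl h
  · exact Prod.ext (hv.1 (by simp [boolDegree])) rfl
  · exact Prod.ext rfl (hv.2 (by simp [boolDegree]))
  · exact absurd rfl h

/-- The inverse of the décalage. -/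
def undecalage {n : ℕ} (Λ : FormOperation 𝕜 d R n) :
    FormOperation 𝕜 d R n :=
  ∑ b : Fin n → Bool, sgn 𝕜 (∑ i : Fin n, ((n : ℤ) - 1 - i) * boolDegree (b i)) •
    Λ.compLinearMap fun i => degreeProj 𝕜 R d (b i)

theorem undecalage_apply {n : ℕ}
    (Λ : FormOperation 𝕜 d R n)
    (a : Fin n → ℤ) (v : Fin n → R × (Fin d → R)) (hv : ∀ i, v i ∈ formGrading 𝕜 d R (a i)) :
    undecalage Λ v = sgn 𝕜 (∑ i : Fin n, ((n : ℤ) - 1 - i) * a i) • Λ v := by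
  by_cases ha : ∀ i, ∃ b, a i = boolDegree b
  · choose b hb using ha
    obtain rfl : a = fun i => boolDegree (b i) := funext hb
    rw [undecalage, sum_apply, Fintype.sum_eq_single b]
    · simp only [smul_apply, MultilinearMap.compLinearMap_apply, degreeProj_self (b _) (hv _)]
    · intro c hc
      obtain ⟨i, hi⟩ := Function.ne_iff.1 hc
      rw [smul_apply, MultilinearMap.compLinearMap_apply,
        MultilinearMap.map_coord_zero _ i (degreeProj_ne hi (hv i)), smul_zero]
  · push Not at ha
    obtain ⟨i, hi⟩ := ha
    have h0 : v i = 0 := formGrading_eq_zero (hv i) (hi false) (hi true)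
    rw [MultilinearMap.map_coord_zero _ i h0, MultilinearMap.map_coord_zero _ i h0, smul_zero]

theorem decalage_undecalage {n : ℕ}
    (Λ : FormOperation 𝕜 d R n)
    (a : Fin n → ℤ) (v : Fin n → R × (Fin d → R)) (hv : ∀ i, v i ∈ formGrading 𝕜 d R (a i)) :
    decalage (undecalage Λ) a v = Λ v := by
  rw [decalage, undecalage_apply Λ a v hv, sgn_smul_sgn_smul]

theorem undecalage_skew {n : ℕ}
    (Λ : FormOperation 𝕜 d R n)
    (hΛ : ∀ (a : Fin n → ℤ) (v : Fin n → R × (Fin d → R)),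
      (∀ i, v i ∈ formGrading 𝕜 d R (a i)) → ∀ i j : Fin n, (i : ℕ) + 1 = j →
        Λ (v ∘ swap i j) = sgn 𝕜 ((a i - 1) * (a j - 1)) • Λ v)
    (a : Fin n → ℤ) (v : Fin n → R × (Fin d → R)) (hv : ∀ i, v i ∈ formGrading 𝕜 d R (a i))
    (i j : Fin n) (hij : (i : ℕ) + 1 = j) :
    undecalage Λ (v ∘ swap i j) = -(sgn 𝕜 (a i * a j) • undecalage Λ v) := by
  rw [undecalage_apply Λ a v hv,
    undecalage_apply Λ (fun k => a (swap i j k)) (v ∘ swap i j) (fun k => hv _), hΛ a v hv i j hij,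
    sum_decalage_swap a hij, smul_smul, smul_smul, ← neg_smul, ← sgn_add, ← sgn_add,
    neg_eq_neg_one_mul, ← sgn_one, ← sgn_add]
  congr 1
  exact sgn_congr ⟨-a i, by ring⟩

end FormGrading

/-! ## The brackets determined by gauge variations and brackets of gauge parameters -/

section Brackets

variable (P : (n : ℕ) → R →ₗ[𝕜] MultilinearMap 𝕜 (fun _ : Fin n => Fin d → R) (Fin d → R))
  (Q : (n : ℕ) → R →ₗ[𝕜] R →ₗ[𝕜] MultilinearMap 𝕜 (fun _ : Fin n => Fin d → R) R)

/-- The map `(v₀, …, vₙ) ↦ Pₙ(v₀; v₁, …, vₙ)`. -/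
def oneParam (n : ℕ) : MultilinearMap 𝕜 (fun _ : Fin (n + 1) => R × (Fin d → R)) (Fin d → R) :=
  (multilinearCurryLeftEquiv 𝕜 (fun _ : Fin (n + 1) => R × (Fin d → R)) (Fin d → R)).symm
    (MultilinearMap.compLinearMapₗ (fun _ => LinearMap.snd 𝕜 R (Fin d → R)) ∘ₗ P n
      ∘ₗ LinearMap.fst 𝕜 R (Fin d → R))

/-- The map `(v₀, …, vₙ₊₁) ↦ Qₙ(v₀, v₁; v₂, …, vₙ₊₁)`. -/
def twoParam (n : ℕ) : MultilinearMap 𝕜 (fun _ : Fin (n + 2) => R × (Fin d → R)) R :=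
  (multilinearCurryLeftEquiv 𝕜 (fun _ : Fin (n + 2) => R × (Fin d → R)) R).symm
    ((multilinearCurryLeftEquiv 𝕜 (fun _ : Fin (n + 1) => R × (Fin d → R)) R).symm.toLinearMap ∘ₗ
      (LinearMap.lcomp 𝕜 _ (LinearMap.fst 𝕜 R (Fin d → R)))
      ∘ₗ (LinearMap.compRight 𝕜
        (MultilinearMap.compLinearMapₗ (fun _ => LinearMap.snd 𝕜 R (Fin d → R))))
      ∘ₗ Q n ∘ₗ LinearMap.fst 𝕜 R (Fin d → R))

theorem oneParam_apply (n : ℕ) (v : Fin (n + 1) → R × (Fin d → R)) :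
    oneParam P n v = P n (v 0).1 fun i => (v i.succ).2 := rfl

theorem twoParam_apply (n : ℕ) (v : Fin (n + 2) → R × (Fin d → R)) :
    twoParam Q n v = Q n (v 0).1 (v 1).1 fun i => (v i.succ.succ).2 := rfl

/-- The sign of the order of two indices. -/
def orderSign (𝕜 : Type) [Field 𝕜] {n : ℕ} (i j : Fin n) : 𝕜 := if i < j then 1 else -1

/-- The décalage of the brackets with one gauge parameter. -/
def oneParamSymm (n : ℕ) :
    MultilinearMap 𝕜 (fun _ : Fin (n + 1) => R × (Fin d → R)) (Fin d → R) :=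
  (1 / (n.factorial : 𝕜)) • ∑ σ : Perm (Fin (n + 1)), (oneParam P n).domDomCongr σ

/-- The décalage of the brackets with two gauge parameters. -/
def twoParamSymm (n : ℕ) : MultilinearMap 𝕜 (fun _ : Fin (n + 2) => R × (Fin d → R)) R :=
  (-1 / (2 * n.factorial : 𝕜)) • ∑ σ : Perm (Fin (n + 2)),
    orderSign 𝕜 (σ 0) (σ 1) • (twoParam Q n).domDomCongr σ

theorem oneParamSymm_apply (n : ℕ) (v : Fin (n + 1) → R × (Fin d → R)) :
    oneParamSymm P n v = (1 / (n.factorial : 𝕜)) • ∑ σ : Perm (Fin (n + 1)),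
      P n (v (σ 0)).1 fun i => (v (σ i.succ)).2 := by
  simp [oneParamSymm, oneParam_apply]

theorem twoParamSymm_apply (n : ℕ) (v : Fin (n + 2) → R × (Fin d → R)) :
    twoParamSymm Q n v = (-1 / (2 * n.factorial : 𝕜)) • ∑ σ : Perm (Fin (n + 2)),
      orderSign 𝕜 (σ 0) (σ 1) • Q n (v (σ 0)).1 (v (σ 1)).1 fun i => (v (σ i.succ.succ)).2 := by
  simp [twoParamSymm, twoParam_apply]

/-- The décalage of the brackets. -/
def symmBracket : (n : ℕ) →
    FormOperation 𝕜 d R n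
  | 0 => 0
  | 1 => (LinearMap.inr 𝕜 R (Fin d → R)).compMultilinearMap (oneParamSymm P 0)
  | n + 2 => (LinearMap.inl 𝕜 R (Fin d → R)).compMultilinearMap (twoParamSymm Q n)
      + (LinearMap.inr 𝕜 R (Fin d → R)).compMultilinearMap (oneParamSymm P (n + 1))

theorem symmBracket_succ_snd (n : ℕ) (v : Fin (n + 1) → R × (Fin d → R)) :
    (symmBracket P Q (n + 1) v).2 = oneParamSymm P n v := by
  cases n <;> simp [symmBracket]

theorem symmBracket_one_fst (v : Fin 1 → R × (Fin d → R)) :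
    (symmBracket P Q 1 v).1 = 0 := by
  simp [symmBracket]

theorem symmBracket_fst (n : ℕ) (v : Fin (n + 2) → R × (Fin d → R)) :
    (symmBracket P Q (n + 2) v).1 = twoParamSymm Q n v := by
  simp [symmBracket]

variable {P Q} in
theorem degree_of_oneParam_ne_zero {n : ℕ} {a : Fin (n + 1) → ℤ}
    {v : Fin (n + 1) → R × (Fin d → R)}
    (hv : ∀ i, v i ∈ formGrading 𝕜 d R (a i)) (σ : Perm (Fin (n + 1)))
    (h : (P n (v (σ 0)).1 fun i => (v (σ i.succ)).2) ≠ 0) :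
    a (σ 0) = 0 ∧ ∀ i : Fin n, a (σ i.succ) = 1 := by
  constructor
  · by_contra h0
    exact h (by rw [(mem_formGrading.1 (hv (σ 0))).1 h0, map_zero]; rfl)
  · intro i
    by_contra h1
    exact h (MultilinearMap.map_coord_zero _ i ((mem_formGrading.1 (hv (σ i.succ))).2 h1))

variable {P Q} in
theorem degree_of_twoParam_ne_zero {n : ℕ} {a : Fin (n + 2) → ℤ}
    {v : Fin (n + 2) → R × (Fin d → R)}
    (hv : ∀ i, v i ∈ formGrading 𝕜 d R (a i)) (σ : Perm (Fin (n + 2)))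
    (h : (Q n (v (σ 0)).1 (v (σ 1)).1 fun i => (v (σ i.succ.succ)).2) ≠ 0) :
    a (σ 0) = 0 ∧ a (σ 1) = 0 ∧ ∀ i : Fin n, a (σ i.succ.succ) = 1 := by
  refine ⟨?_, ?_, ?_⟩
  · by_contra h0
    exact h (by rw [(mem_formGrading.1 (hv (σ 0))).1 h0, map_zero]; rfl)
  · by_contra h0
    exact h (by rw [(mem_formGrading.1 (hv (σ 1))).1 h0, map_zero]; rfl)
  · intro i
    by_contra h1
    exact h (MultilinearMap.map_coord_zero _ i ((mem_formGrading.1 (hv (σ i.succ.succ))).2 h1))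

theorem symmBracket_degree (n : ℕ) (a : Fin n → ℤ) (v : Fin n → R × (Fin d → R))
    (hv : ∀ i, v i ∈ formGrading 𝕜 d R (a i)) :
    symmBracket P Q n v ∈ formGrading 𝕜 d R ((∑ i, a i) + 2 - n) := by
  have h1 : ∀ (n : ℕ) (a : Fin (n + 1) → ℤ) (v : Fin (n + 1) → R × (Fin d → R)),
      (∀ i, v i ∈ formGrading 𝕜 d R (a i)) → (∑ i, a i) + 2 - (n + 1 : ℕ) ≠ 1 →
      (symmBracket P Q (n + 1) v).2 = 0 := by
    intro n a v hv hk
    rw [symmBracket_succ_snd, oneParamSymm_apply, sum_eq_zero, smul_zero]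
    intro σ _
    by_contra h
    obtain ⟨h0, h1⟩ := degree_of_oneParam_ne_zero hv σ h
    refine hk ?_
    rw [← Equiv.sum_comp σ, sum_univ_succ, h0]
    simp only [h1]
    simp
  match n with
  | 0 => exact Submodule.zero_mem _
  | 1 => exact mem_formGrading.2 ⟨fun _ => symmBracket_one_fst P Q v, h1 0 a v hv⟩
  | n + 2 =>
    refine mem_formGrading.2 ⟨fun hk => ?_, h1 (n + 1) a v hv⟩
    rw [symmBracket_fst, twoParamSymm_apply, sum_eq_zero, smul_zero]
    intro σ _
    by_contra h
    obtain ⟨h0, h1, h2⟩ := degree_of_twoParam_ne_zero hv σ (right_ne_zero_of_smul h)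
    refine hk ?_
    rw [← Equiv.sum_comp σ, sum_univ_succ, sum_univ_succ, h0]
    simp only [h2]
    change 0 + (a (σ 1) + _) + _ - _ = _
    rw [h1]
    simp

theorem symmBracket_swap (n : ℕ) (a : Fin n → ℤ) (v : Fin n → R × (Fin d → R))
    (hv : ∀ i, v i ∈ formGrading 𝕜 d R (a i)) (i j : Fin n) (hij : (i : ℕ) + 1 = j) :
    symmBracket P Q n (v ∘ swap i j)
      = sgn 𝕜 ((a i - 1) * (a j - 1)) • symmBracket P Q n v := by
  have hne : i ≠ j := fun e => by subst e; omega
  have h1 : ∀ (n : ℕ) (a : Fin (n + 1) → ℤ) (v : Fin (n + 1) → R × (Fin d → R))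
      (i j : Fin (n + 1)), i ≠ j → (∀ i, v i ∈ formGrading 𝕜 d R (a i)) →
      (symmBracket P Q (n + 1) (v ∘ swap i j)).2
        = sgn 𝕜 ((a i - 1) * (a j - 1)) • (symmBracket P Q (n + 1) v).2 := by
    intro n a v i j hne hv
    rw [symmBracket_succ_snd, symmBracket_succ_snd, oneParamSymm_apply, oneParamSymm_apply,
      smul_comm (sgn 𝕜 _)]
    congr 1
    rw [smul_sum]
    refine Fintype.sum_equiv (Equiv.mulLeft (swap i j)) _ _ fun σ => ?_
    simp only [Function.comp_apply, Equiv.coe_mulLeft, Equiv.Perm.coe_mul]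
    by_cases h : (P n (v (swap i j (σ 0))).1
        fun k => (v (swap i j (σ k.succ))).2) = 0
    · rw [h, smul_zero]
    · obtain ⟨h0, h1⟩ := degree_of_oneParam_ne_zero hv (swap i j * σ) h
      have h2 : (a i - 1) * (a j - 1) = 0 := by
        have h3 : ∀ x, x = (swap i j * σ) 0 ∨ a x = 1 := by
          intro x
          obtain ⟨y, rfl⟩ := (swap i j * σ).surjective x
          induction y using Fin.cases with
          | zero => exact Or.inl rfl
          | succ y => exact Or.inr (h1 y)
        rcases h3 i with e | e
        · rcases h3 j with e' | e'
          · exact absurd (e.trans e'.symm) hne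
          · rw [e']; ring
        · rw [e]; ring
      rw [h2, sgn_zero, one_smul]
  match n with
  | 0 => exact i.elim0
  | 1 =>
    refine Prod.ext ?_ (h1 0 a v i j hne hv)
    rw [Prod.smul_fst, symmBracket_one_fst, symmBracket_one_fst, smul_zero]
  | n + 2 =>
    refine Prod.ext ?_ (h1 (n + 1) a v i j hne hv)
    rw [Prod.smul_fst, symmBracket_fst, symmBracket_fst, twoParamSymm_apply, twoParamSymm_apply,
      smul_comm (sgn 𝕜 _)]
    congr 1
    rw [smul_sum]
    refine Fintype.sum_equiv (Equiv.mulLeft (swap i j)) _ _ fun σ => ?_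
    simp only [Function.comp_apply, Equiv.coe_mulLeft, Equiv.Perm.coe_mul]
    by_cases h : (Q n (v (swap i j (σ 0))).1 (v (swap i j (σ 1))).1
        fun k => (v (swap i j (σ k.succ.succ))).2) = 0
    · rw [h, smul_zero, smul_zero, smul_zero]
    · obtain ⟨h0, h1, h2⟩ := degree_of_twoParam_ne_zero hv (swap i j * σ) h
      rw [smul_smul]
      congr 1
      have h3 : ∀ x, a (swap i j x) = 1 ∨ x = σ 0 ∨ x = σ 1 := by
        intro x
        obtain ⟨y, rfl⟩ := σ.surjective x
        induction y using Fin.cases with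
        | zero => exact Or.inr (Or.inl rfl)
        | succ y =>
          induction y using Fin.cases with
          | zero => exact Or.inr (Or.inr rfl)
          | succ y => exact Or.inl (h2 y)
      have h01 : σ 0 ≠ σ 1 := fun e => by simpa using σ.injective e
      by_cases hc : (σ 0 = i ∧ σ 1 = j) ∨ (σ 0 = j ∧ σ 1 = i)
      · have hlt : i < j := by rw [lt_def]; omega
        rcases hc with ⟨e0, e1⟩ | ⟨e0, e1⟩
        · rw [Equiv.Perm.mul_apply, e0, Equiv.swap_apply_left] at h0
          rw [Equiv.Perm.mul_apply, e1, Equiv.swap_apply_right] at h1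
          rw [e0, e1, h0, h1]
          simp [orderSign, hlt, hlt.le, sgn_one]
        · rw [Equiv.Perm.mul_apply, e0, Equiv.swap_apply_right] at h0
          rw [Equiv.Perm.mul_apply, e1, Equiv.swap_apply_left] at h1
          rw [e0, e1, h0, h1]
          simp [orderSign, hlt, hlt.le, sgn_one]
      · have h4 : (a i - 1) * (a j - 1) = 0 := by
          have h5 := h3 i
          have h6 := h3 j
          rw [Equiv.swap_apply_left] at h5
          rw [Equiv.swap_apply_right] at h6
          rcases h5 with e | e
          · rw [e]; ring
          · rcases h6 with e' | e'
            · rw [e']; ring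
            · exfalso
              rcases e with e | e <;> rcases e' with e' | e'
              · exact hne (e.trans e'.symm)
              · exact hc (Or.inl ⟨e.symm, e'.symm⟩)
              · exact hc (Or.inr ⟨e'.symm, e.symm⟩)
              · exact hne (e.trans e'.symm)
        rw [h4, sgn_zero, one_mul]
        simp only [orderSign, swap_lt_swap hij _ _ hc]

theorem sum_perm_one {n : ℕ} {W : Type} [AddCommMonoid W]
    (F : Perm (Fin (n + 1)) → W) (h : ∀ σ, σ 0 ≠ 0 → F σ = 0) :
    ∑ σ, F σ = ∑ e : Perm (Fin n), F (Equiv.Perm.decomposeFin.symm (0, e)) := by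
  rw [← Equiv.sum_comp Equiv.Perm.decomposeFin.symm, Fintype.sum_prod_type,
    Fintype.sum_eq_single 0]
  intro p hp
  exact sum_eq_zero fun e _ => h _ (by simpa using hp)

variable [CharZero 𝕜]

theorem oneParamSymm_args₁ (hP : ∀ n f A (σ : Perm (Fin n)), P n f (A ∘ σ) = P n f A)
    {n : ℕ} (f : R) (B : Fin n → Fin d → R) : oneParamSymm P n (args₁ f B) = P n f B := by
  have h0 : ∀ σ : Perm (Fin (n + 1)), σ 0 ≠ 0 →
      (P n (args₁ f B (σ 0)).1 fun i => (args₁ f B (σ i.succ)).2) = 0 := by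
    intro σ hσ
    obtain ⟨i, hi⟩ := exists_succ_eq_of_ne_zero hσ
    rw [← hi]
    simp [args₁]
  rw [oneParamSymm_apply, sum_perm_one _ h0]
  have h1 : ∀ e : Perm (Fin n),
      (P n (args₁ f B (Equiv.Perm.decomposeFin.symm (0, e) 0)).1 fun i =>
        (args₁ f B (Equiv.Perm.decomposeFin.symm (0, e) i.succ)).2) = P n f B := by
    intro e
    rw [← hP n f B e]
    simp only [Equiv.Perm.decomposeFin_symm_apply_zero, Equiv.Perm.decomposeFin_symm_apply_succ,
      Equiv.swap_self, Equiv.refl_apply]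
    simp [args₁]
    rfl
  simp only [h1, sum_const, card_univ, Fintype.card_perm, Fintype.card_fin]
  rw [← cast_smul_eq_nsmul 𝕜, smul_smul, one_div_mul_cancel, one_smul]
  exact_mod_cast n.factorial_ne_zero

theorem twoParamSymm_args₂ (hQ : ∀ n f g A (σ : Perm (Fin n)), Q n f g (A ∘ σ) = Q n f g A)
    (hskew : ∀ n f g, Q n g f = -Q n f g)
    {n : ℕ} (f g : R) (B : Fin n → Fin d → R) :
    twoParamSymm Q n (args₂ f g B) = -Q n f g B := by
  have hz : ∀ x : Fin (n + 2), x ≠ 0 → x ≠ 1 → (args₂ f g B x).1 = 0 := by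
    intro x h0 h1
    obtain ⟨i, rfl⟩ := exists_succ_eq_of_ne_zero h0
    obtain ⟨k, rfl⟩ := exists_succ_eq_of_ne_zero
      (show i ≠ 0 from fun e => h1 (by rw [e]; rfl))
    simp [args₂]
  have key : ∀ e : Perm (Fin n), Q n f g (fun i => B (e i)) = Q n f g B :=
    fun e => hQ n f g B e
  rw [twoParamSymm_apply]
  have h1 : ∑ σ : Perm (Fin (n + 2)), orderSign 𝕜 (σ 0) (σ 1) •
      (Q n (args₂ f g B (σ 0)).1 (args₂ f g B (σ 1)).1 fun i => (args₂ f g B (σ i.succ.succ)).2)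
      = (2 * n.factorial) • Q n f g B := by
    rw [← Equiv.sum_comp Equiv.Perm.decomposeFin.symm, Fintype.sum_prod_type,
      Fintype.sum_eq_add 0 1 (by simp)]
    · have hs : ∀ k : Fin n, swap (0 : Fin (n + 2)) 1 k.succ.succ = k.succ.succ := fun k =>
        Equiv.swap_apply_of_ne_of_ne (by simp) (by simp [Fin.ext_iff])
      have e0 : ∀ p : Fin (n + 2), ∀ e : Perm (Fin (n + 1)),
          Equiv.Perm.decomposeFin.symm (p, e) 1 = swap 0 p (e 0).succ := fun p e =>
        Equiv.Perm.decomposeFin_symm_apply_one e p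
      rw [sum_perm_one, sum_perm_one]
      · simp only [Equiv.Perm.decomposeFin_symm_apply_zero, e0,
          Equiv.Perm.decomposeFin_symm_apply_succ, Equiv.swap_self, Equiv.refl_apply,
          Fin.succ_zero_eq_one, Equiv.swap_apply_right, hs]
        simp only [args₂, cons_zero, cons_succ, orderSign]
        have e1 : (Fin.cons (f, 0) (Fin.cons (g, 0) fun i => (0, B i)) :
            Fin (n + 2) → R × (Fin d → R)) 1 = (g, 0) := rfl
        simp only [e1, key, hskew n f g, neg_apply]
        simp [Fintype.card_perm, two_mul, add_smul]
      · intro σ hσ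
        rw [Equiv.Perm.decomposeFin_symm_apply_zero, e0]
        obtain ⟨k, hk⟩ := exists_succ_eq_of_ne_zero hσ
        rw [← hk, hs, hz k.succ.succ (by simp) (by simp [Fin.ext_iff])]
        simp
      · intro σ hσ
        rw [Equiv.Perm.decomposeFin_symm_apply_zero, e0]
        obtain ⟨k, hk⟩ := exists_succ_eq_of_ne_zero hσ
        rw [← hk, Equiv.swap_self, Equiv.refl_apply,
          hz k.succ.succ (by simp) (by simp [Fin.ext_iff])]
        simp
    · rintro p ⟨hp0, hp1⟩
      refine sum_eq_zero fun e _ => ?_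
      rw [Equiv.Perm.decomposeFin_symm_apply_zero, hz p hp0 hp1]
      simp
  rw [h1, ← cast_smul_eq_nsmul 𝕜, smul_smul]
  have h2 : (-1 / (2 * n.factorial : 𝕜)) * ((2 * n.factorial : ℕ) : 𝕜) = -1 := by
    have := (Nat.cast_ne_zero (R := 𝕜)).2 n.factorial_ne_zero
    push_cast
    field_simp
  rw [h2, neg_one_smul]

end Brackets

/-! ## Words of gauge parameters and gauge fields -/

section Words

/-- A gauge parameter or a gauge field as an element of `C^∞(U) ⊕ Ω¹(U)`. -/
def letter : R ⊕ (Fin d → R) → R × (Fin d → R) := Sum.elim (fun f => (f, 0)) fun A => (0, A)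

/-- The degree of a gauge parameter or a gauge field. -/
def letterDeg : R ⊕ (Fin d → R) → ℤ := Sum.elim (fun _ => 0) fun _ => 1

theorem letter_mem (x : R ⊕ (Fin d → R)) : letter x ∈ formGrading 𝕜 d R (letterDeg x) := by
  rw [mem_formGrading]
  cases x <;> simp [letter, letterDeg]

/-- The value of the décalage of `φ` on a word. -/
def wordVal {n : ℕ} (φ : FormOperation 𝕜 d R n)
    (w : Fin n → R ⊕ (Fin d → R)) : R × (Fin d → R) :=
  decalage φ (fun i => letterDeg (w i)) fun i => letter (w i)

theorem koszulSign_eq_subset {n : ℕ} (a : Fin n → ℤ) (σ : Perm (Fin n)) (s : Finset (Fin n))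
    (hs : ∀ x, x ∉ s → a x = 0) :
    koszulSign 𝕜 a σ
      = ∏ x ∈ s, ∏ y ∈ s, if y < x ∧ σ.symm x < σ.symm y then sgn 𝕜 (a x * a y) else 1 := by
  rw [koszulSign_eq, ← prod_subset (subset_univ s)]
  · refine prod_congr rfl fun x _ => ?_
    rw [← prod_subset (subset_univ s)]
    intro y _ hy
    simp [hs y hy, sgn_zero]
  · intro x _ hx
    simp [hs x hx, sgn_zero]

theorem koszulSign_one_odd {n : ℕ} (a : Fin n → ℤ) (σ : Perm (Fin n)) (x : Fin n)
    (hs : ∀ z, z ≠ x → a z = 0) : koszulSign 𝕜 a σ = 1 := by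
  rw [koszulSign_eq_subset a σ {x} (fun z hz => hs z (by simpa using hz))]
  simp

theorem koszulSign_two_odd {n : ℕ} (a : Fin n → ℤ) (σ : Perm (Fin n)) {x y : Fin n}
    (hxy : x < y) (hx : a x = -1) (hy : a y = -1) (hs : ∀ z, z ≠ x → z ≠ y → a z = 0) :
    koszulSign 𝕜 a σ = orderSign 𝕜 (σ.symm x) (σ.symm y) := by
  have hne : σ.symm x ≠ σ.symm y := fun e => hxy.ne (σ.symm.injective e)
  rw [koszulSign_eq_subset a σ {x, y} (fun z hz => by
    simp only [mem_insert, mem_singleton, not_or] at hz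
    exact hs z hz.1 hz.2)]
  rw [prod_pair hxy.ne, prod_pair hxy.ne, prod_pair hxy.ne, orderSign]
  simp only [lt_irrefl, false_and, if_false, hxy, hxy.not_gt, true_and, hx, hy, one_mul, mul_one]
  rcases lt_or_gt_of_ne hne with h | h
  · simp [h, h.not_gt]
  · simp [h, h.not_gt, sgn_one]

theorem koszulSign_three_odd {n : ℕ} (a : Fin n → ℤ) (σ : Perm (Fin n)) {x y z : Fin n}
    (hxy : x < y) (hyz : y < z) (hx : a x = -1) (hy : a y = -1) (hz : a z = -1)
    (hs : ∀ u, u ≠ x → u ≠ y → u ≠ z → a u = 0) :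
    koszulSign 𝕜 a σ = orderSign 𝕜 (σ.symm x) (σ.symm y) * orderSign 𝕜 (σ.symm x) (σ.symm z)
      * orderSign 𝕜 (σ.symm y) (σ.symm z) := by
  have hxz := hxy.trans hyz
  have hne : ∀ {x y}, x < y → σ.symm x ≠ σ.symm y := fun h e => h.ne (σ.symm.injective e)
  have key : ∀ {x y}, x < y →
      (if σ.symm y < σ.symm x then (-1 : 𝕜) else 1) = orderSign 𝕜 (σ.symm x) (σ.symm y) := by
    intro x y h
    rw [orderSign]
    rcases lt_or_gt_of_ne (hne h) with h | h <;> simp [h, h.not_gt]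
  rw [koszulSign_eq_subset a σ {x, y, z} (fun u hu => by
    simp only [mem_insert, mem_singleton, not_or] at hu
    exact hs u hu.1 hu.2.1 hu.2.2)]
  have h1 : x ∉ ({y, z} : Finset (Fin n)) := by simp [hxy.ne, hxz.ne]
  have h2 : y ∉ ({z} : Finset (Fin n)) := by simp [hyz.ne]
  simp only [prod_insert h1, prod_insert h2, Finset.prod_singleton, lt_irrefl,
    false_and, if_false, hxy, hxz, hyz, hxy.not_gt, hxz.not_gt, hyz.not_gt, true_and, hx, hy, hz,
    one_mul, mul_one]
  norm_num [sgn_one, key hxy, key hxz, key hyz]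
  ring

/-- `σ` takes `i` to `0` and preserves the order of the other indices. -/
theorem exists_perm_front₁ {n : ℕ} (i : Fin (n + 1)) :
    ∃ σ : Perm (Fin (n + 1)), σ i = 0 ∧ ∀ k, σ (i.succAbove k) = k.succ :=
  ⟨i.cycleRange, Fin.cycleRange_self i, fun k => Fin.cycleRange_succAbove i k⟩

/-- `σ` takes `i` to `0`, the next index to `1`, and preserves the order of the others. -/
theorem exists_perm_front₂ {n : ℕ} (i : Fin (n + 2)) (j : Fin (n + 1)) :
    ∃ σ : Perm (Fin (n + 2)), σ i = 0 ∧ σ (i.succAbove j) = 1 ∧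
      ∀ k, σ (i.succAbove (j.succAbove k)) = k.succ.succ := by
  obtain ⟨τ, h0, h1⟩ := exists_perm_front₁ j
  obtain ⟨ρ, h2, h3⟩ := exists_perm_front₁ i
  refine ⟨Equiv.Perm.decomposeFin.symm (0, τ) * ρ, ?_, ?_, fun k => ?_⟩
  · simp [h2]
  · rw [Equiv.Perm.mul_apply, h3, Equiv.Perm.decomposeFin_symm_apply_succ, h0]
    simp
  · rw [Equiv.Perm.mul_apply, h3, Equiv.Perm.decomposeFin_symm_apply_succ, h1]
    simp

/-- Graded skew-symmetry of a multilinear map. -/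
def IsGradedSkew {n : ℕ}
    (φ : FormOperation 𝕜 d R n) : Prop :=
  ∀ (a : Fin n → ℤ) (v : Fin n → R × (Fin d → R)), (∀ i, v i ∈ formGrading 𝕜 d R (a i)) →
    ∀ i j : Fin n, (i : ℕ) + 1 = j → φ (v ∘ swap i j) = -(sgn 𝕜 (a i * a j) • φ v)

/-- A multilinear map of degree `2 - n`. -/
def IsBracketDegree {n : ℕ}
    (φ : FormOperation 𝕜 d R n) : Prop :=
  ∀ (a : Fin n → ℤ) (v : Fin n → R × (Fin d → R)), (∀ i, v i ∈ formGrading 𝕜 d R (a i)) →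
    φ v ∈ formGrading 𝕜 d R ((∑ i, a i) + 2 - n)

section

variable {n : ℕ} {φ : FormOperation 𝕜 d R n}

theorem wordVal_perm (hφ : IsGradedSkew φ) (w : Fin n → R ⊕ (Fin d → R))
    (σ : Perm (Fin n)) :
    wordVal φ (fun i => w (σ i))
      = koszulSign 𝕜 (fun i => letterDeg (w i) - 1) σ • wordVal φ w :=
  decalage_perm φ hφ (fun i => letterDeg (w i)) (fun i => letter (w i))
    (fun i => letter_mem (w i)) σ

theorem wordVal_mem (hφ : IsBracketDegree φ) (w : Fin n → R ⊕ (Fin d → R)) :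
    wordVal φ w ∈ formGrading 𝕜 d R ((∑ i, letterDeg (w i)) + 2 - n) :=
  Submodule.smul_mem _ _ (hφ (fun i => letterDeg (w i)) _ fun i => letter_mem (w i))

omit [CommRing R] in
theorem sum_letterDeg (w : Fin n → R ⊕ (Fin d → R)) (s : Finset (Fin n))
    (hs : ∀ i, i ∈ s ↔ (w i).isLeft) : ∑ i, letterDeg (w i) = n - s.card := by
  have e : ∀ i, letterDeg (w i) = 1 - if i ∈ s then 1 else 0 := by
    intro i
    have := hs i
    cases h : w i <;> simp [h] at this <;> simp [this, letterDeg]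
  simp only [e, sum_sub_distrib]
  simp

theorem wordVal_zero_param (hφ : IsBracketDegree φ) (w : Fin n → R ⊕ (Fin d → R))
    (B : Fin n → Fin d → R) (hw : ∀ i, w i = inr (B i)) : wordVal φ w = 0 := by
  refine formGrading_eq_zero (wordVal_mem hφ w) ?_ ?_ <;>
  · rw [sum_letterDeg w ∅ (by simp [hw])]
    simp

theorem wordVal_three_param (hφ : IsBracketDegree φ) (w : Fin n → R ⊕ (Fin d → R))
    (s : Finset (Fin n)) (hs : ∀ i, i ∈ s ↔ (w i).isLeft) (h3 : 3 ≤ s.card) :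
    wordVal φ w = 0 := by
  refine formGrading_eq_zero (wordVal_mem hφ w) ?_ ?_ <;>
  · rw [sum_letterDeg w s hs]
    omega

end

variable (ℓ : OperationFamily 𝕜 d R)

/-- The décalage of the brackets with one gauge parameter. -/
def paramVal₁ (n : ℕ) (f : R) (B : Fin n → Fin d → R) : Fin d → R :=
  (wordVal (ℓ (n + 1)) (Fin.cons (inl f) fun i => inr (B i))).2

/-- The décalage of the brackets with two gauge parameters. -/
def paramVal₂ (n : ℕ) (f g : R) (B : Fin n → Fin d → R) : R :=
  (wordVal (ℓ (n + 2)) (Fin.cons (inl f) (Fin.cons (inl g) fun i => inr (B i)))).1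

variable {ℓ} (hskew : ∀ n, IsGradedSkew (ℓ n)) (hdeg : ∀ n, IsBracketDegree (ℓ n))

include hdeg in
theorem wordVal_front₁ (n : ℕ) (f : R) (B : Fin n → Fin d → R) :
    wordVal (ℓ (n + 1)) (Fin.cons (inl f) fun i => inr (B i))
      = (0, paramVal₁ ℓ n f B) := by
  refine Prod.ext ((mem_formGrading.1 (wordVal_mem (hdeg (n + 1)) _)).1 ?_) rfl
  rw [sum_univ_succ]
  simp [letterDeg]

include hdeg in
theorem wordVal_front₂ (n : ℕ) (f g : R) (B : Fin n → Fin d → R) :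
    wordVal (ℓ (n + 2)) (Fin.cons (inl f) (Fin.cons (inl g) fun i => inr (B i)))
      = (paramVal₂ ℓ n f g B, 0) := by
  refine Prod.ext rfl ((mem_formGrading.1 (wordVal_mem (hdeg (n + 2)) _)).2 ?_)
  rw [sum_univ_succ, sum_univ_succ]
  simp [letterDeg]

include hskew hdeg in
theorem wordVal_one_param {n : ℕ} (w : Fin (n + 1) → R ⊕ (Fin d → R)) (i : Fin (n + 1)) (f : R)
    (B : Fin (n + 1) → Fin d → R) (hi : w i = inl f) (hw : ∀ k, k ≠ i → w k = inr (B k)) :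
    wordVal (ℓ (n + 1)) w = (0, paramVal₁ ℓ n f fun k => B (i.succAbove k)) := by
  obtain ⟨σ, h0, h1⟩ := exists_perm_front₁ i
  let w₀ : Fin (n + 1) → R ⊕ (Fin d → R) :=
    Fin.cons (inl f) fun k => inr (B (i.succAbove k))
  have e : w = fun k => w₀ (σ k) := by
    funext k
    rcases Fin.eq_self_or_eq_succAbove i k with rfl | ⟨k, rfl⟩
    · rw [hi, h0]; rfl
    · rw [hw _ (Fin.succAbove_ne _ _), h1]; rfl
  rw [e, wordVal_perm (hskew _), koszulSign_one_odd _ σ 0, one_smul]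
  · exact wordVal_front₁ hdeg n f _
  · intro z hz
    obtain ⟨k, rfl⟩ := exists_succ_eq_of_ne_zero hz
    simp [w₀, letterDeg]

include hskew hdeg in
theorem wordVal_two_param {n : ℕ} (w : Fin (n + 2) → R ⊕ (Fin d → R)) (i : Fin (n + 2))
    (j : Fin (n + 1)) (f g : R) (B : Fin (n + 2) → Fin d → R) (hi : w i = inl f)
    (hj : w (i.succAbove j) = inl g)
    (hw : ∀ k, k ≠ i → k ≠ i.succAbove j → w k = inr (B k)) :
    wordVal (ℓ (n + 2)) w = orderSign 𝕜 i (i.succAbove j) •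
      (paramVal₂ ℓ n f g fun k => B (i.succAbove (j.succAbove k)), 0) := by
  obtain ⟨σ, h0, h1, h2⟩ := exists_perm_front₂ i j
  let w₀ : Fin (n + 2) → R ⊕ (Fin d → R) :=
    Fin.cons (inl f) (Fin.cons (inl g) fun k =>
      inr (B (i.succAbove (j.succAbove k))))
  have e : w = fun k => w₀ (σ k) := by
    funext k
    rcases Fin.eq_self_or_eq_succAbove i k with rfl | ⟨k, rfl⟩
    · rw [hi, h0]; rfl
    · rcases Fin.eq_self_or_eq_succAbove j k with rfl | ⟨k, rfl⟩
      · rw [hj, h1]; rfl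
      · rw [h2, hw _ (Fin.succAbove_ne _ _)
          fun e => Fin.succAbove_ne j k (Fin.succAbove_right_injective e)]
        rfl
  rw [e, wordVal_perm (hskew _), koszulSign_two_odd _ σ (x := 0) (y := 1) (by simp),
    σ.symm_apply_eq.2 h0.symm, σ.symm_apply_eq.2 h1.symm]
  · rw [← wordVal_front₂ hdeg]
  · simp [w₀, letterDeg]
  · change letterDeg (inl g) - 1 = -1
    simp [letterDeg]
  · intro z hz hz1
    obtain ⟨k, rfl⟩ := exists_succ_eq_of_ne_zero hz
    obtain ⟨k, rfl⟩ := exists_succ_eq_of_ne_zero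
      (show k ≠ 0 from fun e => hz1 (by rw [e]; rfl))
    simp [w₀, letterDeg]

/-- `P_b(f; A, …, A)`. -/
def diag₁ (ℓ : OperationFamily 𝕜 d R)
    (b : ℕ) (f : R) (A : Fin d → R) : Fin d → R :=
  paramVal₁ ℓ b f fun _ => A

/-- `P_{b+1}(f; B, A, …, A)`. -/
def cons₁ (ℓ : OperationFamily 𝕜 d R)
    (b : ℕ) (f : R) (B A : Fin d → R) : Fin d → R :=
  paramVal₁ ℓ (b + 1) f (Fin.cons B fun _ => A)

/-- `Q_b(f, g; A, …, A)`. -/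
def diag₂ (ℓ : OperationFamily 𝕜 d R)
    (b : ℕ) (f g : R) (A : Fin d → R) : R :=
  paramVal₂ ℓ b f g fun _ => A

/-- `Q_{b+1}(f, g; B, A, …, A)`. -/
def cons₂ (ℓ : OperationFamily 𝕜 d R)
    (b : ℕ) (f g : R) (B A : Fin d → R) : R :=
  paramVal₂ ℓ (b + 1) f g (Fin.cons B fun _ => A)

include hskew hdeg in
theorem wordVal_diag₁ {N : ℕ} (w : Fin N → R ⊕ (Fin d → R)) (i : Fin N) (f : R) (A : Fin d → R)
    (hi : w i = inl f) (hw : ∀ k, k ≠ i → w k = inr A) :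
    wordVal (ℓ N) w = (0, diag₁ ℓ (N - 1) f A) := by
  cases N with
  | zero => exact i.elim0
  | succ N => exact wordVal_one_param hskew hdeg w i f (fun _ => A) hi hw

include hskew hdeg in
theorem wordVal_cons₁ {N : ℕ} (w : Fin (N + 1) → R ⊕ (Fin d → R)) (i : Fin N) (f : R)
    (B A : Fin d → R) (h0 : w 0 = inr B) (hi : w i.succ = inl f)
    (hw : ∀ k, k ≠ i → w k.succ = inr A) :
    wordVal (ℓ (N + 1)) w = (0, cons₁ ℓ (N - 1) f B A) := by
  cases N with
  | zero => exact i.elim0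
  | succ N =>
    rw [wordVal_one_param hskew hdeg w i.succ f (Fin.cons B fun _ => A) hi, cons₁]
    · congr 2
      funext k
      induction k using Fin.cases with
      | zero => simp
      | succ k => simp
    · intro k hk
      induction k using Fin.cases with
      | zero => exact h0
      | succ k => exact hw k fun e => hk (by rw [e])

include hskew hdeg in
theorem wordVal_diag₂ {N : ℕ} (w : Fin N → R ⊕ (Fin d → R)) (i j : Fin N) (hij : i ≠ j) (f g : R)
    (A : Fin d → R) (hi : w i = inl f) (hj : w j = inl g)
    (hw : ∀ k, k ≠ i → k ≠ j → w k = inr A) :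
    wordVal (ℓ N) w = orderSign 𝕜 i j • (diag₂ ℓ (N - 2) f g A, 0) := by
  match N with
  | 0 => exact i.elim0
  | 1 => exact absurd (Subsingleton.elim i j) hij
  | N + 2 =>
    obtain ⟨j, rfl⟩ := Fin.exists_succAbove_eq hij.symm
    exact wordVal_two_param hskew hdeg w i j f g (fun _ => A) hi hj hw

include hskew hdeg in
theorem wordVal_cons₂ {N : ℕ} (w : Fin (N + 1) → R ⊕ (Fin d → R)) (i j : Fin N) (hij : i ≠ j)
    (f g : R) (B A : Fin d → R) (h0 : w 0 = inr B) (hi : w i.succ = inl f)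
    (hj : w j.succ = inl g) (hw : ∀ k, k ≠ i → k ≠ j → w k.succ = inr A) :
    wordVal (ℓ (N + 1)) w = orderSign 𝕜 i j • (cons₂ ℓ (N - 2) f g B A, 0) := by
  match N with
  | 0 => exact i.elim0
  | 1 => exact absurd (Subsingleton.elim i j) hij
  | N + 2 =>
    obtain ⟨j, rfl⟩ := Fin.exists_succAbove_eq hij.symm
    have e : (i.succAbove j).succ = i.succ.succAbove j.succ := by simp
    rw [wordVal_two_param hskew hdeg w i.succ j.succ f g (Fin.cons B fun _ => A) hi
      (by rw [← e]; exact hj), cons₂, ← e]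
    · have e2 : orderSign 𝕜 i.succ (i.succAbove j).succ = orderSign 𝕜 i (i.succAbove j) := by
        simp [orderSign]
      rw [e2]
      congr 3
      funext k
      induction k using Fin.cases with
      | zero => simp
      | succ k => simp
    · intro k hk hk'
      rw [← e] at hk'
      induction k using Fin.cases with
      | zero => exact h0
      | succ k => exact hw k (fun e => hk (by rw [e])) fun e => hk' (by rw [e])

end Words

/-! ## Insertion of one multilinear map into another -/

section Nest

/-- The first `k` and the last `n - k` of `n` indices. -/
def splitIdx {n : ℕ} (k : Fin (n + 1)) : Fin k ⊕ Fin (n - k) ≃ Fin n :=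
  finSumFinEquiv.trans (finCongr (by omega))

theorem splitIdx_inl {n : ℕ} (k : Fin (n + 1)) (i : Fin k) :
    splitIdx k (inl i) = firstIdx k i := Fin.ext (by simp [splitIdx, firstIdx])

theorem splitIdx_inr {n : ℕ} (k : Fin (n + 1)) (i : Fin (n - k)) :
    splitIdx k (inr i) = lastIdx k i := Fin.ext (by simp [splitIdx, lastIdx])

theorem sum_first_last {M : Type} [AddCommMonoid M] {n : ℕ} (k : Fin (n + 1)) (f : Fin n → M) :
    ∑ i, f i = ∑ i, f (firstIdx k i) + ∑ i, f (lastIdx k i) := by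
  rw [← Equiv.sum_comp (splitIdx k), Fintype.sum_sum_type]
  simp only [splitIdx_inl, splitIdx_inr]

variable {𝕜 V W : Type} [Field 𝕜] [AddCommGroup V] [Module 𝕜 V] [AddCommGroup W] [Module 𝕜 W]
  {n : ℕ}

/-- The value of `φ(ℓ(v₁, …, vₖ), v_{k+1}, …, vₙ)` in terms of décalages. -/
def nestVal (k : Fin (n + 1)) (φ : MultilinearMap 𝕜 (fun _ : Fin (n - k + 1) => V) W)
    (ℓ : MultilinearMap 𝕜 (fun _ : Fin k => V) V) (a : Fin n → ℤ) (v : Fin n → V) : W :=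
  decalage φ (Fin.cons ((∑ i, a (firstIdx k i)) + 2 - k) fun i => a (lastIdx k i))
    (Fin.cons (decalage ℓ (fun i => a (firstIdx k i)) fun i => v (firstIdx k i))
      fun i => v (lastIdx k i))

/-- `nestVal` as a multilinear map. -/
def nestMap (k : Fin (n + 1)) (φ : MultilinearMap 𝕜 (fun _ : Fin (n - k + 1) => V) W)
    (ℓ : MultilinearMap 𝕜 (fun _ : Fin k => V) V) (a : Fin n → ℤ) :
    MultilinearMap 𝕜 (fun _ : Fin n => V) W :=
  (sgn 𝕜 (∑ i : Fin (n - k + 1), (((n - k + 1 : ℕ) : ℤ) - 1 - i) *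
      (Fin.cons ((∑ i, a (firstIdx k i)) + 2 - k) fun i => a (lastIdx k i) : Fin _ → ℤ) i)
    * sgn 𝕜 (∑ i : Fin k, (((k : ℕ) : ℤ) - 1 - i) * a (firstIdx k i))) •
  (MultilinearMap.uncurrySum (φ.curryLeft.compMultilinearMap ℓ)).domDomCongr (splitIdx k)

theorem nestMap_apply (k : Fin (n + 1)) (φ : MultilinearMap 𝕜 (fun _ : Fin (n - k + 1) => V) W)
    (ℓ : MultilinearMap 𝕜 (fun _ : Fin k => V) V) (a : Fin n → ℤ) (v : Fin n → V) :
    nestMap k φ ℓ a v = nestVal k φ ℓ a v := by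
  rw [nestMap, nestVal, decalage, decalage, smul_apply, mul_smul]
  congr 1
  have h := φ.cons_smul (fun i => v (lastIdx k i))
    (sgn 𝕜 (∑ i : Fin k, (((k : ℕ) : ℤ) - 1 - i) * a (firstIdx k i)))
    (ℓ fun i => v (firstIdx k i))
  rw [h]
  simp [MultilinearMap.uncurrySum_apply, splitIdx_inl, splitIdx_inr]

theorem decalage_mem {𝒱 : ℤ → Submodule 𝕜 V} {𝒲 : ℤ → Submodule 𝕜 W} {e : ℤ}
    (φ : MultilinearMap 𝕜 (fun _ : Fin n => V) W)
    (hφ : ∀ (a : Fin n → ℤ) (v : Fin n → V), (∀ i, v i ∈ 𝒱 (a i)) → φ v ∈ 𝒲 ((∑ i, a i) + e - n))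
    (a : Fin n → ℤ) (v : Fin n → V) (hv : ∀ i, v i ∈ 𝒱 (a i)) :
    decalage φ a v ∈ 𝒲 ((∑ i, a i) + e - n) :=
  Submodule.smul_mem _ _ (hφ a v hv)

theorem nestVal_mem {𝒱 : ℤ → Submodule 𝕜 V} {𝒲 : ℤ → Submodule 𝕜 W} {e : ℤ} (k : Fin (n + 1))
    (φ : MultilinearMap 𝕜 (fun _ : Fin (n - k + 1) => V) W)
    (ℓ : MultilinearMap 𝕜 (fun _ : Fin k => V) V)
    (hφ : ∀ (a : Fin (n - k + 1) → ℤ) (v : Fin (n - k + 1) → V), (∀ i, v i ∈ 𝒱 (a i)) →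
      φ v ∈ 𝒲 ((∑ i, a i) + e - (n - k + 1 : ℕ)))
    (hℓ : ∀ (a : Fin k → ℤ) (v : Fin k → V), (∀ i, v i ∈ 𝒱 (a i)) →
      ℓ v ∈ 𝒱 ((∑ i, a i) + 2 - (k : ℕ)))
    (a : Fin n → ℤ) (v : Fin n → V) (hv : ∀ i, v i ∈ 𝒱 (a i)) :
    nestVal k φ ℓ a v ∈ 𝒲 ((∑ i, a i) + 1 + e - n) := by
  have h := decalage_mem (𝒲 := 𝒲) φ hφ
    (Fin.cons ((∑ i, a (firstIdx k i)) + 2 - k) fun i => a (lastIdx k i))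
    (Fin.cons (decalage ℓ (fun i => a (firstIdx k i)) fun i => v (firstIdx k i))
      fun i => v (lastIdx k i)) (by
      intro i
      induction i using Fin.cases with
      | zero => exact decalage_mem ℓ hℓ _ _ fun i => hv _
      | succ i => exact hv _)
  rw [nestVal]
  convert h using 2
  rw [sum_univ_succ, sum_first_last k a]
  simp only [cons_zero, cons_succ]
  have := k.is_le
  push_cast [Nat.cast_sub this]
  ring

theorem nestVal_eq (k : Fin (n + 1)) (φ : MultilinearMap 𝕜 (fun _ : Fin (n - k + 1) => V) W)
    (ℓ : MultilinearMap 𝕜 (fun _ : Fin k => V) V) (a : Fin n → ℤ) (v : Fin n → V) :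
    nestVal k φ ℓ a v
      = (sgn 𝕜 (k * (n - k)) * sgn 𝕜 (∑ i : Fin n, ((n : ℤ) - 1 - i) * a i)) •
        φ (Fin.cons (ℓ fun i => v (firstIdx k i)) fun i => v (lastIdx k i)) := by
  have h := φ.cons_smul (fun i => v (lastIdx k i))
    (sgn 𝕜 (∑ i : Fin k, (((k : ℕ) : ℤ) - 1 - i) * a (firstIdx k i)))
    (ℓ fun i => v (firstIdx k i))
  rw [nestVal, decalage, decalage, h, smul_smul, ← sgn_add, ← sgn_add]
  congr 1
  apply sgn_congr
  rw [sum_univ_succ, sum_first_last k fun i : Fin n => ((n : ℤ) - 1 - i) * a i]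
  simp only [cons_zero, cons_succ, firstIdx, lastIdx, Fin.val_zero, Fin.val_succ]
  have hk := k.is_le
  push_cast [Nat.cast_sub hk]
  have e1 : ∑ i : Fin k, ((n : ℤ) - 1 - i) * a (firstIdx k i)
      = ∑ i : Fin k, ((k : ℤ) - 1 - i) * a (firstIdx k i)
        + ((n : ℤ) - k) * ∑ i : Fin k, a (firstIdx k i) := by
    rw [mul_sum, ← sum_add_distrib]
    exact sum_congr rfl fun i _ => by ring
  have e2 : ∑ i : Fin (n - k), ((n : ℤ) - k + 1 - 1 - (i + 1)) * a (lastIdx k i)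
      = ∑ i : Fin (n - k), ((n : ℤ) - 1 - (k + i)) * a (lastIdx k i) :=
    sum_congr rfl fun i _ => by ring
  simp only [firstIdx, lastIdx] at e1 e2
  rw [e1, e2]
  refine ⟨((n : ℤ) - k) * (1 - k), ?_⟩
  ring

theorem jacobi_term_eq (k : Fin (n + 1))
    (φ : MultilinearMap 𝕜 (fun _ : Fin (n - k + 1) => V) W)
    (ℓ : MultilinearMap 𝕜 (fun _ : Fin k => V) V) (a : Fin n → ℤ) (v : Fin n → V)
    (σ : Perm (Fin n)) (c : 𝕜) :
    (sgn 𝕜 (k * (n - k)) / c * ((Equiv.Perm.sign σ : ℤ) : 𝕜) * koszulSign 𝕜 a σ) •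
        φ (Fin.cons (ℓ fun i => v (σ (firstIdx k i))) fun i => v (σ (lastIdx k i)))
      = sgn 𝕜 (∑ i : Fin n, ((n : ℤ) - 1 - i) * a i) •
        ((koszulSign 𝕜 (fun i => a i - 1) σ / c) •
          nestVal k φ ℓ (fun i => a (σ i)) fun i => v (σ i)) := by
  rw [nestVal_eq k φ ℓ (fun i => a (σ i)) fun i => v (σ i), smul_smul, smul_smul]
  congr 1
  have h := sign_mul_koszulSign (𝕜 := 𝕜) a σ
  have h2 := sgn_mul_self (𝕜 := 𝕜) (∑ i : Fin n, ((n : ℤ) - 1 - i) * a (σ i))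
  calc _ = sgn 𝕜 (k * (n - k)) / c * (((Equiv.Perm.sign σ : ℤ) : 𝕜) * koszulSign 𝕜 a σ
          * sgn 𝕜 (∑ i : Fin n, ((n : ℤ) - 1 - i) * a (σ i)))
          * sgn 𝕜 (∑ i : Fin n, ((n : ℤ) - 1 - i) * a (σ i)) := by
        linear_combination -(sgn 𝕜 (k * (n - k)) / c * ((Equiv.Perm.sign σ : ℤ) : 𝕜)
          * koszulSign 𝕜 a σ) * h2
    _ = _ := by rw [h]; ring

end Nest

/-! ## Reduction of graded symmetrizations to words -/

section Reduction

/-- The word has gauge parameters `f r` at the positions `x r`, and the gauge field `A` elsewhere. -/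
structure IsWord {n N : ℕ} (w : Fin n → R ⊕ (Fin d → R)) (x : Fin N → Fin n) (f : Fin N → R)
    (A : Fin d → R) : Prop where
  mono : StrictMono x
  left : ∀ r, w (x r) = inl (f r)
  right : ∀ i, (∀ r, i ≠ x r) → w i = inr A

omit [CommRing R] in
theorem IsWord.sum_letterDeg {n N : ℕ} {w : Fin n → R ⊕ (Fin d → R)} {x : Fin N → Fin n}
    {f : Fin N → R} {A : Fin d → R} (h : IsWord w x f A) : ∑ i, letterDeg (w i) = n - N := by
  rw [AlmostPoisson.sum_letterDeg w (univ.map ⟨x, h.mono.injective⟩)]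
  · simp
  · intro i
    simp only [Finset.mem_map, mem_univ, true_and, Function.Embedding.coeFn_mk]
    constructor
    · rintro ⟨r, rfl⟩
      simp [h.left]
    · intro hi
      by_contra! h2
      rw [h.right i fun r e => h2 r e.symm] at hi
      exact absurd hi (by simp)

section

variable {n : ℕ} {w : Fin n → R ⊕ (Fin d → R)} {A : Fin d → R} (σ : Perm (Fin n))

omit [CommRing R] in
theorem IsWord.left_symm {N : ℕ} {x : Fin N → Fin n} {f : Fin N → R} (h : IsWord w x f A)
    (r : Fin N) : w (σ (σ.symm (x r))) = inl (f r) := by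
  rw [σ.apply_symm_apply, h.left]

omit [CommRing R] in
theorem IsWord.right_symm₁ {x : Fin 1 → Fin n} {f : Fin 1 → R} (h : IsWord w x f A) (i : Fin n)
    (h0 : i ≠ σ.symm (x 0)) : w (σ i) = inr A :=
  h.right _ (Fin.forall_fin_one.2 fun e => h0 (by rw [← e, σ.symm_apply_apply]))

omit [CommRing R] in
theorem IsWord.right_symm₂ {x : Fin 2 → Fin n} {f : Fin 2 → R} (h : IsWord w x f A) (i : Fin n)
    (h0 : i ≠ σ.symm (x 0)) (h1 : i ≠ σ.symm (x 1)) : w (σ i) = inr A :=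
  h.right _ (Fin.forall_fin_two.2 ⟨fun e => h0 (by rw [← e, σ.symm_apply_apply]),
    fun e => h1 (by rw [← e, σ.symm_apply_apply])⟩)

omit [CommRing R] in
theorem IsWord.koszulSign₁ {x : Fin 1 → Fin n} {f : Fin 1 → R} (h : IsWord w x f A) :
    koszulSign 𝕜 (fun i => letterDeg (w i) - 1) σ = 1 :=
  koszulSign_one_odd _ σ (x 0) fun z hz => by rw [h.right z (Fin.forall_fin_one.2 hz)]; rfl

omit [CommRing R] in
theorem IsWord.koszulSign₂ {x : Fin 2 → Fin n} {f : Fin 2 → R} (h : IsWord w x f A) :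
    koszulSign 𝕜 (fun i => letterDeg (w i) - 1) σ
      = orderSign 𝕜 (σ.symm (x 0)) (σ.symm (x 1)) :=
  koszulSign_two_odd _ σ (h.mono (by simp)) (by rw [h.left]; rfl) (by rw [h.left]; rfl)
    fun z h0 h1 => by rw [h.right z (Fin.forall_fin_two.2 ⟨h0, h1⟩)]; rfl

end

variable {n : ℕ} {W : Type} [AddCommGroup W] [Module 𝕜 W]
  (G : (Fin n → ℤ) → MultilinearMap 𝕜 (fun _ : Fin n => R × (Fin d → R)) W)

theorem altMap_eq_zero_of_words [CharZero 𝕜]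
    (hG : ∀ (N : ℕ) (w : Fin n → R ⊕ (Fin d → R)) (x : Fin N → Fin n) (f : Fin N → R)
      (A : Fin d → R), IsWord w x f A →
        altMap G (fun i => letterDeg (w i)) (fun i => letter (w i)) = 0)
    (a : Fin n → ℤ) (v : Fin n → R × (Fin d → R)) (hv : ∀ i, v i ∈ formGrading 𝕜 d R (a i)) :
    altMap G a v = 0 := by
  by_cases h0 : ∃ i, v i = 0
  · obtain ⟨i, hi⟩ := h0
    exact MultilinearMap.map_coord_zero _ i hi
  push Not at h0
  have ha : ∀ i, a i = 0 ∨ a i = 1 := by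
    intro i
    by_contra! h
    exact h0 i (formGrading_eq_zero (hv i) h.1 h.2)
  have e : v = fun i => if a i = 1 then (0, (v i).2) else ((v i).1, 0) := by
    funext i
    split_ifs with h
    · exact Prod.ext ((mem_formGrading.1 (hv i)).1 (by rw [h]; exact one_ne_zero)) rfl
    · exact Prod.ext rfl ((mem_formGrading.1 (hv i)).2 h)
  rw [e]
  refine altMap_eq_zero_of_diag G a (fun f A => ?_) (fun i => (v i).1) (fun i => (v i).2)
  let w : Fin n → R ⊕ (Fin d → R) := fun i => if a i = 1 then inr A else inl (f i)
  let s : Finset (Fin n) := univ.filter fun i => a i ≠ 1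
  have h := hG s.card w (s.orderEmbOfFin rfl) (fun r => f (s.orderEmbOfFin rfl r)) A
    ⟨(s.orderEmbOfFin rfl).strictMono, fun r => if_neg
      (mem_filter.1 (Finset.orderEmbOfFin_mem s rfl r)).2, fun i hi => if_pos (by
        by_contra h
        have h2 : i ∈ Set.range (s.orderEmbOfFin rfl) := by
          rw [Finset.range_orderEmbOfFin]
          simpa [s] using h
        obtain ⟨r, hr⟩ := h2
        exact hi r hr.symm)⟩
  convert h using 1
  congr 2
  · funext i
    rcases ha i with h | h <;> simp [w, h, letterDeg]
  · funext i
    simp only [w]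
    split_ifs <;> rfl

end Reduction

/-! ## Sums over permutations and subsets -/

section Subsets

variable {𝕜 W : Type} [Field 𝕜] [CharZero 𝕜] [AddCommGroup W] [Module 𝕜 W] {n : ℕ}

theorem sum_perm_eq_sum_subset (T : (k : Fin (n + 1)) → Perm (Fin n) → W)
    (ε : Perm (Fin n) → 𝕜) (F : ℕ → Finset (Fin n) → W)
    (hF : ∀ k σ, ε σ • T k σ = F k (univ.filter fun x => (σ.symm x : ℕ) < k)) :
    ∑ k : Fin (n + 1), ∑ σ : Perm (Fin n),
      (ε σ / ((k : ℕ).factorial * (n - k : ℕ).factorial)) • T k σ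
      = ∑ S ∈ powerset univ, F S.card S := by
  rw [Finset.sum_powerset, card_univ, Fintype.card_fin, sum_range]
  refine sum_congr rfl fun k _ => ?_
  have e : ∀ σ : Perm (Fin n),
      (ε σ / ((k : ℕ).factorial * (n - k : ℕ).factorial)) • T k σ
        = (((k : ℕ).factorial * (n - k : ℕ).factorial : ℕ) : 𝕜)⁻¹ •
          F k (univ.filter fun x => (σ.symm x : ℕ) < k) := by
    intro σ
    rw [← hF, smul_smul]
    push_cast
    congr 1
    ring
  simp only [e]
  rw [← smul_sum, sum_perm_prefix _ k.is_le, ← cast_smul_eq_nsmul 𝕜, smul_smul,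
    inv_mul_cancel₀ (Nat.cast_ne_zero.2 (mul_pos (Nat.factorial_pos _) (Nat.factorial_pos _)).ne'),
    one_smul]
  exact sum_congr rfl fun S hS => by rw [(Finset.mem_powersetCard.1 hS).2]

theorem sum_subset_one (x : Fin (n + 1)) (F : ℕ → Finset (Fin (n + 1)) → W) (F₀ F₁ : ℕ → W)
    (h₀ : ∀ k S, x ∉ S → F k S = F₀ k) (h₁ : ∀ k S, x ∈ S → F k S = F₁ k) :
    ∑ S ∈ powerset univ, F S.card S
      = ∑ j ∈ range (n + 1), n.choose j • (F₀ j + F₁ (j + 1)) := by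
  have e : (univ : Finset (Fin (n + 1))) = insert x (univ.erase x) := by simp
  have hY : (univ.erase x : Finset (Fin (n + 1))).card = n := by simp
  rw [e, sum_powerset_insert (notMem_erase _ _), ← sum_add_distrib,
    sum_congr rfl (g := fun S : Finset (Fin (n + 1)) => F₀ S.card + F₁ (S.card + 1)),
    sum_powerset_apply_card (fun j => F₀ j + F₁ (j + 1)), hY]
  intro S hS
  have hx : x ∉ S := fun h => notMem_erase x _ (mem_powerset.1 hS h)
  rw [h₀ _ _ hx, h₁ _ _ (mem_insert_self _ _), card_insert_of_notMem hx]

theorem sum_subset_two {x y : Fin (n + 2)} (hxy : x ≠ y) (F : ℕ → Finset (Fin (n + 2)) → W)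
    (F₀ F₁ F₂ F₃ : ℕ → W)
    (h₀ : ∀ k S, x ∉ S → y ∉ S → F k S = F₀ k) (h₁ : ∀ k S, x ∈ S → y ∉ S → F k S = F₁ k)
    (h₂ : ∀ k S, x ∉ S → y ∈ S → F k S = F₂ k) (h₃ : ∀ k S, x ∈ S → y ∈ S → F k S = F₃ k) :
    ∑ S ∈ powerset univ, F S.card S
      = ∑ j ∈ range (n + 1), n.choose j •
          (F₀ j + F₁ (j + 1) + F₂ (j + 1) + F₃ (j + 2)) := by
  let Y : Finset (Fin (n + 2)) := (univ.erase x).erase y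
  have e : (univ : Finset (Fin (n + 2))) = insert x (insert y Y) := by
    ext z; simp only [Y, mem_univ, mem_insert, mem_erase]; tauto
  have hxY : x ∉ Y := by simp [Y]
  have hyY : y ∉ Y := by simp [Y]
  have hY : Y.card = n := by
    simp only [Y]
    rw [card_erase_of_mem (by simp [hxy.symm]), card_erase_of_mem (by simp)]
    simp
  have hx' : x ∉ insert y Y := by simp [hxY, hxy]
  rw [e, sum_powerset_insert hx', sum_powerset_insert hyY,
    sum_powerset_insert hyY, ← sum_add_distrib, ← sum_add_distrib,
    ← sum_add_distrib,
    sum_congr rfl (g := fun S : Finset (Fin (n + 2)) =>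
      F₀ S.card + F₁ (S.card + 1) + F₂ (S.card + 1) + F₃ (S.card + 2)),
    sum_powerset_apply_card (fun j => F₀ j + F₁ (j + 1) + F₂ (j + 1) + F₃ (j + 2)), hY]
  intro S hS
  have hx : x ∉ S := fun h => hxY (mem_powerset.1 hS h)
  have hy : y ∉ S := fun h => hyY (mem_powerset.1 hS h)
  have hx2 : x ∉ insert y S := by simp [hx, hxy]
  rw [card_insert_of_notMem hx2, card_insert_of_notMem hx,
    card_insert_of_notMem hy, h₀ _ _ hx hy, h₁ _ (insert x S) (by simp) (by simp [hy, hxy.symm]),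
    h₂ _ (insert y S) hx2 (by simp), h₃ _ (insert x (insert y S)) (by simp) (by simp)]
  abel

theorem sum_subset_three {x y z : Fin (n + 3)} (hxy : x ≠ y) (hxz : x ≠ z) (hyz : y ≠ z)
    (F : ℕ → Finset (Fin (n + 3)) → W) (Fx Fy Fz Fxy Fxz Fyz : ℕ → W)
    (h₀ : ∀ k S, x ∉ S → y ∉ S → z ∉ S → F k S = 0)
    (h₁ : ∀ k S, x ∈ S → y ∉ S → z ∉ S → F k S = Fx k)
    (h₂ : ∀ k S, x ∉ S → y ∈ S → z ∉ S → F k S = Fy k)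
    (h₃ : ∀ k S, x ∉ S → y ∉ S → z ∈ S → F k S = Fz k)
    (h₄ : ∀ k S, x ∈ S → y ∈ S → z ∉ S → F k S = Fxy k)
    (h₅ : ∀ k S, x ∈ S → y ∉ S → z ∈ S → F k S = Fxz k)
    (h₆ : ∀ k S, x ∉ S → y ∈ S → z ∈ S → F k S = Fyz k)
    (h₇ : ∀ k S, x ∈ S → y ∈ S → z ∈ S → F k S = 0) :
    ∑ S ∈ powerset univ, F S.card S
      = ∑ j ∈ range (n + 1), n.choose j •
          (Fx (j + 1) + Fy (j + 1) + Fz (j + 1) + Fxy (j + 2) + Fxz (j + 2) + Fyz (j + 2)) := by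
  let Y : Finset (Fin (n + 3)) := ((univ.erase x).erase y).erase z
  have e : (univ : Finset (Fin (n + 3))) = insert x (insert y (insert z Y)) := by
    ext u; simp only [Y, mem_univ, mem_insert, mem_erase]; tauto
  have hxY : x ∉ Y := by simp [Y]
  have hyY : y ∉ Y := by simp [Y]
  have hzY : z ∉ Y := by simp [Y]
  have hY : Y.card = n := by
    simp only [Y]
    rw [card_erase_of_mem (by simp [hxz.symm, hyz.symm]),
      card_erase_of_mem (by simp [hxy.symm]), card_erase_of_mem (by simp)]
    simp
  have hx' : x ∉ insert y (insert z Y) := by simp [hxY, hxy, hxz]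
  have hy' : y ∉ insert z Y := by simp [hyY, hyz]
  rw [e, sum_powerset_insert hx', sum_powerset_insert hy',
    sum_powerset_insert hzY, sum_powerset_insert hzY, sum_powerset_insert hy',
    sum_powerset_insert hzY, sum_powerset_insert hzY]
  simp only [← sum_add_distrib]
  rw [sum_congr rfl (g := fun S : Finset (Fin (n + 3)) =>
      Fx (S.card + 1) + Fy (S.card + 1) + Fz (S.card + 1) + Fxy (S.card + 2) + Fxz (S.card + 2)
        + Fyz (S.card + 2)),
    sum_powerset_apply_card
      (fun j => Fx (j + 1) + Fy (j + 1) + Fz (j + 1) + Fxy (j + 2) + Fxz (j + 2) + Fyz (j + 2)), hY]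
  intro S hS
  have hx : x ∉ S := fun h => hxY (mem_powerset.1 hS h)
  have hy : y ∉ S := fun h => hyY (mem_powerset.1 hS h)
  have hz : z ∉ S := fun h => hzY (mem_powerset.1 hS h)
  have hxy' : x ∉ insert y S := by simp [hx, hxy]
  have hxz' : x ∉ insert z S := by simp [hx, hxz]
  have hyz' : y ∉ insert z S := by simp [hy, hyz]
  rw [h₀ _ _ hx hy hz, h₁ _ (insert x S) (by simp) (by simp [hy, hxy.symm]) (by simp [hz, hxz.symm]),
    h₂ _ (insert y S) hxy' (by simp) (by simp [hz, hyz.symm]),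
    h₃ _ (insert z S) hxz' hyz' (by simp),
    h₄ _ (insert x (insert y S)) (by simp) (by simp) (by simp [hz, hxz.symm, hyz.symm]),
    h₅ _ (insert x (insert z S)) (by simp) (by simp [hy, hxy.symm, hyz]) (by simp),
    h₆ _ (insert y (insert z S)) (by simp [hx, hxy, hxz]) (by simp) (by simp),
    h₇ _ (insert x (insert y (insert z S))) (by simp) (by simp) (by simp),
    card_insert_of_notMem hxy', card_insert_of_notMem hxz',
    card_insert_of_notMem hyz', card_insert_of_notMem hx,
    card_insert_of_notMem hy, card_insert_of_notMem hz]
  abel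

end Subsets

/-! ## Homotopy Jacobi identities on words -/

section NestWords

variable {n : ℕ} (k : Fin (n + 1))
  (φ : MultilinearMap 𝕜 (fun _ : Fin (n - k + 1) => R × (Fin d → R)) (R × (Fin d → R)))

/-- `nestVal` on a word. -/
def nestWord (ℓ : MultilinearMap 𝕜 (fun _ : Fin k => R × (Fin d → R)) (R × (Fin d → R)))
    (u : Fin n → R ⊕ (Fin d → R)) : R × (Fin d → R) :=
  nestVal k φ ℓ (fun i => letterDeg (u i)) fun i => letter (u i)

theorem nestWord_of_inner
    {ℓ : MultilinearMap 𝕜 (fun _ : Fin k => R × (Fin d → R)) (R × (Fin d → R))}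
    (u : Fin n → R ⊕ (Fin d → R)) (c : 𝕜) (y : R ⊕ (Fin d → R))
    (hin : wordVal ℓ (fun i => u (firstIdx k i)) = c • letter y)
    (hdeg : ∑ i, letterDeg (u (firstIdx k i)) + 2 - k = letterDeg y) :
    nestWord k φ ℓ u = c • wordVal φ (Fin.cons y fun i => u (lastIdx k i)) := by
  rw [wordVal] at hin
  have h := φ.cons_smul (fun i => letter (u (lastIdx k i))) c (letter y)
  have e1 : (Fin.cons (letterDeg y) fun i => letterDeg (u (lastIdx k i)) : Fin (n - k + 1) → ℤ)
      = fun i => letterDeg ((Fin.cons y fun i => u (lastIdx k i) : Fin (n - k + 1) → _) i) := by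
    funext i
    induction i using Fin.cases <;> rfl
  have e2 : (Fin.cons (letter y) fun i => letter (u (lastIdx k i)) :
        Fin (n - k + 1) → R × (Fin d → R))
      = fun i => letter ((Fin.cons y fun i => u (lastIdx k i) : Fin (n - k + 1) → _) i) := by
    funext i
    induction i using Fin.cases <;> rfl
  rw [nestWord, nestVal, hdeg, hin, decalage, h, wordVal, decalage, smul_comm c, e1, e2]

theorem nestWord_of_inner_zero
    {ℓ : MultilinearMap 𝕜 (fun _ : Fin k => R × (Fin d → R)) (R × (Fin d → R))}
    (u : Fin n → R ⊕ (Fin d → R)) (hin : wordVal ℓ (fun i => u (firstIdx k i)) = 0) :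
    nestWord k φ ℓ u = 0 := by
  rw [wordVal] at hin
  rw [nestWord, nestVal, hin, decalage, φ.map_coord_zero 0 rfl, smul_zero]

variable {ℓ : OperationFamily 𝕜 d R}
  (hskew : ∀ n, IsGradedSkew (ℓ n)) (hdeg : ∀ n, IsBracketDegree (ℓ n))
  (u : Fin n → R ⊕ (Fin d → R)) (A : Fin d → R)

include hdeg in
theorem nestWord_none (hu : ∀ i : Fin n, (i : ℕ) < k → u i = inr A) :
    nestWord k φ (ℓ k) u = 0 :=
  nestWord_of_inner_zero k φ u
    (wordVal_zero_param (hdeg k) _ (fun _ => A) fun i => hu (firstIdx k i) i.2)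

include hdeg in
theorem nestWord_three (x y z : Fin n) (hxy : x ≠ y) (hxz : x ≠ z) (hyz : y ≠ z)
    (hx : (x : ℕ) < k) (hy : (y : ℕ) < k) (hz : (z : ℕ) < k) (ux : (u x).isLeft)
    (uy : (u y).isLeft) (uz : (u z).isLeft) : nestWord k φ (ℓ k) u = 0 := by
  refine nestWord_of_inner_zero k φ u (wordVal_three_param (hdeg k) _
    (univ.filter fun i => (u (firstIdx k i)).isLeft) (by simp) ?_)
  rw [show (3 : ℕ) = ({⟨x, hx⟩, ⟨y, hy⟩, ⟨z, hz⟩} : Finset (Fin k)).card from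
    (Finset.card_eq_three.2 ⟨_, _, _, by simpa [Fin.ext_iff] using hxy,
      by simpa [Fin.ext_iff] using hxz, by simpa [Fin.ext_iff] using hyz, rfl⟩).symm]
  refine Finset.card_le_card ?_
  rw [insert_subset_iff, insert_subset_iff, Finset.singleton_subset_iff]
  simp only [mem_filter, mem_univ, true_and]
  exact ⟨ux, uy, uz⟩

include hskew hdeg in
theorem nestWord_one (x : Fin n) (hx : (x : ℕ) < k) (f : R) (ux : u x = inl f)
    (hu : ∀ i : Fin n, (i : ℕ) < k → i ≠ x → u i = inr A) :
    nestWord k φ (ℓ k) u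
      = wordVal φ (Fin.cons (inr (diag₁ ℓ (k - 1) f A)) fun i => u (lastIdx k i)) := by
  have hu' : ∀ i : Fin k, i ≠ ⟨x, hx⟩ → u (firstIdx k i) = inr A := fun i hi =>
    hu _ i.2 fun e => hi (Fin.ext (show (i : ℕ) = x from congrArg Fin.val e))
  rw [nestWord_of_inner k φ u 1 (inr (diag₁ ℓ (k - 1) f A)), one_smul]
  · rw [one_smul, wordVal_diag₁ hskew hdeg (fun i => u (firstIdx k i)) ⟨x, hx⟩ f A ux hu']
    rfl
  · rw [sum_letterDeg (fun i => u (firstIdx k i)) {⟨x, hx⟩}]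
    · simp [letterDeg]
      ring
    · intro i
      rw [mem_singleton]
      by_cases h : i = ⟨x, hx⟩
      · subst h
        simp [firstIdx, ux]
      · simp [h, hu' i h]

include hskew hdeg in
theorem nestWord_two (x y : Fin n) (hxy : x ≠ y) (hx : (x : ℕ) < k) (hy : (y : ℕ) < k) (f g : R)
    (ux : u x = inl f) (uy : u y = inl g)
    (hu : ∀ i : Fin n, (i : ℕ) < k → i ≠ x → i ≠ y → u i = inr A) :
    nestWord k φ (ℓ k) u = orderSign 𝕜 x y •
      wordVal φ (Fin.cons (inl (diag₂ ℓ (k - 2) f g A)) fun i => u (lastIdx k i)) := by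
  have hu' : ∀ i : Fin k, i ≠ ⟨x, hx⟩ → i ≠ ⟨y, hy⟩ → u (firstIdx k i) = inr A :=
    fun i hi hi' => hu _ i.2 (fun e => hi (Fin.ext (show (i : ℕ) = x from congrArg Fin.val e)))
      fun e => hi' (Fin.ext (show (i : ℕ) = y from congrArg Fin.val e))
  have hne : (⟨x, hx⟩ : Fin k) ≠ ⟨y, hy⟩ := fun e => hxy (Fin.ext (Fin.mk.inj_iff.1 e))
  rw [nestWord_of_inner k φ u (orderSign 𝕜 x y) (inl (diag₂ ℓ (k - 2) f g A))]
  · rw [wordVal_diag₂ hskew hdeg (fun i => u (firstIdx k i)) ⟨x, hx⟩ ⟨y, hy⟩ hne f g A ux uy hu']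
    rfl
  · rw [sum_letterDeg (fun i => u (firstIdx k i)) {⟨x, hx⟩, ⟨y, hy⟩}]
    · simp [letterDeg, Finset.card_pair hne]
    · intro i
      rw [mem_insert, mem_singleton]
      by_cases h : i = ⟨x, hx⟩
      · subst h
        simp [firstIdx, ux]
      · by_cases h' : i = ⟨y, hy⟩
        · subst h'
          simp [firstIdx, uy]
        · simp [h, h', hu' i h h']

theorem lastIdx_sub {x : Fin n} (hx : ¬(x : ℕ) < k) :
    lastIdx k ⟨x - k, by omega⟩ = x := Fin.ext (by simp [lastIdx]; omega)

theorem orderSign_of_lt {m : ℕ} {i j : Fin m} (h : i < j) : orderSign 𝕜 i j = 1 := if_pos h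

theorem orderSign_of_gt {m : ℕ} {i j : Fin m} (h : j < i) : orderSign 𝕜 i j = -1 :=
  if_neg h.not_gt

theorem orderSign_mul_self {m : ℕ} (i j : Fin m) :
    orderSign 𝕜 i j * orderSign 𝕜 i j = 1 := by
  rw [orderSign]; split_ifs <;> simp

end NestWords

section Jacobi

variable {n : ℕ} (k : Fin (n + 1))
  {ℓ : OperationFamily 𝕜 d R}
  (hskew : ∀ n, IsGradedSkew (ℓ n)) (hdeg : ∀ n, IsBracketDegree (ℓ n))
  (u : Fin n → R ⊕ (Fin d → R)) (A : Fin d → R)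

include hskew hdeg in
theorem nestWord_one_of_two (x y : Fin n) (hx : (x : ℕ) < k) (hy : ¬(y : ℕ) < k) (f g : R)
    (ux : u x = inl f) (uy : u y = inl g)
    (hu : ∀ i : Fin n, i ≠ x → i ≠ y → u i = inr A) :
    nestWord k (ℓ (n - k + 1)) (ℓ k) u
      = (0, cons₁ ℓ (n - k - 1) g (diag₁ ℓ (k - 1) f A) A) := by
  rw [nestWord_one k _ hskew hdeg u A x hx f ux fun i hi hix =>
    hu i hix fun e => hy (e ▸ hi)]
  refine wordVal_cons₁ hskew hdeg _ ⟨y - k, by omega⟩ g _ A rfl ?_ ?_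
  · rw [cons_succ, lastIdx_sub k hy, uy]
  · intro i hi
    rw [cons_succ]
    refine hu _ (fun e => ?_) fun e => hi ?_
    · rw [← e] at hx; simp [lastIdx] at hx
    · apply Fin.ext; simp [← e, lastIdx]

include hskew hdeg in
theorem nestWord_two_of_two (x y : Fin n) (hxy : x ≠ y) (hx : (x : ℕ) < k) (hy : (y : ℕ) < k)
    (f g : R) (ux : u x = inl f) (uy : u y = inl g)
    (hu : ∀ i : Fin n, i ≠ x → i ≠ y → u i = inr A) :
    nestWord k (ℓ (n - k + 1)) (ℓ k) u
      = orderSign 𝕜 x y • (0, diag₁ ℓ (n - k) (diag₂ ℓ (k - 2) f g A) A) := by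
  rw [nestWord_two k _ hskew hdeg u A x y hxy hx hy f g ux uy fun i _ => hu i,
    wordVal_diag₁ hskew hdeg _ 0 (diag₂ ℓ (k - 2) f g A) A rfl]
  · rfl
  · intro i hi
    obtain ⟨i, rfl⟩ := exists_succ_eq_of_ne_zero hi
    rw [cons_succ]
    exact hu _ (fun e => by rw [← e] at hx; simp [lastIdx] at hx)
      fun e => by rw [← e] at hy; simp [lastIdx] at hy

include hskew hdeg in
theorem nestWord_one_of_three (x y z : Fin n) (hyz : y ≠ z) (hx : (x : ℕ) < k)
    (hy : ¬(y : ℕ) < k) (hz : ¬(z : ℕ) < k) (f g h : R)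
    (ux : u x = inl f) (uy : u y = inl g) (uz : u z = inl h)
    (hu : ∀ i : Fin n, i ≠ x → i ≠ y → i ≠ z → u i = inr A) :
    nestWord k (ℓ (n - k + 1)) (ℓ k) u
      = orderSign 𝕜 y z • (cons₂ ℓ (n - k - 2) g h (diag₁ ℓ (k - 1) f A) A, 0) := by
  rw [nestWord_one k _ hskew hdeg u A x hx f ux fun i hi hix =>
    hu i hix (fun e => hy (e ▸ hi)) fun e => hz (e ▸ hi)]
  rw [wordVal_cons₂ hskew hdeg _ ⟨y - k, by omega⟩ ⟨z - k, by omega⟩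
    (fun e => hyz (Fin.ext (by simp at e; omega))) g h (diag₁ ℓ (k - 1) f A) A rfl]
  · congr 1
    simp only [orderSign, lt_def]
    refine if_congr ?_ rfl rfl
    omega
  · rw [cons_succ, lastIdx_sub k hy, uy]
  · rw [cons_succ, lastIdx_sub k hz, uz]
  · intro i hi hi'
    rw [cons_succ]
    refine hu _ (fun e => ?_) (fun e => hi ?_) fun e => hi' ?_
    · rw [← e] at hx; simp [lastIdx] at hx
    · apply Fin.ext; simp [← e, lastIdx]
    · apply Fin.ext; simp [← e, lastIdx]

include hskew hdeg in
theorem nestWord_two_of_three (x y z : Fin n) (hxy : x ≠ y) (hx : (x : ℕ) < k)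
    (hy : (y : ℕ) < k) (hz : ¬(z : ℕ) < k) (f g h : R)
    (ux : u x = inl f) (uy : u y = inl g) (uz : u z = inl h)
    (hu : ∀ i : Fin n, i ≠ x → i ≠ y → i ≠ z → u i = inr A) :
    nestWord k (ℓ (n - k + 1)) (ℓ k) u
      = orderSign 𝕜 x y • (diag₂ ℓ (n - k - 1) (diag₂ ℓ (k - 2) f g A) h A, 0) := by
  have hl : lastIdx k ⟨z - k, by omega⟩ = z := lastIdx_sub k hz
  rw [nestWord_two k _ hskew hdeg u A x y hxy hx hy f g ux uy fun i hi hix hiy =>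
      hu i hix hiy fun e => hz (e ▸ hi),
    wordVal_diag₂ hskew hdeg _ 0 (Fin.succ ⟨z - k, by omega⟩) (Fin.succ_ne_zero _).symm
      (diag₂ ℓ (k - 2) f g A) h A rfl (by rw [cons_succ, hl, uz]),
    orderSign_of_lt (Fin.succ_pos _), one_smul]
  · rfl
  · intro i hi hi'
    obtain ⟨i, rfl⟩ := exists_succ_eq_of_ne_zero hi
    rw [cons_succ]
    refine hu _ (fun e => ?_) (fun e => ?_) fun e => hi' ?_
    · rw [← e] at hx; simp [lastIdx] at hx
    · rw [← e] at hy; simp [lastIdx] at hy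
    · congr 1; apply Fin.ext; simp [← e, lastIdx]

end Jacobi

section Criterion

variable [CharZero 𝕜]
  (ℓ : OperationFamily 𝕜 d R)

/-- The homotopy Jacobi identities with two gauge parameters. -/
def ClosureIdentity : Prop := ∀ (f g : R) (A : Fin d → R) (m : ℕ),
  ∑ j ∈ range (m + 1), m.choose j • (cons₁ ℓ (m - j) g (diag₁ ℓ j f A) A
    - cons₁ ℓ (m - j) f (diag₁ ℓ j g A) A + diag₁ ℓ (m - j) (diag₂ ℓ j f g A) A) = 0

/-- The homotopy Jacobi identities with three gauge parameters. -/
def ParameterIdentity : Prop := ∀ (f g h : R) (A : Fin d → R) (m : ℕ),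
  ∑ j ∈ range (m + 1), m.choose j • (cons₂ ℓ (m - j) g h (diag₁ ℓ j f A) A
    - cons₂ ℓ (m - j) f h (diag₁ ℓ j g A) A + cons₂ ℓ (m - j) f g (diag₁ ℓ j h A) A
    + diag₂ ℓ (m - j) (diag₂ ℓ j f g A) h A - diag₂ ℓ (m - j) (diag₂ ℓ j f h A) g A
    + diag₂ ℓ (m - j) (diag₂ ℓ j g h A) f A) = 0

variable {ℓ} (hskew : ∀ n, IsGradedSkew (ℓ n)) (hdeg : ∀ n, IsBracketDegree (ℓ n)) {n : ℕ}

/-- The sum over permutations in the homotopy Jacobi identity, on a word. -/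
def jacobiSum (ℓ : OperationFamily 𝕜 d R)
    (w : Fin n → R ⊕ (Fin d → R)) : R × (Fin d → R) :=
  ∑ k : Fin (n + 1), ∑ σ : Perm (Fin n),
    (koszulSign 𝕜 (fun i => letterDeg (w i) - 1) σ /
      ((k : ℕ).factorial * (n - k : ℕ).factorial)) •
      nestWord k (ℓ (n - k + 1)) (ℓ k) fun i => w (σ i)

include hskew hdeg in
theorem jacobiSum_two (h2 : ClosureIdentity ℓ) {w : Fin n → R ⊕ (Fin d → R)} {x : Fin 2 → Fin n}
    {f : Fin 2 → R} {A : Fin d → R} (hw : IsWord w x f A) : jacobiSum ℓ w = 0 := by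
  have hxy : x 0 < x 1 := hw.mono (by simp)
  obtain ⟨m, rfl⟩ : ∃ m, n = m + 2 := by
    have := (x 0).2; have := (x 1).2; rw [lt_def] at hxy
    exact ⟨n - 2, by omega⟩
  let F : ℕ → Finset (Fin (m + 2)) → R × (Fin d → R) := fun k S =>
    if x 0 ∈ S then if x 1 ∈ S then (0, diag₁ ℓ (m + 2 - k) (diag₂ ℓ (k - 2) (f 0) (f 1) A) A)
      else (0, cons₁ ℓ (m + 2 - k - 1) (f 1) (diag₁ ℓ (k - 1) (f 0) A) A)
    else if x 1 ∈ S then -(0, cons₁ ℓ (m + 2 - k - 1) (f 0) (diag₁ ℓ (k - 1) (f 1) A) A)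
      else 0
  rw [jacobiSum, sum_perm_eq_sum_subset _ _ F]
  · rw [sum_subset_two hxy.ne F (fun _ => 0)
      (fun k => (0, cons₁ ℓ (m + 2 - k - 1) (f 1) (diag₁ ℓ (k - 1) (f 0) A) A))
      (fun k => -(0, cons₁ ℓ (m + 2 - k - 1) (f 0) (diag₁ ℓ (k - 1) (f 1) A) A))
      (fun k => (0, diag₁ ℓ (m + 2 - k) (diag₂ ℓ (k - 2) (f 0) (f 1) A) A))]
    · have h := h2 (f 0) (f 1) A m
      refine Prod.ext ?_ ?_
      · simp [Prod.fst_sum]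
      · rw [Prod.snd_sum]
        refine Eq.trans (sum_congr rfl fun j hj => ?_) h
        have hj := mem_range.1 hj
        simp only [Prod.snd_add, Prod.smul_snd, Prod.snd_neg, zero_add]
        rw [show m + 2 - (j + 1) - 1 = m - j by omega, show m + 2 - (j + 2) = m - j by omega,
          show j + 1 - 1 = j by omega, show j + 2 - 2 = j by omega, sub_eq_add_neg]
    all_goals intro k S h1 h2; simp [F, h1, h2]
  · intro k σ
    have hs : σ.symm (x 0) ≠ σ.symm (x 1) := fun e => hxy.ne (σ.symm.injective e)
    have u0 := hw.left_symm σ 0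
    have u1 := hw.left_symm σ 1
    have hu := hw.right_symm₂ σ
    rw [hw.koszulSign₂ σ]
    simp only [F, mem_filter, mem_univ, true_and]
    split_ifs with h0 h1 h1
    · rw [nestWord_two_of_two k hskew hdeg _ A _ _ hs h0 h1 _ _ u0 u1 hu, smul_smul,
        orderSign_mul_self, one_smul]
    · rw [nestWord_one_of_two k hskew hdeg _ A _ _ h0 h1 _ _ u0 u1 hu,
        orderSign_of_lt (by rw [lt_def]; omega), one_smul]
    · rw [nestWord_one_of_two k hskew hdeg _ A _ _ h1 h0 _ _ u1 u0 fun i h h' => hu i h' h,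
        orderSign_of_gt (by rw [lt_def]; omega), neg_one_smul]
    · rw [nestWord_none k _ hdeg _ A, smul_zero]
      exact fun i hi => hu i (fun e => h0 (e ▸ hi)) fun e => h1 (e ▸ hi)

include hskew hdeg in
theorem jacobiSum_three (h3 : ParameterIdentity ℓ) {w : Fin n → R ⊕ (Fin d → R)}
    {x : Fin 3 → Fin n} {f : Fin 3 → R} {A : Fin d → R} (hw : IsWord w x f A) :
    jacobiSum ℓ w = 0 := by
  have h01 : x 0 < x 1 := hw.mono (by simp)
  have h12 : x 1 < x 2 := hw.mono (by decide)
  have h02 := h01.trans h12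
  have hr : ∀ i, i ≠ x 0 → i ≠ x 1 → i ≠ x 2 → w i = inr A := fun i h0 h1 h2 =>
    hw.right i (by intro r; fin_cases r; exacts [h0, h1, h2])
  obtain ⟨m, rfl⟩ : ∃ m, n = m + 3 := by
    have := (x 2).2; rw [lt_def] at h01 h12
    exact ⟨n - 3, by omega⟩
  let F : ℕ → Finset (Fin (m + 3)) → R × (Fin d → R) := fun k S =>
    ((if x 0 ∈ S then
      if x 1 ∈ S then
        if x 2 ∈ S then 0 else diag₂ ℓ (m + 3 - k - 1) (diag₂ ℓ (k - 2) (f 0) (f 1) A) (f 2) A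
      else
        if x 2 ∈ S then -diag₂ ℓ (m + 3 - k - 1) (diag₂ ℓ (k - 2) (f 0) (f 2) A) (f 1) A
        else cons₂ ℓ (m + 3 - k - 2) (f 1) (f 2) (diag₁ ℓ (k - 1) (f 0) A) A
    else
      if x 1 ∈ S then
        if x 2 ∈ S then diag₂ ℓ (m + 3 - k - 1) (diag₂ ℓ (k - 2) (f 1) (f 2) A) (f 0) A
        else -cons₂ ℓ (m + 3 - k - 2) (f 0) (f 2) (diag₁ ℓ (k - 1) (f 1) A) A
      else
        if x 2 ∈ S then cons₂ ℓ (m + 3 - k - 2) (f 0) (f 1) (diag₁ ℓ (k - 1) (f 2) A) A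
        else 0 : R), (0 : Fin d → R))
  rw [jacobiSum, sum_perm_eq_sum_subset _ _ F]
  · rw [sum_subset_three h01.ne h02.ne h12.ne F
      (fun k => (cons₂ ℓ (m + 3 - k - 2) (f 1) (f 2) (diag₁ ℓ (k - 1) (f 0) A) A, 0))
      (fun k => (-cons₂ ℓ (m + 3 - k - 2) (f 0) (f 2) (diag₁ ℓ (k - 1) (f 1) A) A, 0))
      (fun k => (cons₂ ℓ (m + 3 - k - 2) (f 0) (f 1) (diag₁ ℓ (k - 1) (f 2) A) A, 0))
      (fun k => (diag₂ ℓ (m + 3 - k - 1) (diag₂ ℓ (k - 2) (f 0) (f 1) A) (f 2) A, 0))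
      (fun k => (-diag₂ ℓ (m + 3 - k - 1) (diag₂ ℓ (k - 2) (f 0) (f 2) A) (f 1) A, 0))
      (fun k => (diag₂ ℓ (m + 3 - k - 1) (diag₂ ℓ (k - 2) (f 1) (f 2) A) (f 0) A, 0))]
    · have h := h3 (f 0) (f 1) (f 2) A m
      refine Prod.ext ?_ ?_
      · rw [Prod.fst_sum]
        refine Eq.trans (sum_congr rfl fun j hj => ?_) h
        have hj := mem_range.1 hj
        simp only [Prod.fst_add, Prod.smul_fst]
        rw [show m + 3 - (j + 1) - 2 = m - j by omega, show m + 3 - (j + 2) - 1 = m - j by omega,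
          show j + 1 - 1 = j by omega, show j + 2 - 2 = j by omega, sub_eq_add_neg, sub_eq_add_neg]
      · simp [Prod.snd_sum]
    all_goals intro k S h1 h2 h3; simp [F, h1, h2, h3]
  · intro k σ
    have hs : ∀ {i j}, i < j → σ.symm i ≠ σ.symm j := fun h e => h.ne (σ.symm.injective e)
    have u : ∀ r, w (σ (σ.symm (x r))) = inl (f r) := fun r => by
      rw [σ.apply_symm_apply, hw.left]
    have hu : ∀ i, i ≠ σ.symm (x 0) → i ≠ σ.symm (x 1) → i ≠ σ.symm (x 2) →
        w (σ i) = inr A := fun i h0 h1 h2 =>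
      hr _ (fun e => h0 (by rw [← e, σ.symm_apply_apply]))
        (fun e => h1 (by rw [← e, σ.symm_apply_apply]))
        fun e => h2 (by rw [← e, σ.symm_apply_apply])
    rw [koszulSign_three_odd _ σ h01 h12 (by rw [hw.left]; rfl) (by rw [hw.left]; rfl)
      (by rw [hw.left]; rfl) (fun z h0 h1 h2 => by rw [hr z h0 h1 h2]; rfl)]
    simp only [F, mem_filter, mem_univ, true_and]
    have lt : ∀ {i j : Fin (m + 3)}, (i : ℕ) < k → ¬(j : ℕ) < k → i < j := fun h h' => by
      rw [lt_def]; omega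
    have sq := orderSign_mul_self (𝕜 := 𝕜) (m := m + 3)
    have neg_fst : ∀ a : R, ((-a : R), (0 : Fin d → R)) = (-1 : 𝕜) • (a, (0 : Fin d → R)) :=
      fun a => by simp
    split_ifs with h0 h1 h2 h2 h1 h2 h2
    · rw [nestWord_three k _ hdeg _ _ _ _ (hs h01) (hs h02) (hs h12) h0 h1 h2 (by rw [u]; rfl)
        (by rw [u]; rfl) (by rw [u]; rfl), smul_zero]
      rfl
    · rw [nestWord_two_of_three k hskew hdeg _ A _ _ _ (hs h01) h0 h1 h2 _ _ _ (u 0) (u 1) (u 2) hu,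
        smul_smul, orderSign_of_lt (lt h0 h2), orderSign_of_lt (lt h1 h2), mul_one, mul_one, sq,
        one_smul]
    · rw [nestWord_two_of_three k hskew hdeg _ A _ _ _ (hs h02) h0 h2 h1 _ _ _ (u 0) (u 2) (u 1)
        fun i ha hb hc => hu i ha hc hb, smul_smul, orderSign_of_lt (lt h0 h1),
        orderSign_of_gt (lt h2 h1), neg_fst, one_mul, mul_neg_one, neg_mul, sq]
    · rw [nestWord_one_of_three k hskew hdeg _ A _ _ _ (hs h12) h0 h1 h2 _ _ _ (u 0) (u 1) (u 2) hu,
        smul_smul, orderSign_of_lt (lt h0 h1), orderSign_of_lt (lt h0 h2), one_mul, one_mul, sq,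
        one_smul]
    · rw [nestWord_two_of_three k hskew hdeg _ A _ _ _ (hs h12) h1 h2 h0 _ _ _ (u 1) (u 2) (u 0)
        fun i ha hb hc => hu i hc ha hb, smul_smul, orderSign_of_gt (lt h1 h0),
        orderSign_of_gt (lt h2 h0), neg_mul_neg, one_mul, one_mul, sq, one_smul]
    · rw [nestWord_one_of_three k hskew hdeg _ A _ _ _ (hs h02) h1 h0 h2 _ _ _ (u 1) (u 0) (u 2)
        fun i ha hb hc => hu i hb ha hc, smul_smul, orderSign_of_gt (lt h1 h0),
        orderSign_of_lt (lt h1 h2), neg_fst, mul_one, mul_assoc, sq, mul_one]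
    · rw [nestWord_one_of_three k hskew hdeg _ A _ _ _ (hs h01) h2 h0 h1 _ _ _ (u 2) (u 0) (u 1)
        fun i ha hb hc => hu i hb hc ha, smul_smul, orderSign_of_gt (lt h2 h0),
        orderSign_of_gt (lt h2 h1), mul_neg_one, mul_neg_one, neg_neg, sq, one_smul]
    · rw [nestWord_none k _ hdeg _ A, smul_zero]
      · rfl
      · exact fun i hi => hu i (fun e => h0 (e ▸ hi)) (fun e => h1 (e ▸ hi)) fun e => h2 (e ▸ hi)

omit [CharZero 𝕜] in
theorem nestWord_mem {e : ℤ} (k : Fin (n + 1))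
    (φ : MultilinearMap 𝕜 (fun _ : Fin (n - k + 1) => R × (Fin d → R)) (R × (Fin d → R)))
    (hφ : ∀ (a : Fin (n - k + 1) → ℤ) (v : Fin (n - k + 1) → R × (Fin d → R)),
      (∀ i, v i ∈ formGrading 𝕜 d R (a i)) →
        φ v ∈ formGrading 𝕜 d R ((∑ i, a i) + e - (n - k + 1 : ℕ)))
    (hdeg : ∀ n, IsBracketDegree (ℓ n)) (w : Fin n → R ⊕ (Fin d → R))
    (σ : Perm (Fin n)) :
    nestWord k φ (ℓ k) (fun i => w (σ i))
      ∈ formGrading 𝕜 d R ((∑ i, letterDeg (w i)) + 1 + e - n) := by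
  have h := nestVal_mem (𝒲 := formGrading 𝕜 d R) k φ (ℓ k) hφ (hdeg k)
    (fun i => letterDeg (w (σ i))) (fun i => letter (w (σ i))) fun i => letter_mem _
  rwa [Equiv.sum_comp σ fun i => letterDeg (w i)] at h

include hskew hdeg in
theorem homotopy_jacobi (h2 : ClosureIdentity ℓ) (h3 : ParameterIdentity ℓ) (a : Fin n → ℤ)
    (v : Fin n → R × (Fin d → R)) (hv : ∀ i, v i ∈ formGrading 𝕜 d R (a i)) :
    ∑ k : Fin (n + 1), ∑ σ : Perm (Fin n),
      (sgn 𝕜 (k * (n - k)) / ((k : ℕ).factorial * (n - k : ℕ).factorial) *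
          ((Equiv.Perm.sign σ : ℤ) : 𝕜) * koszulSign 𝕜 a σ) •
        ℓ (n - k + 1) (Fin.cons (ℓ k fun i => v (σ (firstIdx k i)))
          (fun i => v (σ (lastIdx k i)))) = 0 := by
  simp only [jacobi_term_eq]
  rw [← smul_zero (sgn 𝕜 (∑ i : Fin n, ((n : ℤ) - 1 - i) * a i))]
  simp only [← smul_sum]
  congr 1
  let G : (Fin n → ℤ) → FormOperation 𝕜 d R n :=
    fun a => ∑ k : Fin (n + 1), (((k : ℕ).factorial * (n - k : ℕ).factorial : 𝕜))⁻¹ •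
      nestMap k (ℓ (n - k + 1)) (ℓ k) a
  have hG : ∀ (a : Fin n → ℤ) (v : Fin n → R × (Fin d → R)), altMap G a v
      = ∑ k : Fin (n + 1), ∑ σ : Perm (Fin n),
        (koszulSign 𝕜 (fun i => a i - 1) σ /
          ((k : ℕ).factorial * (n - k : ℕ).factorial)) •
          nestVal k (ℓ (n - k + 1)) (ℓ k) (fun i => a (σ i)) fun i => v (σ i) := by
    intro a v
    rw [altMap_apply, sum_comm]
    refine sum_congr rfl fun σ _ => ?_
    simp only [G, sum_apply, smul_apply, nestMap_apply, smul_sum, smul_smul, div_eq_mul_inv]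
  rw [← hG]
  refine altMap_eq_zero_of_words G (fun N w x f A hw => ?_) a v hv
  rw [hG]
  change jacobiSum ℓ w = 0
  by_cases h : N = 2
  · subst h
    exact jacobiSum_two hskew hdeg h2 hw
  by_cases h' : N = 3
  · subst h'
    exact jacobiSum_three hskew hdeg h3 hw
  refine sum_eq_zero fun k _ => sum_eq_zero fun σ _ => ?_
  have hm := nestWord_mem (ℓ := ℓ) (e := 2) k (ℓ (n - k + 1)) (hdeg _) hdeg w σ
  rw [hw.sum_letterDeg] at hm
  rw [formGrading_eq_zero hm (by omega) (by omega), smul_zero]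

end Criterion

/-! ## The `L_∞`-structure of the gauge algebroid -/

section ArgumentSigns

variable {ℓ : OperationFamily 𝕜 d R}

theorem sgn_natCast (n : ℕ) : sgn 𝕜 n = (-1) ^ n := by simp [sgn]

theorem sgn_sum_reverse (n : ℕ) :
    sgn 𝕜 (∑ i : Fin n, ((n : ℤ) - 1 - i)) = (-1) ^ (n * (n - 1) / 2) := by
  rw [← Finset.sum_range_id, ← sgn_natCast, ← sum_range_reflect, sum_range]
  push_cast
  congr 1
  refine sum_congr rfl fun i _ => ?_
  have := i.2
  omega

theorem letter_args₁ {n : ℕ} (f : R) (B : Fin n → Fin d → R) :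
    (fun i => letter ((Fin.cons (inl f) fun i => inr (B i) :
      Fin (n + 1) → R ⊕ (Fin d → R)) i)) = args₁ f B := by
  funext i
  induction i using Fin.cases <;> rfl

theorem letter_args₂ {n : ℕ} (f g : R) (B : Fin n → Fin d → R) :
    (fun i => letter ((Fin.cons (inl f) (Fin.cons (inl g) fun i => inr (B i)) :
      Fin (n + 2) → R ⊕ (Fin d → R)) i)) = args₂ f g B := by
  funext i
  induction i using Fin.cases with
  | zero => rfl
  | succ i => induction i using Fin.cases <;> rfl

theorem neg_one_pow_smul_smul {W : Type} [AddCommGroup W] [Module 𝕜 W] (n : ℕ) (w : W) :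
    (-1 : 𝕜) ^ n • (-1 : 𝕜) ^ n • w = w := by
  rw [smul_smul, ← mul_pow]
  simp

variable (hdeg : ∀ n, IsBracketDegree (ℓ n))

include hdeg in
theorem bracket_args₁ {n : ℕ} (f : R) (B : Fin n → Fin d → R) :
    ℓ (n + 1) (args₁ f B) = (0, (-1 : 𝕜) ^ (n * (n - 1) / 2) • paramVal₁ ℓ n f B) := by
  have h := wordVal_front₁ hdeg n f B
  have e : wordVal (ℓ (n + 1)) (Fin.cons (inl f) fun i => inr (B i))
      = (-1 : 𝕜) ^ (n * (n - 1) / 2) • ℓ (n + 1) (args₁ f B) := by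
    rw [wordVal, decalage, letter_args₁, ← sgn_sum_reverse, sum_univ_succ]
    congr 2
    simp only [cons_zero, cons_succ, letterDeg, Sum.elim_inl, Sum.elim_inr, mul_zero,
      zero_add, mul_one, Fin.val_succ]
    refine sum_congr rfl fun i _ => ?_
    push_cast
    ring
  rw [e] at h
  have h2 := congrArg (fun w => (-1 : 𝕜) ^ (n * (n - 1) / 2) • w) h
  simpa only [neg_one_pow_smul_smul, Prod.smul_mk, smul_zero] using h2

include hdeg in
theorem bracket_args₂ {n : ℕ} (f g : R) (B : Fin n → Fin d → R) :
    ℓ (n + 2) (args₂ f g B) = ((-1 : 𝕜) ^ (n * (n - 1) / 2) • paramVal₂ ℓ n f g B, 0) := by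
  have h := wordVal_front₂ hdeg n f g B
  have e : wordVal (ℓ (n + 2)) (Fin.cons (inl f) (Fin.cons (inl g) fun i => inr (B i)))
      = (-1 : 𝕜) ^ (n * (n - 1) / 2) • ℓ (n + 2) (args₂ f g B) := by
    rw [wordVal, decalage, letter_args₂, ← sgn_sum_reverse, sum_univ_succ, sum_univ_succ]
    congr 2
    simp only [cons_zero, cons_succ, letterDeg, Sum.elim_inl, Sum.elim_inr, mul_zero,
      zero_add, mul_one, Fin.val_succ]
    refine sum_congr rfl fun i _ => ?_
    push_cast
    ring
  rw [e] at h
  have h2 := congrArg (fun w => (-1 : 𝕜) ^ (n * (n - 1) / 2) • w) h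
  simpa only [neg_one_pow_smul_smul, Prod.smul_mk, smul_zero] using h2

end ArgumentSigns

section Undecalage

variable [CharZero 𝕜]
  {P : (n : ℕ) → R →ₗ[𝕜] MultilinearMap 𝕜 (fun _ : Fin n => Fin d → R) (Fin d → R)}
  {Q : (n : ℕ) → R →ₗ[𝕜] R →ₗ[𝕜] MultilinearMap 𝕜 (fun _ : Fin n => Fin d → R) R}

omit [CharZero 𝕜] in
theorem isBracketDegree_undecalage (n : ℕ) :
    IsBracketDegree (undecalage (symmBracket P Q n)) := by
  intro a v hv
  rw [undecalage_apply _ a v hv]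
  exact Submodule.smul_mem _ _ (symmBracket_degree P Q n a v hv)

omit [CharZero 𝕜] in
theorem isGradedSkew_undecalage (n : ℕ) :
    IsGradedSkew (undecalage (symmBracket P Q n)) :=
  fun a v hv i j hij => undecalage_skew _ (symmBracket_swap P Q n) a v hv i j hij

omit [CharZero 𝕜] in
theorem wordVal_undecalage {n : ℕ}
    (Λ : FormOperation 𝕜 d R n)
    (w : Fin n → R ⊕ (Fin d → R)) : wordVal (undecalage Λ) w = Λ fun i => letter (w i) :=
  decalage_undecalage Λ _ _ fun _ => letter_mem _

theorem paramVal₁_undecalage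
    (hP : ∀ n f A (σ : Perm (Fin n)), P n f (A ∘ σ) = P n f A) (n : ℕ) (f : R)
    (B : Fin n → Fin d → R) :
    paramVal₁ (fun n => undecalage (symmBracket P Q n)) n f B = P n f B := by
  rw [paramVal₁, wordVal_undecalage, letter_args₁, symmBracket_succ_snd, oneParamSymm_args₁ P hP]

theorem paramVal₂_undecalage
    (hQ : ∀ n f g A (σ : Perm (Fin n)), Q n f g (A ∘ σ) = Q n f g A)
    (hskew : ∀ n f g, Q n g f = -Q n f g) (n : ℕ) (f g : R) (B : Fin n → Fin d → R) :
    paramVal₂ (fun n => undecalage (symmBracket P Q n)) n f g B = -Q n f g B := by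
  rw [paramVal₂, wordVal_undecalage, letter_args₂, symmBracket_fst, twoParamSymm_args₂ Q hQ hskew]

end Undecalage

section GaugeStructure

variable [CharZero 𝕜]
  (D : Fin d → Derivation 𝕜 R R)
  (γ : TensorFamily d R)
  {ϑ : TensorFamily d R}
  (Υ : MultiplierFamily d R)

variable (ϑ) in
/-- The brackets of the `L_∞`-structure of the gauge algebroid. -/
def gaugeMap (n : ℕ) : FormOperation 𝕜 d R n :=
  undecalage (symmBracket (variationMap D γ ϑ Υ) (bracketMap D γ ϑ Υ) n)

theorem paramVal₁_gaugeMap (n : ℕ) (f : R) (B : Fin n → Fin d → R) :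
    paramVal₁ (gaugeMap D γ ϑ Υ) n f B = variationMap D γ ϑ Υ n f B :=
  paramVal₁_undecalage (variationMap_symm D γ ϑ Υ) n f B

variable (hϑ : ∀ n i j k, ϑ n j i k = -ϑ n i j k)

include hϑ in
theorem paramVal₂_gaugeMap (n : ℕ) (f g : R) (B : Fin n → Fin d → R) :
    paramVal₂ (gaugeMap D γ ϑ Υ) n f g B = -bracketMap D γ ϑ Υ n f g B :=
  paramVal₂_undecalage (bracketMap_symm D γ ϑ Υ) (bracketMap_skew D γ Υ hϑ) n f g B

variable (hJ : BracketJacobi D γ ϑ) (hR : MultiplierRecursion D γ ϑ Υ)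

include hϑ hJ hR in
theorem closureIdentity_gaugeMap : ClosureIdentity (gaugeMap D γ ϑ Υ) := by
  intro f g A m
  have h := variationMap_closure D γ ϑ Υ hϑ hJ hR f g A m
  rw [Finset.Nat.sum_antidiagonal_eq_sum_range_succ_mk] at h
  rw [← h]
  refine sum_congr rfl fun j _ => ?_
  simp only [cons₁, diag₁, diag₂, paramVal₁_gaugeMap, paramVal₂_gaugeMap D γ Υ hϑ, map_neg,
    neg_apply, sub_eq_add_neg]

include hϑ hJ hR in
theorem parameterIdentity_gaugeMap : ParameterIdentity (gaugeMap D γ ϑ Υ) := by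
  intro f g k A m
  have h := bracketMap_jacobi D γ ϑ Υ hϑ hJ hR f g k A m
  simp only [Finset.Nat.sum_antidiagonal_eq_sum_range_succ_mk] at h
  rw [← neg_zero, ← h, ← sum_neg_distrib]
  refine sum_congr rfl fun j _ => ?_
  have e : ∀ n (f g : R) (B : Fin n → Fin d → R),
      bracketMap D γ ϑ Υ n g f B = -bracketMap D γ ϑ Υ n f g B := fun n f g B => by
    rw [bracketMap_skew D γ Υ hϑ n f g, neg_apply]
  have en : ∀ n (q f : R) (B : Fin n → Fin d → R),
      bracketMap D γ ϑ Υ n (-q) f B = -bracketMap D γ ϑ Υ n q f B := fun n q f B => by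
    rw [e n f (-q), map_neg, neg_apply, e n f q]
  simp only [cons₂, diag₁, diag₂, paramVal₁_gaugeMap, paramVal₂_gaugeMap D γ Υ hϑ, en]
  rw [← smul_neg]
  congr 1
  rw [e (m - j) _ k, e (m - j) _ g, e (m - j) _ f, e j f k, e (m - j + 1) f k, en]
  abel

/-- The `L_∞`-structure of the gauge algebroid. -/
def gaugeStructure : LInfinityStructure (formGrading 𝕜 d R) where
  ℓ := gaugeMap D γ ϑ Υ
  flat := by
    ext v : 1
    rw [gaugeMap, undecalage_apply _ (fun i => i.elim0) v fun i => i.elim0]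
    simp [symmBracket]
  degree := isBracketDegree_undecalage
  skew := isGradedSkew_undecalage
  jacobi _ := homotopy_jacobi isGradedSkew_undecalage isBracketDegree_undecalage
    (closureIdentity_gaugeMap D γ Υ hϑ hJ hR) (parameterIdentity_gaugeMap D γ Υ hϑ hJ hR)

end GaugeStructure

section Induces

variable [CharZero 𝕜]
  (D : Fin d → Derivation 𝕜 R R)
  (γ ϑ : TensorFamily d R)
  (Υ : MultiplierFamily d R)

omit [CharZero 𝕜] in
theorem neg_one_pow_div_smul {W : Type} [AddCommGroup W] [Module 𝕜 W] (n : ℕ) (c : 𝕜) (w : W) :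
    ((-1 : 𝕜) ^ n / c) • (-1 : 𝕜) ^ n • w = (1 / c) • w := by
  rw [smul_smul, div_mul_eq_mul_div, ← mul_pow]
  simp

theorem induces_of_diag (S : LInfinityStructure (formGrading 𝕜 d R))
    (h1 : ∀ n f A, diag₁ S.ℓ n f A = variationMap D γ ϑ Υ n f fun _ => A)
    (h2 : ∀ n f g A, diag₂ S.ℓ n f g A = -bracketMap D γ ϑ Υ n f g fun _ => A) :
    Induces D γ ϑ Υ S where
  variation f A i := by
    ext n
    rw [coeff_mk, bracket_args₁ S.degree, coeff_gaugeVariation, ← h1]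
    simp only [Pi.smul_apply]
    rw [neg_one_pow_div_smul]
    rfl
  bracket f g A := by
    ext n
    cases n with
    | zero => rw [coeff_gaugeBracket_zero, PowerSeries.coeff_zero_X_mul]
    | succ n =>
      rw [coeff_succ_X_mul, coeff_mk, bracket_args₂ S.degree,
        coeff_gaugeBracket, neg_one_pow_div_smul, ← smul_neg]
      congr 1
      rw [← neg_eq_iff_eq_neg, ← h2]
      rfl

end Induces

/-! ## Coefficients of exponential generating series -/

section Egf

variable {R : Type} [CommRing R]

/-- The coefficient of `tⁿ/n!`. -/
def egfCoeff (n : ℕ) : PowerSeries R →+ R :=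
  n.factorial • (coeff n).toAddMonoidHom

theorem egfCoeff_apply (n : ℕ) (F : PowerSeries R) :
    egfCoeff n F = n.factorial • coeff n F := rfl

theorem egfCoeff_mul (n : ℕ) (F G : PowerSeries R) :
    egfCoeff n (F * G) = ∑ pq ∈ antidiagonal n,
      n.choose pq.1 • (egfCoeff pq.1 F * egfCoeff pq.2 G) := by
  rw [egfCoeff_apply, coeff_mul, smul_sum]
  refine sum_congr rfl fun pq h => ?_
  have h1 := Nat.add_choose_mul_factorial_mul_factorial pq.1 pq.2
  have h2 := Finset.HasAntidiagonal.mem_antidiagonal.1 h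
  rw [h2, Nat.choose_symm_of_eq_add (h2.symm.trans (add_comm _ _))] at h1
  rw [egfCoeff_apply, egfCoeff_apply, ← h1]
  simp only [nsmul_eq_mul]
  push_cast
  ring

theorem egfCoeff_C_mul (n : ℕ) (r : R) (F : PowerSeries R) :
    egfCoeff n (C r * F) = r * egfCoeff n F := by
  rw [egfCoeff_apply, egfCoeff_apply, PowerSeries.coeff_C_mul, mul_smul_comm]

theorem egfCoeff_mul_C (n : ℕ) (r : R) (F : PowerSeries R) :
    egfCoeff n (F * C r) = egfCoeff n F * r := by
  rw [mul_comm, egfCoeff_C_mul, mul_comm]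

theorem egfCoeff_C (n : ℕ) (r : R) :
    egfCoeff n (C r) = if n = 0 then r else 0 := by
  rw [egfCoeff_apply, coeff_C]
  split_ifs with h
  · simp [h]
  · simp

theorem egfCoeff_X_mul (n : ℕ) (F : PowerSeries R) :
    egfCoeff n (X * F) = n • egfCoeff (n - 1) F := by
  cases n with
  | zero => simp [egfCoeff_apply]
  | succ n =>
    rw [egfCoeff_apply, egfCoeff_apply, coeff_succ_X_mul, smul_smul, Nat.factorial_succ,
      Nat.add_sub_cancel]

end Egf

/-! ## The Lagrangian multiplier tensors -/

section MultiplierTensors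

variable (D : Fin d → Derivation 𝕜 R R)
  (Υ : MultiplierFamily d R) (α A : Fin d → R)

/-- `X ↦ Υ^{(l)}(DA(X^⊗), A^{⊗l})`. -/
def upsilonCov (l : ℕ) : (Fin d → R) →ₗ[𝕜] Fin d → R where
  toFun X := upsilonT Υ l (covD D A X) A
  map_add' X Y := by
    cases l with
    | zero => simp [upsilonT]
    | succ l =>
      funext i
      simp [upsilonT, covD, mul_add, add_mul, sum_add_distrib]
  map_smul' c X := by
    cases l with
    | zero => simp [upsilonT]
    | succ l =>
      funext i
      simp [upsilonT, covD, smul_sum, sum_mul]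

theorem upsilonCov_apply (l : ℕ) (X : Fin d → R) :
    upsilonCov D Υ A l X = upsilonT Υ l (covD D A X) A := rfl

theorem upsilonCov_zero (X : Fin d → R) : upsilonCov D Υ A 0 X = 0 := rfl

theorem nestedUpsilon_cons (l : ℕ) {ls : List ℕ} (h : ls ≠ []) :
    nestedUpsilon D Υ α A (l :: ls) = upsilonCov D Υ A l (nestedUpsilon D Υ α A ls) := by
  cases ls with
  | nil => exact absurd rfl h
  | cons l' ls => rfl

/-- The positive tuples of length `k + 1` and sum `n - k`. -/
def tupleIndex (k n : ℕ) : Finset (Fin (k + 1) → ℕ) :=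
  (Finset.Nat.antidiagonalTuple (k + 1) (n - k)).filter fun l => ∀ r, 1 ≤ l r

theorem mem_tupleIndex {k n : ℕ} {l : Fin (k + 1) → ℕ} :
    l ∈ tupleIndex k n ↔ ∑ r, l r = n - k ∧ ∀ r, 1 ≤ l r := by
  rw [tupleIndex, mem_filter, Finset.Nat.mem_antidiagonalTuple]

theorem le_of_mem_tupleIndex {k n : ℕ} {l : Fin (k + 1) → ℕ} (h : l ∈ tupleIndex k n) :
    2 * k + 1 ≤ n := by
  obtain ⟨h1, h2⟩ := mem_tupleIndex.1 h
  have h3 : ∑ _r : Fin (k + 1), 1 ≤ ∑ r, l r := Finset.sum_le_sum fun r _ => h2 r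
  simp at h3
  omega

/-- The summand of `L^{(n)}` with `k + 1` factors `Υ`. -/
def multiplierPart (k n : ℕ) : Fin d → R :=
  ∑ l ∈ tupleIndex k n, ((n + 1).factorial / ∏ r, ((l r + 1).factorial : 𝕜)) •
    nestedUpsilon D Υ α A (List.ofFn l)

theorem multiplierPart_eq_zero {k n : ℕ} (h : n < 2 * k + 1) :
    multiplierPart D Υ α A k n = 0 := by
  rw [multiplierPart, sum_eq_zero]
  intro l hl
  exact absurd (le_of_mem_tupleIndex hl) (by omega)

theorem multiplierPart_zero [CharZero 𝕜] (n : ℕ) :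
    multiplierPart D Υ α A 0 n = upsilonT Υ n α A := by
  rcases Nat.eq_zero_or_pos n with rfl | hn
  · exact multiplierPart_eq_zero D Υ α A (by omega)
  · have e : tupleIndex 0 n = {fun _ => n} := by
      ext l
      rw [mem_tupleIndex, mem_singleton, funext_iff]
      have h1 : ∑ r : Fin (0 + 1), l r = l 0 := Fin.sum_univ_one _
      rw [h1]
      refine ⟨fun h r => ?_, fun h => ⟨h 0, fun r => ?_⟩⟩
      · rw [show r = 0 from Subsingleton.elim (α := Fin 1) r 0]
        exact h.1
      · rw [h r]
        exact hn
    have h1 : ∏ _r : Fin (0 + 1), ((n + 1).factorial : 𝕜) = (n + 1).factorial :=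
      Fin.prod_univ_one _
    rw [multiplierPart, e, sum_singleton, h1,
      div_self (by exact_mod_cast (n + 1).factorial_ne_zero), one_smul]
    rfl

theorem multiplierT_eq_sum [CharZero 𝕜] {n K : ℕ} (hK : n ≤ K) :
    multiplierT D Υ n α A = ∑ k ∈ range (K + 1), multiplierPart D Υ α A k n := by
  rw [sum_range_succ', multiplierPart_zero, add_comm, multiplierT, add_right_inj,
    Finset.range_eq_Ico, Finset.sum_Ico_add' (fun k => multiplierPart D Υ α A k n) 0 K 1]
  refine sum_subset (fun k hk => ?_) fun k hk hk' => ?_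
  · rw [mem_Icc] at hk
    rw [mem_Ico]
    omega
  · rw [mem_Ico] at hk
    rw [mem_Icc] at hk'
    exact multiplierPart_eq_zero D Υ α A (by omega)

theorem multiplierPart_succ [CharZero 𝕜] (k n : ℕ) :
    multiplierPart D Υ α A (k + 1) n
      = ∑ pq ∈ antidiagonal (n + 1), (n + 1).choose pq.1 •
        upsilonCov D Υ A (pq.1 - 1) (multiplierPart D Υ α A k (pq.2 - 1)) := by
  have e : ∀ pq ∈ antidiagonal (n + 1), (n + 1).choose pq.1 •
        upsilonCov D Υ A (pq.1 - 1) (multiplierPart D Υ α A k (pq.2 - 1))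
      = ∑ l ∈ if 2 ≤ pq.1 then tupleIndex k (pq.2 - 1) else ∅,
        ((n + 1).choose pq.1 * ((pq.2 - 1 + 1).factorial / ∏ r, ((l r + 1).factorial : 𝕜))) •
        upsilonCov D Υ A (pq.1 - 1) (nestedUpsilon D Υ α A (List.ofFn l)) := by
    intro pq _
    split_ifs with h
    · rw [multiplierPart, map_sum, smul_sum]
      refine sum_congr rfl fun l _ => ?_
      rw [map_smul, mul_smul, cast_smul_eq_nsmul]
    · rw [show pq.1 - 1 = 0 by omega, upsilonCov_zero, smul_zero, sum_empty]
  rw [sum_congr rfl e, sum_sigma', multiplierPart]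
  refine sum_bij' (fun l _ => ⟨(l 0 + 1, n - l 0), Fin.tail l⟩)
    (fun x _ => Fin.cons (x.1.1 - 1) x.2) ?_ ?_ ?_ ?_ ?_
  · intro l hl
    have h0 := le_of_mem_tupleIndex hl
    obtain ⟨h1, h2⟩ := mem_tupleIndex.1 hl
    rw [sum_univ_succ] at h1
    have h3 := h2 0
    rw [mem_sigma, Finset.HasAntidiagonal.mem_antidiagonal, if_pos (by simpa using h3),
      mem_tupleIndex]
    simp only [Fin.tail]
    refine ⟨by omega, ?_, fun r => h2 _⟩
    omega
  · rintro ⟨⟨p, q⟩, l⟩ hl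
    rw [mem_sigma, Finset.HasAntidiagonal.mem_antidiagonal] at hl
    obtain ⟨h1, h2⟩ := hl
    simp only at h1 h2
    split_ifs at h2 with hp
    · have h0 := le_of_mem_tupleIndex h2
      obtain ⟨h3, h4⟩ := mem_tupleIndex.1 h2
      rw [mem_tupleIndex, sum_univ_succ]
      simp only [cons_zero, cons_succ]
      refine ⟨by omega, fun r => ?_⟩
      induction r using Fin.cases with
      | zero => simp; omega
      | succ r => exact h4 r
    · exact absurd h2 (notMem_empty _)
  · intro l hl
    simp
  · rintro ⟨⟨p, q⟩, l⟩ hl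
    rw [mem_sigma, Finset.HasAntidiagonal.mem_antidiagonal] at hl
    obtain ⟨h1, h2⟩ := hl
    simp only at h1 h2
    split_ifs at h2 with hp
    · simp only [cons_zero, Fin.tail_cons, Sigma.mk.injEq, Prod.mk.injEq, heq_eq_eq, and_true]
      omega
    · exact absurd h2 (notMem_empty _)
  · intro l hl
    have h0 := le_of_mem_tupleIndex hl
    obtain ⟨h1, h2⟩ := mem_tupleIndex.1 hl
    rw [sum_univ_succ] at h1
    rw [List.ofFn_succ, nestedUpsilon_cons _ _ _ _ _ (by simp), Nat.add_sub_cancel]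
    refine congrArg₂ _ ?_ rfl
    rw [Fin.prod_univ_succ, ← mul_div_assoc]
    have h3 : l 0 + 1 ≤ n + 1 := by omega
    have h4 := Nat.choose_mul_factorial_mul_factorial h3
    have h5 : ((l 0 + 1).factorial : 𝕜) ≠ 0 := by exact_mod_cast (l 0 + 1).factorial_ne_zero
    rw [show n - l 0 - 1 + 1 = n + 1 - (l 0 + 1) by omega, ← h4, div_mul_eq_div_div]
    push_cast
    rw [mul_right_comm, mul_div_cancel_right₀ _ h5]
    rfl

theorem multiplierT_recursion [CharZero 𝕜] (n : ℕ) :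
    multiplierT D Υ n α A = upsilonT Υ n α A
      + ∑ pq ∈ antidiagonal (n + 1), (n + 1).choose pq.1 •
        upsilonCov D Υ A (pq.1 - 1) (multiplierT D Υ (pq.2 - 1) α A) := by
  have e : ∀ pq ∈ antidiagonal (n + 1), (n + 1).choose pq.1 •
        upsilonCov D Υ A (pq.1 - 1) (multiplierT D Υ (pq.2 - 1) α A)
      = ∑ k ∈ range (n + 1), (n + 1).choose pq.1 •
        upsilonCov D Υ A (pq.1 - 1) (multiplierPart D Υ α A k (pq.2 - 1)) := by
    intro pq h
    have h := Finset.HasAntidiagonal.mem_antidiagonal.1 h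
    rw [multiplierT_eq_sum D Υ α A (K := n) (by omega), map_sum, smul_sum]
  rw [multiplierT_eq_sum D Υ α A (K := n + 1) (by omega), sum_range_succ',
    multiplierPart_zero, add_comm, add_right_inj, sum_congr rfl e, sum_comm]
  exact sum_congr rfl fun k _ => multiplierPart_succ D Υ α A k n

theorem multiplierT_zero : multiplierT D Υ 0 α A = 0 := by
  simp [multiplierT, upsilonT]

theorem egfCoeff_lambdaSeries [CharZero 𝕜] (n : ℕ) (β : Fin d → R) (i : Fin d) :
    ∑ b, egfCoeff n (X ^ 2 * evJ D A (lambdaSeries 𝕜 Υ i b)) * β b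
      = -upsilonT Υ (n - 1) β A i := by
  simp only [pow_two, mul_assoc, egfCoeff_X_mul]
  match n with
  | 0 => simp [upsilonT]
  | 1 => simp [upsilonT]
  | n + 2 =>
    simp only [Nat.add_sub_cancel, show n + 2 - 1 = n + 1 by omega, upsilonT, egfCoeff_apply]
    rw [← smul_neg, ← sum_neg_distrib, smul_sum]
    refine sum_congr rfl fun b _ => ?_
    have h : coeff n (evJ D A (lambdaSeries 𝕜 Υ i b))
        = -((1 / ((n : 𝕜) + 2)) • contract n (Υ n i b) A A) := by
      rw [coeff_evJ, lambdaSeries, coeff_mk, map_neg,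
        ← IsScalarTower.algebraMap_smul R (1 / ((n : 𝕜) + 2)), map_smul,
        IsScalarTower.algebraMap_smul, map_sum]
      simp [contract]
    rw [h, smul_smul, smul_smul, ← cast_smul_eq_nsmul 𝕜, ← cast_smul_eq_nsmul 𝕜, smul_neg,
      smul_smul, neg_mul, smul_neg, smul_mul_assoc, mul_comm (β b)]
    congr 2
    have h2 : (n : 𝕜) + 2 ≠ 0 := by exact_mod_cast (n + 1).succ_ne_zero
    rw [Nat.factorial_succ]
    push_cast
    field_simp

theorem egfCoeff_multiplier [CharZero 𝕜] (f : R) (n : ℕ) (i : Fin d) :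
    egfCoeff n (multiplier D Υ A (C f) i)
      = -multiplierT D Υ (n - 1) (dFun D f) A i := by
  induction n using Nat.strong_induction_on generalizing i with
  | _ n ih =>
    have h : multiplier D Υ A (C f) i
        = ∑ b, X ^ 2 * evJ D A (lambdaSeries 𝕜 Υ i b) * C (dFun D f b)
          - ∑ b, X ^ 2 * evJ D A (lambdaSeries 𝕜 Υ i b)
            * ∑ m, C (D b (A m)) * multiplier D Υ A (C f) m := by
      conv_lhs => rw [multiplier_fixed]
      rw [← sum_sub_distrib]
      refine sum_congr rfl fun b _ => ?_
      rw [dSer_C, mul_sub]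
      rfl
    rw [h, map_sub, map_sum, map_sum]
    simp only [egfCoeff_mul_C]
    rw [egfCoeff_lambdaSeries]
    simp only [egfCoeff_mul n (X ^ 2 * _)]
    rw [sum_comm]
    cases n with
    | zero =>
      simp only [Finset.HasAntidiagonal.antidiagonal_zero, sum_singleton, Nat.choose_self, one_smul]
      rw [egfCoeff_lambdaSeries]
      simp [upsilonT, multiplierT_zero]
    | succ n =>
      rw [Nat.add_sub_cancel, multiplierT_recursion, Pi.add_apply, neg_add, Finset.sum_apply,
        sub_eq_add_neg, add_right_inj]
      congr 1
      refine sum_congr rfl fun pq hpq => ?_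
      have hpq := Finset.HasAntidiagonal.mem_antidiagonal.1 hpq
      rw [← smul_sum, egfCoeff_lambdaSeries, Pi.smul_apply]
      congr 1
      rcases Nat.eq_zero_or_pos pq.1 with h0 | h0
      · simp [h0, upsilonCov_zero, upsilonT]
      · have e : (fun b => egfCoeff pq.2
              (∑ m, C (D b (A m)) * multiplier D Υ A (C f) m))
            = covD D A (-multiplierT D Υ (pq.2 - 1) (dFun D f) A) := by
          funext b
          rw [map_sum, covD]
          refine sum_congr rfl fun m _ => ?_
          rw [egfCoeff_C_mul, ih _ (by omega), Pi.neg_apply]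
        rw [e, ← upsilonCov_apply D Υ A (pq.1 - 1) (-_), map_neg, Pi.neg_apply, neg_neg]

end MultiplierTensors

/-! ## The explicit brackets -/

theorem sum_range_eq_sum_Icc_succ {M : Type} [AddCommMonoid M] {F : ℕ → M} {a b N : ℕ}
    (h1 : ∀ k, a ≤ k → k ≤ b → k + 1 < N)
    (h2 : ∀ P < N, ¬(a + 1 ≤ P ∧ P ≤ b + 1) → F P = 0) :
    ∑ P ∈ range N, F P = ∑ k ∈ Icc a b, F (k + 1) := by
  rw [← Finset.sum_image (f := F) (g := fun k => k + 1) (fun _ _ _ _ h => Nat.succ_injective h)]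
  symm
  refine sum_subset (fun P hP => ?_) fun P hP hP' => h2 P (mem_range.1 hP) ?_
  · obtain ⟨k, hk, rfl⟩ := Finset.mem_image.1 hP
    rw [mem_Icc] at hk
    exact mem_range.2 (h1 k hk.1 hk.2)
  · rintro ⟨h3, h4⟩
    refine hP' (Finset.mem_image.2 ⟨P - 1, ?_, by omega⟩)
    rw [mem_Icc]
    omega

section ExplicitBrackets

variable (D : Fin d → Derivation 𝕜 R R)
  (γ ϑ : TensorFamily d R)
  (Υ : MultiplierFamily d R) (α A : Fin d → R)

/-- The coefficient of `tᵖ/p!` of `α_c s_A^*{x^c, p_a}`. -/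
def mixedT (p : ℕ) (α : Fin d → R) : Fin d → R :=
  if p = 0 then α else gammaT γ p α A

theorem mixedT_of_pos {p : ℕ} (hp : p ≠ 0) : mixedT γ A p α = gammaT γ p α A := if_neg hp

theorem aeval_fibrePoly (n : ℕ) (c : (Fin n → Fin d) → R) :
    aeval A (fibrePoly n c) = ∑ k, c k * ∏ m, A (k m) := by
  simp [fibrePoly]

theorem egfCoeff_mixedBracket (p : ℕ) (a : Fin d) :
    ∑ c, egfCoeff p (sect A (mixedBracket γ c a)) * α c = mixedT γ A p α a := by
  have h : ∀ c, egfCoeff p (sect A (mixedBracket γ c a))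
      = (if p = 0 then if c = a then 1 else 0 else 0)
        + p • egfCoeff (p - 1) (sect A (gammaSeries γ a c)) := by
    intro c
    rw [mixedBracket, map_add, map_add, map_mul, sect_X, egfCoeff_X_mul]
    congr 1
    have h1 : sect A (if c = a then 1 else 0) = C (if c = a then 1 else 0) := by
      split_ifs <;> simp
    rw [h1, egfCoeff_C]
  simp only [h]
  cases p with
  | zero => simp [mixedT]
  | succ p =>
    rw [mixedT_of_pos _ _ _ p.succ_ne_zero]
    simp only [Nat.succ_ne_zero, if_false, zero_add, Nat.add_sub_cancel, egfCoeff_apply, coeff_sect,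
      gammaSeries, coeff_mk, aeval_fibrePoly, smul_smul, ← Nat.factorial_succ, gammaT,
      contract, smul_sum, smul_mul_assoc, sum_mul]
    refine sum_congr rfl fun c _ => sum_congr rfl fun k _ => ?_
    rw [mul_right_comm]

theorem egfCoeff_baseBracket (p : ℕ) (α β : Fin d → R) :
    ∑ i, ∑ j, egfCoeff p (sect A (baseBracket ϑ i j)) * α i * β j
      = p • thetaT ϑ (p - 1) α β A := by
  simp only [baseBracket, map_mul, sect_X, egfCoeff_X_mul, thetaT, contract]
  rw [smul_sum, smul_sum]
  refine sum_congr rfl fun i _ => ?_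
  simp only [egfCoeff_apply, coeff_sect, thetaSeries, coeff_mk, aeval_fibrePoly,
    smul_sum, mul_sum, smul_mul_assoc, sum_mul]
  refine sum_congr rfl fun j _ => sum_congr rfl fun k _ => ?_
  congr 2
  ring

theorem sum_mul_mixedT (p : ℕ) (X : Fin d → R) (b : Fin d) :
    ∑ a, X a * mixedT γ A p (dFun D (A a)) b = mixedT γ A p (covD D A X) b := by
  simp only [← egfCoeff_mixedBracket, mul_sum]
  rw [sum_comm]
  refine sum_congr rfl fun c _ => ?_
  rw [covD, mul_sum]
  refine sum_congr rfl fun a _ => ?_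
  rw [dFun]
  ring

theorem pair_mixedT (p : ℕ) (X : Fin d → R) (Y : Fin d → R) :
    ∑ b, Y b * pair (mixedT γ A p (dFun D (A b))) X = pair (mixedT γ A p (covD D A Y)) X := by
  simp only [pair, ← sum_mul_mixedT, mul_sum, sum_mul]
  rw [sum_comm]
  refine sum_congr rfl fun c _ => sum_congr rfl fun a _ => ?_
  ring

theorem sum_mul_egfCoeff_constraint (p : ℕ) (X : Fin d → R) (b : Fin d) :
    ∑ a, X a * egfCoeff p (sect A (cosymplecticBracket D γ ϑ (constraint A a) (constraint A b)))
      = pair (mixedT γ A p (dFun D (A b))) X - mixedT γ A p (covD D A X) b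
        + p • thetaT ϑ (p - 1) (covD D A X) (dFun D (A b)) A := by
  have h : ∀ a, X a * egfCoeff p (sect A
        (cosymplecticBracket D γ ϑ (constraint A a) (constraint A b)))
      = mixedT γ A p (dFun D (A b)) a * X a - X a * mixedT γ A p (dFun D (A a)) b
        + ∑ c, ∑ e, egfCoeff p (sect A (baseBracket ϑ c e)) * (D c (A a) * X a)
          * dFun D (A b) e := by
    intro a
    rw [bracket_constraint_constraint]
    simp only [sum_add_distrib, sum_sub_distrib, map_add, map_sub, map_sum, map_mul,
      sect_pull, egfCoeff_mul_C, ← egfCoeff_mixedBracket, mul_sum, sum_mul, dFun,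
      mul_add, mul_sub]
    congr 1
    · congr 1
      exact sum_congr rfl fun c _ => mul_comm _ _
    · refine sum_congr rfl fun c _ => sum_congr rfl fun e _ => ?_
      ring
  simp only [h, sum_add_distrib, sum_sub_distrib]
  rw [sum_mul_mixedT, ← egfCoeff_baseBracket, sum_comm]
  congr 1
  refine sum_congr rfl fun c _ => ?_
  rw [sum_comm]
  refine sum_congr rfl fun e _ => ?_
  rw [← sum_mul, ← mul_sum]
  rfl

theorem thetaT_sum_right (n : ℕ) (α Y : Fin d → R) :
    ∑ b, Y b * thetaT ϑ n α (dFun D (A b)) A = thetaT ϑ n α (covD D A Y) A := by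
  simp only [thetaT, contract, covD, dFun, mul_sum, sum_mul, smul_sum]
  rw [sum_comm]
  refine sum_congr rfl fun i _ => ?_
  rw [sum_comm]
  refine sum_congr rfl fun j _ => ?_
  rw [sum_comm]
  refine sum_congr rfl fun k _ => sum_congr rfl fun b _ => ?_
  rw [mul_smul_comm]
  congr 1
  ring

theorem sum_mul_mul_egfCoeff_constraint (p : ℕ) (X Y : Fin d → R) :
    ∑ a, ∑ b, X a * Y b
        * egfCoeff p (sect A (cosymplecticBracket D γ ϑ (constraint A a) (constraint A b)))
      = pair (mixedT γ A p (covD D A Y)) X - pair (mixedT γ A p (covD D A X)) Y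
        + p • thetaT ϑ (p - 1) (covD D A X) (covD D A Y) A := by
  rw [sum_comm]
  have h : ∀ b, ∑ a, X a * Y b
        * egfCoeff p (sect A (cosymplecticBracket D γ ϑ (constraint A a) (constraint A b)))
      = Y b * pair (mixedT γ A p (dFun D (A b))) X - mixedT γ A p (covD D A X) b * Y b
        + p • (Y b * thetaT ϑ (p - 1) (covD D A X) (dFun D (A b)) A) := by
    intro b
    simp only [mul_comm (X _) (Y b), mul_assoc (Y b)]
    rw [← mul_sum, sum_mul_egfCoeff_constraint, mul_add, mul_sub, mul_smul_comm,
      mul_comm (Y b) (mixedT _ _ _ _ _)]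
  simp only [h, sum_add_distrib, sum_sub_distrib]
  rw [pair_mixedT, ← smul_sum, thetaT_sum_right]
  rfl

theorem pair_covD_sub (X Y : Fin d → R) :
    pair (covD D A Y) X - pair (covD D A X) Y = pair (curv D A X) Y := by
  simp only [pair, covD, curv, sum_mul, mul_sub, sub_mul, sum_sub_distrib]
  rw [sum_comm]
  congr 1
  · refine sum_congr rfl fun b _ => sum_congr rfl fun a _ => ?_
    ring
  · refine sum_congr rfl fun b _ => sum_congr rfl fun a _ => ?_
    ring

theorem pair_dFun_sub (X : Fin d → R) (i : Fin d) :
    pair (dFun D (A i)) X - covD D A X i = curv D A X i := by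
  simp only [pair, covD, curv, dFun, mul_sub, sum_sub_distrib]
  congr 1 <;> exact sum_congr rfl fun a _ => mul_comm _ _

variable [CharZero 𝕜]

theorem egfCoeff_gaugeVariation (n : ℕ) (f : R) (i : Fin d) :
    egfCoeff n (gaugeVariation D γ ϑ Υ f A i)
      = mixedT γ A n (dFun D f) i - n • thetaT ϑ (n - 1) (dFun D f) (dFun D (A i)) A
        - ∑ q ∈ range (n + 1), n.choose q •
          (pair (mixedT γ A (n - q) (dFun D (A i))) (multiplierT D Υ (q - 1) (dFun D f) A)
            - mixedT γ A (n - q) (covD D A (multiplierT D Υ (q - 1) (dFun D f) A)) i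
            + (n - q) • thetaT ϑ (n - q - 1) (covD D A (multiplierT D Υ (q - 1) (dFun D f) A))
              (dFun D (A i)) A) := by
  rw [gaugeVariation_eq, gaugeHam, ham, bracket_add_left, map_add, map_add,
    sect_bracket_constraintApply_left, bracket_pull_constraint]
  simp only [← sum_mul_egfCoeff_constraint]
  rw [sub_eq_add_neg (_ - _)]
  congr 1
  · simp only [sub_mul, sum_sub_distrib, sum_mul, map_sub, map_sum, map_mul,
      sect_pull, dSer_C, egfCoeff_mul_C]
    rw [← egfCoeff_mixedBracket, ← egfCoeff_baseBracket]
    congr 1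
    refine sum_congr rfl fun a _ => sum_congr rfl fun b _ => ?_
    rw [dFun, dFun, mul_right_comm]
  · rw [map_sum, ← sum_neg_distrib]
    simp only [egfCoeff_mul, Finset.Nat.sum_antidiagonal_eq_sum_range_succ_mk, egfCoeff_multiplier]
    rw [sum_comm]
    refine sum_congr rfl fun q _ => ?_
    simp only [neg_mul, smul_neg, sum_neg_distrib, smul_sum]

theorem egfCoeff_gaugeBracket (n : ℕ) (f g : R) :
    egfCoeff n (gaugeBracket D γ ϑ Υ f g A)
      = n • thetaT ϑ (n - 1) (dFun D f) (dFun D g) A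
        - ∑ P ∈ range (n + 1), n.choose P • ∑ q ∈ range (P + 1), P.choose q •
          (pair (mixedT γ A (n - P) (covD D A (multiplierT D Υ (P - q - 1) (dFun D g) A)))
              (multiplierT D Υ (q - 1) (dFun D f) A)
            - pair (mixedT γ A (n - P) (covD D A (multiplierT D Υ (q - 1) (dFun D f) A)))
              (multiplierT D Υ (P - q - 1) (dFun D g) A)
            + (n - P) • thetaT ϑ (n - P - 1) (covD D A (multiplierT D Υ (q - 1) (dFun D f) A))
              (covD D A (multiplierT D Υ (P - q - 1) (dFun D g) A)) A) := by
  rw [gaugeBracket_eq, map_sub, sect_bracket_constraintApply_left, bracket_pull_pull]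
  simp only [sect_bracket_constraintApply_right, ← sum_mul_mul_egfCoeff_constraint]
  congr 1
  · simp only [map_sum, map_mul, sect_pull, dSer_C, egfCoeff_mul_C]
    rw [← egfCoeff_baseBracket]
    rfl
  · simp only [mul_sum, ← mul_assoc, map_sum]
    simp only [egfCoeff_mul, Finset.Nat.sum_antidiagonal_eq_sum_range_succ_mk, egfCoeff_multiplier,
      neg_mul_neg, sum_mul, smul_sum, smul_mul_assoc]
    simp only [← smul_sum]
    rw [sum_congr rfl fun a _ => sum_comm, sum_comm]
    refine sum_congr rfl fun P _ => ?_
    simp only [smul_sum]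
    rw [sum_congr rfl fun a _ => sum_comm, sum_comm]

theorem explicit_gaugeVariation {n : ℕ} (hn : n ≠ 0) (f : R) (i : Fin d) :
    (-1 : 𝕜) ^ (n * (n - 1) / 2) • egfCoeff n (gaugeVariation D γ ϑ Υ f A i)
      = explicitBracket₁ D γ ϑ Υ n f A i := by
  rw [explicitBracket₁, egfCoeff_gaugeVariation, mixedT_of_pos _ _ _ hn, sum_range_succ]
  congr 1
  simp only [Nat.sub_self, Nat.choose_self, one_smul, zero_smul, add_zero, mixedT, if_true]
  rw [pair_dFun_sub, add_comm (Finset.sum _ _), ← sub_sub]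
  rw [sub_eq_add_neg (_ - _) (Finset.sum _ _), add_right_inj, ← sum_neg_distrib]
  symm
  have h0 : ∀ p, mixedT γ A p (covD D A (0 : Fin d → R)) i = 0 := by
    intro p
    rw [← sum_mul_mixedT]
    simp
  refine (sum_congr rfl fun q hq => ?_).trans
    (sum_subset (fun q hq => ?_) fun q hq hq' => ?_)
  · rw [mem_Icc] at hq
    rw [if_neg (by omega), if_neg (by omega), ← smul_neg]
    congr 1
    abel
  · rw [mem_Icc] at hq
    exact mem_range.2 (by omega)
  · rw [mem_range] at hq
    rw [mem_Icc] at hq'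
    have h1 := h0 (n - q)
    rw [mixedT] at h1
    rw [show q - 1 = 0 by omega, multiplierT_zero, h1]
    simp [pair, thetaT, covD]

theorem explicit_gaugeBracket (n : ℕ) (f g : R) :
    (-(-1 : 𝕜) ^ (n * (n - 1) / 2)) • n.factorial •
        coeff (n + 1) (gaugeBracket D γ ϑ Υ f g A)
      = explicitBracket₂ D γ ϑ Υ n f g A := by
  have hn : (n : 𝕜) + 1 ≠ 0 := by exact_mod_cast n.succ_ne_zero
  suffices h : egfCoeff (n + 1) (gaugeBracket D γ ϑ Υ f g A) = ((n : 𝕜) + 1) •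
      (thetaT ϑ n (dFun D f) (dFun D g) A
        - ∑ k ∈ Icc 1 (n - 2), ((n.choose k : 𝕜) / (k + 1)) •
            pair (curv D A (multiplierT D Υ k (dFun D f) A))
              (multiplierT D Υ (n - k - 1) (dFun D g) A)
        + ∑ k ∈ Icc 3 (n - 1), ((n.choose k : 𝕜) / (k + 1)) •
            ∑ l ∈ Icc 1 (k - 2), (k + 1).choose (l + 1) •
              (pair (gammaT γ (n - k) (covD D A (multiplierT D Υ l (dFun D f) A)) A)
                  (multiplierT D Υ (k - l - 1) (dFun D g) A)
                - pair (gammaT γ (n - k) (covD D A (multiplierT D Υ l (dFun D g) A)) A)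
                  (multiplierT D Υ (k - l - 1) (dFun D f) A)
                - (n - k) • thetaT ϑ (n - k - 1) (covD D A (multiplierT D Υ l (dFun D f) A))
                    (covD D A (multiplierT D Υ (k - l - 1) (dFun D g) A)) A)) by
    rw [explicitBracket₂]
    congr 1
    refine smul_right_injective R hn ?_
    simp only
    rw [← h, egfCoeff_apply, Nat.factorial_succ, mul_smul, ← cast_smul_eq_nsmul 𝕜 (n + 1)]
    push_cast
    rfl
  have hc : ∀ k, k ≤ n → ((n : 𝕜) + 1) * ((n.choose k : 𝕜) / (k + 1)) = (n + 1).choose (k + 1) := by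
    intro k _
    have hk : (k : 𝕜) + 1 ≠ 0 := by exact_mod_cast k.succ_ne_zero
    rw [← mul_div_assoc, div_eq_iff hk]
    exact_mod_cast Nat.add_one_mul_choose_eq n k
  have h0 : ∀ p, pair (mixedT γ A p (covD D A (0 : Fin d → R))) = 0 := by
    intro p
    funext X
    rw [← pair_mixedT]
    simp
  have hp : ∀ α : Fin d → R, pair α 0 = 0 := fun α => by simp [pair]
  have hc0 : covD D A (0 : Fin d → R) = 0 := by funext i; simp [covD]
  have ht1 : ∀ n β, thetaT ϑ n 0 β A = 0 := fun n β => by simp [thetaT]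
  have ht2 : ∀ n β, thetaT ϑ n β 0 A = 0 := fun n β => by simp [thetaT, contract]
  set L := fun m => multiplierT D Υ m (dFun D f) A with hL
  set L' := fun m => multiplierT D Υ m (dFun D g) A with hL'
  have hL0 : L 0 = 0 := multiplierT_zero _ _ _ _
  have hL0' : L' 0 = 0 := multiplierT_zero _ _ _ _
  rw [egfCoeff_gaugeBracket, sum_range_succ, smul_add, smul_sub, ← cast_smul_eq_nsmul 𝕜,
    Nat.cast_add, Nat.cast_one, Nat.add_sub_cancel, add_comm (Finset.sum _ _), ← sub_sub,
    sub_eq_add_neg (_ - _)]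
  congr 1
  · congr 1
    simp only [Nat.choose_self, one_smul, Nat.sub_self, zero_smul, add_zero, mixedT, if_true,
      pair_covD_sub]
    rw [sum_range_eq_sum_Icc_succ (a := 1) (b := n - 2), smul_sum]
    · refine sum_congr rfl fun k hk => ?_
      rw [mem_Icc] at hk
      rw [smul_smul, hc k (by omega), cast_smul_eq_nsmul, Nat.add_sub_cancel,
        show n + 1 - (k + 1) - 1 = n - k - 1 by omega]
    · omega
    · intro q hq hq'
      by_cases h : q ≤ 1
      · change _ • pair (curv D A (L (q - 1))) _ = 0
        rw [show q - 1 = 0 by omega, hL0]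
        simp [curv, pair]
      · change _ • pair _ (L' (n + 1 - q - 1)) = 0
        rw [show n + 1 - q - 1 = 0 by omega, hL0', hp, smul_zero]
  · have hG : ∀ P q, ¬(2 ≤ q ∧ q + 2 ≤ P) →
        pair (mixedT γ A (n + 1 - P) (covD D A (L' (P - q - 1)))) (L (q - 1))
            - pair (mixedT γ A (n + 1 - P) (covD D A (L (q - 1)))) (L' (P - q - 1))
            + (n + 1 - P) • thetaT ϑ (n + 1 - P - 1) (covD D A (L (q - 1)))
              (covD D A (L' (P - q - 1))) A = 0 := by
      intro P q h
      by_cases h1 : q ≤ 1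
      · rw [show q - 1 = 0 by omega, hL0, h0, hp, hc0, ht1]
        simp
      · rw [show P - q - 1 = 0 by omega, hL0', h0, hp, hc0, ht2]
        simp
    rw [sum_range_eq_sum_Icc_succ (a := 3) (b := n - 1), smul_sum,
      ← sum_neg_distrib]
    · refine sum_congr rfl fun k hk => ?_
      rw [mem_Icc] at hk
      rw [smul_smul, hc k (by omega), cast_smul_eq_nsmul, ← smul_neg]
      congr 1
      rw [sum_range_eq_sum_Icc_succ (a := 1) (b := k - 2)]
      · have e : ∀ l ∈ Icc 1 (k - 2), (k + 1).choose (l + 1) •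
              (pair (mixedT γ A (n + 1 - (k + 1)) (covD D A (L' (k + 1 - (l + 1) - 1))))
                (L (l + 1 - 1))
              - pair (mixedT γ A (n + 1 - (k + 1)) (covD D A (L (l + 1 - 1))))
                (L' (k + 1 - (l + 1) - 1))
              + (n + 1 - (k + 1)) • thetaT ϑ (n + 1 - (k + 1) - 1) (covD D A (L (l + 1 - 1)))
                (covD D A (L' (k + 1 - (l + 1) - 1))) A)
            = (k + 1).choose (k - l - 1 + 1) •
                pair (gammaT γ (n - k) (covD D A (L' (k - l - 1))) A) (L (k - (k - l - 1) - 1))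
              - ((k + 1).choose (l + 1) •
                  pair (gammaT γ (n - k) (covD D A (L l)) A) (L' (k - l - 1))
                - (k + 1).choose (l + 1) • (n - k) • thetaT ϑ (n - k - 1) (covD D A (L l))
                  (covD D A (L' (k - l - 1))) A) := by
          intro l hl
          rw [mem_Icc] at hl
          rw [show n + 1 - (k + 1) = n - k by omega, show k + 1 - (l + 1) - 1 = k - l - 1 by omega,
            Nat.add_sub_cancel, mixedT_of_pos _ _ _ (by omega), mixedT_of_pos _ _ _ (by omega),
            show k - (k - l - 1) - 1 = l by omega,
            ← Nat.choose_symm_of_eq_add (show k + 1 = (l + 1) + (k - l - 1 + 1) by omega),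
            smul_add, smul_sub]
          abel
        rw [sum_congr rfl e, sum_sub_distrib,
          sum_bij' (t := Icc 1 (k - 2)) (fun l _ => k - l - 1) (fun l _ => k - l - 1)
            (g := fun l => (k + 1).choose (l + 1) •
                pair (gammaT γ (n - k) (covD D A (L' l)) A) (L (k - l - 1)))
            (by intro l hl; rw [mem_Icc] at *; omega)
            (by intro l hl; rw [mem_Icc] at *; omega)
            (by intro l hl; rw [mem_Icc] at *; omega)
            (by intro l hl; rw [mem_Icc] at *; omega)
            (fun l _ => rfl), ← sum_sub_distrib, ← sum_neg_distrib]
        refine sum_congr rfl fun l _ => ?_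
        rw [smul_sub, smul_sub]
        abel
      · omega
      · intro q _ hq'
        rw [hG _ _ (by omega), smul_zero]
    · omega
    · intro P hP hP'
      rw [sum_eq_zero, smul_zero]
      intro q hq
      rw [hG _ _ (by omega), smul_zero]

end ExplicitBrackets

section GaugeStructureBrackets

variable [CharZero 𝕜]
  (D : Fin d → Derivation 𝕜 R R)
  (γ : TensorFamily d R)
  {ϑ : TensorFamily d R}
  (Υ : MultiplierFamily d R)
  (hϑ : ∀ n i j k, ϑ n j i k = -ϑ n i j k) (hJ : BracketJacobi D γ ϑ)
  (hR : MultiplierRecursion D γ ϑ Υ)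

theorem gaugeStructure_args₁ (n : ℕ) (f : R) (A : Fin d → R) :
    (gaugeStructure D γ Υ hϑ hJ hR).ℓ (n + 1) (args₁ f fun _ : Fin n => A)
      = (0, fun i => (-1 : 𝕜) ^ (n * (n - 1) / 2) •
          egfCoeff n (gaugeVariation D γ ϑ Υ f A i)) := by
  rw [bracket_args₁ (gaugeStructure D γ Υ hϑ hJ hR).degree]
  refine Prod.ext rfl (funext fun i => ?_)
  change (-1 : 𝕜) ^ (n * (n - 1) / 2) • paramVal₁ (gaugeMap D γ ϑ Υ) n f (fun _ => A) i = _
  rw [paramVal₁_gaugeMap, variationMap_diag]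
  rfl

theorem gaugeStructure_args₂ (n : ℕ) (f g : R) (A : Fin d → R) :
    (gaugeStructure D γ Υ hϑ hJ hR).ℓ (n + 2) (args₂ f g fun _ : Fin n => A)
      = (explicitBracket₂ D γ ϑ Υ n f g A, 0) := by
  rw [bracket_args₂ (gaugeStructure D γ Υ hϑ hJ hR).degree, ← explicit_gaugeBracket]
  refine Prod.ext ?_ rfl
  change (-1 : 𝕜) ^ (n * (n - 1) / 2) • paramVal₂ (gaugeMap D γ ϑ Υ) n f g (fun _ => A) = _
  rw [paramVal₂_gaugeMap D γ Υ hϑ, bracketMap_diag, smul_neg, neg_smul]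

theorem gaugeStructure_induces : Induces D γ ϑ Υ (gaugeStructure D γ Υ hϑ hJ hR) :=
  induces_of_diag D γ ϑ Υ _ (fun n f _ => paramVal₁_gaugeMap D γ Υ n f _)
    fun n f g _ => paramVal₂_gaugeMap D γ Υ hϑ n f g _

end GaugeStructureBrackets

section LowOrder

variable {D : Fin d → Derivation 𝕜 R R} {θ : Fin d → Fin d → R} (E : LocalSymplecticEmbedding D θ)
  {Υ : MultiplierFamily d R}

theorem jacobiator_skew (hθ : ∀ i j, θ j i = -θ i j) (i j k : Fin d) :
    jacobiator D θ i k j = -jacobiator D θ i j k := by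
  rw [jacobiator, jacobiator, ← smul_neg, ← sum_neg_distrib]
  congr 1
  refine sum_congr rfl fun l _ => ?_
  rw [hθ j k, hθ k i, hθ i j]
  simp only [map_neg]
  ring

theorem almostPoissonBracket_skew (hθ : ∀ i j, θ j i = -θ i j) (f g : R) :
    almostPoissonBracket D θ g f = -almostPoissonBracket D θ f g := by
  rw [almostPoissonBracket, almostPoissonBracket, sum_comm]
  simp only [← sum_neg_distrib]
  refine sum_congr rfl fun i _ => sum_congr rfl fun j _ => ?_
  rw [hθ i j]
  ring

theorem thetaT_zero (f g : R) (A : Fin d → R) :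
    thetaT E.ϑ 0 (dFun D f) (dFun D g) A = almostPoissonBracket D θ f g := by
  simp only [thetaT, contract, almostPoissonBracket, Nat.factorial_zero, one_smul, mul_sum,
    E.ϑ_zero, dFun, univ_unique, sum_singleton, univ_eq_empty,
    prod_empty, mul_one]
  refine sum_congr rfl fun i _ => sum_congr rfl fun j _ => ?_
  ring

theorem thetaT_one (α β A : Fin d → R) :
    thetaT E.ϑ 1 α β A = -pair A (jacobiatorT D θ α β) := by
  have h : ∀ i j, ∑ k : Fin 1 → Fin d, E.ϑ 1 i j k * β j * ∏ m, A (k m)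
      = ∑ k, -(jacobiator D θ i j k * β j * A k) := by
    intro i j
    refine Fintype.sum_equiv (Equiv.funUnique (Fin 1) (Fin d)) _ _ fun k => ?_
    rw [E.ϑ_one, Fin.prod_univ_one, neg_mul, neg_mul]
    rfl
  simp only [thetaT, contract, Nat.factorial_one, one_smul, h, pair, jacobiatorT, mul_sum]
  rw [sum_congr rfl fun i _ => sum_comm, sum_comm]
  simp only [← sum_neg_distrib]
  refine sum_congr rfl fun i _ => sum_congr rfl fun j _ =>
    sum_congr rfl fun k _ => ?_
  ring

theorem pair_jacobiatorT_swap (hθ : ∀ i j, θ j i = -θ i j) (α β A : Fin d → R) :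
    pair β (jacobiatorT D θ α A) = -pair A (jacobiatorT D θ α β) := by
  simp only [pair, jacobiatorT, mul_sum]
  rw [sum_comm, sum_congr rfl fun i _ => sum_comm,
    sum_comm (f := fun k i => ∑ j, A k * _)]
  simp only [← sum_neg_distrib]
  refine sum_congr rfl fun i _ => ?_
  refine sum_congr rfl fun j _ => sum_congr rfl fun k _ => ?_
  rw [jacobiator_skew hθ]
  ring

theorem multiplierT_one (hΥ : IsLagrangianMultiplier E Υ) (α A : Fin d → R) :
    multiplierT D Υ 1 α A = jacobiatorT D θ α A := by
  funext i
  simp only [multiplierT, upsilonT, contract, jacobiatorT, hΥ.zero, mul_sum, Pi.add_apply]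
  simp only [univ_unique, sum_singleton, univ_eq_empty, prod_empty,
    mul_one, Nat.sub_self, Nat.zero_div, zero_add, Nat.factorial_one, one_smul]
  rw [Icc_eq_empty (by omega), sum_empty, Pi.zero_apply, add_zero]
  refine sum_congr rfl fun j _ => sum_congr rfl fun l _ => ?_
  rw [jacobiator_rotate D θ i j l]
  ring

variable [CharZero 𝕜]

theorem explicitBracket₂_three (hΥ : IsLagrangianMultiplier E Υ) (f g : R) (A : Fin d → R) :
    explicitBracket₂ D E.γ E.ϑ Υ 3 f g A = thetaT E.ϑ 3 (dFun D f) (dFun D g) A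
      - (3 / 2 : 𝕜) • pair (curv D A (jacobiatorT D θ (dFun D f) A))
          (jacobiatorT D θ (dFun D g) A) := by
  have e1 : Icc 1 (3 - 2) = {1} := rfl
  have e2 : Icc 3 (3 - 1) = ∅ := rfl
  have e3 : 3 - 1 - 1 = 1 := rfl
  rw [explicitBracket₂, e1, e2, sum_singleton, sum_empty, add_zero, e3]
  simp only [multiplierT_one E hΥ]
  norm_num

theorem hasExplicitBrackets_of_diag (hθ : ∀ i j, θ j i = -θ i j)
    (hΥ : IsLagrangianMultiplier E Υ) (S : LInfinityStructure (formGrading 𝕜 d R))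
    (h1 : ∀ n f A, S.ℓ (n + 1) (args₁ f fun _ : Fin n => A)
      = (0, fun i => (-1 : 𝕜) ^ (n * (n - 1) / 2) •
          egfCoeff n (gaugeVariation D E.γ E.ϑ Υ f A i)))
    (h2 : ∀ n f g A, S.ℓ (n + 2) (args₂ f g fun _ : Fin n => A)
      = (explicitBracket₂ D E.γ E.ϑ Υ n f g A, 0)) :
    HasExplicitBrackets D E.γ E.ϑ Υ θ S := by
  have h3 : ∀ n, n ≠ 0 → ∀ f A, S.ℓ (n + 1) (args₁ f fun _ : Fin n => A)
      = (0, explicitBracket₁ D E.γ E.ϑ Υ n f A) := fun n hn f A => by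
    rw [h1]
    exact Prod.ext rfl (funext fun i => explicit_gaugeVariation D E.γ E.ϑ Υ A hn f i)
  exact
    { one f := by
        have e : (![] : Fin 0 → Fin d → R) = fun _ => 0 := Subsingleton.elim _ _
        rw [e]
        refine (h1 0 f _).trans ?_
        refine Prod.ext rfl (funext fun i => ?_)
        simp [egfCoeff_gaugeVariation, multiplierT_zero, mixedT, pair, covD]
      two f A := by
        have e : ![A] = fun _ : Fin 1 => A := by funext i; simp
        rw [e]
        refine (h3 1 one_ne_zero f A).trans ?_
        refine Prod.ext rfl (funext fun i => ?_)
        simp only [explicitBracket₁, Nat.sub_self, multiplierT_zero, thetaT_zero,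
          almostPoissonBracket_skew hθ f]
        rw [Icc_eq_empty (by omega)]
        simp [curv, sub_eq_add_neg, add_comm]
      three f A := by
        have e : ![A, A] = fun _ : Fin 2 => A := by funext i; fin_cases i <;> rfl
        rw [e]
        refine (h3 2 two_ne_zero f A).trans ?_
        refine Prod.ext rfl (funext fun i => ?_)
        simp only [explicitBracket₁, show 2 - 1 = 1 from rfl, multiplierT_one E hΥ, thetaT_one,
          ← pair_jacobiatorT_swap hθ]
        rw [Icc_eq_empty (by omega)]
        norm_num
        ring
      general n hn f A := h3 n (by omega) f A
      two' f g := by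
        have e : (![] : Fin 0 → Fin d → R) = fun _ => 0 := Subsingleton.elim _ _
        rw [e]
        refine (h2 0 f g _).trans ?_
        refine Prod.ext ?_ rfl
        simp only [explicitBracket₂, thetaT_zero]
        simp
      three' f g A := by
        have e : ![A] = fun _ : Fin 1 => A := by funext i; simp
        rw [e]
        refine (h2 1 f g _).trans ?_
        refine Prod.ext ?_ rfl
        simp only [explicitBracket₂, thetaT_one]
        simp
      four' f g A := by
        have e : ![A, A] = fun _ : Fin 2 => A := by funext i; fin_cases i <;> rfl
        rw [e]
        refine (h2 2 f g _).trans ?_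
        refine Prod.ext ?_ rfl
        simp [explicitBracket₂]
      five' f g A := by
        have e : ![A, A, A] = fun _ : Fin 3 => A := by funext i; fin_cases i <;> rfl
        rw [e, ← explicitBracket₂_three E hΥ]
        exact h2 3 f g A
      general' n _ f g A := h2 n f g A }

end LowOrder

/-! ## Sums over compositions -/

section Compositions

variable {𝕜 W : Type} [Field 𝕜] [AddCommGroup W] [Module 𝕜 W]

/-- The tuples of `m` positive integers of sum `n`. -/
def posTuples (m n : ℕ) : Finset (Fin m → ℕ) :=
  (Finset.Nat.antidiagonalTuple m n).filter fun b => ∀ r, 1 ≤ b r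

theorem mem_posTuples {m n : ℕ} {b : Fin m → ℕ} :
    b ∈ posTuples m n ↔ ∑ r, b r = n ∧ ∀ r, 1 ≤ b r := by
  rw [posTuples, mem_filter, Finset.Nat.mem_antidiagonalTuple]

theorem sum_composition (n : ℕ) (h : (m : ℕ) → (Fin m → ℕ) → W) :
    ∑ c : Composition n, h c.length c.blocksFun
      = ∑ m ∈ range (n + 1), ∑ b ∈ posTuples m n, h m b := by
  rw [sum_sigma']
  refine sum_bij' (fun c _ => ⟨c.length, c.blocksFun⟩)
    (fun x hx => ⟨List.ofFn x.2, fun {i} hi => ?_, ?_⟩) ?_ (fun _ _ => mem_univ _) ?_ ?_ ?_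
  · obtain ⟨r, rfl⟩ := List.mem_ofFn.1 hi
    exact (mem_posTuples.1 (mem_sigma.1 hx).2).2 r
  · rw [List.sum_ofFn]
    exact (mem_posTuples.1 (mem_sigma.1 hx).2).1
  · intro c _
    rw [mem_sigma, mem_range, mem_posTuples]
    exact ⟨Nat.lt_succ_of_le c.length_le, c.sum_blocksFun, fun r => c.one_le_blocksFun r⟩
  · intro c _
    exact Composition.ext c.ofFn_blocksFun
  · rintro ⟨m, b⟩ _
    refine Fin.sigma_eq_of_eq_comp_cast (by simp [Composition.length]) (funext fun r => ?_)
    simp [Composition.blocksFun]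
    rfl
  · intro c _
    rfl

theorem sum_posTuples_remove {m n : ℕ} (r : Fin (m + 1)) (H : (Fin m → ℕ) → W) :
    ∑ b ∈ posTuples (m + 1) (n + 1), (if b r = 1 then H fun k => b (r.succAbove k) else 0)
      = ∑ b ∈ posTuples m n, H b := by
  rw [← sum_filter]
  refine sum_bij' (fun b _ k => b (r.succAbove k)) (fun b _ => r.insertNth 1 b) ?_ ?_ ?_ ?_
    fun _ _ => rfl
  · intro b hb
    obtain ⟨hb, h1⟩ := mem_filter.1 hb
    rw [mem_posTuples, Fin.sum_univ_succAbove _ r, h1] at hb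
    exact mem_posTuples.2 ⟨by omega, fun k => hb.2 _⟩
  · intro b hb
    rw [mem_posTuples] at hb
    rw [mem_filter, mem_posTuples, Fin.sum_univ_succAbove _ r, Fin.forall_iff_succAbove r]
    simp only [Fin.insertNth_apply_same, Fin.insertNth_apply_succAbove, le_refl, and_true, true_and]
    exact ⟨by omega, hb.2⟩
  · intro b hb
    funext k
    rcases Fin.eq_self_or_eq_succAbove r k with rfl | ⟨k, rfl⟩
    · rw [Fin.insertNth_apply_same, (mem_filter.1 hb).2]
    · rw [Fin.insertNth_apply_succAbove]
  · intro b _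
    simp

/-- The weight of a composition in the identities of an `L_∞`-morphism. -/
def tupleWeight (𝕜 : Type) [Field 𝕜] (m : ℕ) (b : Fin m → ℕ) : 𝕜 :=
  1 / (m.factorial * ∏ r, ((b r).factorial : 𝕜))

theorem sum_composition_one [CharZero 𝕜] (n : ℕ) (Z : (m : ℕ) → (Fin m → ℕ) → Fin m → W)
    (Y : (m : ℕ) → (Fin m → ℕ) → W)
    (h : ∀ m b r, Z (m + 1) b r = Y m fun k => b (r.succAbove k)) :
    ∑ c : Composition (n + 1), tupleWeight 𝕜 c.length c.blocksFun •
        ∑ r, (if c.blocksFun r = 1 then Z c.length c.blocksFun r else 0)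
      = ∑ c : Composition n, tupleWeight 𝕜 c.length c.blocksFun • Y c.length c.blocksFun := by
  rw [sum_composition (n + 1) fun m b => tupleWeight 𝕜 m b • ∑ r, if b r = 1 then Z m b r else 0,
    sum_composition n fun m b => tupleWeight 𝕜 m b • Y m b, sum_range_succ']
  have e0 : ∀ b : Fin 0 → ℕ, tupleWeight 𝕜 0 b •
      ∑ r, (if b r = 1 then Z 0 b r else 0) = 0 := fun b => by simp
  simp only [e0, sum_const_zero, add_zero]
  refine sum_congr rfl fun m _ => ?_
  have e : ∀ r b, tupleWeight 𝕜 (m + 1) b • (if b r = 1 then Z (m + 1) b r else 0)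
      = if b r = 1 then (1 / ((m : 𝕜) + 1)) • tupleWeight 𝕜 m (fun k => b (r.succAbove k)) •
          Y m (fun k => b (r.succAbove k)) else 0 := by
    intro r b
    split_ifs with hr
    · rw [h, smul_smul, tupleWeight, tupleWeight, Fin.prod_univ_succAbove _ r, hr,
        Nat.factorial_succ]
      congr 1
      push_cast
      rw [one_div_mul_one_div, Nat.factorial_one, Nat.cast_one, one_mul, mul_assoc]
    · rw [smul_zero]
  simp only [smul_sum, e]
  rw [sum_comm]
  simp only [sum_posTuples_remove _ fun b => (1 / ((m : 𝕜) + 1)) • tupleWeight 𝕜 m b • Y m b]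
  rw [sum_const, card_univ, Fintype.card_fin, ← smul_sum,
    ← cast_smul_eq_nsmul 𝕜, smul_smul, Nat.cast_succ,
    mul_one_div_cancel (by exact_mod_cast m.succ_ne_zero), one_smul]

theorem sum_composition_two [CharZero 𝕜] (n : ℕ) (Z : (m : ℕ) → (Fin m → ℕ) → Fin m → Fin m → W)
    (Y : (m : ℕ) → (Fin m → ℕ) → W)
    (h : ∀ m b r j, Z (m + 2) b r (r.succAbove j) = Y m fun k => b (r.succAbove (j.succAbove k))) :
    ∑ c : Composition (n + 2), tupleWeight 𝕜 c.length c.blocksFun •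
        ∑ r, (if c.blocksFun r = 1 then ∑ r', (if c.blocksFun r' = 1 then
          if r ≠ r' then Z c.length c.blocksFun r r' else 0 else 0) else 0)
      = ∑ c : Composition n, tupleWeight 𝕜 c.length c.blocksFun • Y c.length c.blocksFun := by
  let Z' : (m : ℕ) → (Fin m → ℕ) → Fin m → W := fun m b j =>
    match m, b, j with
    | 0, _, _ => 0
    | m + 1, b, j => Y m fun k => b (j.succAbove k)
  rw [sum_composition_one (n + 1) (fun m b r => ∑ r', (if b r' = 1 then
    if r ≠ r' then Z m b r r' else 0 else 0)) fun m b => ∑ j, if b j = 1 then Z' m b j else 0]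
  · exact sum_composition_one n Z' Y fun m b r => rfl
  · intro m b r
    rw [Fin.sum_univ_succAbove _ r]
    simp only [ne_eq, not_true_eq_false, if_false, ite_self, zero_add]
    refine sum_congr rfl fun j _ => ?_
    rw [if_pos (Fin.succAbove_ne r j).symm]
    cases m with
    | zero => exact j.elim0
    | succ m => rw [h]

variable {n : ℕ} (c : Composition n)

theorem sum_index (Z : Fin c.length → W) :
    ∑ s, (if c.blocksFun (c.index s) = 1 then Z (c.index s) else 0)
      = ∑ r, if c.blocksFun r = 1 then Z r else 0 := by
  rw [← c.blocksFinEquiv.sum_comp, Fintype.sum_sigma]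
  refine sum_congr rfl fun r _ => ?_
  have e : ∀ i, c.index (c.blocksFinEquiv ⟨r, i⟩) = r := fun i => c.index_embedding r i
  simp only [e]
  rw [sum_const, card_univ, Fintype.card_fin]
  split_ifs with h
  · rw [h, one_smul]
  · rw [smul_zero]

theorem eq_of_index_eq {s t : Fin n} (h1 : c.blocksFun (c.index s) = 1)
    (h : c.index s = c.index t) : s = t := by
  rw [← c.embedding_comp_inv s, ← c.embedding_comp_inv t]
  apply Fin.ext
  have h2 := (c.invEmbedding s).2
  have h3 : ((c.invEmbedding t : Fin _) : ℕ) < 1 :=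
    (c.invEmbedding t).2.trans_eq ((congrArg c.blocksFun h.symm).trans h1)
  have h4 : c.sizeUpTo (c.index s) = c.sizeUpTo (c.index t) := by rw [h]
  rw [Composition.coe_embedding, Composition.coe_embedding]
  omega

theorem sum_index_two (Z : Fin c.length → Fin c.length → W) :
    ∑ s, ∑ t, (if s ≠ t then if c.blocksFun (c.index s) = 1 ∧ c.blocksFun (c.index t) = 1 then
        Z (c.index s) (c.index t) else 0 else 0)
      = ∑ r, if c.blocksFun r = 1 then ∑ r', (if c.blocksFun r' = 1 then
          if r ≠ r' then Z r r' else 0 else 0) else 0 := by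
  rw [← sum_index]
  refine sum_congr rfl fun s _ => ?_
  split_ifs with h1
  · rw [← sum_index c fun r' => if c.index s ≠ r' then Z (c.index s) r' else 0]
    refine sum_congr rfl fun t _ => ?_
    by_cases h : s = t
    · simp [h]
    · have h2 : c.index s ≠ c.index t := fun e => h (eq_of_index_eq c h1 e)
      simp [h, h1, h2]
  · simp [h1]

theorem index_lt_index {s t : Fin n} (h : c.index s ≠ c.index t) :
    c.index s < c.index t ↔ s < t := by
  have key : ∀ s t : Fin n, c.index s < c.index t → s < t := fun s t h => by
    rw [lt_def]
    refine (c.lt_sizeUpTo_index_succ s).trans_le ((c.monotone_sizeUpTo ?_).trans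
      (c.sizeUpTo_index_le t))
    rw [lt_def] at h
    simpa using h
  refine ⟨key s t, fun hst => ?_⟩
  by_contra hn
  exact absurd (key t s (lt_of_le_of_ne (not_lt.1 hn) h.symm)) hst.not_gt

end Compositions

/-! ## Field redefinitions as `L_∞`-morphisms -/

section MorphismMap

variable (T : SeibergWittenMap 𝕜 d R)

/-- The décalage of the components of the morphism: the identity, and `χₙ` on gauge fields. -/
def morphismSymm : (n : ℕ) →
    FormOperation 𝕜 d R n
  | 0 => 0
  | 1 => MultilinearMap.ofSubsingleton 𝕜 _ _ 0 LinearMap.id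
  | n + 2 => (LinearMap.inr 𝕜 R (Fin d → R)).compMultilinearMap
      ((T.χ (n + 2)).compLinearMap fun _ => LinearMap.snd 𝕜 R (Fin d → R))

theorem morphismSymm_of_two_le {n : ℕ} (hn : 2 ≤ n) (v : Fin n → R × (Fin d → R)) :
    morphismSymm T n v = (0, T.χ n fun i => (v i).2) := by
  match n, hn with
  | n + 2, _ => rfl

theorem morphismSymm_form {n : ℕ} (hn : n ≠ 0) (B : Fin n → Fin d → R) :
    (morphismSymm T n fun i => (0, B i)) = (0, T.χ n B) := by
  match n, hn with
  | 1, _ => exact Prod.ext rfl (T.one B).symm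
  | n + 2, _ => rfl

theorem morphismSymm_eq_zero {n : ℕ} (hn : 2 ≤ n) (v : Fin n → R × (Fin d → R)) (i : Fin n)
    (hi : (v i).2 = 0) : morphismSymm T n v = 0 := by
  rw [morphismSymm_of_two_le T hn, (T.χ n).map_coord_zero i hi]
  rfl

/-- The components of the morphism. -/
def morphismMap (n : ℕ) : FormOperation 𝕜 d R n :=
  undecalage (morphismSymm T n)

theorem morphismMap_degree (n : ℕ) (a : Fin n → ℤ) (v : Fin n → R × (Fin d → R))
    (hv : ∀ i, v i ∈ formGrading 𝕜 d R (a i)) :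
    morphismMap T n v ∈ formGrading 𝕜 d R ((∑ i, a i) + 1 - n) := by
  rw [morphismMap, undecalage_apply _ a v hv]
  refine Submodule.smul_mem _ _ ?_
  match n with
  | 0 => exact Submodule.zero_mem _
  | 1 => simpa [morphismSymm] using hv 0
  | n + 2 =>
    by_cases h : ∀ i, a i = 1
    · rw [mem_formGrading]
      refine ⟨fun _ => rfl, fun h1 => absurd ?_ h1⟩
      simp [h]
    · push Not at h
      obtain ⟨i, hi⟩ := h
      rw [morphismSymm_eq_zero T (by omega) v i ((mem_formGrading.1 (hv i)).2 hi)]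
      exact Submodule.zero_mem _

theorem morphismMap_skew (n : ℕ) : IsGradedSkew (morphismMap T n) := by
  refine fun a v hv i j hij => undecalage_skew _ (fun a v hv i j hij => ?_) a v hv i j hij
  have hn : 2 ≤ n := by omega
  by_cases hi : a i = 1
  · by_cases hj : a j = 1
    · rw [hi, sub_self, zero_mul, sgn_zero, one_smul, morphismSymm_of_two_le T hn,
        morphismSymm_of_two_le T hn, ← T.symm n (fun i => (v i).2) (swap i j)]
      rfl
    · have h := (mem_formGrading.1 (hv j)).2 hj
      rw [morphismSymm_eq_zero T hn v j h, morphismSymm_eq_zero T hn _ i (by simpa using h),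
        smul_zero]
  · have h := (mem_formGrading.1 (hv i)).2 hi
    rw [morphismSymm_eq_zero T hn v i h, morphismSymm_eq_zero T hn _ j (by simpa using h),
      smul_zero]

theorem wordVal_morphismMap {n : ℕ} (w : Fin n → R ⊕ (Fin d → R)) :
    wordVal (morphismMap T n) w = morphismSymm T n fun i => letter (w i) :=
  wordVal_undecalage _ w

theorem morphismMap_one (v : R × (Fin d → R)) : morphismMap T 1 (fun _ => v) = v := by
  obtain ⟨L, hL⟩ := (MultilinearMap.ofSubsingleton 𝕜 (R × (Fin d → R)) (R × (Fin d → R))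
    (0 : Fin 1)).surjective (morphismMap T 1)
  have key : ∀ x : R ⊕ (Fin d → R), L (letter x) = letter x := fun x => by
    have h : L (letter x) = morphismMap T 1 fun _ => letter x := by rw [← hL]; rfl
    rw [h, morphismMap, undecalage_apply _ (fun _ => letterDeg x) _ fun _ => letter_mem x]
    simp [sgn_zero, morphismSymm]
  have e : v = letter (inl v.1) + letter (inr v.2) := by simp [letter]
  rw [← hL]
  change L v = v
  rw [e, map_add, key, key]

end MorphismMap

/-! ## Insertion of multilinear maps along a composition -/

section CompWord

variable (T : SeibergWittenMap 𝕜 d R)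
  {n : ℕ} (c : Composition n)
  (ℓ : OperationFamily 𝕜 d R)

/-- The value of `ℓ(φ(v …), …, φ(… v))` for the blocks of a composition, in terms of décalages. -/
def compVal (φ : OperationFamily 𝕜 d R)
    (a : Fin n → ℤ) (v : Fin n → R × (Fin d → R)) : R × (Fin d → R) :=
  decalage (ℓ c.length) (fun r => (∑ i, a (c.embedding r i)) + 1 - c.blocksFun r)
    (fun r => decalage (φ (c.blocksFun r)) (fun i => a (c.embedding r i))
      fun i => v (c.embedding r i))

/-- `compVal` as a multilinear map. -/
def compMap (φ : OperationFamily 𝕜 d R)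
    (a : Fin n → ℤ) : FormOperation 𝕜 d R n :=
  sgn 𝕜 (∑ r : Fin c.length, ((c.length : ℤ) - 1 - r) *
      ((∑ i, a (c.embedding r i)) + 1 - c.blocksFun r)) •
    ((ℓ c.length).compMultilinearMap fun r =>
      sgn 𝕜 (∑ i : Fin (c.blocksFun r), ((c.blocksFun r : ℤ) - 1 - i) * a (c.embedding r i)) •
        φ (c.blocksFun r)).domDomCongr c.blocksFinEquiv

theorem compMap_apply
    (φ : OperationFamily 𝕜 d R)
    (a : Fin n → ℤ) (v : Fin n → R × (Fin d → R)) : compMap c ℓ φ a v = compVal c ℓ φ a v := rfl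

/-- `compVal` for the components of a field redefinition, on a word. -/
def compWord (u : Fin n → R ⊕ (Fin d → R)) : R × (Fin d → R) :=
  compVal c ℓ (morphismMap T) (fun i => letterDeg (u i)) fun i => letter (u i)

theorem compWord_eq (u : Fin n → R ⊕ (Fin d → R)) (y : Fin c.length → R ⊕ (Fin d → R))
    (A : Fin d → R)
    (h : ∀ r, (c.blocksFun r = 1 ∧ ∃ f, y r = inl f ∧ ∀ i, u (c.embedding r i) = inl f) ∨
      y r = inr (T.χ (c.blocksFun r) fun _ => A) ∧ ∀ i, u (c.embedding r i) = inr A) :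
    compWord T c ℓ u = wordVal (ℓ c.length) y := by
  rw [compWord, compVal, wordVal]
  congr 1
  · funext r
    rcases h r with ⟨h1, f, hy, hu⟩ | ⟨hy, hu⟩
    · simp [hy, hu, h1, letterDeg]
    · simp [hy, hu, letterDeg]
  · funext r
    refine (wordVal_morphismMap T fun i => u (c.embedding r i)).trans ?_
    rcases h r with ⟨h1, f, hy, hu⟩ | ⟨hy, hu⟩
    · simp only [hu, hy]
      generalize c.blocksFun r = b at h1
      subst h1
      rfl
    · simp only [hu, hy]
      exact morphismSymm_form T (Nat.one_le_iff_ne_zero.1 (c.one_le_blocksFun r)) fun _ => A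

theorem compWord_eq_zero (u : Fin n → R ⊕ (Fin d → R)) (s : Fin n) (f : R)
    (hs : u s = inl f) (h : c.blocksFun (c.index s) ≠ 1) : compWord T c ℓ u = 0 := by
  rw [compWord, compVal, decalage, (ℓ c.length).map_coord_zero (c.index s), smul_zero]
  refine (wordVal_morphismMap T fun i => u (c.embedding (c.index s) i)).trans ?_
  have := c.one_le_blocksFun (c.index s)
  refine morphismSymm_eq_zero T (by omega) _ (c.invEmbedding s) ?_
  rw [c.embedding_comp_inv, hs]
  rfl

variable {ℓ} (hdeg : ∀ n, IsBracketDegree (ℓ n))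

include hdeg in
theorem compWord_mem (w : Fin n → R ⊕ (Fin d → R)) (σ : Perm (Fin n)) :
    compWord T c ℓ (fun i => w (σ i))
      ∈ formGrading 𝕜 d R ((∑ i, letterDeg (w i)) + 2 - n) := by
  have h := decalage_mem (𝒱 := formGrading 𝕜 d R) (ℓ c.length) (hdeg _)
    (fun r => (∑ i, letterDeg (w (σ (c.embedding r i)))) + 1 - c.blocksFun r) _
    fun r => decalage_mem (morphismMap T (c.blocksFun r)) (morphismMap_degree T _) _ _
      fun i => letter_mem (w (σ (c.embedding r i)))
  have e : ∑ r, ((∑ i, letterDeg (w (σ (c.embedding r i)))) + 1 - c.blocksFun r) + 2 - c.length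
      = ∑ i, letterDeg (w i) + 2 - n := by
    rw [sum_sub_distrib, sum_add_distrib, ← Nat.cast_sum, c.sum_blocksFun,
      ← Equiv.sum_comp σ, ← c.blocksFinEquiv.sum_comp, Fintype.sum_sigma]
    simp [Composition.blocksFinEquiv]
    ring
  rwa [e] at h

end CompWord

section Compatibility

variable [CharZero 𝕜]
  (T : SeibergWittenMap 𝕜 d R)
  (ℓ ℓ' : OperationFamily 𝕜 d R)

/-- The morphism identities with one gauge parameter. -/
def VariationIdentity : Prop := ∀ (f : R) (A : Fin d → R) (n : ℕ),
  ∑ j ∈ range (n + 1), n.choose j • T.χ (n - j + 1) (Fin.cons (diag₁ ℓ j f A) fun _ => A)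
    = n.factorial • ∑ c : Composition n, tupleWeight 𝕜 c.length c.blocksFun •
        paramVal₁ ℓ' c.length f fun r => T.χ (c.blocksFun r) fun _ => A

/-- The morphism identities with two gauge parameters. -/
def BracketIdentity : Prop := ∀ (f g : R) (A : Fin d → R) (n : ℕ),
  diag₂ ℓ n f g A
    = n.factorial • ∑ c : Composition n, tupleWeight 𝕜 c.length c.blocksFun •
        paramVal₂ ℓ' c.length f g fun r => T.χ (c.blocksFun r) fun _ => A

/-- The sum over unshuffles in the compatibility of the morphism, on a word. -/
def nestSum {n : ℕ} (w : Fin n → R ⊕ (Fin d → R)) : R × (Fin d → R) :=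
  ∑ k : Fin (n + 1), ∑ σ : Perm (Fin n),
    (koszulSign 𝕜 (fun i => letterDeg (w i) - 1) σ /
      ((k : ℕ).factorial * (n - k : ℕ).factorial)) •
      nestWord k (morphismMap T (n - k + 1)) (ℓ k) fun i => w (σ i)

/-- The sum over compositions in the compatibility of the morphism, on a word. -/
def compSum {n : ℕ} (w : Fin n → R ⊕ (Fin d → R)) : R × (Fin d → R) :=
  ∑ c : Composition n, ∑ σ : Perm (Fin n),
    (koszulSign 𝕜 (fun i => letterDeg (w i) - 1) σ /
      (c.length.factorial * ∏ r, ((c.blocksFun r).factorial : 𝕜))) •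
      compWord T c ℓ' fun i => w (σ i)

variable {T ℓ ℓ'} (hskew : ∀ n, IsGradedSkew (ℓ n)) (hdeg : ∀ n, IsBracketDegree (ℓ n))
  (hskew' : ∀ n, IsGradedSkew (ℓ' n)) (hdeg' : ∀ n, IsBracketDegree (ℓ' n)) {n : ℕ}

include hskew hdeg in
theorem nestSum_one {w : Fin (n + 1) → R ⊕ (Fin d → R)} {x : Fin 1 → Fin (n + 1)} {f : Fin 1 → R}
    {A : Fin d → R} (hw : IsWord w x f A) :
    nestSum T ℓ w = ∑ j ∈ range (n + 1), n.choose j •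
      (0, T.χ (n - j + 1) (Fin.cons (diag₁ ℓ j (f 0) A) fun _ => A)) := by
  let F₁ : ℕ → R × (Fin d → R) := fun k =>
    (0, T.χ (n + 1 - k + 1) (Fin.cons (diag₁ ℓ (k - 1) (f 0) A) fun _ => A))
  rw [nestSum, sum_perm_eq_sum_subset _ _ fun k S => if x 0 ∈ S then F₁ k else 0]
  · rw [sum_subset_one (x 0) _ (fun _ => 0) F₁ (fun k S h => if_neg h) fun k S h => if_pos h]
    refine sum_congr rfl fun j hj => ?_
    simp only [F₁, zero_add, Nat.add_sub_cancel]
    rw [show n + 1 - (j + 1) = n - j by omega]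
  · intro k σ
    have u0 := hw.left_symm σ 0
    have hu := hw.right_symm₁ σ
    rw [hw.koszulSign₁ σ, one_smul]
    simp only [mem_filter, mem_univ, true_and]
    split_ifs with h0
    · rw [nestWord_one k _ hskew hdeg _ A _ h0 _ u0 fun i _ => hu i, wordVal_morphismMap]
      refine Eq.trans (congrArg _ (funext fun i => ?_)) (morphismSymm_form T (Nat.succ_ne_zero _)
        (Fin.cons (diag₁ ℓ (k - 1) (f 0) A) fun _ => A))
      induction i using Fin.cases with
      | zero => rfl
      | succ i =>
        rw [cons_succ, cons_succ, hu]
        · rfl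
        · intro e
          rw [← e] at h0
          simp [lastIdx] at h0
    · exact nestWord_none k _ hdeg _ A fun i hi => hu i fun e => h0 (e ▸ hi)

include hskew hdeg in
theorem nestSum_two {w : Fin (n + 2) → R ⊕ (Fin d → R)} {x : Fin 2 → Fin (n + 2)} {f : Fin 2 → R}
    {A : Fin d → R} (hw : IsWord w x f A) :
    nestSum T ℓ w = (diag₂ ℓ n (f 0) (f 1) A, 0) := by
  have hxy : x 0 < x 1 := hw.mono (by simp)
  let F₃ : ℕ → R × (Fin d → R) := fun k => if k = n + 2 then (diag₂ ℓ n (f 0) (f 1) A, 0) else 0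
  rw [nestSum, sum_perm_eq_sum_subset _ _ fun k S => if x 0 ∈ S ∧ x 1 ∈ S then F₃ k else 0]
  · rw [sum_subset_two hxy.ne (fun k S => if x 0 ∈ S ∧ x 1 ∈ S then F₃ k else 0) (fun _ => 0) (fun _ => 0) (fun _ => 0) F₃ (fun k S h _ => by simp [h])
      (fun k S _ h => by simp [h]) (fun k S h _ => by simp [h]) fun k S h h' => by simp [h, h'],
      sum_range_succ, sum_eq_zero]
    · simp [F₃]
    · intro j hj
      have hj := (mem_range.1 hj).ne
      simp [F₃, hj]
  · intro k σ
    have hs : σ.symm (x 0) ≠ σ.symm (x 1) := fun e => hxy.ne (σ.symm.injective e)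
    have u0 := hw.left_symm σ 0
    have u1 := hw.left_symm σ 1
    have hu := hw.right_symm₂ σ
    have one : ∀ a b g, (a : Fin (n + 2)) = σ.symm (x 0) ∧ b = σ.symm (x 1) ∨
        a = σ.symm (x 1) ∧ b = σ.symm (x 0) → w (σ a) = inl g → (a : ℕ) < k → ¬(b : ℕ) < k →
        nestWord k (morphismMap T (n + 2 - k + 1)) (ℓ k) (fun i => w (σ i)) = 0 := by
      intro a b g hab ua ha hb
      have hu' : ∀ i, i ≠ a → i ≠ b → w (σ i) = inr A := by
        rcases hab with ⟨rfl, rfl⟩ | ⟨rfl, rfl⟩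
        exacts [hu, fun i h h' => hu i h' h]
      rw [nestWord_one k _ hskew hdeg _ A a ha g ua fun i hi hia =>
        hu' i hia fun e => hb (e ▸ hi), wordVal_morphismMap]
      refine morphismSymm_eq_zero T (by omega) _ (Fin.succ ⟨b - k, by omega⟩) ?_
      rw [cons_succ, lastIdx_sub k hb]
      rcases hab with ⟨_, rfl⟩ | ⟨_, rfl⟩
      · rw [u1]; rfl
      · rw [u0]; rfl
    rw [hw.koszulSign₂ σ]
    simp only [mem_filter, mem_univ, true_and]
    by_cases h0 : (σ.symm (x 0) : ℕ) < k
    · by_cases h1 : (σ.symm (x 1) : ℕ) < k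
      · rw [if_pos ⟨h0, h1⟩, nestWord_two k _ hskew hdeg _ A _ _ hs h0 h1 _ _ u0 u1 fun i _ => hu i,
          smul_smul, orderSign_mul_self, one_smul, wordVal_morphismMap]
        obtain ⟨k, hk⟩ := k
        simp only [F₃]
        split_ifs with hkn
        · subst hkn
          rw [Nat.add_sub_cancel]
          generalize_proofs pf
          have e : ∀ m (hm : m = 0) (z : Fin m → R ⊕ (Fin d → R)) (y : R ⊕ (Fin d → R)),
              morphismSymm T (m + 1) (fun i => letter (Fin.cons (α := fun _ => R ⊕ (Fin d → R))
                y z i)) = letter y := by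
            rintro m rfl z y
            rfl
          exact e _ (Nat.sub_self _) _ _
        · exact morphismSymm_eq_zero T (by omega) _ 0 rfl
      · rw [if_neg fun h => h1 h.2, one _ _ _ (Or.inl ⟨rfl, rfl⟩) u0 h0 h1, smul_zero]
    · rw [if_neg fun h => h0 h.1]
      by_cases h1 : (σ.symm (x 1) : ℕ) < k
      · rw [one _ _ _ (Or.inr ⟨rfl, rfl⟩) u1 h1 h0, smul_zero]
      · rw [nestWord_none k _ hdeg _ A, smul_zero]
        exact fun i hi => hu i (fun e => h0 (e ▸ hi)) fun e => h1 (e ▸ hi)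

omit [CharZero 𝕜] in
theorem sum_perm_div_smul (ε : Perm (Fin n) → 𝕜) (q : 𝕜) (z : Perm (Fin n) → R × (Fin d → R)) :
    ∑ σ, (ε σ / q) • z σ = (1 / q) • ∑ σ, ε σ • z σ := by
  rw [smul_sum]
  refine sum_congr rfl fun σ _ => ?_
  rw [smul_smul, one_div_mul_eq_div]

include hskew' hdeg' in
theorem compSum_one {w : Fin (n + 1) → R ⊕ (Fin d → R)} {x : Fin 1 → Fin (n + 1)} {f : Fin 1 → R}
    {A : Fin d → R} (hw : IsWord w x f A) :
    compSum T ℓ' w = n.factorial • ∑ c : Composition n, tupleWeight 𝕜 c.length c.blocksFun •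
      ((0 : R), paramVal₁ ℓ' c.length (f 0) fun r => T.χ (c.blocksFun r) fun _ => A) := by
  let Z : (m : ℕ) → (Fin m → ℕ) → Fin m → R × (Fin d → R) := fun m b r =>
    wordVal (ℓ' m) fun k => if k = r then inl (f 0) else inr (T.χ (b k) fun _ => A)
  have h := sum_composition_one (𝕜 := 𝕜) n Z
    (fun m b => (0, paramVal₁ ℓ' m (f 0) fun r => T.χ (b r) fun _ => A)) fun m b r => by
      refine wordVal_one_param hskew' hdeg' _ r (f 0) (fun k => T.χ (b k) fun _ => A)
        (if_pos rfl) fun k hk => if_neg hk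
  rw [← h, smul_sum, compSum]
  refine sum_congr rfl fun c _ => ?_
  rw [sum_perm_div_smul, smul_comm, ← sum_index, tupleWeight]
  congr 1
  refine Eq.trans (sum_congr rfl fun σ _ => ?_) (sum_perm_apply (x 0) fun s =>
    if c.blocksFun (c.index s) = 1 then Z c.length c.blocksFun (c.index s) else 0)
  have u0 := hw.left_symm σ 0
  have hu := hw.right_symm₁ σ
  rw [hw.koszulSign₁ σ, one_smul]
  split_ifs with h1
  · refine compWord_eq T c ℓ' _ _ A fun r => ?_
    by_cases hrs : r = c.index (σ.symm (x 0))
    · subst hrs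
      refine Or.inl ⟨h1, f 0, if_pos rfl, fun i => ?_⟩
      rw [← eq_of_index_eq c h1 (c.index_embedding _ i).symm, u0]
    · refine Or.inr ⟨if_neg hrs, fun i => hu _ fun e => hrs ?_⟩
      rw [← e, c.index_embedding]
  · exact compWord_eq_zero T c ℓ' (fun i => w (σ i)) _ _ u0 h1

include hskew' hdeg' in
theorem compSum_two {w : Fin (n + 2) → R ⊕ (Fin d → R)} {x : Fin 2 → Fin (n + 2)} {f : Fin 2 → R}
    {A : Fin d → R} (hw : IsWord w x f A) :
    compSum T ℓ' w = n.factorial • ∑ c : Composition n, tupleWeight 𝕜 c.length c.blocksFun •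
      (paramVal₂ ℓ' c.length (f 0) (f 1) (fun r => T.χ (c.blocksFun r) fun _ => A),
        (0 : Fin d → R)) := by
  have hxy : x 0 < x 1 := hw.mono (by simp)
  let y : (m : ℕ) → (Fin m → ℕ) → Fin m → Fin m → Fin m → R ⊕ (Fin d → R) := fun m b r r' k =>
    if k = r then inl (f 0) else if k = r' then inl (f 1)
      else inr (T.χ (b k) fun _ => A)
  let Z : (m : ℕ) → (Fin m → ℕ) → Fin m → Fin m → R × (Fin d → R) := fun m b r r' =>
    orderSign 𝕜 r r' • wordVal (ℓ' m) (y m b r r')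
  have h := sum_composition_two (𝕜 := 𝕜) n Z
    (fun m b => (paramVal₂ ℓ' m (f 0) (f 1) (fun r => T.χ (b r) fun _ => A), 0)) fun m b r j => by
      simp only [Z]
      rw [wordVal_two_param hskew' hdeg' (y (m + 2) b r (r.succAbove j)) r j (f 0) (f 1)
        (fun k => T.χ (b k) fun _ => A) (if_pos rfl)
        ((if_neg (Fin.succAbove_ne r j)).trans (if_pos rfl))
        fun k hk hk' => (if_neg hk).trans (if_neg hk'), smul_smul, orderSign_mul_self, one_smul]
  rw [← h, smul_sum, compSum]
  refine sum_congr rfl fun c _ => ?_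
  rw [sum_perm_div_smul, smul_comm, ← sum_index_two, tupleWeight]
  congr 1
  refine Eq.trans (sum_congr rfl fun σ _ => ?_) (sum_perm_apply₂ hxy.ne fun s t =>
    if c.blocksFun (c.index s) = 1 ∧ c.blocksFun (c.index t) = 1 then
      Z c.length c.blocksFun (c.index s) (c.index t) else 0)
  have hs : σ.symm (x 0) ≠ σ.symm (x 1) := fun e => hxy.ne (σ.symm.injective e)
  have u0 := hw.left_symm σ 0
  have u1 := hw.left_symm σ 1
  have hu := hw.right_symm₂ σ
  rw [hw.koszulSign₂ σ]
  split_ifs with h1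
  · have hne : c.index (σ.symm (x 0)) ≠ c.index (σ.symm (x 1)) :=
      fun e => hs (eq_of_index_eq c h1.1 e)
    have ho : orderSign 𝕜 (σ.symm (x 0)) (σ.symm (x 1))
        = orderSign 𝕜 (c.index (σ.symm (x 0))) (c.index (σ.symm (x 1))) := by
      rw [orderSign, orderSign, if_congr (index_lt_index c hne) rfl rfl]
    simp only [Z]
    rw [ho]
    congr 1
    refine compWord_eq T c ℓ' _ _ A fun r => ?_
    by_cases hrs : r = c.index (σ.symm (x 0))
    · subst hrs
      refine Or.inl ⟨h1.1, f 0, if_pos rfl, fun i => ?_⟩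
      rw [← eq_of_index_eq c h1.1 (c.index_embedding _ i).symm, u0]
    · by_cases hrt : r = c.index (σ.symm (x 1))
      · subst hrt
        refine Or.inl ⟨h1.2, f 1, (if_neg hrs).trans (if_pos rfl), fun i => ?_⟩
        rw [← eq_of_index_eq c h1.2 (c.index_embedding _ i).symm, u1]
      · refine Or.inr ⟨(if_neg hrs).trans (if_neg hrt), fun i => hu _ (fun e => hrs ?_)
          fun e => hrt ?_⟩ <;> rw [← e, c.index_embedding]
  · by_cases h2 : c.blocksFun (c.index (σ.symm (x 0))) = 1
    · rw [compWord_eq_zero T c ℓ' (fun i => w (σ i)) _ _ u1 fun h3 => h1 ⟨h2, h3⟩, smul_zero]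
    · rw [compWord_eq_zero T c ℓ' (fun i => w (σ i)) _ _ u0 h2, smul_zero]

include hskew hdeg hskew' hdeg' in
theorem morphism_compat (h1 : VariationIdentity T ℓ ℓ') (h2 : BracketIdentity T ℓ ℓ')
    (a : Fin n → ℤ) (v : Fin n → R × (Fin d → R)) (hv : ∀ i, v i ∈ formGrading 𝕜 d R (a i)) :
    ∑ k : Fin (n + 1), ∑ σ : Perm (Fin n),
      (koszulSign 𝕜 (fun i => a i - 1) σ / ((k : ℕ).factorial * (n - k : ℕ).factorial)) •
        nestVal k (morphismMap T (n - k + 1)) (ℓ k) (fun i => a (σ i)) (fun i => v (σ i))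
    = ∑ c : Composition n, ∑ σ : Perm (Fin n),
      (koszulSign 𝕜 (fun i => a i - 1) σ /
          (c.length.factorial * ∏ r, ((c.blocksFun r).factorial : 𝕜))) •
        compVal c ℓ' (morphismMap T) (fun i => a (σ i)) (fun i => v (σ i)) := by
  let G : (Fin n → ℤ) → FormOperation 𝕜 d R n :=
    fun a => ∑ k : Fin (n + 1), (((k : ℕ).factorial * (n - k : ℕ).factorial : 𝕜))⁻¹ •
        nestMap k (morphismMap T (n - k + 1)) (ℓ k) a
      - ∑ c : Composition n, (c.length.factorial * ∏ r, ((c.blocksFun r).factorial : 𝕜))⁻¹ •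
        compMap c ℓ' (morphismMap T) a
  have hG : ∀ (a : Fin n → ℤ) (v : Fin n → R × (Fin d → R)), altMap G a v
      = ∑ k : Fin (n + 1), ∑ σ : Perm (Fin n),
        (koszulSign 𝕜 (fun i => a i - 1) σ / ((k : ℕ).factorial * (n - k : ℕ).factorial)) •
          nestVal k (morphismMap T (n - k + 1)) (ℓ k) (fun i => a (σ i)) (fun i => v (σ i))
        - ∑ c : Composition n, ∑ σ : Perm (Fin n),
        (koszulSign 𝕜 (fun i => a i - 1) σ /
            (c.length.factorial * ∏ r, ((c.blocksFun r).factorial : 𝕜))) •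
          compVal c ℓ' (morphismMap T) (fun i => a (σ i)) (fun i => v (σ i)) := by
    intro a v
    rw [altMap_apply, sum_comm, sum_comm (s := univ (α := Composition n)),
      ← sum_sub_distrib]
    refine sum_congr rfl fun σ _ => ?_
    simp only [G, sub_apply, sum_apply, smul_apply, nestMap_apply, compMap_apply, smul_sum,
      smul_sub, smul_smul, div_eq_mul_inv]
  rw [← sub_eq_zero, ← hG]
  refine altMap_eq_zero_of_words G (fun N w x f A hw => ?_) a v hv
  rw [hG]
  change nestSum T ℓ w - compSum T ℓ' w = 0
  have pos : ∀ r : Fin N, (r : ℕ) < n := fun r => by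
    have h := Fintype.card_le_of_injective x hw.mono.injective
    simp only [Fintype.card_fin] at h
    omega
  by_cases hN : N = 1
  · subst hN
    obtain ⟨m, rfl⟩ : ∃ m, n = m + 1 := ⟨n - 1, by have := pos 0; omega⟩
    rw [nestSum_one hskew hdeg hw, compSum_one hskew' hdeg' hw, sub_eq_zero]
    refine Prod.ext ?_ ?_
    · simp [Prod.fst_sum]
    · simp only [Prod.snd_sum, Prod.smul_snd]
      exact h1 (f 0) A m
  by_cases hN' : N = 2
  · subst hN'
    obtain ⟨m, rfl⟩ : ∃ m, n = m + 2 := ⟨n - 2, by have := pos 1; simp at this; omega⟩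
    rw [nestSum_two hskew hdeg hw, compSum_two hskew' hdeg' hw, sub_eq_zero]
    refine Prod.ext ?_ ?_
    · simp only [Prod.fst_sum, Prod.smul_fst]
      exact h2 (f 0) (f 1) A m
    · simp [Prod.snd_sum]
  rw [nestSum, compSum, sum_eq_zero, sum_eq_zero, sub_zero]
  · refine fun c _ => sum_eq_zero fun σ _ => ?_
    have hm := compWord_mem T c hdeg' w σ
    rw [hw.sum_letterDeg] at hm
    rw [formGrading_eq_zero hm (by omega) (by omega), smul_zero]
  · refine fun k _ => sum_eq_zero fun σ _ => ?_
    have hm := nestWord_mem (e := 1) k (morphismMap T (n - k + 1)) (morphismMap_degree T _) hdeg w σ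
    rw [hw.sum_letterDeg] at hm
    rw [formGrading_eq_zero hm (by omega) (by omega), smul_zero]

end Compatibility

section QuasiIsomorphism

variable [CharZero 𝕜]
  (T : SeibergWittenMap 𝕜 d R) {S S' : LInfinityStructure (formGrading 𝕜 d R)}

/-- The `L_∞`-morphism given by a field redefinition. -/
def fieldRedefinition (h1 : VariationIdentity T S.ℓ S'.ℓ) (h2 : BracketIdentity T S.ℓ S'.ℓ) :
    LInfinityMorphism S S' where
  φ := morphismMap T
  flat := by
    ext v : 1
    rw [morphismMap, undecalage_apply _ (fun i => i.elim0) v fun i => i.elim0]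
    simp [morphismSymm]
  degree := morphismMap_degree T
  skew := morphismMap_skew T
  compat _ := morphism_compat S.skew S.degree S'.skew S'.degree h1 h2

omit [CharZero 𝕜] in
theorem differential_apply (v : R × (Fin d → R)) : S.differential v = (0, diag₁ S.ℓ 0 v.1 0) := by
  obtain ⟨L, hL⟩ := (MultilinearMap.ofSubsingleton 𝕜 (R × (Fin d → R)) (R × (Fin d → R))
    (0 : Fin 1)).surjective (S.ℓ 1)
  have h0 : L (v.1, 0) = (0, diag₁ S.ℓ 0 v.1 0) := by
    have h := bracket_args₁ S.degree v.1 fun _ : Fin 0 => (0 : Fin d → R)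
    rw [← hL] at h
    refine Eq.trans ?_ (h.trans ?_)
    · rfl
    · simp [diag₁]
  have h1 : L (0, v.2) = 0 := by
    have h := S.degree 1 (fun _ => 1) (fun _ => (0, v.2)) fun _ => letter_mem (inr v.2)
    rw [← hL] at h
    exact formGrading_eq_zero h (by simp) (by simp)
  have e : v = (v.1, 0) + (0, v.2) := by simp
  rw [LInfinityStructure.differential, ← hL]
  change L v = _
  rw [e, map_add, h0, h1, add_zero]
  simp

theorem quasiIsomorphic_of_identities (h1 : VariationIdentity T S.ℓ S'.ℓ)
    (h2 : BracketIdentity T S.ℓ S'.ℓ) : S.QuasiIsomorphic S' := by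
  have hl : ∀ v, (fieldRedefinition T h1 h2).linear v = v := morphismMap_one T
  have hd : ∀ v, S'.differential v = S.differential v := fun v => by
    have h := h1 v.1 0 0
    rw [differential_apply, differential_apply]
    rw [Fintype.sum_eq_single (Composition.ones 0) fun c hc => absurd
      (Composition.eq_ones_iff_length.2 (Nat.le_zero.1 c.length_le)) hc] at h
    have e : tupleWeight 𝕜 (Composition.ones 0).length (Composition.ones 0).blocksFun = 1 := by
      simp [tupleWeight]
    rw [e] at h
    simp only [zero_add, Finset.range_one, sum_singleton, Nat.choose_self, one_smul, T.one,
      cons_zero, Nat.factorial_zero] at h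
    rw [h]
    refine congrArg (Prod.mk 0) (congrArg (paramVal₁ S'.ℓ 0 v.1) (Subsingleton.elim _ _))
  refine ⟨fieldRedefinition T h1 h2, fun v _ ⟨w, hw⟩ => ⟨w, ?_⟩, fun w hw => ⟨w, 0, ?_, ?_⟩⟩
  · rw [← hd, hw, hl]
  · rw [← hd, hw]
  · rw [hl, LInfinityStructure.differential, (S'.ℓ 1).map_coord_zero 0 rfl, add_zero]

end QuasiIsomorphism

section Identities

variable [CharZero 𝕜]
  {D : Fin d → Derivation 𝕜 R R}
  {γ ϑ : TensorFamily d R}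
  {Υ : MultiplierFamily d R}
  {T : SeibergWittenMap 𝕜 d R} {S S' : LInfinityStructure (formGrading 𝕜 d R)}
  (h : InducesUpTo D γ ϑ Υ T S')

include h in
theorem InducesUpTo.variationIdentity
    (hS : ∀ n f A k, diag₁ S.ℓ n f A k = n.factorial • coeff n (gaugeVariation D γ ϑ Υ f A k)) :
    VariationIdentity T S.ℓ S'.ℓ := by
  intro f A n
  have h := h.variation f A n
  have e : ∀ m, (fun k => coeff m (gaugeVariation D γ ϑ Υ f A k))
      = (1 / (m.factorial : 𝕜)) • diag₁ S.ℓ m f A := fun m => by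
    funext k
    rw [Pi.smul_apply, hS, ← cast_smul_eq_nsmul 𝕜, smul_smul, one_div_mul_cancel, one_smul]
    exact_mod_cast m.factorial_ne_zero
  have e' : ∀ (m : ℕ) (c : 𝕜) (B A : Fin d → R), T.χ (m + 1) (Fin.cons (c • B) fun _ => A)
      = c • T.χ (m + 1) (Fin.cons B fun _ => A) := fun m c B A =>
    (T.χ (m + 1)).cons_smul (fun _ => A) c B
  simp only [e, e', bracket_args₁ S'.degree, neg_one_pow_div_smul] at h
  rw [← sum_range_reflect] at h
  rw [show (∑ c : Composition n, tupleWeight 𝕜 c.length c.blocksFun •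
        paramVal₁ S'.ℓ c.length f fun r => T.χ (c.blocksFun r) fun _ => A) = _ from h,
    smul_sum]
  refine sum_congr rfl fun j hj => ?_
  have hj := Finset.mem_range_succ_iff.1 hj
  rw [show n + 1 - 1 - j = n - j by omega, show n - (n - j) = j by omega, smul_smul,
    ← cast_smul_eq_nsmul 𝕜, ← cast_smul_eq_nsmul 𝕜, smul_smul, Nat.cast_choose 𝕜 hj]
  congr 1
  ring

omit [CharZero 𝕜] in
include h in
theorem InducesUpTo.bracketIdentity
    (hS : ∀ n f g A, diag₂ S.ℓ n f g A
      = -(n.factorial • coeff (n + 1) (gaugeBracket D γ ϑ Υ f g A))) :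
    BracketIdentity T S.ℓ S'.ℓ := by
  intro f g A n
  have h := congrArg (coeff (n + 1)) (h.bracket f g A)
  rw [coeff_succ_X_mul, coeff_mk] at h
  simp only [bracket_args₂ S'.degree, neg_one_pow_div_smul] at h
  rw [hS, h, smul_neg, neg_neg]
  rfl

/-- The trivial field redefinition. -/
def trivialRedefinition (𝕜 R : Type) (d : ℕ) [Field 𝕜] [CommRing R] [Algebra 𝕜 R] :
    SeibergWittenMap 𝕜 d R where
  χ n := if h : n = 1 then h ▸ MultilinearMap.ofSubsingleton 𝕜 _ _ (0 : Fin 1) LinearMap.id else 0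
  symm n A σ := by
    split_ifs with h
    · subst h
      rw [Subsingleton.elim σ 1]
      rfl
    · rfl
  one _ := rfl

omit [CharZero 𝕜] in
theorem sum_composition_trivial {W : Type} [AddCommGroup W] [Module 𝕜 W] (n : ℕ) (A : Fin d → R)
    (c : ℕ → 𝕜) (F : (m : ℕ) → (Fin m → Fin d → R) → W)
    (hF : ∀ m B r, B r = 0 → F m B = 0) :
    ∑ b : Composition n, (c b.length / (b.length.factorial * ∏ r, ((b.blocksFun r).factorial : 𝕜))) •
        F b.length (fun r => (trivialRedefinition 𝕜 R d).χ (b.blocksFun r) fun _ => A)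
      = (c n / n.factorial) • F n fun _ => A := by
  rw [sum_eq_single (Composition.ones n)]
  · have h1 : ∀ r, (Composition.ones n).blocksFun r = 1 := fun r => by simp
    have h2 : ∀ r, ((trivialRedefinition 𝕜 R d).χ ((Composition.ones n).blocksFun r) fun _ => A) = A :=
      fun r => by rw [h1]; rfl
    simp only [h1, h2, Nat.factorial_one, Nat.cast_one, Finset.prod_const_one, mul_one]
    rw [Composition.ones_length]
  · intro b _ hb
    obtain ⟨r, hr⟩ : ∃ r, b.blocksFun r ≠ 1 := by
      by_contra! h
      refine hb (Composition.eq_ones_iff.2 fun i hi => ?_)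
      obtain ⟨r, rfl⟩ := List.get_of_mem hi
      exact h r
    rw [hF _ _ r, smul_zero]
    simp [trivialRedefinition, hr]
  · simp

theorem Induces.inducesUpTo (h : Induces D γ ϑ Υ S') :
    InducesUpTo D γ ϑ Υ (trivialRedefinition 𝕜 R d) S' where
  variation f A n := by
    rw [sum_composition_trivial n A (fun m => (-1) ^ (m * (m - 1) / 2))
      fun m B => (S'.ℓ (m + 1) (args₁ f B)).2, sum_eq_single 0]
    · funext i
      change _ = ((1 / (Nat.factorial 0 : 𝕜)) • fun i =>
        coeff (n - 0) (gaugeVariation D γ ϑ Υ f A i)) i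
      simp [h.variation]
    · intro m _ hm
      simp [trivialRedefinition, hm]
    · simp
    · intro m B r hr
      rw [(S'.ℓ (m + 1)).map_coord_zero r.succ]
      · rfl
      · simp [args₁, hr]
  bracket f g A := by
    rw [h.bracket]
    congr 2
    funext n
    rw [sum_composition_trivial n A (fun m => (-1) ^ (m * (m - 1) / 2))
      fun m B => (S'.ℓ (m + 2) (args₂ f g B)).1]
    intro m B r hr
    rw [(S'.ℓ (m + 2)).map_coord_zero r.succ.succ]
    · rfl
    · simp [args₂, hr]

end Identities

section Gauge

variable [CharZero 𝕜]
  (D : Fin d → Derivation 𝕜 R R)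
  (γ : TensorFamily d R)
  {ϑ : TensorFamily d R}
  (Υ : MultiplierFamily d R)
  (hϑ : ∀ n i j k, ϑ n j i k = -ϑ n i j k) (hJ : BracketJacobi D γ ϑ)
  (hR : MultiplierRecursion D γ ϑ Υ)

theorem gaugeStructure_quasiIsomorphic {T : SeibergWittenMap 𝕜 d R}
    {S' : LInfinityStructure (formGrading 𝕜 d R)} (h : InducesUpTo D γ ϑ Υ T S') :
    (gaugeStructure D γ Υ hϑ hJ hR).QuasiIsomorphic S' :=
  quasiIsomorphic_of_identities T
    (h.variationIdentity fun n f A k =>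
      (congrFun (paramVal₁_gaugeMap D γ Υ n f _) k).trans (variationMap_diag D γ ϑ Υ n f A k))
    (h.bracketIdentity fun n f g A =>
      (paramVal₂_gaugeMap D γ Υ hϑ n f g _).trans (congrArg _ (bracketMap_diag D γ ϑ Υ n f g A)))

end Gauge

end AlmostPoisson

end

theorem proposition5p5 (𝕜 : Type) [RCLike 𝕜] (d : ℕ)
    (U : TopologicalSpace.Opens (EuclideanSpace ℝ (Fin d)))
    (θ : Fin d → Fin d → AlmostPoisson.smoothFunctions 𝕜 U) (hθ : ∀ i j, θ j i = -θ i j)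
    (E : AlmostPoisson.LocalSymplecticEmbedding (AlmostPoisson.partialDeriv 𝕜 U) θ) :
    (∃! Υ, AlmostPoisson.IsLagrangianMultiplier E Υ) ∧
    ∀ Υ, AlmostPoisson.IsLagrangianMultiplier E Υ →
      ∃ S : AlmostPoisson.LInfinityStructure
          (AlmostPoisson.formGrading 𝕜 d (AlmostPoisson.smoothFunctions 𝕜 U)),
        AlmostPoisson.Induces (AlmostPoisson.partialDeriv 𝕜 U) E.γ E.ϑ Υ S ∧
        AlmostPoisson.HasExplicitBrackets (AlmostPoisson.partialDeriv 𝕜 U) E.γ E.ϑ Υ θ S ∧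
        (∀ S', AlmostPoisson.Induces (AlmostPoisson.partialDeriv 𝕜 U) E.γ E.ϑ Υ S' →
          S.QuasiIsomorphic S') ∧
        (∀ T S', AlmostPoisson.InducesUpTo (AlmostPoisson.partialDeriv 𝕜 U) E.γ E.ϑ Υ T S' →
          S.QuasiIsomorphic S') := by
  refine ⟨AlmostPoisson.existsUnique_isLagrangianMultiplier E (AlmostPoisson.coordinate 𝕜 U)
    (AlmostPoisson.partialDeriv_coordinate 𝕜 U), fun Υ hΥ => ?_⟩
  refine ⟨AlmostPoisson.gaugeStructure _ E.γ Υ E.ϑ_skew E.jacobi hΥ.recursion,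
    AlmostPoisson.gaugeStructure_induces _ E.γ Υ E.ϑ_skew E.jacobi hΥ.recursion,
    AlmostPoisson.hasExplicitBrackets_of_diag E hθ hΥ _
      (AlmostPoisson.gaugeStructure_args₁ _ E.γ Υ E.ϑ_skew E.jacobi hΥ.recursion)
      (AlmostPoisson.gaugeStructure_args₂ _ E.γ Υ E.ϑ_skew E.jacobi hΥ.recursion),
    fun S' h => ?_, fun T S' h => ?_⟩
  · exact AlmostPoisson.gaugeStructure_quasiIsomorphic _ E.γ Υ E.ϑ_skew E.jacobi hΥ.recursion
      h.inducesUpTo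
  · exact AlmostPoisson.gaugeStructure_quasiIsomorphic _ E.γ Υ E.ϑ_skew E.jacobi hΥ.recursion h
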